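/- A cluster graph is a disjoint union of complete graphs. For a finite simple graph $G$ and a cost function $c:V(G)\to\mathbb{Q}_{\ge 0}$, a hitting set of $G$ is a set $X\subseteq V(G)$ such that $G-X$ is a cluster graph, $c(X)=\sum_{v\in X}c(v)$, and $\mathrm{OPT}(G,c)$ is the minimum of $c(X)$ over all hitting sets $X$; Cluster Vertex Deletion asks for a hitting set of minimum cost. An induced subgraph $H$ of $G$ with a cost function $c_H:V(H)\to\mathbb{Q}_{\ge0}$ is $2$-good in $G$ if $c_H\not\equiv0$ and $c_H(X\cap V(H))\le 2\,\mathrm{OPT}(H,c_H)$ for every inclusionwise minimal hitting set $X$ of $G$. Distinct vertices $u,u'$ are true twins if they are adjacent and have the same neighbours among the other vertices. Consider the following recursive local-ratio algorithm on $(G,c)$. If $G$ is a cluster graph, return $\varnothing$. Otherwise, if some vertex $u$ has $c(u)=0$, recurse on $G-u$ with the same costs to get $X'$, and return $X'$ if it is a hitting set of $G$ and $X'\cup\{u\}$ if not. Otherwise, if there are true twins $u,u'$, recurse on $G-u'$ with $c(u')$ added to the cost of $u$ to get $X'$, and return $X'$ if $u\notin X'$ and $X'\cup\{u'\}$ if $u\in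 X'$. Otherwise, choose a weighted induced subgraph $(H,c_H)$ that is $2$-good in $G$, let $\lambda^*$ be the largest $\lambda$ with $c(v)-\lambda c_H(v)\ge0$ for all $v\in V(H)$, recurse on $G$ with the cost of each $v\in V(H)$ decreased by $\lambda^* c_H(v)$ (the other costs unchanged), and return the result. Theorem. Cluster Vertex Deletion has a polynomial-time $2$-approximation algorithm. More precisely: (1) For every finite graph $G$ and every $c:V(G)\to\mathbb{Q}_{\ge0}$, the algorithm above can be run to completion on $(G,c)$, and every set $X$ that it can return, whatever choices it makes, is an inclusionwise minimal hitting set of $G$ with $c(X)\le 2\,\mathrm{OPT}(G,c)$. (2) There is a deterministic program for a random access machine with integer registers and arrays (instructions: constants, addition, subtraction, multiplication, indirect load and store, and tests for positivity) which, for every graph $G$ on $n$ vertices given by its adjacency matrix and every $c:V(G)\to\mathbb{Q}_{\ge0}$ given by numerators and denominators, computes a set $X$ that the algorithm above can return on $(G,c)$, hence a minimal hitting set with $c(X)\le2\,\mathrm{OPT}(G,c)$. It executes $O(n^4)$ instructions, and its bit cost (the total binary length of all integers read, written or used as addresses) is bounded by a polynomial in the bit size of the input. (3) The factor is tight relative to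 Vertex Cover: for every real $\rho$, if Cluster Vertex Deletion has a polynomial-time $\rho$-approximation algorithm, then so does minimum-cost Vertex Cover (with nonnegative rational vertex costs). Here polynomial time refers to the bit cost on the same machine model. -/

import Mathlib

open Finset

/-! ## Cluster vertex deletion -/

/-- A cluster graph is a disjoint union of complete graphs: two distinct vertices are adjacent
exactly when they lie in the same class of a partition of the vertex set. -/
def IsClusterGraph {W : Type*} (H : SimpleGraph W) : Prop :=
  ∃ r : Setoid W, ∀ u v : W, H.Adj u v ↔ u ≠ v ∧ r u v

/-- The cost `c(X)` of a vertex set. -/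
def cost {V : Type*} (c : V → ℚ) (X : Finset V) : ℚ := ∑ v ∈ X, c v

section ClusterVD

variable {V : Type*} [DecidableEq V]

/-- `X` is a hitting set of the induced subgraph `G[S]`: `X` consists of vertices of `G[S]`, and
deleting them leaves a cluster graph. (For a whole finite graph, `S = univ`.) -/
def IsHittingSet (G : SimpleGraph V) (S X : Finset V) : Prop :=
  X ⊆ S ∧ IsClusterGraph (G.induce (↑(S \ X) : Set V))

/-- `X` is an inclusionwise minimal hitting set of `G[S]`. -/
def IsMinimalHittingSet (G : SimpleGraph V) (S X : Finset V) : Prop :=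
  Minimal (IsHittingSet G S) X

theorem isHittingSet_self (G : SimpleGraph V) (S : Finset V) : IsHittingSet G S S := by
  refine ⟨Finset.Subset.refl S, ⊤, fun u _ => ?_⟩
  have hu := u.2
  simp at hu

open Classical in
/-- `OPT(G[S], c)`: the minimum cost of a hitting set of `G[S]`. -/
noncomputable def OPT (G : SimpleGraph V) (S : Finset V) (c : V → ℚ) : ℚ :=
  (S.powerset.filter (IsHittingSet G S)).inf'
    ⟨S, by simp [isHittingSet_self G S]⟩ (cost c)

/-- The weighted graph `(G[T], d)` is an `α`-good weighted induced subgraph of `G[S]`. Only the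
values of `d` on `T` matter. -/
def IsGoodIn (α : ℚ) (G : SimpleGraph V) (S T : Finset V) (d : V → ℚ) : Prop :=
  T ⊆ S ∧ (∀ v ∈ T, 0 ≤ d v) ∧ (∃ v ∈ T, d v ≠ 0) ∧
    ∀ X : Finset V, IsMinimalHittingSet G S X → cost d (X ∩ T) ≤ α * OPT G T d

/-- `u` and `u'` are true twins in `G[S]`. -/
def AreTrueTwins (G : SimpleGraph V) (S : Finset V) (u u' : V) : Prop :=
  u ∈ S ∧ u' ∈ S ∧ G.Adj u u' ∧ ∀ v ∈ S, v ≠ u → v ≠ u' → (G.Adj u v ↔ G.Adj u' v)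

/-- `LocalRatio G S c X`: the recursive local-ratio algorithm, run on the weighted graph
`(G[S], c)`, can return `X`. The only freedom is in the choice of the zero-cost vertex `u`, of the
pair `u, u'` of true twins, and of the `2`-good weighted induced subgraph `(G[T], d)`; the four
cases are tried in the order in which they are listed. -/
inductive LocalRatio (G : SimpleGraph V) : Finset V → (V → ℚ) → Finset V → Prop
  | cluster (S : Finset V) (c : V → ℚ) (hcl : IsClusterGraph (G.induce (↑S : Set V))) :
      LocalRatio G S c ∅
  | zero_keep (S : Finset V) (c : V → ℚ) (X' : Finset V) (u : V)
      (hcl : ¬ IsClusterGraph (G.induce (↑S : Set V)))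
      (hu : u ∈ S) (hcu : c u = 0)
      (hrec : LocalRatio G (S.erase u) c X')
      (hX' : IsHittingSet G S X') :
      LocalRatio G S c X'
  | zero_add (S : Finset V) (c : V → ℚ) (X' : Finset V) (u : V)
      (hcl : ¬ IsClusterGraph (G.induce (↑S : Set V)))
      (hu : u ∈ S) (hcu : c u = 0)
      (hrec : LocalRatio G (S.erase u) c X')
      (hX' : ¬ IsHittingSet G S X') :
      LocalRatio G S c (insert u X')
  | twins_keep (S : Finset V) (c : V → ℚ) (X' : Finset V) (u u' : V)
      (hcl : ¬ IsClusterGraph (G.induce (↑S : Set V)))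
      (hzero : ∀ v ∈ S, c v ≠ 0)
      (htw : AreTrueTwins G S u u')
      (hrec : LocalRatio G (S.erase u') (Function.update c u (c u + c u')) X')
      (hX' : u ∉ X') :
      LocalRatio G S c X'
  | twins_add (S : Finset V) (c : V → ℚ) (X' : Finset V) (u u' : V)
      (hcl : ¬ IsClusterGraph (G.induce (↑S : Set V)))
      (hzero : ∀ v ∈ S, c v ≠ 0)
      (htw : AreTrueTwins G S u u')
      (hrec : LocalRatio G (S.erase u') (Function.update c u (c u + c u')) X')
      (hX' : u ∈ X') :
      LocalRatio G S c (insert u' X')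
  | subtract (S : Finset V) (c : V → ℚ) (X : Finset V) (T : Finset V) (d : V → ℚ) (lam : ℚ)
      (hcl : ¬ IsClusterGraph (G.induce (↑S : Set V)))
      (hzero : ∀ v ∈ S, c v ≠ 0)
      (htw : ∀ u u' : V, ¬ AreTrueTwins G S u u')
      (hgood : IsGoodIn 2 G S T d)
      (hlam : IsGreatest {μ : ℚ | ∀ v ∈ T, 0 ≤ c v - μ * d v} lam)
      (hrec : LocalRatio G S (fun v => if v ∈ T then c v - lam * d v else c v) X) :
      LocalRatio G S c X

end ClusterVD

/-! ## Random access machines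

A program works with finitely many integer registers and finitely many integer arrays, has no
division, and uses structured control flow. The unit cost of a run is the number of executed
instructions and tests; its bit cost (logarithmic cost) is the total length of the integers that
the executed instructions and tests read, write, or use as addresses. -/

/-- Length of an integer in binary, with sign. -/
def bitLen (z : ℤ) : ℕ := z.natAbs.size + 1

/-- A machine state: the contents of register `r`, and of array `k` at address `z`. -/
structure RAMState where
  reg : ℕ → ℤ
  arr : ℕ → ℤ → ℤ

/-- Set register `r` to `z`. -/
def RAMState.setReg (s : RAMState) (r : ℕ) (z : ℤ) : RAMState :=
  { s with reg := Function.update s.reg r z }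

/-- Set the entry of array `k` at address `a` to `z`. -/
def RAMState.setArr (s : RAMState) (k : ℕ) (a z : ℤ) : RAMState :=
  { s with arr := Function.update s.arr k (Function.update (s.arr k) a z) }

/-- Elementary instructions. -/
inductive RAMInstr
  | const (r : ℕ) (z : ℤ)
  | add (r a b : ℕ)
  | sub (r a b : ℕ)
  | mul (r a b : ℕ)
  | load (r k a : ℕ)
  | store (k a b : ℕ)

/-- Effect of an instruction. -/
def RAMInstr.run : RAMInstr → RAMState → RAMState
  | .const r z, s => s.setReg r z
  | .add r a b, s => s.setReg r (s.reg a + s.reg b)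
  | .sub r a b, s => s.setReg r (s.reg a - s.reg b)
  | .mul r a b, s => s.setReg r (s.reg a * s.reg b)
  | .load r k a, s => s.setReg r (s.arr k (s.reg a))
  | .store k a b, s => s.setArr k (s.reg a) (s.reg b)

/-- Bit cost of an instruction. -/
def RAMInstr.bitCost : RAMInstr → RAMState → ℕ
  | .const _ z, _ => bitLen z
  | .add _ a b, s => bitLen (s.reg a) + bitLen (s.reg b) + bitLen (s.reg a + s.reg b)
  | .sub _ a b, s => bitLen (s.reg a) + bitLen (s.reg b) + bitLen (s.reg a - s.reg b)
  | .mul _ a b, s => bitLen (s.reg a) + bitLen (s.reg b) + bitLen (s.reg a * s.reg b)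
  | .load _ k a, s => bitLen (s.reg a) + bitLen (s.arr k (s.reg a))
  | .store _ a b, s => bitLen (s.reg a) + bitLen (s.reg b)

/-- Programs: instructions, sequencing, `if 0 < register a then p else q`, and
`while 0 < register a do p`. -/
inductive RAMProg
  | instr (i : RAMInstr)
  | seq (p q : RAMProg)
  | ite (a : ℕ) (p q : RAMProg)
  | loop (a : ℕ) (p : RAMProg)

/-- `RAMExec P s s' t b`: started in state `s`, the program `P` halts in state `s'`, after `t`
steps and with total bit cost `b`. -/
inductive RAMExec : RAMProg → RAMState → RAMState → ℕ → ℕ → Prop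
  | instr (i : RAMInstr) (s : RAMState) :
      RAMExec (.instr i) s (i.run s) 1 (i.bitCost s)
  | seq (p q : RAMProg) (s s' s'' : RAMState) (t t' b b' : ℕ)
      (hp : RAMExec p s s' t b) (hq : RAMExec q s' s'' t' b') :
      RAMExec (.seq p q) s s'' (t + t') (b + b')
  | ite_pos (a : ℕ) (p q : RAMProg) (s s' : RAMState) (t b : ℕ)
      (ha : 0 < s.reg a) (hp : RAMExec p s s' t b) :
      RAMExec (.ite a p q) s s' (t + 1) (b + bitLen (s.reg a))
  | ite_neg (a : ℕ) (p q : RAMProg) (s s' : RAMState) (t b : ℕ)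
      (ha : ¬ 0 < s.reg a) (hq : RAMExec q s s' t b) :
      RAMExec (.ite a p q) s s' (t + 1) (b + bitLen (s.reg a))
  | loop_pos (a : ℕ) (p : RAMProg) (s s' s'' : RAMState) (t t' b b' : ℕ)
      (ha : 0 < s.reg a) (hp : RAMExec p s s' t b)
      (hrec : RAMExec (.loop a p) s' s'' t' b') :
      RAMExec (.loop a p) s s'' (t + t' + 1) (b + b' + bitLen (s.reg a))
  | loop_neg (a : ℕ) (p : RAMProg) (s : RAMState) (ha : ¬ 0 < s.reg a) :
      RAMExec (.loop a p) s s 1 (bitLen (s.reg a))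

/-! ## Vertex-weighted graphs as inputs, vertex sets as outputs -/

open Classical in
/-- The initial state for the vertex-weighted graph `(G, c)` on the vertices `0, …, n - 1`:
register `0` holds `n`, array `0` the adjacency matrix row by row, arrays `1` and `2` the
numerators and denominators of the costs; everything else is `0`. -/
noncomputable def ramInput {n : ℕ} (G : SimpleGraph (Fin n)) (c : Fin n → ℚ) : RAMState where
  reg := fun r => if r = 0 then (n : ℤ) else 0
  arr := fun k z =>
    if k = 0 then
      if ∃ i j : Fin n, z = (n : ℤ) * (i : ℕ) + (j : ℕ) ∧ G.Adj i j then 1 else 0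
    else if h : 0 ≤ z ∧ z.toNat < n then
      if k = 1 then (c ⟨z.toNat, h.2⟩).num
      else if k = 2 then ((c ⟨z.toNat, h.2⟩).den : ℤ)
      else 0
    else 0

/-- The bit size of the input: the adjacency matrix and the costs. -/
def inputSize {n : ℕ} (c : Fin n → ℚ) : ℕ :=
  n ^ 2 + ∑ i : Fin n, (bitLen (c i).num + bitLen ((c i).den : ℤ))

/-- The final state `s` outputs the vertex set `X`: array `3` holds its characteristic vector. -/
def RAMOutputs {n : ℕ} (s : RAMState) (X : Finset (Fin n)) : Prop :=
  ∀ i : Fin n, s.arr 3 ((i : ℕ) : ℤ) = if i ∈ X then 1 else 0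

/-- The problem of finding a minimum-cost feasible vertex set in a graph with nonnegative rational
vertex costs has a polynomial-time `ρ`-approximation algorithm: some program computes, with bit
cost polynomial in the bit size of the input, a feasible set whose cost is at most `ρ` times the
cost of every feasible set. -/
def HasPolyTimeApprox
    (Feasible : (n : ℕ) → SimpleGraph (Fin n) → Finset (Fin n) → Prop) (ρ : ℝ) : Prop :=
  ∃ (P : RAMProg) (p : Polynomial ℕ),
    ∀ (n : ℕ) (G : SimpleGraph (Fin n)) (c : Fin n → ℚ), (∀ v, 0 ≤ c v) →
      ∃ (X : Finset (Fin n)) (s : RAMState) (t b : ℕ),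
        RAMExec P (ramInput G c) s t b ∧
        b ≤ p.eval (inputSize c) ∧
        RAMOutputs s X ∧
        Feasible n G X ∧
        ∀ Y : Finset (Fin n), Feasible n G Y → (cost c X : ℝ) ≤ ρ * (cost c Y : ℝ)

/-! The local-ratio principle: if `c(X)` is split into a part handled by recursion and a multiple of
`d(X ∩ T)`, with `d` a `2`-good cost function, then a factor of `2` on both parts gives a factor of
`2` on the sum (`LocalRatio.correct`). Goodness only speaks of minimal hitting sets, so minimality
is carried along. Zero-cost vertices and twins are harmless: a minimal hitting set contains both of
two twins or neither, so twins can be merged into one vertex of the summed cost.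

The core is `exists_isGoodIn`: a twin-free graph that is not a cluster graph has a `2`-good cost
function. The complement of a hitting set is a cluster subgraph, so it suffices that every cluster
subgraph `K` has `2 d(K) ≤ d(S) + a` while every minimal hitting set has cost at most `d(S) - a`
(`isGoodIn_of_forall_le`). Fix a vertex `v₀`. If its neighbourhood contains a hole `T`, weight `1`
on `T` and `|T| - 4` on `v₀` works with `a = 0` (`IsHole.isGoodIn`).

Otherwise the neighbourhood is chordal and `a = 1` is used: a minimal hitting set misses some vertex
of the closed neighbourhood of `v₀`, so weights of at least `1` there supply the `-1`. The vertices
are inserted one at a time, and the inequality is maintained for the representatives of the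
true-twin classes of the part built so far (`TwinWeights`). A new vertex that splits classes gets
the number of split classes as its weight; a new twin joins a class and leaves the weights alone; a
new neighbour of `v₀` with neither property gets weight `1`, and `v₀` one more. The last case needs
a vertex that extends the clique of earlier neighbours. Maximum cardinality search supplies it: in a
perfect search order, a vertex whose earlier neighbours form a maximal clique is a twin of its
predecessor (`IsMCS.twin_of_maximal`); an order that is not perfect produces a hole
(`IsMCS.exists_isHole`). At the end, the absence of twins makes all classes singletons.

For the machine, the algorithm is written in a small language whose compiler is verified once. The
step count is a polynomial whose degree is the nesting depth of the loops, here `4`. The bit cost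
follows without any analysis of the computed numbers: the program multiplies only by denominators of
the input, so each step lengthens the numbers by a bounded number of bits (`Tame.bitCost_le`). Costs
are kept integral by rescaling, which `LocalRatio.scale` permits. Each pass of the main loop deletes
a vertex unless a cluster graph has been reached, and a second loop undoes the deletions in reverse
order.

For the reduction from Vertex Cover, a pendant vertex of equal cost is attached to every vertex. An
edge with both ends uncovered forms an induced path with a pendant vertex, and deleting a vertex
cover leaves only isolated vertices and pendant edges. Hence covers and hitting sets convert into
each other without loss of cost. -/

/-! ## A small imperative language and its compilation to random access machines -/

/-- `Steps P s s' T`: started in `s`, the program `P` halts in `s'` after at most `T` steps. -/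
def Steps (P : RAMProg) (s s' : RAMState) (T : ℕ) : Prop :=
  ∃ t b, RAMExec P s s' t b ∧ t ≤ T

namespace Steps

theorem instr (i : RAMInstr) (s : RAMState) : Steps (.instr i) s (i.run s) 1 :=
  ⟨1, _, .instr i s, le_rfl⟩

theorem seq {p q : RAMProg} {s s' s'' : RAMState} {T T' : ℕ} (hp : Steps p s s' T)
    (hq : Steps q s' s'' T') : Steps (.seq p q) s s'' (T + T') := by
  obtain ⟨t, b, h, ht⟩ := hp
  obtain ⟨t', b', h', ht'⟩ := hq
  exact ⟨_, _, .seq _ _ _ _ _ _ _ _ _ h h', by omega⟩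

theorem mono {p : RAMProg} {s s' : RAMState} {T T' : ℕ} (hp : Steps p s s' T) (h : T ≤ T') :
    Steps p s s' T' := by
  obtain ⟨t, b, h', ht⟩ := hp
  exact ⟨t, b, h', ht.trans h⟩

theorem ite_pos {a : ℕ} {p q : RAMProg} {s s' : RAMState} {T : ℕ} (ha : 0 < s.reg a)
    (hp : Steps p s s' T) : Steps (.ite a p q) s s' (T + 1) := by
  obtain ⟨t, b, h, ht⟩ := hp
  exact ⟨_, _, .ite_pos _ _ _ _ _ _ _ ha h, by omega⟩

theorem ite_neg {a : ℕ} {p q : RAMProg} {s s' : RAMState} {T : ℕ} (ha : ¬ 0 < s.reg a)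
    (hp : Steps q s s' T) : Steps (.ite a p q) s s' (T + 1) := by
  obtain ⟨t, b, h, ht⟩ := hp
  exact ⟨_, _, .ite_neg _ _ _ _ _ _ _ ha h, by omega⟩

/-- A loop that counts its register down to `0`. -/
theorem loop {a : ℕ} {p : RAMProg} {T : ℕ} (I : ℕ → RAMState → Prop) (n : ℕ)
    (hbody : ∀ m < n, ∀ s, I (m + 1) s → s.reg a = (m : ℤ) + 1 →
      ∃ s', Steps p s s' T ∧ I m s' ∧ s'.reg a = (m : ℤ))
    {s : RAMState} (hs : I n s) (hn : s.reg a = (n : ℤ)) :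
    ∃ s', Steps (.loop a p) s s' (n * (T + 1) + 1) ∧ I 0 s' ∧ s'.reg a = 0 := by
  induction n generalizing s with
  | zero =>
    have hn' : s.reg a = 0 := by simpa using hn
    exact ⟨s, ⟨_, _, .loop_neg a p s (by simp [hn']), by simp⟩, hs, hn'⟩
  | succ n ih =>
    obtain ⟨s', ⟨t, b, h, ht⟩, hI, hr⟩ := hbody n (by omega) s hs (by simpa using hn)
    obtain ⟨s'', ⟨t', b', h', ht'⟩, hI', hr'⟩ :=
      ih (fun m hm => hbody m (by omega)) hI hr
    refine ⟨s'', ⟨_, _, .loop_pos _ _ _ _ _ _ _ _ _ ?_ h h', ?_⟩, hI', hr'⟩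
    · rw [hn]; push_cast; positivity
    · nlinarith

end Steps

/-- Expressions: the input size `n`, variables, bound variables, constants, sums and differences,
array access, `if 0 < c then a else b`, the sum and the maximum (with `0`) over `i < n`, and the
product with an entry of array `2`. -/
inductive HExpr
  | size
  | var (v : ℕ)
  | bvar (l : ℕ)
  | const (z : ℤ)
  | add (a b : HExpr)
  | sub (a b : HExpr)
  | load (k : ℕ) (e : HExpr)
  | cond (c a b : HExpr)
  | sum (l : ℕ) (e : HExpr)
  | sup (l : ℕ) (e : HExpr)
  | scale (e a : HExpr)

/-- The value of an expression, where `ρ` gives the values of the bound variables. -/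
def HExpr.eval (n : ℕ) (σ : RAMState) : HExpr → (ℕ → ℤ) → ℤ
  | .size, _ => n
  | .var v, _ => σ.reg v
  | .bvar l, ρ => ρ l
  | .const z, _ => z
  | .add a b, ρ => a.eval n σ ρ + b.eval n σ ρ
  | .sub a b, ρ => a.eval n σ ρ - b.eval n σ ρ
  | .load k e, ρ => σ.arr k (e.eval n σ ρ)
  | .cond c a b, ρ => if 0 < c.eval n σ ρ then a.eval n σ ρ else b.eval n σ ρ
  | .sum l e, ρ => ∑ i : Fin n, e.eval n σ (Function.update ρ l ((i : ℕ) : ℤ))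
  | .sup l e, ρ =>
      ((Finset.univ.sup fun i : Fin n => (e.eval n σ (Function.update ρ l ((i : ℕ) : ℤ))).toNat :
        ℕ) : ℤ)
  | .scale e a, ρ => e.eval n σ ρ * σ.arr 2 (a.eval n σ ρ)

/-- Statements. `map k l e` sets the entry of array `k` at each `i < n` to the value of `e` at
`l := i`, all at once; `iter i p` runs `p` for `i = n - 1, …, 0`. -/
inductive HStmt
  | skip
  | assign (v : ℕ) (e : HExpr)
  | store (k : ℕ) (a e : HExpr)
  | map (k l : ℕ) (e : HExpr)
  | seq (p q : HStmt)
  | ite (c : HExpr) (p q : HStmt)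
  | iter (i : ℕ) (p : HStmt)

/-- Run `f (n - 1)`, …, `f 0`. -/
def iterDown {α : Type*} (f : ℕ → α → α) : ℕ → α → α
  | 0, s => s
  | m + 1, s => iterDown f m (f m s)

/-- The effect of a statement. -/
def HStmt.run (n : ℕ) : HStmt → RAMState → RAMState
  | .skip, σ => σ
  | .assign v e, σ => σ.setReg v (e.eval n σ 0)
  | .store k a e, σ => σ.setArr k (a.eval n σ 0) (e.eval n σ 0)
  | .map k l e, σ =>
      { σ with arr := Function.update σ.arr k fun z =>
          if 0 ≤ z ∧ z < n then e.eval n σ (Function.update 0 l z) else σ.arr k z }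
  | .seq p q, σ => q.run n (p.run n σ)
  | .ite c p q, σ => if 0 < c.eval n σ 0 then p.run n σ else q.run n σ
  | .iter i p, σ => iterDown (fun m σ => p.run n (σ.setReg i m)) n σ

/-- The `j`-th temporary register. -/
def tmp (j : ℕ) : ℕ := 2 * j + 1

/-- The register that holds the variable `v`. -/
def varReg (v : ℕ) : ℕ := 2 * v + 2

/-- The machine array that holds array `k`; machine array `4` is used as scratch space. -/
def arrIdx (k : ℕ) : ℕ := if k < 4 then k else k + 1

/-- Copy a register, using the target as temporary. -/
def copyReg (r a : ℕ) : RAMProg := .seq (.instr (.const r 0)) (.instr (.add r a r))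

/-- Code that leaves the value of the expression in temporary `j`; bound variable `l` is held in
temporary `ρ l`. -/
def HExpr.compile : HExpr → (ℕ → ℕ) → ℕ → RAMProg
  | .size, _, j => copyReg (tmp j) 0
  | .var v, _, j => copyReg (tmp j) (varReg v)
  | .bvar l, ρ, j => copyReg (tmp j) (tmp (ρ l))
  | .const z, _, j => .instr (.const (tmp j) z)
  | .add a b, ρ, j => .seq (a.compile ρ j) (.seq (b.compile ρ (j + 1))
      (.instr (.add (tmp j) (tmp j) (tmp (j + 1)))))
  | .sub a b, ρ, j => .seq (a.compile ρ j) (.seq (b.compile ρ (j + 1))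
      (.instr (.sub (tmp j) (tmp j) (tmp (j + 1)))))
  | .load k e, ρ, j => .seq (e.compile ρ j) (.instr (.load (tmp j) (arrIdx k) (tmp j)))
  | .cond c a b, ρ, j => .seq (c.compile ρ j) (.ite (tmp j) (a.compile ρ j) (b.compile ρ j))
  | .sum l e, ρ, j => .seq (.instr (.const (tmp j) 0)) (.seq (copyReg (tmp (j + 1)) 0)
      (.loop (tmp (j + 1)) (.seq (.instr (.const (tmp (j + 2)) 1))
        (.seq (.instr (.sub (tmp (j + 1)) (tmp (j + 1)) (tmp (j + 2))))
          (.seq (e.compile (Function.update ρ l (j + 1)) (j + 2))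
            (.instr (.add (tmp j) (tmp j) (tmp (j + 2)))))))))
  | .sup l e, ρ, j => .seq (.instr (.const (tmp j) 0)) (.seq (copyReg (tmp (j + 1)) 0)
      (.loop (tmp (j + 1)) (.seq (.instr (.const (tmp (j + 2)) 1))
        (.seq (.instr (.sub (tmp (j + 1)) (tmp (j + 1)) (tmp (j + 2))))
          (.seq (e.compile (Function.update ρ l (j + 1)) (j + 2))
            (.seq (.instr (.sub (tmp (j + 3)) (tmp (j + 2)) (tmp j)))
              (.ite (tmp (j + 3)) (copyReg (tmp j) (tmp (j + 2)))
                (.instr (.const (tmp (j + 3)) 0)))))))))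
  | .scale e a, ρ, j => .seq (e.compile ρ j) (.seq (a.compile ρ (j + 1))
      (.seq (.instr (.load (tmp (j + 1)) 2 (tmp (j + 1))))
        (.instr (.mul (tmp j) (tmp j) (tmp (j + 1))))))

/-- A bound for the number of steps that the compiled expression takes. -/
def HExpr.time (n : ℕ) : HExpr → ℕ
  | .size => 2
  | .var _ => 2
  | .bvar _ => 2
  | .const _ => 1
  | .add a b => a.time n + (b.time n + 1)
  | .sub a b => a.time n + (b.time n + 1)
  | .load _ e => e.time n + 1
  | .cond c a b => c.time n + (a.time n + b.time n + 1)
  | .sum _ e => 1 + (2 + (n * (1 + (1 + (e.time n + 1)) + 1) + 1))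
  | .sup _ e => 1 + (2 + (n * (1 + (1 + (e.time n + (1 + 3))) + 1) + 1))
  | .scale e a => e.time n + (a.time n + (1 + 1))

/-- Code for a statement, using the temporaries from `j` on. -/
def HStmt.compile : HStmt → ℕ → RAMProg
  | .skip, j => .instr (.const (tmp j) 0)
  | .assign v e, j => .seq (e.compile 0 j) (copyReg (varReg v) (tmp j))
  | .store k a e, j => .seq (a.compile 0 j) (.seq (e.compile 0 (j + 1))
      (.instr (.store (arrIdx k) (tmp j) (tmp (j + 1)))))
  -- Two passes: all values first go to the scratch array, so that `e` is evaluated with the old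
  -- contents of array `k` throughout.
  | .map k l e, j => .seq
      (.seq (copyReg (tmp j) 0)
        (.loop (tmp j) (.seq (.instr (.const (tmp (j + 1)) 1))
          (.seq (.instr (.sub (tmp j) (tmp j) (tmp (j + 1))))
            (.seq (e.compile (Function.update 0 l j) (j + 1))
              (.instr (.store 4 (tmp j) (tmp (j + 1)))))))))
      (.seq (copyReg (tmp j) 0)
        (.loop (tmp j) (.seq (.instr (.const (tmp (j + 1)) 1))
          (.seq (.instr (.sub (tmp j) (tmp j) (tmp (j + 1))))
            (.seq (.instr (.load (tmp (j + 1)) 4 (tmp j)))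
              (.instr (.store (arrIdx k) (tmp j) (tmp (j + 1)))))))))
  | .seq p q, j => .seq (p.compile j) (q.compile j)
  | .ite c p q, j => .seq (c.compile 0 j) (.ite (tmp j) (p.compile j) (q.compile j))
  | .iter i p, j => .seq (copyReg (tmp j) 0)
      (.loop (tmp j) (.seq (.instr (.const (tmp (j + 1)) 1))
        (.seq (.instr (.sub (tmp j) (tmp j) (tmp (j + 1))))
          (.seq (copyReg (varReg i) (tmp j)) (p.compile (j + 1))))))

/-- A bound for the number of steps that the compiled statement takes. -/
def HStmt.time (n : ℕ) : HStmt → ℕ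
  | .skip => 1
  | .assign _ e => e.time n + 2
  | .store _ a e => a.time n + (e.time n + 1)
  | .map _ _ e => (2 + (n * (1 + (1 + (e.time n + 1)) + 1) + 1)) +
      (2 + (n * (1 + (1 + (1 + 1)) + 1) + 1))
  | .seq p q => p.time n + q.time n
  | .ite c p q => c.time n + (p.time n + q.time n + 1)
  | .iter _ p => 2 + (n * (1 + (1 + (2 + p.time n)) + 1) + 1)

/-- The nesting depth of the loops in an expression. -/
def HExpr.depth : HExpr → ℕ
  | .add a b => max a.depth b.depth
  | .sub a b => max a.depth b.depth
  | .load _ e => e.depth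
  | .cond c a b => max c.depth (max a.depth b.depth)
  | .sum _ e => e.depth + 1
  | .sup _ e => e.depth + 1
  | .scale e a => max e.depth a.depth
  | _ => 0

/-- The nesting depth of the loops in a statement. -/
def HStmt.depth : HStmt → ℕ
  | .skip => 0
  | .assign _ e => e.depth
  | .store _ a e => max a.depth e.depth
  | .map _ _ e => e.depth + 1
  | .seq p q => max p.depth q.depth
  | .ite c p q => max c.depth (max p.depth q.depth)
  | .iter _ p => p.depth + 1

/-! ### Polynomial bounds for running times. -/

/-- `f` is bounded by a constant times `n ^ d + 1`. -/
def PolyBound (d : ℕ) (f : ℕ → ℕ) : Prop := ∃ C, ∀ n, f n ≤ C * (n ^ d + 1)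

theorem PolyBound.const (d c : ℕ) : PolyBound d fun _ => c :=
  ⟨c, fun n => by nlinarith [Nat.zero_le (c * n ^ d)]⟩

theorem PolyBound.mono {d d' : ℕ} {f : ℕ → ℕ} (h : PolyBound d f) (hd : d ≤ d') :
    PolyBound d' f := by
  obtain ⟨C, hC⟩ := h
  -- The factor `2` pays for `n = 0`, where `0 ^ 0 = 1` may exceed `0 ^ d'`.
  refine ⟨2 * C, fun n => (hC n).trans ?_⟩
  rcases Nat.eq_zero_or_pos n with rfl | hn
  · have : (0 : ℕ) ^ d ≤ 1 := by cases d <;> simp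
    nlinarith [Nat.zero_le (C * 0 ^ d')]
  · have := Nat.pow_le_pow_right hn hd
    nlinarith [Nat.zero_le (C * n ^ d')]

theorem PolyBound.add {d : ℕ} {f g : ℕ → ℕ} (hf : PolyBound d f) (hg : PolyBound d g) :
    PolyBound d fun n => f n + g n := by
  obtain ⟨C, hC⟩ := hf
  obtain ⟨C', hC'⟩ := hg
  exact ⟨C + C', fun n => by rw [add_mul]; exact Nat.add_le_add (hC n) (hC' n)⟩

theorem PolyBound.mul_id {d : ℕ} {f : ℕ → ℕ} (hf : PolyBound d f) :
    PolyBound (d + 1) fun n => n * f n := by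
  obtain ⟨C, hC⟩ := hf
  refine ⟨2 * C, fun n => (Nat.mul_le_mul_left n (hC n)).trans ?_⟩
  have h : n ≤ n ^ (d + 1) + 1 := by
    rcases Nat.eq_zero_or_pos n with rfl | hn
    · simp
    · exact (Nat.le_self_pow (Nat.succ_ne_zero d) n).trans (Nat.le_succ _)
  calc n * (C * (n ^ d + 1)) = C * (n ^ (d + 1) + n) := by ring
    _ ≤ C * (n ^ (d + 1) + (n ^ (d + 1) + 1)) := by gcongr
    _ ≤ 2 * C * (n ^ (d + 1) + 1) := by nlinarith [Nat.zero_le C]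

/-- The recursion for `time` multiplies by `n` exactly where `depth` increases by one. -/
theorem HExpr.polyBound_time (e : HExpr) : PolyBound e.depth fun n => e.time n := by
  have c := PolyBound.const
  induction e with
  | size => exact c _ _
  | var => exact c _ _
  | bvar => exact c _ _
  | const => exact c _ _
  | add a b ha hb | sub a b ha hb | scale a b ha hb =>
    exact (ha.mono (le_max_left _ _)).add ((hb.mono (le_max_right _ _)).add (c _ _))
  | load k e he => exact he.add (c _ _)
  | cond x a b hx ha hb =>
    refine (hx.mono (le_max_left _ _)).add (((ha.mono ?_).add (hb.mono ?_)).add (c _ _))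
    · exact (le_max_left _ _).trans (le_max_right _ _)
    · exact (le_max_right _ _).trans (le_max_right _ _)
  | sum l e he | sup l e he =>
    exact (c _ _).add ((c _ _).add
      ((((c _ _).add ((c _ _).add (he.add (c _ _)))).add (c _ _)).mul_id.add (c _ _)))

theorem HStmt.polyBound_time (p : HStmt) : PolyBound p.depth fun n => p.time n := by
  have c := PolyBound.const
  induction p with
  | skip => exact c _ _
  | assign v e => exact e.polyBound_time.add (c _ _)
  | store k a e =>
    exact (a.polyBound_time.mono (le_max_left _ _)).add
      ((e.polyBound_time.mono (le_max_right _ _)).add (c _ _))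
  | map k l e =>
    refine PolyBound.add ((c _ _).add
      ((((c _ _).add ((c _ _).add (e.polyBound_time.add (c _ _)))).add (c _ _)).mul_id.add
        (c _ _))) ((c _ _).add (PolyBound.add ?_ (c _ _)))
    exact ((c e.depth _)).mul_id
  | seq p q hp hq => exact (hp.mono (le_max_left _ _)).add (hq.mono (le_max_right _ _))
  | ite x p q hp hq =>
    refine (x.polyBound_time.mono (le_max_left _ _)).add
      (((hp.mono ?_).add (hq.mono ?_)).add (c _ _))
    · exact (le_max_left _ _).trans (le_max_right _ _)
    · exact (le_max_right _ _).trans (le_max_right _ _)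
  | iter i p hp =>
    exact (c _ _).add
      ((((c _ _).add ((c _ _).add ((c _ _).add hp))).add (c _ _)).mul_id.add (c _ _))

/-! ### Correctness of the compiler. -/

theorem tmp_ne_tmp {i j : ℕ} (h : i ≠ j) : tmp i ≠ tmp j := by simp only [tmp]; omega

theorem tmp_ne_varReg (i v : ℕ) : tmp i ≠ varReg v := by simp only [tmp, varReg]; omega

theorem tmp_ne_zero (i : ℕ) : tmp i ≠ 0 := by simp [tmp]

theorem varReg_ne_zero (i : ℕ) : varReg i ≠ 0 := by simp [varReg]

theorem varReg_injective : Function.Injective varReg := fun a b h => by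
  simp only [varReg] at h; omega

theorem arrIdx_injective : Function.Injective arrIdx := fun a b h => by
  simp only [arrIdx] at h; split_ifs at h <;> omega

theorem arrIdx_ne_four (k : ℕ) : arrIdx k ≠ 4 := by
  simp only [arrIdx]; split_ifs <;> omega

@[simp] theorem RAMState.setReg_arr (s : RAMState) (r : ℕ) (z : ℤ) : (s.setReg r z).arr = s.arr :=
  rfl

@[simp] theorem RAMState.setArr_reg (s : RAMState) (k : ℕ) (a z : ℤ) :
    (s.setArr k a z).reg = s.reg := rfl

theorem RAMState.setReg_reg (s : RAMState) (r r' : ℕ) (z : ℤ) :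
    (s.setReg r z).reg r' = if r' = r then z else s.reg r' := by
  simp [RAMState.setReg, Function.update_apply]

theorem RAMState.setArr_arr (s : RAMState) (k k' : ℕ) (a z : ℤ) :
    (s.setArr k a z).arr k' = if k' = k then Function.update (s.arr k) a z else s.arr k' := by
  simp [RAMState.setArr, Function.update_apply]

/-- `s'` differs from `s` only in the temporaries from `j` on. -/
def SameBelow (j : ℕ) (s s' : RAMState) : Prop :=
  s'.arr = s.arr ∧ s'.reg 0 = s.reg 0 ∧ (∀ v, s'.reg (varReg v) = s.reg (varReg v)) ∧
    ∀ i < j, s'.reg (tmp i) = s.reg (tmp i)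

namespace SameBelow

theorem trans {j j' : ℕ} {s s' s'' : RAMState} (h : SameBelow j s s') (h' : SameBelow j' s' s'')
    (hj : j ≤ j') : SameBelow j s s'' :=
  ⟨h'.1.trans h.1, h'.2.1.trans h.2.1, fun v => (h'.2.2.1 v).trans (h.2.2.1 v),
    fun i hi => (h'.2.2.2 i (by omega)).trans (h.2.2.2 i hi)⟩

theorem mono {j j' : ℕ} {s s' : RAMState} (h : SameBelow j s s') (hj : j' ≤ j) :
    SameBelow j' s s' := ⟨h.1, h.2.1, h.2.2.1, fun i hi => h.2.2.2 i (by omega)⟩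

theorem setReg (s : RAMState) {i j : ℕ} (h : j ≤ i) (z : ℤ) :
    SameBelow j s (s.setReg (tmp i) z) := by
  refine ⟨rfl, ?_, fun v => ?_, fun k hk => ?_⟩ <;> rw [RAMState.setReg_reg, if_neg]
  · exact (tmp_ne_zero i).symm
  · exact (tmp_ne_varReg i v).symm
  · exact tmp_ne_tmp (by omega)

end SameBelow

theorem steps_copyReg (s : RAMState) {r a : ℕ} (h : a ≠ r) :
    Steps (copyReg r a) s (s.setReg r (s.reg a)) 2 := by
  have h1 := Steps.instr (.const r 0) s
  have h2 := Steps.instr (.add r a r) (s.setReg r 0)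
  have h3 : (RAMInstr.add r a r).run (s.setReg r 0) = s.setReg r (s.reg a) := by
    simp [RAMInstr.run, RAMState.setReg, h]
  rw [h3] at h2
  exact h1.seq h2

/-- A machine state represents a state of the language. -/
def Represents (n : ℕ) (σ s : RAMState) : Prop :=
  s.reg 0 = n ∧ (∀ v, s.reg (varReg v) = σ.reg v) ∧ ∀ k, s.arr (arrIdx k) = σ.arr k

theorem Represents.of_sameBelow {n j : ℕ} {σ s s' : RAMState} (h : Represents n σ s)
    (hs : SameBelow j s s') : Represents n σ s' :=
  ⟨hs.2.1.trans h.1, fun v => (hs.2.2.1 v).trans (h.2.1 v), fun k => by rw [hs.1]; exact h.2.2 k⟩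

/-- The temporaries `ρ` below `j` hold the values `env` of the bound variables. -/
def HoldsEnv (ρ : ℕ → ℕ) (j : ℕ) (env : ℕ → ℤ) (s : RAMState) : Prop :=
  ∀ l, ρ l < j ∧ s.reg (tmp (ρ l)) = env l

theorem HoldsEnv.of_sameBelow {ρ : ℕ → ℕ} {j j' : ℕ} {env : ℕ → ℤ} {s s' : RAMState}
    (h : HoldsEnv ρ j env s) (hs : SameBelow j s s') (hj : j ≤ j') : HoldsEnv ρ j' env s' :=
  fun l => ⟨(h l).1.trans_le hj, (hs.2.2.2 _ (h l).1).trans (h l).2⟩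

theorem HoldsEnv.update {ρ : ℕ → ℕ} {j i l : ℕ} {env : ℕ → ℤ} {s : RAMState}
    (h : HoldsEnv ρ j env s) (hi : i < j) :
    HoldsEnv (Function.update ρ l i) j (Function.update env l (s.reg (tmp i))) s := by
  intro m
  by_cases hm : m = l
  · subst hm; simp [hi]
  · simpa [hm] using h m

/-- The loop `for i = n - 1, …, 0`, with counter in temporary `j`. -/
theorem steps_countdown {n j T : ℕ} {p : RAMProg} (I : ℕ → RAMState → Prop)
    {s : RAMState} (hs : I n (s.setReg (tmp j) n)) (h0 : s.reg 0 = n)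
    (hbody : ∀ m < n, ∀ s, I (m + 1) s →
      ∃ s', Steps p ((s.setReg (tmp (j + 1)) 1).setReg (tmp j) m) s' T ∧ I m s' ∧
        s'.reg (tmp j) = m) :
    ∃ s', Steps (.seq (copyReg (tmp j) 0)
        (.loop (tmp j) (.seq (.instr (.const (tmp (j + 1)) 1))
          (.seq (.instr (.sub (tmp j) (tmp j) (tmp (j + 1)))) p)))) s s'
        (2 + (n * (1 + (1 + T) + 1) + 1)) ∧ I 0 s' := by
  have hc := steps_copyReg s (tmp_ne_zero j).symm
  rw [h0] at hc
  obtain ⟨s', h1, h2, -⟩ := Steps.loop (a := tmp j) (T := 1 + (1 + T)) I n (p :=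
      (.seq (.instr (.const (tmp (j + 1)) 1))
          (.seq (.instr (.sub (tmp j) (tmp j) (tmp (j + 1)))) p))) (fun m hm s hI hr => by
    obtain ⟨s', h1, h2, h3⟩ := hbody m hm s hI
    refine ⟨s', (Steps.instr _ s).seq ((Steps.instr _ _).seq ?_), h2, h3⟩
    convert h1 using 2
    simp [RAMInstr.run, RAMState.setReg_reg, hr, tmp_ne_tmp (show j ≠ j + 1 by omega)])
    hs (by simp [RAMState.setReg_reg])
  exact ⟨s', hc.seq h1, h2⟩

/-- Loops count down, so the accumulator holds the sum over `m ≤ i < n`, and each pass adds the term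
at the lower end. -/
theorem sum_fin_range_succ_sub {n m : ℕ} (f : ℕ → ℤ) (hm : m < n) :
    ∑ i ∈ (Finset.range n).filter (m ≤ ·), f i =
      f m + ∑ i ∈ (Finset.range n).filter (m + 1 ≤ ·), f i := by
  have : (Finset.range n).filter (m ≤ ·) = insert m ((Finset.range n).filter (m + 1 ≤ ·)) := by
    ext i; simp; omega
  rw [this, Finset.sum_insert (by simp)]

/-- Code at level `j` changes no temporary below `j`, so operands and loop data already stored
survive the evaluation of subexpressions. In a loop, temporary `j` accumulates, `j + 1` counts and
holds the bound variable, and the body works from `j + 2` on. -/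
theorem HExpr.steps_compile {n : ℕ} {σ : RAMState} (e : HExpr) :
    ∀ (ρ : ℕ → ℕ) (j : ℕ) (env : ℕ → ℤ) (s : RAMState), Represents n σ s → HoldsEnv ρ j env s →
      ∃ s', Steps (e.compile ρ j) s s' (e.time n) ∧ SameBelow j s s' ∧
        s'.reg (tmp j) = e.eval n σ env := by
  induction e with
  | size =>
    intro ρ j env s hs he
    refine ⟨_, steps_copyReg s (tmp_ne_zero j).symm, .setReg _ le_rfl _, ?_⟩
    simp [RAMState.setReg_reg, hs.1, eval]
  | var v =>
    intro ρ j env s hs he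
    refine ⟨_, steps_copyReg s (tmp_ne_varReg j v).symm, .setReg _ le_rfl _, ?_⟩
    simp [RAMState.setReg_reg, hs.2.1, eval]
  | bvar l =>
    intro ρ j env s hs he
    refine ⟨_, steps_copyReg s (tmp_ne_tmp (he l).1.ne), .setReg _ le_rfl _, ?_⟩
    simp [RAMState.setReg_reg, (he l).2, eval]
  | const z =>
    intro ρ j env s hs he
    exact ⟨_, Steps.instr _ s, .setReg _ le_rfl _, by simp [RAMInstr.run, RAMState.setReg_reg, eval]⟩
  | add a b iha ihb | sub a b iha ihb =>
    intro ρ j env s hs he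
    obtain ⟨s1, h1, f1, v1⟩ := iha ρ j env s hs he
    obtain ⟨s2, h2, f2, v2⟩ := ihb ρ (j + 1) env s1 (hs.of_sameBelow f1)
      (he.of_sameBelow f1 (by omega))
    refine ⟨_, h1.seq (h2.seq (Steps.instr _ s2)),
      (f1.trans f2 (by omega)).trans (.setReg _ le_rfl _) le_rfl, ?_⟩
    simp [RAMInstr.run, RAMState.setReg_reg, eval, v2, f2.2.2.2 j (by omega), v1]
  | load k e ih =>
    intro ρ j env s hs he
    obtain ⟨s1, h1, f1, v1⟩ := ih ρ j env s hs he
    refine ⟨_, h1.seq (Steps.instr _ s1), f1.trans (.setReg _ le_rfl _) le_rfl, ?_⟩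
    simp [RAMInstr.run, RAMState.setReg_reg, eval, v1, f1.1, hs.2.2]
  | cond c a b ihc iha ihb =>
    intro ρ j env s hs he
    obtain ⟨s1, h1, f1, v1⟩ := ihc ρ j env s hs he
    by_cases hc : 0 < c.eval n σ env
    · obtain ⟨s2, h2, f2, v2⟩ := iha ρ j env s1 (hs.of_sameBelow f1)
        (he.of_sameBelow f1 le_rfl)
      refine ⟨_, h1.seq ((Steps.ite_pos (by rwa [v1]) h2).mono ?_), f1.trans f2 le_rfl, ?_⟩
      · omega
      · simp [eval, hc, v2]
    · obtain ⟨s2, h2, f2, v2⟩ := ihb ρ j env s1 (hs.of_sameBelow f1)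
        (he.of_sameBelow f1 le_rfl)
      refine ⟨_, h1.seq ((Steps.ite_neg (by rwa [v1]) h2).mono ?_), f1.trans f2 le_rfl, ?_⟩
      · omega
      · simp [eval, hc, v2]
  | sum l e ih =>
    intro ρ j env s hs he
    have f0 : SameBelow j s (s.setReg (tmp j) 0) := .setReg _ le_rfl _
    obtain ⟨s', h1, f, v⟩ := steps_countdown (n := n) (j := j + 1) (T := e.time n + 1)
      (fun m s' => SameBelow j s s' ∧ s'.reg (tmp j) =
        ∑ i ∈ (Finset.range n).filter (m ≤ ·), e.eval n σ (Function.update env l ((i : ℕ) : ℤ)))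
      (s := s.setReg (tmp j) 0)
      (p := .seq (e.compile (Function.update ρ l (j + 1)) (j + 2))
            (.instr (.add (tmp j) (tmp j) (tmp (j + 2)))))
      (by
      refine ⟨f0.trans (.setReg _ (Nat.le_succ j) _) le_rfl, ?_⟩
      rw [RAMState.setReg_reg, if_neg (tmp_ne_tmp (Nat.lt_succ_self j).ne), RAMState.setReg_reg,
        if_pos rfl, Finset.sum_eq_zero]
      intro i hi
      simp at hi
      omega)
      (by
      exact f0.2.1.trans hs.1)
      (by
      rintro m hm s1 ⟨f1, v1⟩
      set s2 := (s1.setReg (tmp (j + 1 + 1)) 1).setReg (tmp (j + 1)) m with hs2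
      have f2 : SameBelow (j + 1) s1 s2 :=
        (SameBelow.setReg s1 (by omega) 1).trans (.setReg _ (by omega) _) le_rfl
      have v2 : s2.reg (tmp (j + 1)) = m := by simp [hs2, RAMState.setReg_reg]
      have f3 := f1.trans f2 (by omega)
      have he2 := (he.of_sameBelow f3 (show j ≤ j + 2 by omega)).update (l := l)
        (show j + 1 < j + 2 by omega)
      rw [v2] at he2
      obtain ⟨s3, h3, f4, v3⟩ := ih _ _ _ s2 (hs.of_sameBelow f3) he2
      refine ⟨_, h3.seq (Steps.instr _ s3), ⟨(f3.trans f4 (by omega)).trans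
        (.setReg _ le_rfl _) le_rfl, ?_⟩, ?_⟩
      · simp only [RAMInstr.run, RAMState.setReg_reg, if_true]
        rw [v3, f4.2.2.2 j (by omega), f2.2.2.2 j (by omega), v1, sum_fin_range_succ_sub
          (fun i : ℕ => e.eval n σ (Function.update env l (i : ℤ))) hm, add_comm]
      · simp only [RAMInstr.run, RAMState.setReg_reg]
        rw [if_neg (tmp_ne_tmp (by omega)), f4.2.2.2 _ (by omega), v2])
    refine ⟨s', (Steps.instr _ s).seq h1, f, ?_⟩
    rw [v, eval, ← Finset.sum_range fun i : ℕ => e.eval n σ (Function.update env l (i : ℤ))]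
    simp
  | sup l e ih =>
    intro ρ j env s hs he
    have f0 : SameBelow j s (s.setReg (tmp j) 0) := .setReg _ le_rfl _
    obtain ⟨s', h1, f, v⟩ := steps_countdown (n := n) (j := j + 1) (T := e.time n + (1 + 3))
      (fun m s' => SameBelow j s s' ∧ s'.reg (tmp j) =
        ((((Finset.range n).filter (m ≤ ·)).sup fun i : ℕ =>
          (e.eval n σ (Function.update env l (i : ℤ))).toNat : ℕ) : ℤ))
      (s := s.setReg (tmp j) 0)
      (p := .seq (e.compile (Function.update ρ l (j + 1)) (j + 2))
            (.seq (.instr (.sub (tmp (j + 3)) (tmp (j + 2)) (tmp j)))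
              (.ite (tmp (j + 3)) (copyReg (tmp j) (tmp (j + 2)))
                (.instr (.const (tmp (j + 3)) 0)))))
      (by
      refine ⟨f0.trans (.setReg _ (Nat.le_succ j) _) le_rfl, ?_⟩
      rw [RAMState.setReg_reg, if_neg (tmp_ne_tmp (Nat.lt_succ_self j).ne), RAMState.setReg_reg,
        if_pos rfl]
      have : (Finset.range n).filter (n ≤ ·) = ∅ := by ext i; simp
      simp [this])
      (by
      exact f0.2.1.trans hs.1)
      (by
      rintro m hm s1 ⟨f1, v1⟩
      set s2 := (s1.setReg (tmp (j + 1 + 1)) 1).setReg (tmp (j + 1)) m with hs2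
      have f2 : SameBelow (j + 1) s1 s2 :=
        (SameBelow.setReg s1 (by omega) 1).trans (.setReg _ (by omega) _) le_rfl
      have v2 : s2.reg (tmp (j + 1)) = m := by simp [hs2, RAMState.setReg_reg]
      have f3 := f1.trans f2 (by omega)
      have he2 := (he.of_sameBelow f3 (show j ≤ j + 2 by omega)).update (l := l)
        (show j + 1 < j + 2 by omega)
      rw [v2] at he2
      obtain ⟨s3, h3, f4, v3⟩ := ih _ _ _ s2 (hs.of_sameBelow f3) he2
      have hset : (Finset.range n).filter (m ≤ ·) =
          insert m ((Finset.range n).filter (m + 1 ≤ ·)) := by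
        ext i; simp; omega
      have vj : s3.reg (tmp j) = ((((Finset.range n).filter (m + 1 ≤ ·)).sup fun i : ℕ =>
          (e.eval n σ (Function.update env l (i : ℤ))).toNat : ℕ) : ℤ) := by
        rw [f4.2.2.2 j (by omega), f2.2.2.2 j (by omega), v1]
      set s4 := s3.setReg (tmp (j + 3)) (s3.reg (tmp (j + 2)) - s3.reg (tmp j)) with hs4
      have f5 : SameBelow (j + 3) s3 s4 := .setReg _ le_rfl _
      have f35 : SameBelow j s s4 := (f3.trans f4 (by omega)).trans f5 (by omega)
      have h4 : Steps (.instr (.sub (tmp (j + 3)) (tmp (j + 2)) (tmp j))) s3 s4 1 := .instr _ _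
      have v4 : s4.reg (tmp (j + 3)) = s3.reg (tmp (j + 2)) - s3.reg (tmp j) := by
        simp [hs4, RAMState.setReg_reg]
      rw [hset, Finset.sup_insert]
      -- The accumulator is replaced only by a larger value. Since it is never negative, negative
      -- values count as `0`, in agreement with `Int.toNat`.
      by_cases hlt : 0 < s4.reg (tmp (j + 3))
      · refine ⟨_, h3.seq (h4.seq (Steps.ite_pos hlt
          (steps_copyReg s4 (tmp_ne_tmp (show j + 2 ≠ j by omega))))),
          ⟨f35.trans (.setReg _ le_rfl _) le_rfl, ?_⟩, ?_⟩
        · rw [RAMState.setReg_reg, if_pos rfl, f5.2.2.2 _ (by omega), v3]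
          rw [v4, v3, vj] at hlt
          push_cast
          rw [Int.toNat_of_nonneg (by omega)]
          exact (max_eq_left (by omega)).symm
        · rw [RAMState.setReg_reg, if_neg (tmp_ne_tmp (by omega)), f5.2.2.2 _ (by omega),
            f4.2.2.2 _ (by omega), v2]
      · refine ⟨_, h3.seq (h4.seq ((Steps.ite_neg hlt (Steps.instr _ s4)).mono (by omega))),
          ⟨f35.trans (.setReg _ (by omega) _) le_rfl, ?_⟩, ?_⟩
        · simp only [RAMInstr.run, RAMState.setReg_reg]
          rw [if_neg (tmp_ne_tmp (by omega)), f5.2.2.2 _ (by omega), vj]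
          rw [v4, v3, vj] at hlt
          congr 1
          exact (sup_eq_right.2 (Int.toNat_le.2 (by omega))).symm
        · simp only [RAMInstr.run, RAMState.setReg_reg]
          rw [if_neg (tmp_ne_tmp (by omega)), f5.2.2.2 _ (by omega), f4.2.2.2 _ (by omega), v2])
    refine ⟨s', (Steps.instr _ s).seq h1, f, ?_⟩
    rw [v, eval]
    congr 1
    apply le_antisymm
    · refine Finset.sup_le fun i hi => ?_
      simp at hi
      exact Finset.le_sup (f := fun i : Fin n =>
        (e.eval n σ (Function.update env l ((i : ℕ) : ℤ))).toNat) (Finset.mem_univ ⟨i, hi⟩)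
    · refine Finset.sup_le fun i _ => ?_
      exact Finset.le_sup (f := fun i : ℕ =>
        (e.eval n σ (Function.update env l (i : ℤ))).toNat) (by simp)
  | scale a b iha ihb =>
    intro ρ j env s hs he
    obtain ⟨s1, h1, f1, v1⟩ := iha ρ j env s hs he
    obtain ⟨s2, h2, f2, v2⟩ := ihb ρ (j + 1) env s1 (hs.of_sameBelow f1)
      (he.of_sameBelow f1 (by omega))
    have f3 := f1.trans f2 (by omega)
    refine ⟨_, h1.seq (h2.seq ((Steps.instr _ s2).seq (Steps.instr _ _))),
      (f3.trans (.setReg _ (by omega) _) le_rfl).trans (.setReg _ le_rfl _) le_rfl, ?_⟩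
    have h22 : s2.arr 2 = σ.arr 2 := by rw [f3.1]; exact hs.2.2 2
    simp [RAMInstr.run, RAMState.setReg_reg, eval, v2, tmp_ne_tmp (show j ≠ j + 1 by omega),
      f2.2.2.2 j (by omega), v1, h22]

theorem Represents.setReg {n v : ℕ} {σ s : RAMState} (h : Represents n σ s) (z : ℤ) :
    Represents n (σ.setReg v z) (s.setReg (varReg v) z) := by
  refine ⟨?_, fun v' => ?_, h.2.2⟩
  · rw [RAMState.setReg_reg, if_neg (varReg_ne_zero v).symm]
    exact h.1
  · simp only [RAMState.setReg_reg, varReg_injective.eq_iff, h.2.1]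

theorem Represents.setArr {n k : ℕ} {σ s : RAMState} (h : Represents n σ s) (a z : ℤ) :
    Represents n (σ.setArr k a z) (s.setArr (arrIdx k) a z) := by
  refine ⟨h.1, h.2.1, fun k' => ?_⟩
  simp only [RAMState.setArr_arr, arrIdx_injective.eq_iff, h.2.2]

/-- `s'` agrees with `s` on the temporaries below `j`. -/
def SameTemps (j : ℕ) (s s' : RAMState) : Prop := ∀ i < j, s'.reg (tmp i) = s.reg (tmp i)

theorem SameTemps.trans {j : ℕ} {s s' s'' : RAMState} (h : SameTemps j s s')
    (h' : SameTemps j s' s'') : SameTemps j s s'' := fun i hi => (h' i hi).trans (h i hi)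

theorem SameTemps.mono {j j' : ℕ} {s s' : RAMState} (h : SameTemps j s s') (hj : j' ≤ j) :
    SameTemps j' s s' := fun i hi => h i (by omega)

theorem SameBelow.sameTemps {j : ℕ} {s s' : RAMState} (h : SameBelow j s s') : SameTemps j s s' :=
  h.2.2.2

theorem SameTemps.setReg (s : RAMState) (j v : ℕ) (z : ℤ) :
    SameTemps j s (s.setReg (varReg v) z) := fun i _ => by
  rw [RAMState.setReg_reg, if_neg (tmp_ne_varReg i v)]

/-- Lists the intermediate states, indexed by the number of remaining iterations; `steps_countdown`
wants its invariant in this form. -/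
theorem iterDown_eq_of_le {α : Type*} (f : ℕ → α → α) (n : ℕ) (s : α) :
    ∃ g : ℕ → α, g n = s ∧ g 0 = iterDown f n s ∧ ∀ m < n, g m = f m (g (m + 1)) := by
  induction n generalizing s with
  | zero => exact ⟨fun _ => s, rfl, rfl, by simp⟩
  | succ n ih =>
    obtain ⟨g, h1, h2, h3⟩ := ih (f n s)
    refine ⟨fun m => if m = n + 1 then s else g m, by simp, by simp [h2, iterDown], ?_⟩
    intro m hm
    rcases Nat.lt_succ_iff_lt_or_eq.1 hm with h | rfl
    · simp [h3 m h, show m ≠ n + 1 by omega, show m ≠ n by omega]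
    · simp [h1]

/-- A statement may change variables and arrays, so in contrast to expressions only the temporaries
below `j` are preserved. These hold the counters of the enclosing loops. -/
theorem HStmt.steps_compile {n : ℕ} (p : HStmt) :
    ∀ (j : ℕ) (σ s : RAMState), Represents n σ s → 0 < j → s.reg (tmp 0) = 0 →
      ∃ s', Steps (p.compile j) s s' (p.time n) ∧ Represents n (p.run n σ) s' ∧
        SameTemps j s s' := by
  -- Outside of all binders every bound variable is read from temporary `0`. It initially holds `0`,
  -- and it is never overwritten because statements are compiled with `0 < j`.
  have he : ∀ {j : ℕ} {s : RAMState}, 0 < j → s.reg (tmp 0) = 0 → HoldsEnv 0 j 0 s :=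
    fun hj h l => ⟨hj, h⟩
  induction p with
  | skip =>
    intro j σ s hs hj h0
    have f : SameBelow j s (s.setReg (tmp j) 0) := .setReg _ le_rfl _
    exact ⟨_, Steps.instr _ s, hs.of_sameBelow f, f.sameTemps⟩
  | assign v e =>
    intro j σ s hs hj h0
    obtain ⟨s1, h1, f1, v1⟩ := e.steps_compile 0 j 0 s hs (he hj h0)
    refine ⟨_, h1.seq (steps_copyReg s1 (tmp_ne_varReg j v)), ?_, ?_⟩
    · rw [v1]
      exact (hs.of_sameBelow f1).setReg _
    · exact f1.sameTemps.trans (.setReg _ _ _ _)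
  | store k a e =>
    intro j σ s hs hj h0
    obtain ⟨s1, h1, f1, v1⟩ := a.steps_compile 0 j 0 s hs (he hj h0)
    obtain ⟨s2, h2, f2, v2⟩ := e.steps_compile 0 (j + 1) 0 s1 (hs.of_sameBelow f1)
      ((he hj h0).of_sameBelow f1 (by omega))
    have f3 := f1.trans f2 (by omega)
    refine ⟨_, h1.seq (h2.seq (Steps.instr _ s2)), ?_, f3.sameTemps⟩
    simp only [RAMInstr.run, v2, f2.2.2.2 j (by omega), v1]
    exact (hs.of_sameBelow f3).setArr _ _
  | map k l e =>
    intro j σ s hs hj h0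
    have hold : ∀ {s' : RAMState}, SameTemps j s s' → HoldsEnv 0 j 0 s' := fun h =>
      he hj ((h 0 hj).trans h0)
    -- Machine array `4` is not in the range of `arrIdx`, so writing to it does not affect the
    -- represented state.
    have scratch : ∀ {s' : RAMState} (a z : ℤ), Represents n σ s' →
        Represents n σ (s'.setArr 4 a z) := fun a z h =>
      ⟨h.1, h.2.1, fun k' => by rw [RAMState.setArr_arr, if_neg (arrIdx_ne_four k'), h.2.2]⟩
    obtain ⟨s1, h1, r1, f1, v1⟩ := steps_countdown (n := n) (j := j) (T := e.time n + 1)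
      (fun m s' => Represents n σ s' ∧ SameTemps j s s' ∧
        ∀ i : ℕ, m ≤ i → i < n → s'.arr 4 i = e.eval n σ (Function.update 0 l (i : ℤ)))
      (s := s) (p := .seq (e.compile (Function.update 0 l j) (j + 1))
              (.instr (.store 4 (tmp j) (tmp (j + 1)))))
      ⟨hs.of_sameBelow (.setReg _ le_rfl _), (SameBelow.setReg s le_rfl _).sameTemps,
        fun i h1 h2 => absurd h1 (by omega)⟩ hs.1 (by
      rintro m hm s1 ⟨r1, f1, v1⟩
      set s2 := (s1.setReg (tmp (j + 1)) 1).setReg (tmp j) m with hs2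
      have f2 : SameBelow j s1 s2 :=
        (SameBelow.setReg s1 (by omega) 1).trans (.setReg _ le_rfl _) le_rfl
      have v2 : s2.reg (tmp j) = m := by simp [hs2, RAMState.setReg_reg]
      have he2 : HoldsEnv _ _ _ s2 := HoldsEnv.update (l := l) (fun l' =>
        ⟨((hold (f1.trans f2.sameTemps)) l').1.trans_le (Nat.le_succ j),
          ((hold (f1.trans f2.sameTemps)) l').2⟩) (Nat.lt_succ_self j)
      rw [v2] at he2
      obtain ⟨s3, h3, f3, v3⟩ := e.steps_compile _ _ _ s2 (r1.of_sameBelow f2) he2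
      have v3j : s3.reg (tmp j) = m := (f3.2.2.2 j (by omega)).trans v2
      refine ⟨_, h3.seq (Steps.instr _ s3), ⟨?_, ?_, ?_⟩, ?_⟩
      · exact scratch _ _ ((r1.of_sameBelow f2).of_sameBelow f3)
      · exact (f1.trans f2.sameTemps).trans (f3.mono (Nat.le_succ j)).sameTemps
      · intro i hi hin
        simp only [RAMInstr.run, RAMState.setArr_arr, if_true, v3j]
        rcases Nat.eq_or_lt_of_le hi with rfl | hlt
        · simp [v3]
        · rw [Function.update_of_ne (by omega), f3.1, f2.1, v1 i hlt hin]
      · exact v3j)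
    obtain ⟨s2, h2, r2, f2, v2⟩ := steps_countdown (n := n) (j := j) (T := 1 + 1)
      (fun m s' => Represents n ⟨σ.reg, Function.update σ.arr k fun z =>
          if m ≤ z ∧ z < n then e.eval n σ (Function.update 0 l z) else σ.arr k z⟩ s' ∧
        SameTemps j s s' ∧
        ∀ i : ℕ, i < n → s'.arr 4 i = e.eval n σ (Function.update 0 l (i : ℤ)))
      (s := s1) (p := .seq (.instr (.load (tmp (j + 1)) 4 (tmp j)))
              (.instr (.store (arrIdx k) (tmp j) (tmp (j + 1))))) (by
      have f3 : SameBelow j s1 (s1.setReg (tmp j) n) := .setReg _ le_rfl _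
      refine ⟨?_, f1.trans f3.sameTemps, fun i hi => v1 i (Nat.zero_le i) hi⟩
      convert r1.of_sameBelow f3 using 1
      have : (fun z => if (n : ℤ) ≤ z ∧ z < n then e.eval n σ (Function.update 0 l z)
          else σ.arr k z) = σ.arr k := by
        funext z
        rw [if_neg (by omega)]
      rw [this, Function.update_eq_self]) r1.1 (by
      rintro m hm s1 ⟨r1, f1, v1⟩
      set s2 := (s1.setReg (tmp (j + 1)) 1).setReg (tmp j) m with hs2
      have f2 : SameBelow j s1 s2 :=
        (SameBelow.setReg s1 (by omega) 1).trans (.setReg _ le_rfl _) le_rfl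
      have v2 : s2.reg (tmp j) = m := by simp [hs2, RAMState.setReg_reg]
      set s3 := (RAMInstr.load (tmp (j + 1)) 4 (tmp j)).run s2 with hs3
      have f3 : SameBelow (j + 1) s2 s3 := .setReg _ le_rfl _
      have v3j : s3.reg (tmp j) = m := (f3.2.2.2 j (by omega)).trans v2
      have v3 : s3.reg (tmp (j + 1)) = e.eval n σ (Function.update 0 l (m : ℤ)) := by
        rw [hs3, RAMInstr.run, RAMState.setReg_reg, if_pos rfl, v2, f2.1, v1 m hm]
      refine ⟨_, (Steps.instr _ s2).seq (Steps.instr _ s3), ⟨?_, ?_, ?_⟩, ?_⟩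
      · have r3 := ((r1.of_sameBelow f2).of_sameBelow f3).setArr (k := k) (m : ℤ)
          (e.eval n σ (Function.update 0 l (m : ℤ)))
        simp only [RAMInstr.run, v3j, v3]
        convert r3 using 1
        simp only [RAMState.setArr, RAMState.mk.injEq, true_and, Function.update_idem,
          Function.update_self]
        congr 1
        funext z
        by_cases hz : z = m
        · subst hz
          simp [hm]
        · rw [Function.update_of_ne hz]
          have : (m : ℤ) ≤ z ↔ ((m + 1 : ℕ) : ℤ) ≤ z := by push_cast; omega
          simp only [this]
      · exact (f1.trans f2.sameTemps).trans (f3.mono (Nat.le_succ j)).sameTemps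
      · intro i hin
        simp only [RAMInstr.run, RAMState.setArr_arr, if_neg (arrIdx_ne_four k).symm]
        rw [f3.1, f2.1, v1 i hin]
      · exact v3j)
    exact ⟨s2, h1.seq h2, by simpa [run] using r2, f2⟩
  | seq p q hp hq =>
    intro j σ s hs hj h0
    obtain ⟨s1, h1, r1, f1⟩ := hp j σ s hs hj h0
    obtain ⟨s2, h2, r2, f2⟩ := hq j _ s1 r1 hj ((f1 0 hj).trans h0)
    exact ⟨s2, h1.seq h2, r2, f1.trans f2⟩
  | ite c p q hp hq =>
    intro j σ s hs hj h0
    obtain ⟨s1, h1, f1, v1⟩ := c.steps_compile 0 j 0 s hs (he hj h0)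
    have r1 := hs.of_sameBelow f1
    have h01 : s1.reg (tmp 0) = 0 := (f1.2.2.2 0 hj).trans h0
    by_cases hc : 0 < c.eval n σ 0
    · obtain ⟨s2, h2, r2, f2⟩ := hp j σ s1 r1 hj h01
      refine ⟨s2, h1.seq ((Steps.ite_pos (by rwa [v1]) h2).mono (by omega)), ?_,
        f1.sameTemps.trans f2⟩
      simpa [run, hc] using r2
    · obtain ⟨s2, h2, r2, f2⟩ := hq j σ s1 r1 hj h01
      refine ⟨s2, h1.seq ((Steps.ite_neg (by rwa [v1]) h2).mono (by omega)), ?_,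
        f1.sameTemps.trans f2⟩
      simpa [run, hc] using r2
  | iter i p hp =>
    intro j σ s hs hj h0
    obtain ⟨g, g1, g2, g3⟩ := iterDown_eq_of_le (fun m σ => p.run n (σ.setReg i m)) n σ
    obtain ⟨s1, h1, r1, f1⟩ := steps_countdown (n := n) (j := j) (T := 2 + p.time n)
      (fun m s' => Represents n (g m) s' ∧ SameTemps j s s')
      (s := s) (p := .seq (copyReg (varReg i) (tmp j)) (p.compile (j + 1)))
      ⟨by rw [g1]; exact hs.of_sameBelow (.setReg _ le_rfl _),
        (SameBelow.setReg s le_rfl _).sameTemps⟩ hs.1 (by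
      rintro m hm s1 ⟨r1, f1⟩
      set s2 := (s1.setReg (tmp (j + 1)) 1).setReg (tmp j) m with hs2
      have f2 : SameBelow j s1 s2 :=
        (SameBelow.setReg s1 (by omega) 1).trans (.setReg _ le_rfl _) le_rfl
      have v2 : s2.reg (tmp j) = m := by simp [hs2, RAMState.setReg_reg]
      have h2 := steps_copyReg s2 (tmp_ne_varReg j i)
      rw [v2] at h2
      have f3 : SameTemps (j + 1) s2 (s2.setReg (varReg i) m) := .setReg _ _ _ _
      have f23 := (f1.trans f2.sameTemps).trans (f3.mono (Nat.le_succ j))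
      obtain ⟨s3, h3, r3, f4⟩ := hp (j + 1) _ _ ((r1.of_sameBelow f2).setReg (v := i) m)
        (by omega) ((f23 0 hj).trans h0)
      refine ⟨s3, h2.seq h3, ⟨by rw [g3 m hm]; exact r3,
        f23.trans (f4.mono (Nat.le_succ j))⟩, ?_⟩
      rw [f4 j (by omega), f3 j (by omega), v2])
    exact ⟨s1, h1, by rw [run, ← g2]; exact r1, f1⟩

/-! ## Bit cost -/

/-- All registers and array entries are at most `2 ^ B` in absolute value. -/
def BoundedState (B : ℕ) (s : RAMState) : Prop :=
  (∀ r, (s.reg r).natAbs ≤ 2 ^ B) ∧ ∀ k z, (s.arr k z).natAbs ≤ 2 ^ B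

theorem BoundedState.mono {B B' : ℕ} {s : RAMState} (h : BoundedState B s) (hB : B ≤ B') :
    BoundedState B' s :=
  have h2 : 2 ^ B ≤ 2 ^ B' := Nat.pow_le_pow_right (by norm_num) hB
  ⟨fun r => (h.1 r).trans h2, fun k z => (h.2 k z).trans h2⟩

theorem BoundedState.setReg {B : ℕ} {s : RAMState} (h : BoundedState B s) (r : ℕ) {z : ℤ}
    (hz : z.natAbs ≤ 2 ^ B) : BoundedState B (s.setReg r z) := by
  refine ⟨fun r' => ?_, h.2⟩
  rw [RAMState.setReg_reg]
  split_ifs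
  exacts [hz, h.1 r']

theorem BoundedState.setArr {B : ℕ} {s : RAMState} (h : BoundedState B s) (k : ℕ) (a : ℤ) {z : ℤ}
    (hz : z.natAbs ≤ 2 ^ B) : BoundedState B (s.setArr k a z) := by
  refine ⟨h.1, fun k' a' => ?_⟩
  rw [RAMState.setArr_arr]
  split_ifs
  · rw [Function.update_apply]
    split_ifs
    exacts [hz, h.2 k a']
  · exact h.2 k' a'

theorem bitLen_le {B : ℕ} {z : ℤ} (h : z.natAbs ≤ 2 ^ B) : bitLen z ≤ B + 2 := by
  have : z.natAbs.size ≤ B + 1 :=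
    Nat.size_le.2 (h.trans_lt (Nat.pow_lt_pow_right (by norm_num) (Nat.lt_succ_self B)))
  simp only [bitLen]
  omega

theorem natAbs_le_two_pow_bitLen (z : ℤ) : z.natAbs ≤ 2 ^ bitLen z :=
  (Nat.lt_size_self _).le.trans (Nat.pow_le_pow_right (by norm_num) (Nat.le_succ _))

/-- The values that occur in a run are bounded in terms of its bit cost. -/
theorem RAMExec.boundedState {P : RAMProg} {s s' : RAMState} {t b : ℕ} (h : RAMExec P s s' t b) :
    ∀ {B : ℕ}, BoundedState B s → BoundedState (B + b) s' := by
  have key : ∀ {B b : ℕ} {z : ℤ}, bitLen z ≤ b → z.natAbs ≤ 2 ^ (B + b) := fun {B b z} h =>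
    (natAbs_le_two_pow_bitLen z).trans (Nat.pow_le_pow_right (by norm_num) (by omega))
  induction h with
  | instr i s =>
    intro B hB
    have h' := hB.mono (Nat.le_add_right B (i.bitCost s))
    cases i with
    | const r z => exact h'.setReg _ (key le_rfl)
    | add r a b => exact h'.setReg _ (key (by simp [RAMInstr.bitCost]))
    | sub r a b => exact h'.setReg _ (key (by simp [RAMInstr.bitCost]))
    | mul r a b => exact h'.setReg _ (key (by simp [RAMInstr.bitCost]))
    | load r k a => exact h'.setReg _ (key (by simp [RAMInstr.bitCost]))
    | store k a b => exact h'.setArr _ _ (key (by simp [RAMInstr.bitCost]))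
  | seq p q s s' s'' t t' b b' hp hq ihp ihq =>
    intro B hB
    rw [← add_assoc]
    exact ihq (ihp hB)
  | ite_pos a p q s s' t b ha hp ih | ite_neg a p q s s' t b ha hp ih =>
    intro B hB
    exact (ih hB).mono (by omega)
  | loop_pos a p s s' s'' t t' b b' ha hp hrec ihp ihr =>
    intro B hB
    exact (ihr (ihp hB)).mono (by omega)
  | loop_neg a p s ha =>
    intro B hB
    exact hB.mono (by omega)

/-- Programs that multiply only by entries of array `2`, do not change this array, and use
constants of at most `c` bits. -/
inductive Tame (c : ℕ) : RAMProg → Prop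
  | const (r : ℕ) (z : ℤ) (hz : z.natAbs ≤ 2 ^ c) : Tame c (.instr (.const r z))
  | add (r a b : ℕ) : Tame c (.instr (.add r a b))
  | sub (r a b : ℕ) : Tame c (.instr (.sub r a b))
  | load (r k a : ℕ) : Tame c (.instr (.load r k a))
  | store (k a b : ℕ) (hk : k ≠ 2) : Tame c (.instr (.store k a b))
  | scale (q a r x : ℕ) (hx : x ≠ q) :
      Tame c (.seq (.instr (.load q 2 a)) (.instr (.mul r x q)))
  | seq {p q : RAMProg} (hp : Tame c p) (hq : Tame c q) : Tame c (.seq p q)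
  | ite (a : ℕ) {p q : RAMProg} (hp : Tame c p) (hq : Tame c q) : Tame c (.ite a p q)
  | loop (a : ℕ) {p : RAMProg} (hp : Tame c p) : Tame c (.loop a p)

theorem Tame.mono {c c' : ℕ} {P : RAMProg} (h : Tame c P) (hc : c ≤ c') : Tame c' P := by
  induction h with
  | const r z hz => exact .const r z (hz.trans (Nat.pow_le_pow_right (by norm_num) hc))
  | add r a b => exact .add r a b
  | sub r a b => exact .sub r a b
  | load r k a => exact .load r k a
  | store k a b hk => exact .store k a b hk
  | scale q a r x hx => exact .scale q a r x hx
  | seq _ _ ihp ihq => exact .seq ihp ihq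
  | ite a _ _ ihp ihq => exact .ite a ihp ihq
  | loop a _ ih => exact .loop a ih

theorem two_pow_add_le {B : ℕ} {x y : ℕ} (hx : x ≤ 2 ^ B) (hy : y ≤ 2 ^ B) :
    x + y ≤ 2 ^ (B + 1) := by rw [pow_succ]; omega

/-- In a tame run the bit lengths grow at most linearly with the number of steps. -/
theorem Tame.bitCost_le {c D : ℕ} {P : RAMProg} {s s' : RAMState} {t b : ℕ}
    (h : RAMExec P s s' t b) : Tame c P → ∀ {B : ℕ}, BoundedState B s → c ≤ B →
      (∀ z, (s.arr 2 z).natAbs ≤ 2 ^ D) →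
      BoundedState (B + t * (D + 1)) s' ∧ s'.arr 2 = s.arr 2 ∧
        b ≤ t * (3 * (B + t * (D + 1) + 2)) := by
  induction h with
  | instr i s =>
    intro hT B hB hc hD
    have h' := hB.mono (show B ≤ B + 1 * (D + 1) by omega)
    have hadd : ∀ {x y : ℤ}, x.natAbs ≤ 2 ^ B → y.natAbs ≤ 2 ^ B →
        (x + y).natAbs ≤ 2 ^ (B + 1 * (D + 1)) := fun {x y} hx hy =>
      ((Int.natAbs_add_le x y).trans (two_pow_add_le hx hy)).trans
        (Nat.pow_le_pow_right (by norm_num) (by omega))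
    have hsub : ∀ {x y : ℤ}, x.natAbs ≤ 2 ^ B → y.natAbs ≤ 2 ^ B →
        (x - y).natAbs ≤ 2 ^ (B + 1 * (D + 1)) := fun {x y} hx hy => by
      rw [sub_eq_add_neg]
      exact hadd hx (by rwa [Int.natAbs_neg])
    cases hT with
    | const r z hz =>
      have hz' : z.natAbs ≤ 2 ^ (B + 1 * (D + 1)) :=
        hz.trans (Nat.pow_le_pow_right (by norm_num) (by omega))
      refine ⟨h'.setReg _ hz', rfl, ?_⟩
      have := bitLen_le hz'
      simp only [RAMInstr.bitCost]
      omega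
    | add r a b =>
      have hz := hadd (hB.1 a) (hB.1 b)
      refine ⟨h'.setReg _ hz, rfl, ?_⟩
      have h1 := bitLen_le hz
      have h2 := bitLen_le (h'.1 a)
      have h3 := bitLen_le (h'.1 b)
      simp only [RAMInstr.bitCost]
      omega
    | sub r a b =>
      have hz := hsub (hB.1 a) (hB.1 b)
      refine ⟨h'.setReg _ hz, rfl, ?_⟩
      have h1 := bitLen_le hz
      have h2 := bitLen_le (h'.1 a)
      have h3 := bitLen_le (h'.1 b)
      simp only [RAMInstr.bitCost]
      omega
    | load r k a =>
      refine ⟨h'.setReg _ (h'.2 _ _), rfl, ?_⟩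
      have h1 := bitLen_le (h'.2 k (s.reg a))
      have h2 := bitLen_le (h'.1 a)
      simp only [RAMInstr.bitCost]
      omega
    | store k a b hk =>
      refine ⟨h'.setArr _ _ (h'.1 _), ?_, ?_⟩
      · simp [RAMInstr.run, RAMState.setArr_arr, hk.symm]
      have h1 := bitLen_le (h'.1 b)
      have h2 := bitLen_le (h'.1 a)
      simp only [RAMInstr.bitCost]
      omega
  | seq p q s s' s'' t t' b b' hp hq ihp ihq =>
    intro hT B hB hc hD
    cases hT with
    | scale u a r x hx =>
      cases hp
      cases hq
      have h' := hB.mono (show B ≤ B + (1 + 1) * (D + 1) by omega)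
      -- Loading the factor and multiplying count as a unit: the factor comes from array `2`, whose
      -- entries have `D` bits for the whole run, so the product has `B + D` bits.
      have hz : (s.reg x * s.arr 2 (s.reg a)).natAbs ≤ 2 ^ (B + (1 + 1) * (D + 1)) := by
        rw [Int.natAbs_mul]
        refine (Nat.mul_le_mul (hB.1 x) (hD _)).trans ?_
        rw [← pow_add]
        exact Nat.pow_le_pow_right (by norm_num) (by omega)
      have hv : ((RAMInstr.load u 2 a).run s).reg x = s.reg x := by
        simp [RAMInstr.run, RAMState.setReg_reg, hx]
      have hw : ((RAMInstr.load u 2 a).run s).reg u = s.arr 2 (s.reg a) := by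
        simp [RAMInstr.run, RAMState.setReg_reg]
      refine ⟨?_, rfl, ?_⟩
      · rw [RAMInstr.run, hv, hw]
        exact (h'.setReg _ (h'.2 _ _)).setReg _ hz
      · have h1 := bitLen_le hz
        have h2 := bitLen_le (h'.1 a)
        have h3 := bitLen_le (h'.1 x)
        have h4 := bitLen_le (h'.2 2 (s.reg a))
        simp only [RAMInstr.bitCost]
        rw [hv, hw]
        omega
    | seq hTp hTq =>
      obtain ⟨h1, h2, h3⟩ := ihp hTp hB hc hD
      obtain ⟨h4, h5, h6⟩ := ihq hTq h1 (by omega) (by rw [h2]; exact hD)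
      refine ⟨h4.mono (by ring_nf; omega), h5.trans h2, (Nat.add_le_add h3 h6).trans ?_⟩
      have : B + t * (D + 1) + t' * (D + 1) + 2 = B + (t + t') * (D + 1) + 2 := by ring
      rw [this, add_mul t t' (3 * _)]
      have h7 : t * (D + 1) ≤ (t + t') * (D + 1) := Nat.mul_le_mul_right _ (Nat.le_add_right t t')
      exact Nat.add_le_add (Nat.mul_le_mul_left t (by omega)) le_rfl
  | ite_pos a p q s s' t b ha hp ih =>
    intro hT B hB hc hD
    cases hT with
    | ite _ hTp hTq =>
      obtain ⟨h1, h2, h3⟩ := ih hTp hB hc hD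
      refine ⟨h1.mono (by ring_nf; omega), h2, ?_⟩
      have := bitLen_le (hB.1 a)
      have h4 : t * (3 * (B + t * (D + 1) + 2)) ≤ t * (3 * (B + (t + 1) * (D + 1) + 2)) := by
        gcongr; omega
      rw [add_mul t 1]
      nlinarith [Nat.zero_le ((t + 1) * (D + 1))]
  | ite_neg a p q s s' t b ha hp ih =>
    intro hT B hB hc hD
    cases hT with
    | ite _ hTp hTq =>
      obtain ⟨h1, h2, h3⟩ := ih hTq hB hc hD
      refine ⟨h1.mono (by ring_nf; omega), h2, ?_⟩
      have := bitLen_le (hB.1 a)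
      have h4 : t * (3 * (B + t * (D + 1) + 2)) ≤ t * (3 * (B + (t + 1) * (D + 1) + 2)) := by
        gcongr; omega
      rw [add_mul t 1]
      nlinarith [Nat.zero_le ((t + 1) * (D + 1))]
  | loop_pos a p s s' s'' t t' b b' ha hp hrec ihp ihr =>
    intro hT B hB hc hD
    have hT' := hT
    cases hT with
    | loop _ hTp =>
      obtain ⟨h1, h2, h3⟩ := ihp hTp hB hc hD
      obtain ⟨h4, h5, h6⟩ := ihr hT' h1 (by omega) (by rw [h2]; exact hD)
      refine ⟨h4.mono (by ring_nf; omega), h5.trans h2, ?_⟩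
      have h7 := bitLen_le (hB.1 a)
      have h8 : t * (3 * (B + t * (D + 1) + 2)) ≤
          t * (3 * (B + (t + t' + 1) * (D + 1) + 2)) := by gcongr; omega
      have h9 : t' * (3 * (B + t * (D + 1) + t' * (D + 1) + 2)) ≤
          t' * (3 * (B + (t + t' + 1) * (D + 1) + 2)) := by
        have : (t + t' + 1) * (D + 1) = t * (D + 1) + t' * (D + 1) + (D + 1) := by ring
        exact Nat.mul_le_mul_left t' (by omega)
      rw [add_mul (t + t') 1, add_mul t t']
      nlinarith [Nat.zero_le ((t + t' + 1) * (D + 1))]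
  | loop_neg a p s ha =>
    intro hT B hB hc hD
    refine ⟨hB.mono (by omega), rfl, ?_⟩
    have := bitLen_le (hB.1 a)
    omega

theorem tame_copyReg (c r a : ℕ) : Tame c (copyReg r a) :=
  .seq (.const _ _ (by simp)) (.add _ _ _)

/-- One `c` has to serve all levels and environments. This is possible because it only has to
dominate the constants occurring in the expression. -/
theorem HExpr.exists_tame (e : HExpr) : ∃ c, ∀ ρ j, Tame c (e.compile ρ j) := by
  have h0 : ∀ c, (0 : ℤ).natAbs ≤ 2 ^ c := fun c => by simp
  have h1 : ∀ c, (1 : ℤ).natAbs ≤ 2 ^ c := fun c => by simpa using Nat.one_le_two_pow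
  induction e with
  | size => exact ⟨0, fun _ _ => tame_copyReg _ _ _⟩
  | var => exact ⟨0, fun _ _ => tame_copyReg _ _ _⟩
  | bvar => exact ⟨0, fun _ _ => tame_copyReg _ _ _⟩
  | const z => exact ⟨bitLen z, fun _ _ => .const _ _ (natAbs_le_two_pow_bitLen z)⟩
  | add a b iha ihb =>
    obtain ⟨c, hc⟩ := iha
    obtain ⟨c', hc'⟩ := ihb
    exact ⟨max c c', fun _ _ => .seq ((hc _ _).mono (le_max_left _ _))
      (.seq ((hc' _ _).mono (le_max_right _ _)) (.add _ _ _))⟩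
  | sub a b iha ihb =>
    obtain ⟨c, hc⟩ := iha
    obtain ⟨c', hc'⟩ := ihb
    exact ⟨max c c', fun _ _ => .seq ((hc _ _).mono (le_max_left _ _))
      (.seq ((hc' _ _).mono (le_max_right _ _)) (.sub _ _ _))⟩
  | load k e ih =>
    obtain ⟨c, hc⟩ := ih
    exact ⟨c, fun _ _ => .seq (hc _ _) (.load _ _ _)⟩
  | cond x a b ihx iha ihb =>
    obtain ⟨c, hc⟩ := ihx
    obtain ⟨c', hc'⟩ := iha
    obtain ⟨c'', hc''⟩ := ihb
    exact ⟨max c (max c' c''), fun _ _ => .seq ((hc _ _).mono (by simp))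
      (.ite _ ((hc' _ _).mono (by simp)) ((hc'' _ _).mono (by simp)))⟩
  | sum l e ih =>
    obtain ⟨c, hc⟩ := ih
    exact ⟨c, fun _ _ => .seq (.const _ _ (h0 c)) (.seq (tame_copyReg _ _ _)
      (.loop _ (.seq (.const _ _ (h1 c)) (.seq (.sub _ _ _) (.seq (hc _ _) (.add _ _ _))))))⟩
  | sup l e ih =>
    obtain ⟨c, hc⟩ := ih
    exact ⟨c, fun _ _ => .seq (.const _ _ (h0 c)) (.seq (tame_copyReg _ _ _)
      (.loop _ (.seq (.const _ _ (h1 c)) (.seq (.sub _ _ _) (.seq (hc _ _)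
        (.seq (.sub _ _ _) (.ite _ (tame_copyReg _ _ _) (.const _ _ (h0 c)))))))))⟩
  | scale a b iha ihb =>
    obtain ⟨c, hc⟩ := iha
    obtain ⟨c', hc'⟩ := ihb
    exact ⟨max c c', fun _ _ => .seq ((hc _ _).mono (le_max_left _ _))
      (.seq ((hc' _ _).mono (le_max_right _ _)) (.scale _ _ _ _ (tmp_ne_tmp (by omega))))⟩

/-- The statement does not write to array `2`. -/
def HStmt.keepsTwo : HStmt → Bool
  | .store k _ _ => k != 2
  | .map k _ _ => k != 2
  | .seq p q => p.keepsTwo && q.keepsTwo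
  | .ite _ p q => p.keepsTwo && q.keepsTwo
  | .iter _ p => p.keepsTwo
  | _ => true

theorem HStmt.exists_tame (p : HStmt) (h : p.keepsTwo) : ∃ c, ∀ j, Tame c (p.compile j) := by
  have h0 : ∀ c, (0 : ℤ).natAbs ≤ 2 ^ c := fun c => by simp
  have h1 : ∀ c, (1 : ℤ).natAbs ≤ 2 ^ c := fun c => by simpa using Nat.one_le_two_pow
  have hk : ∀ {k : ℕ}, k ≠ 2 → arrIdx k ≠ 2 := fun {k} hk => by
    simp only [arrIdx]; split_ifs <;> omega
  induction p with
  | skip => exact ⟨0, fun _ => .const _ _ (by simp)⟩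
  | assign v e =>
    obtain ⟨c, hc⟩ := e.exists_tame
    exact ⟨c, fun _ => .seq (hc _ _) (tame_copyReg _ _ _)⟩
  | store k a e =>
    simp only [keepsTwo, bne_iff_ne] at h
    obtain ⟨c, hc⟩ := a.exists_tame
    obtain ⟨c', hc'⟩ := e.exists_tame
    exact ⟨max c c', fun _ => .seq ((hc _ _).mono (le_max_left _ _))
      (.seq ((hc' _ _).mono (le_max_right _ _)) (.store _ _ _ (hk h)))⟩
  | map k l e =>
    simp only [keepsTwo, bne_iff_ne] at h
    obtain ⟨c, hc⟩ := e.exists_tame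
    exact ⟨c, fun _ => .seq (.seq (tame_copyReg _ _ _)
        (.loop _ (.seq (.const _ _ (h1 c)) (.seq (.sub _ _ _)
          (.seq (hc _ _) (.store _ _ _ (by norm_num)))))))
      (.seq (tame_copyReg _ _ _)
        (.loop _ (.seq (.const _ _ (h1 c)) (.seq (.sub _ _ _)
          (.seq (.load _ _ _) (.store _ _ _ (hk h)))))))⟩
  | seq p q ihp ihq =>
    simp only [keepsTwo, Bool.and_eq_true] at h
    obtain ⟨c, hc⟩ := ihp h.1
    obtain ⟨c', hc'⟩ := ihq h.2
    exact ⟨max c c', fun _ => .seq ((hc _).mono (le_max_left _ _))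
      ((hc' _).mono (le_max_right _ _))⟩
  | ite x p q ihp ihq =>
    simp only [keepsTwo, Bool.and_eq_true] at h
    obtain ⟨c, hc⟩ := x.exists_tame
    obtain ⟨c', hc'⟩ := ihp h.1
    obtain ⟨c'', hc''⟩ := ihq h.2
    exact ⟨max c (max c' c''), fun _ => .seq ((hc _ _).mono (by simp))
      (.ite _ ((hc' _).mono (by simp)) ((hc'' _).mono (by simp)))⟩
  | iter i p ih =>
    obtain ⟨c, hc⟩ := ih h
    exact ⟨c, fun _ => .seq (tame_copyReg _ _ _)
      (.loop _ (.seq (.const _ _ (h1 c)) (.seq (.sub _ _ _)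
        (.seq (tame_copyReg _ _ _) (hc _)))))⟩

/-- A polynomial bound for the bit cost of at most `C * (x ^ d + 1)` tame steps. -/
noncomputable def bitPoly (c C d : ℕ) : Polynomial ℕ :=
  (Polynomial.C C * (Polynomial.X ^ d + 1)) *
    (3 * (Polynomial.C c + Polynomial.X + (Polynomial.C C * (Polynomial.X ^ d + 1)) *
      (Polynomial.X + 1) + 2))

theorem eval_bitPoly (c C d x : ℕ) : (bitPoly c C d).eval x =
    (C * (x ^ d + 1)) * (3 * (c + x + (C * (x ^ d + 1)) * (x + 1) + 2)) := by
  simp [bitPoly]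

theorem polynomial_eval_mono (p : Polynomial ℕ) {x y : ℕ} (h : x ≤ y) : p.eval x ≤ p.eval y := by
  simp only [Polynomial.eval_eq_sum, Polynomial.sum]
  gcongr

/-- Compiled statements run in polynomially many steps and with polynomial bit cost. -/
theorem HStmt.exists_exec (p : HStmt) (h : p.keepsTwo) :
    ∃ (C : ℕ) (q : Polynomial ℕ), ∀ (n N : ℕ) (σ s : RAMState), n ≤ N → Represents n σ s →
      s.reg (tmp 0) = 0 → BoundedState N s →
      ∃ (s' : RAMState) (t b : ℕ), RAMExec (p.compile 1) s s' t b ∧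
        t ≤ C * (n ^ p.depth + 1) ∧ b ≤ q.eval N ∧ Represents n (p.run n σ) s' ∧
        s'.reg (tmp 0) = 0 := by
  obtain ⟨C, hC⟩ := p.polyBound_time
  obtain ⟨c, hc⟩ := p.exists_tame h
  refine ⟨C, bitPoly c C p.depth, fun n N σ s hn hs h0 hN => ?_⟩
  obtain ⟨s', ⟨t, b, hex, ht⟩, hr, hf⟩ := p.steps_compile 1 σ s hs one_pos h0
  refine ⟨s', t, b, hex, ht.trans (hC n), ?_, hr, (hf 0 one_pos).trans h0⟩
  -- The bound `N` for the whole initial state also bounds the factors in array `2`.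
  have hb := (Tame.bitCost_le (D := N) hex (hc 1) (hN.mono (Nat.le_add_left N c))
    (Nat.le_add_right c N) (hN.2 2)).2.2
  refine hb.trans ?_
  have ht' : t ≤ C * (N ^ p.depth + 1) := by
    refine (ht.trans (hC n)).trans ?_
    gcongr
  rw [eval_bitPoly]
  gcongr

/-! ## Correctness of the local-ratio algorithm -/

section LocalRatioCorrect

variable {V : Type*}

/-- `G[S]` has no induced path on three vertices. -/
def ClusterOn (G : SimpleGraph V) (S : Finset V) : Prop :=
  ∀ u ∈ S, ∀ v ∈ S, ∀ w ∈ S, G.Adj u v → G.Adj v w → u ≠ w → G.Adj u w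

/-- The only candidate for the partition is "equal or adjacent", which is transitive precisely when
there is no induced path on three vertices. -/
theorem isClusterGraph_induce_iff (G : SimpleGraph V) (S : Finset V) :
    IsClusterGraph (G.induce (↑S : Set V)) ↔ ClusterOn G S := by
  constructor
  · rintro ⟨r, hr⟩ u hu v hv w hw huv hvw huw
    have h1 := (hr ⟨u, hu⟩ ⟨v, hv⟩).1 huv
    have h2 := (hr ⟨v, hv⟩ ⟨w, hw⟩).1 hvw
    exact (hr ⟨u, hu⟩ ⟨w, hw⟩).2 ⟨by simpa using huw, r.trans h1.2 h2.2⟩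
  · intro h
    refine ⟨⟨fun u v => u = v ∨ G.Adj u v, fun u => Or.inl rfl, ?_, ?_⟩, fun u v => ?_⟩
    · rintro u v (h | h)
      exacts [Or.inl h.symm, Or.inr h.symm]
    · rintro u v w (rfl | huv) (rfl | hvw)
      · exact Or.inl rfl
      · exact Or.inr hvw
      · exact Or.inr huv
      · by_cases huw : u = w
        · exact Or.inl huw
        · exact Or.inr (h u u.2 v v.2 w w.2 huv hvw fun e => huw (Subtype.ext e))
    · change G.Adj u v ↔ u ≠ v ∧ (u = v ∨ G.Adj u v)
      constructor
      · exact fun h => ⟨fun e => h.ne (congrArg _ e), Or.inr h⟩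
      · rintro ⟨h1, h2⟩
        exact h2.resolve_left h1

theorem ClusterOn.mono {G : SimpleGraph V} {S T : Finset V} (h : ClusterOn G S) (hT : T ⊆ S) :
    ClusterOn G T :=
  fun u hu v hv w hw => h u (hT hu) v (hT hv) w (hT hw)

theorem cost_mono {c : V → ℚ} {X Y : Finset V} (h : X ⊆ Y) (hc : ∀ v ∈ Y, 0 ≤ c v) :
    cost c X ≤ cost c Y :=
  Finset.sum_le_sum_of_subset_of_nonneg h fun v hv _ => hc v hv

theorem AreTrueTwins.symm {G : SimpleGraph V} {S : Finset V} {u u' : V}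
    (h : AreTrueTwins G S u u') : AreTrueTwins G S u' u :=
  ⟨h.2.1, h.1, h.2.2.1.symm, fun v hv h1 h2 => (h.2.2.2 v hv h2 h1).symm⟩

/-- The ratio test: the vertex of least ratio `c / d` is the first to reach cost `0`, and vertices
with `d = 0` impose no condition. -/
theorem isGreatest_ratio {T : Finset V} {c d : V → ℚ} (hd : ∀ v ∈ T, 0 ≤ d v)
    (hc : ∀ v ∈ T, 0 ≤ c v) {v : V} (hv : v ∈ T)
    (hdv : 0 < d v) (hmin : ∀ w ∈ T, 0 < d w → c v * d w ≤ c w * d v) :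
    IsGreatest {μ : ℚ | ∀ w ∈ T, 0 ≤ c w - μ * d w} (c v / d v) := by
  constructor
  · intro w hw
    rcases (hd w hw).eq_or_lt with h0 | h0
    · simpa [← h0] using hc w hw
    · have := hmin w hw h0
      rw [div_mul_eq_mul_div, sub_nonneg, div_le_iff₀ hdv]
      exact this
  · intro μ hμ
    have := hμ v hv
    rw [le_div_iff₀ hdv]
    linarith

theorem exists_min_ratio {T : Finset V} {c d : V → ℚ} (hd : ∀ v ∈ T, 0 ≤ d v)
    (hne : ∃ v ∈ T, d v ≠ 0) :
    ∃ v ∈ T, 0 < d v ∧ ∀ w ∈ T, 0 < d w → c v * d w ≤ c w * d v := by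
  obtain ⟨v, hv, hdv⟩ := hne
  obtain ⟨x, hx, hmin⟩ := Finset.exists_min_image (T.filter fun v => 0 < d v)
    (fun v => c v / d v) ⟨v, mem_filter.2 ⟨hv, (hd v hv).lt_of_ne hdv.symm⟩⟩
  rw [mem_filter] at hx
  refine ⟨x, hx.1, hx.2, fun w hw hdw => ?_⟩
  have := hmin w (mem_filter.2 ⟨hw, hdw⟩)
  rwa [div_le_div_iff₀ hx.2 hdw] at this

variable [DecidableEq V]

theorem isHittingSet_iff (G : SimpleGraph V) (S X : Finset V) :
    IsHittingSet G S X ↔ X ⊆ S ∧ ClusterOn G (S \ X) := by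
  rw [IsHittingSet, isClusterGraph_induce_iff]

theorem IsHittingSet.inter {G : SimpleGraph V} {S T X : Finset V} (h : IsHittingSet G S X)
    (hT : T ⊆ S) : IsHittingSet G T (X ∩ T) := by
  rw [isHittingSet_iff] at h ⊢
  refine ⟨inter_subset_right, h.2.mono fun v hv => ?_⟩
  simp only [mem_sdiff, mem_inter, not_and] at hv ⊢
  exact ⟨hT hv.1, fun hX => hv.2 hX hv.1⟩

theorem IsHittingSet.erase {G : SimpleGraph V} {S X : Finset V} (h : IsHittingSet G S X) (u : V) :
    IsHittingSet G (S.erase u) (X.erase u) := by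
  have := h.inter (erase_subset u S)
  rwa [show X ∩ S.erase u = X.erase u by
    ext v; simp only [mem_inter, mem_erase]
    exact ⟨fun hv => ⟨hv.2.1, hv.1⟩, fun hv => ⟨hv.2, hv.1, h.1 hv.2⟩⟩] at this

theorem OPT_le_cost {G : SimpleGraph V} {S X : Finset V} (h : IsHittingSet G S X) (c : V → ℚ) :
    OPT G S c ≤ cost c X :=
  Finset.inf'_le _ (by classical simp [h, h.1])

theorem exists_cost_eq_OPT (G : SimpleGraph V) (S : Finset V) (c : V → ℚ) :
    ∃ X, IsHittingSet G S X ∧ cost c X = OPT G S c := by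
  classical
  obtain ⟨X, hX, h⟩ := Finset.exists_mem_eq_inf' (s := S.powerset.filter (IsHittingSet G S))
    ⟨S, by simp [isHittingSet_self G S]⟩ (cost c)
  refine ⟨X, (by simpa using hX : X ⊆ S ∧ _).2, ?_⟩
  rw [OPT, ← h]

theorem le_OPT_iff {G : SimpleGraph V} {S : Finset V} {c : V → ℚ} {a : ℚ} :
    a ≤ 2 * OPT G S c ↔ ∀ Y, IsHittingSet G S Y → a ≤ 2 * cost c Y := by
  constructor
  · exact fun h Y hY => h.trans (by linarith [OPT_le_cost hY c])
  · intro h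
    obtain ⟨X, hX, h'⟩ := exists_cost_eq_OPT G S c
    exact h' ▸ h X hX

/-- An induced path through `u'` that avoids `u` can be rerouted through `u`. No induced path on
three vertices contains both, since they are adjacent and see the same third vertices. -/
theorem AreTrueTwins.clusterOn_insert {G : SimpleGraph V} {S K : Finset V} {u u' : V}
    (h : AreTrueTwins G S u u') (hK : K ⊆ S) (hu : u ∈ K) (hc : ClusterOn G K) :
    ClusterOn G (insert u' K) := by
  obtain ⟨-, -, huu, htw⟩ := h
  have key : ∀ v ∈ K, v ≠ u → v ≠ u' → (G.Adj u' v ↔ G.Adj u v) := fun v hv h1 h2 =>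
    (htw v (hK hv) h1 h2).symm
  have key' : ∀ v ∈ K, v ≠ u → v ≠ u' → (G.Adj v u' ↔ G.Adj v u) := fun v hv h1 h2 => by
    rw [G.adj_comm v, G.adj_comm v]; exact key v hv h1 h2
  by_cases hu' : u' ∈ K
  · rwa [insert_eq_of_mem hu']
  have hne : ∀ v ∈ K, v ≠ u' := fun v hv e => hu' (e ▸ hv)
  have mid : ∀ a ∈ K, ∀ b ∈ K, G.Adj a u' → G.Adj u' b → a ≠ b → G.Adj a b := by
    intro a ha b hb h1 h2 hab
    by_cases hau : a = u
    · subst hau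
      exact (key b hb (Ne.symm hab) (hne b hb)).1 h2
    by_cases hbu : b = u
    · subst hbu
      exact (key' a ha hab (hne a ha)).1 h1
    · exact hc a ha u hu b hb ((key' a ha hau (hne a ha)).1 h1) ((key b hb hbu (hne b hb)).1 h2) hab
  have fin : ∀ a ∈ K, ∀ b ∈ K, G.Adj a b → G.Adj b u' → G.Adj a u' := by
    intro a ha b hb h1 h2
    by_cases hau : a = u
    · subst hau; exact huu
    rw [key' a ha hau (hne a ha)]
    by_cases hbu : b = u
    · subst hbu; exact h1
    · exact hc a ha b hb u hu h1 ((key' b hb hbu (hne b hb)).1 h2) hau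
  intro a ha b hb w hw hab hbw haw
  rw [mem_insert] at ha hb hw
  rcases ha with rfl | ha
  · rcases hw with rfl | hw
    · exact absurd rfl haw
    rcases hb with rfl | hb
    · exact hbw
    · exact (fin w hw b hb hbw.symm hab.symm).symm
  · rcases hw with rfl | hw
    · rcases hb with rfl | hb
      · exact hab
      · exact fin a ha b hb hab hbw
    · rcases hb with rfl | hb
      · exact mid a ha w hw hab hbw haw
      · exact hc a ha b hb w hw hab hbw haw

theorem cost_insert {c : V → ℚ} {X : Finset V} {u : V} (h : u ∉ X) :
    cost c (insert u X) = c u + cost c X := Finset.sum_insert h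

theorem cost_update_of_notMem {c : V → ℚ} {X : Finset V} {u : V} (a : ℚ) (h : u ∉ X) :
    cost (Function.update c u a) X = cost c X :=
  Finset.sum_congr rfl fun _ hv => Function.update_of_ne (ne_of_mem_of_not_mem hv h) _ _

theorem cost_erase {c : V → ℚ} {X : Finset V} {u : V} (h : u ∈ X) :
    cost c X = c u + cost c (X.erase u) := (Finset.add_sum_erase X c h).symm

theorem cost_update_of_mem {c : V → ℚ} {X : Finset V} {u : V} (a : ℚ) (h : u ∈ X) :
    cost (Function.update c u (c u + a)) X = cost c X + a := by
  rw [cost_erase h, cost_update_of_notMem _ (notMem_erase u X), cost_erase h,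
    Function.update_self]
  ring

/-- If one of two twins remains, the other can be put back as well. So a minimal hitting set
contains both or neither, which is what the rule for extending `X` respects. -/
theorem AreTrueTwins.isMinimalHittingSet {G : SimpleGraph V} {S X : Finset V} {u u' : V}
    (htw : AreTrueTwins G S u u') (hX : IsMinimalHittingSet G (S.erase u') X) :
    IsMinimalHittingSet G S (if u ∈ X then insert u' X else X) := by
  have hne : u ≠ u' := htw.2.2.1.ne
  have hhit := (isHittingSet_iff _ _ _).1 hX.prop
  have hu'X : u' ∉ X := fun h => by simpa using hhit.1 h
  have hXS : X ⊆ S := hhit.1.trans (erase_subset _ _)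
  have hYX : ∀ Y, IsHittingSet G S Y → Y.erase u' ⊆ X → X ⊆ Y := fun Y hY hs =>
    (hX.le_of_le (hY.erase u') hs).trans (erase_subset _ _)
  split_ifs with hu
  · refine ⟨(isHittingSet_iff _ _ _).2 ⟨insert_subset htw.2.1 hXS, hhit.2.mono fun v hv => ?_⟩, ?_⟩
    · simp only [mem_sdiff, mem_insert, not_or, mem_erase] at hv ⊢
      tauto
    intro Y hY hYs
    have h1 : X ⊆ Y := hYX Y hY fun v hv => by
      rw [mem_erase] at hv
      exact (mem_insert.1 (hYs hv.2)).resolve_left hv.1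
    refine insert_subset ?_ h1
    by_contra hu'Y
    have hYeq : Y = X := Subset.antisymm (fun v hv =>
      (mem_insert.1 (hYs hv)).resolve_left fun e => hu'Y (e ▸ hv)) h1
    subst hYeq
    -- Since `u'` is not deleted, its twin `u` need not be deleted either. This contradicts the
    -- minimality of `X`, which contains `u`.
    have h2 : IsHittingSet G S (Y.erase u) := by
      rw [isHittingSet_iff] at hY ⊢
      refine ⟨(erase_subset _ _).trans hY.1, ?_⟩
      refine (htw.symm.clusterOn_insert sdiff_subset (mem_sdiff.2 ⟨htw.2.1, hu'Y⟩) hY.2).mono ?_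
      intro v hv
      simp only [mem_sdiff, mem_insert, mem_erase] at hv ⊢
      tauto
    have h3 := hYX _ h2 (((erase_subset _ _).trans (erase_subset _ _)))
    simpa using h3 hu
  · refine ⟨(isHittingSet_iff _ _ _).2 ⟨hXS, ?_⟩, fun Y hY hYs =>
      hYX Y hY ((erase_subset _ _).trans hYs)⟩
    refine (htw.clusterOn_insert (K := S.erase u' \ X)
      (sdiff_subset.trans (erase_subset _ _)) (by simp [hne, htw.1, hu]) hhit.2).mono ?_
    intro v hv
    simp only [mem_sdiff, mem_insert, mem_erase] at hv ⊢
    tauto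

/-- Merging twins does not raise the optimum: if only one of the twins is deleted, the deletion can
be dropped, so the merged vertex has to be paid for only when both are in `Y`. -/
theorem AreTrueTwins.exists_isHittingSet {G : SimpleGraph V} {S Y : Finset V} {u u' : V}
    (htw : AreTrueTwins G S u u') (hY : IsHittingSet G S Y) {c : V → ℚ} (hc : ∀ v ∈ S, 0 ≤ c v) :
    ∃ Y', IsHittingSet G (S.erase u') Y' ∧
      cost (Function.update c u (c u + c u')) Y' ≤ cost c Y := by
  have hne : u ≠ u' := htw.2.2.1.ne
  by_cases hu' : u' ∈ Y
  · by_cases hu : u ∈ Y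
    · refine ⟨_, hY.erase u', ?_⟩
      rw [cost_update_of_mem _ (mem_erase.2 ⟨hne, hu⟩), cost_erase hu', add_comm]
    · refine ⟨_, hY.erase u', ?_⟩
      rw [cost_update_of_notMem _ (by simp [hu])]
      exact cost_mono (erase_subset _ _) fun v hv => hc v (hY.1 hv)
  · have hle : cost c (Y.erase u) ≤ cost c Y :=
      cost_mono (erase_subset _ _) fun v hv => hc v (hY.1 hv)
    refine ⟨Y.erase u, ?_, by rwa [cost_update_of_notMem _ (notMem_erase u Y)]⟩
    have h2 : IsHittingSet G S (Y.erase u) := by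
      rw [isHittingSet_iff] at hY ⊢
      refine ⟨(erase_subset _ _).trans hY.1, ?_⟩
      refine (htw.symm.clusterOn_insert sdiff_subset (mem_sdiff.2 ⟨htw.2.1, hu'⟩) hY.2).mono ?_
      intro v hv
      simp only [mem_sdiff, mem_insert, mem_erase] at hv ⊢
      tauto
    have := h2.erase u'
    rwa [erase_eq_of_notMem (show u' ∉ Y.erase u by simp [hu'])] at this

/-- A hitting set of `G[S]` inside the extended set restricts to one of `G[S - u]` and hence
contains `X`. It can avoid `u` only if `X` alone suffices. -/
theorem IsMinimalHittingSet.of_erase {G : SimpleGraph V} {S X : Finset V} {u : V}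
    (hu : u ∈ S) (hX : IsMinimalHittingSet G (S.erase u) X) :
    (IsHittingSet G S X → IsMinimalHittingSet G S X) ∧
      (¬ IsHittingSet G S X → IsMinimalHittingSet G S (insert u X)) := by
  have hhit := (isHittingSet_iff _ _ _).1 hX.prop
  have hYX : ∀ Y, IsHittingSet G S Y → Y.erase u ⊆ X → X ⊆ Y := fun Y hY hs =>
    (hX.le_of_le (hY.erase u) hs).trans (erase_subset _ _)
  refine ⟨fun h => ⟨h, fun Y hY hYs => hYX Y hY ((erase_subset _ _).trans hYs)⟩, fun h => ?_⟩
  refine ⟨(isHittingSet_iff _ _ _).2 ⟨insert_subset hu (hhit.1.trans (erase_subset _ _)),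
    hhit.2.mono fun v hv => ?_⟩, fun Y hY hYs => ?_⟩
  · simp only [mem_sdiff, mem_insert, not_or, mem_erase] at hv ⊢
    tauto
  have h1 : X ⊆ Y := hYX Y hY fun v hv => by
    rw [mem_erase] at hv
    exact (mem_insert.1 (hYs hv.2)).resolve_left hv.1
  refine insert_subset ?_ h1
  by_contra huY
  have hYeq : Y = X := Subset.antisymm (fun v hv =>
    (mem_insert.1 (hYs hv)).resolve_left fun e => huY (e ▸ hv)) h1
  exact h (hYeq ▸ hY)

theorem cost_subtract {c d : V → ℚ} {T X : Finset V} {lam : ℚ} :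
    cost c X = cost (fun v => if v ∈ T then c v - lam * d v else c v) X +
      lam * cost d (X ∩ T) := by
  simp only [cost]
  rw [← Finset.sum_filter_add_sum_filter_not X (· ∈ T) c,
    ← Finset.sum_filter_add_sum_filter_not X (· ∈ T) fun v => if v ∈ T then c v - lam * d v else c v,
    Finset.sum_congr rfl (fun v hv => if_pos (mem_filter.1 hv).2),
    Finset.sum_congr rfl (fun v hv => if_neg (mem_filter.1 hv).2),
    Finset.sum_sub_distrib, ← Finset.mul_sum, Finset.filter_mem_eq_inter]
  ring

/-- Every set returned by the local-ratio algorithm is a minimal hitting set of cost at most twice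
the optimum. -/
theorem LocalRatio.correct {G : SimpleGraph V} {S X : Finset V} {c : V → ℚ}
    (h : LocalRatio G S c X) :
    (∀ v ∈ S, 0 ≤ c v) → IsMinimalHittingSet G S X ∧ cost c X ≤ 2 * OPT G S c := by
  induction h with
  | cluster S c hcl =>
    intro hc
    refine ⟨⟨⟨empty_subset _, by rwa [sdiff_empty]⟩, fun Y _ _ => empty_subset _⟩,
      le_OPT_iff.2 fun Y hY => ?_⟩
    have : 0 ≤ cost c Y := Finset.sum_nonneg fun v hv => hc v (hY.1 hv)
    simpa [cost] using this
  | zero_keep S c X' u hcl hu hcu hrec hX' ih =>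
    intro hc
    obtain ⟨h1, h2⟩ := ih fun v hv => hc v (erase_subset _ _ hv)
    refine ⟨(h1.of_erase hu).1 hX', le_OPT_iff.2 fun Y hY => ?_⟩
    have := le_OPT_iff.1 h2 _ (hY.erase u)
    linarith [cost_mono (erase_subset u Y) fun v hv => hc v (hY.1 hv)]
  | zero_add S c X' u hcl hu hcu hrec hX' ih =>
    intro hc
    obtain ⟨h1, h2⟩ := ih fun v hv => hc v (erase_subset _ _ hv)
    refine ⟨(h1.of_erase hu).2 hX', le_OPT_iff.2 fun Y hY => ?_⟩
    have := le_OPT_iff.1 h2 _ (hY.erase u)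
    rw [cost_insert fun h => by simpa using h1.prop.1 h, hcu]
    linarith [cost_mono (erase_subset u Y) fun v hv => hc v (hY.1 hv)]
  | twins_keep S c X' u u' hcl hzero htw hrec hX' ih =>
    intro hc
    obtain ⟨h1, h2⟩ := ih fun v hv => by
      rw [Function.update_apply]
      split_ifs
      exacts [add_nonneg (hc _ htw.1) (hc _ htw.2.1), hc v (erase_subset _ _ hv)]
    have h3 := htw.isMinimalHittingSet h1
    rw [if_neg hX'] at h3
    refine ⟨h3, le_OPT_iff.2 fun Y hY => ?_⟩
    obtain ⟨Y', hY', hle⟩ := htw.exists_isHittingSet hY hc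
    have := le_OPT_iff.1 h2 _ hY'
    rw [cost_update_of_notMem _ hX'] at this
    linarith
  | twins_add S c X' u u' hcl hzero htw hrec hX' ih =>
    intro hc
    obtain ⟨h1, h2⟩ := ih fun v hv => by
      rw [Function.update_apply]
      split_ifs
      exacts [add_nonneg (hc _ htw.1) (hc _ htw.2.1), hc v (erase_subset _ _ hv)]
    have h3 := htw.isMinimalHittingSet h1
    rw [if_pos hX'] at h3
    refine ⟨h3, le_OPT_iff.2 fun Y hY => ?_⟩
    obtain ⟨Y', hY', hle⟩ := htw.exists_isHittingSet hY hc
    have := le_OPT_iff.1 h2 _ hY'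
    rw [cost_update_of_mem _ hX'] at this
    rw [cost_insert fun h => by simpa using h1.prop.1 h]
    linarith
  | subtract S c X T d lam hcl hzero htw hgood hlam hrec ih =>
    intro hc
    have hlam0 : 0 ≤ lam := hlam.2 fun v hv => by simpa using hc v (hgood.1 hv)
    obtain ⟨h1, h2⟩ := ih fun v hv => by
      dsimp only
      split_ifs with hvT
      exacts [hlam.1 v hvT, hc v hv]
    refine ⟨h1, le_OPT_iff.2 fun Y hY => ?_⟩
    have h3 := le_OPT_iff.1 h2 _ hY
    -- Goodness applies because `X` is minimal by induction; `Y ∩ T` hits `G[T]` and so costs at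
    -- least the optimum there. This estimate is added to `h3` with the factor `lam ≥ 0`.
    have h4 := (hgood.2.2.2 X h1).trans
      (mul_le_mul_of_nonneg_left (OPT_le_cost (hY.inter hgood.1) d) zero_le_two)
    rw [cost_subtract (c := c) (X := X) (T := T) (d := d) (lam := lam),
      cost_subtract (c := c) (X := Y) (T := T) (d := d) (lam := lam)]
    nlinarith

/-- The local-ratio algorithm can be run to completion if good weighted subgraphs exist. -/
theorem exists_localRatio {G : SimpleGraph V}
    (hgood : ∀ S : Finset V, ¬ ClusterOn G S → (∀ u u', ¬ AreTrueTwins G S u u') →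
      ∃ T d, IsGoodIn 2 G S T d) (S : Finset V) :
    ∀ c : V → ℚ, (∀ v ∈ S, 0 ≤ c v) → ∃ X, LocalRatio G S c X := by
  induction hm : S.card using Nat.strong_induction_on generalizing S with
  | _ m ih =>
    subst hm
    have hlt : ∀ {u}, u ∈ S → (S.erase u).card < S.card := fun hu => card_erase_lt_of_mem hu
    -- Deleting a zero-cost vertex is separated out since it is needed twice: a subtraction always
    -- creates such a vertex, and this is why induction on the number of vertices suffices although
    -- subtracting keeps `S`.
    have zero : ∀ c : V → ℚ, (∀ v ∈ S, 0 ≤ c v) → ¬ ClusterOn G S → (∃ u ∈ S, c u = 0) →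
        ∃ X, LocalRatio G S c X := by
      rintro c hc hcl ⟨u, hu, hcu⟩
      rw [← isClusterGraph_induce_iff] at hcl
      obtain ⟨X, hX⟩ := ih _ (hlt hu) _ rfl c fun v hv => hc v (erase_subset _ _ hv)
      by_cases h : IsHittingSet G S X
      · exact ⟨_, .zero_keep S c X u hcl hu hcu hX h⟩
      · exact ⟨_, .zero_add S c X u hcl hu hcu hX h⟩
    intro c hc
    by_cases hcl : ClusterOn G S
    · exact ⟨_, .cluster S c ((isClusterGraph_induce_iff _ _).2 hcl)⟩
    by_cases hz : ∃ u ∈ S, c u = 0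
    · exact zero c hc hcl hz
    have hcl' := hcl
    rw [← isClusterGraph_induce_iff] at hcl'
    push Not at hz
    by_cases ht : ∃ u u', AreTrueTwins G S u u'
    · obtain ⟨u, u', htw⟩ := ht
      obtain ⟨X, hX⟩ := ih _ (hlt htw.2.1) _ rfl (Function.update c u (c u + c u')) fun v hv => by
        rw [Function.update_apply]
        split_ifs
        exacts [add_nonneg (hc _ htw.1) (hc _ htw.2.1), hc v (erase_subset _ _ hv)]
      by_cases h : u ∈ X
      · exact ⟨_, .twins_add S c X u u' hcl' hz htw hX h⟩
      · exact ⟨_, .twins_keep S c X u u' hcl' hz htw hX h⟩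
    push Not at ht
    obtain ⟨T, d, hg⟩ := hgood S hcl ht
    obtain ⟨v, hv, hdv, hmin⟩ := exists_min_ratio (c := c) hg.2.1 hg.2.2.1
    have hlam := isGreatest_ratio hg.2.1 (fun w hw => hc w (hg.1 hw)) hv hdv hmin
    obtain ⟨X, hX⟩ := zero (fun w => if w ∈ T then c w - c v / d v * d w else c w) (fun w hw => by
      split_ifs with hwT
      exacts [hlam.1 w hwT, hc w hw]) hcl ⟨v, hg.1 hv, by simp [hv, hdv.ne']⟩
    exact ⟨X, .subtract S c X T d _ hcl' hz ht hg hlam hX⟩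

end LocalRatioCorrect

/-! ## Good cost functions -/

section GoodWeights

variable {V : Type*} {G : SimpleGraph V}

theorem cost_intCast (d : V → ℤ) (X : Finset V) :
    cost (fun v => (d v : ℚ)) X = ((∑ v ∈ X, d v : ℤ) : ℚ) := by simp [cost]

variable [DecidableEq V]

/-- Complements of hitting sets are cluster subgraphs, so `hK` says that `2 OPT ≥ d(S) - a`, while
`hX` bounds minimal hitting sets by `d(S) - a`. -/
theorem isGoodIn_of_forall_le {S : Finset V} {d : V → ℤ} (hd : ∀ v ∈ S, 0 ≤ d v)
    (hne : ∃ v ∈ S, d v ≠ 0) (a : ℤ)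
    (hK : ∀ K ⊆ S, ClusterOn G K → 2 * ∑ v ∈ K, d v ≤ ∑ v ∈ S, d v + a)
    (hX : ∀ X, IsMinimalHittingSet G S X → ∑ v ∈ X, d v + a ≤ ∑ v ∈ S, d v) :
    IsGoodIn 2 G S S fun v => (d v : ℚ) := by
  refine ⟨Subset.rfl, fun v hv => Int.cast_nonneg (hd v hv), ?_, fun X hXm => ?_⟩
  · obtain ⟨v, hv, h⟩ := hne
    exact ⟨v, hv, Int.cast_ne_zero.2 h⟩
  rw [inter_eq_left.2 hXm.prop.1]
  refine le_OPT_iff.2 fun Y hY => ?_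
  rw [cost_intCast, cost_intCast]
  have h1 := hK _ sdiff_subset ((isHittingSet_iff _ _ _).1 hY).2
  have h2 := hX X hXm
  have h3 := Finset.sum_sdiff hY.1 (f := d)
  have : ∑ v ∈ X, d v ≤ 2 * ∑ v ∈ Y, d v := by linarith
  exact_mod_cast this

/-- If the closed neighbourhood of `v` were deleted entirely, returning `v` would only add an
isolated vertex, against minimality. -/
theorem IsMinimalHittingSet.exists_notMem {S X : Finset V} (hX : IsMinimalHittingSet G S X)
    {v : V} (hv : v ∈ S) : ∃ w ∈ S, (w = v ∨ G.Adj v w) ∧ w ∉ X := by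
  by_contra! h
  have hhit := (isHittingSet_iff _ _ _).1 hX.prop
  have hvX : v ∈ X := h v hv (Or.inl rfl)
  have hnb : ∀ w ∈ S, G.Adj v w → w ∈ X := fun w hw hvw => h w hw (Or.inr hvw)
  have : IsHittingSet G S (X.erase v) := by
    refine (isHittingSet_iff _ _ _).2 ⟨(erase_subset _ _).trans hhit.1, ?_⟩
    have hmem : ∀ a ∈ S \ X.erase v, a ≠ v → a ∈ S \ X := fun a ha hav => by
      simp only [mem_sdiff, mem_erase, not_and] at ha ⊢
      exact ⟨ha.1, ha.2 hav⟩
    have hiso : ∀ a ∈ S \ X.erase v, ¬ G.Adj v a := fun a ha hva => by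
      have hav := hva.ne'
      exact (mem_sdiff.1 (hmem a ha hav)).2 (hnb a (mem_sdiff.1 ha).1 hva)
    intro a ha b hb w hw hab hbw haw
    have hav : a ≠ v := by rintro rfl; exact hiso b hb hab
    have hbv : b ≠ v := by rintro rfl; exact hiso w hw hbw
    have hwv : w ≠ v := by rintro rfl; exact hiso b hb hbw.symm
    exact hhit.2 a (hmem a ha hav) b (hmem b hb hbv) w (hmem w hw hwv) hab hbw haw
  exact notMem_erase v X (hX.le_of_le this (erase_subset _ _) hvX)

/-- A cost function is `2`-good if it is at least `1` on a closed neighbourhood and no cluster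
subgraph has more than half of the total cost, up to `1 / 2`. -/
theorem isGoodIn_of_central {S : Finset V} {d : V → ℤ} {v₀ : V} (hv₀ : v₀ ∈ S)
    (hd : ∀ v ∈ S, 0 ≤ d v) (hd1 : ∀ v ∈ S, v = v₀ ∨ G.Adj v₀ v → 1 ≤ d v)
    (hK : ∀ K ⊆ S, ClusterOn G K → 2 * ∑ v ∈ K, d v ≤ ∑ v ∈ S, d v + 1) :
    IsGoodIn 2 G S S fun v => (d v : ℚ) := by
  refine isGoodIn_of_forall_le hd ⟨v₀, hv₀, ?_⟩ 1 hK fun X hX => ?_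
  · have := hd1 v₀ hv₀ (Or.inl rfl)
    omega
  obtain ⟨w, hw, hwv, hwX⟩ := hX.exists_notMem hv₀
  have h1 := Finset.sum_le_sum_of_subset_of_nonneg (f := d) (insert_subset hw hX.prop.1)
    fun v hv _ => hd v hv
  rw [sum_insert hwX] at h1
  linarith [hd1 w hw hwv]

/-- The case `a = 0`: even deleting all of `S` costs at most twice the optimum, so minimality plays
no role. -/
theorem isGoodIn_of_strong {S : Finset V} {d : V → ℤ} (hd : ∀ v ∈ S, 0 ≤ d v)
    (hne : ∃ v ∈ S, d v ≠ 0)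
    (hK : ∀ K ⊆ S, ClusterOn G K → 2 * ∑ v ∈ K, d v ≤ ∑ v ∈ S, d v) :
    IsGoodIn 2 G S S fun v => (d v : ℚ) :=
  isGoodIn_of_forall_le hd hne 0 (fun K h1 h2 => by simpa using hK K h1 h2) fun X hX => by
    simpa using Finset.sum_le_sum_of_subset_of_nonneg hX.prop.1 fun v hv _ => hd v hv

/-! ### Holes in a neighbourhood. -/

/-- `G[T]` is a disjoint union of induced cycles of length at least four: every vertex has exactly
two neighbours, and they are not adjacent. -/
def IsHole (G : SimpleGraph V) (T : Finset V) : Prop :=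
  T.Nonempty ∧ ∀ v ∈ T, ∃ a ∈ T, ∃ b ∈ T, a ≠ b ∧ ¬ G.Adj a b ∧
    ∀ w ∈ T, G.Adj v w ↔ w = a ∨ w = b

theorem IsHole.four_le_card {T : Finset V} (h : IsHole G T) : 4 ≤ T.card := by
  obtain ⟨⟨v, hv⟩, h⟩ := h
  obtain ⟨a, ha, b, hb, hab, hnab, hvw⟩ := h v hv
  have hva : G.Adj v a := (hvw a ha).2 (Or.inl rfl)
  have hvb : G.Adj v b := (hvw b hb).2 (Or.inr rfl)
  obtain ⟨p, hp, q, hq, hpq, hnpq, haw⟩ := h a ha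
  obtain ⟨c, hc, hac, hcv⟩ : ∃ c ∈ T, G.Adj a c ∧ c ≠ v := by
    by_cases hpv : p = v
    · exact ⟨q, hq, (haw q hq).2 (Or.inr rfl), fun e => hpq (hpv.trans e.symm)⟩
    · exact ⟨p, hp, (haw p hp).2 (Or.inl rfl), hpv⟩
  have hsub : ({v, a, b, c} : Finset V) ⊆ T := by
    intro x hx
    simp only [mem_insert, mem_singleton] at hx
    rcases hx with rfl | rfl | rfl | rfl <;> assumption
  have hcb : b ≠ c := by rintro rfl; exact hnab hac
  have hcard : ({v, a, b, c} : Finset V).card = 4 := by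
    rw [card_insert_of_notMem, card_insert_of_notMem, card_insert_of_notMem, card_singleton]
    · simpa using hcb
    · simp only [mem_insert, mem_singleton, not_or]
      exact ⟨hab, hac.ne⟩
    · simp only [mem_insert, mem_singleton, not_or]
      exact ⟨hva.ne, hvb.ne, hcv.symm⟩
  exact hcard ▸ card_le_card hsub

theorem IsHole.card_inter_le_of_clique {T K : Finset V} (h : IsHole G T)
    (hK : ∀ u ∈ K ∩ T, ∀ v ∈ K ∩ T, u ≠ v → G.Adj u v) : (K ∩ T).card ≤ 2 := by
  by_contra! hc
  obtain ⟨x, hx, y, hy, z, hz, hxy, hxz, hyz⟩ := Finset.two_lt_card.1 hc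
  have hT : ∀ {u}, u ∈ K ∩ T → u ∈ T := fun hu => (mem_inter.1 hu).2
  obtain ⟨a, ha, b, hb, hab, hnab, hw⟩ := h.2 x (hT hx)
  have h1 := (hw y (hT hy)).1 (hK x hx y hy hxy)
  have h2 := (hw z (hT hz)).1 (hK x hx z hz hxz)
  have h3 := hK y hy z hz hyz
  rcases h1 with rfl | rfl <;> rcases h2 with rfl | rfl
  · exact hyz rfl
  · exact hnab h3
  · exact hnab h3.symm
  · exact hyz rfl

/-- Every vertex of `K` in the hole has a neighbour outside `K`, since its two neighbours are not
adjacent. A single missing vertex would thus be adjacent to all others, of which there are at least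
three, but it has only two neighbours. -/
theorem IsHole.card_inter_add_two_le {T K : Finset V} (h : IsHole G T) (hK : ClusterOn G K) :
    (K ∩ T).card + 2 ≤ T.card := by
  by_contra! hc
  have h4 := h.four_le_card
  have hd : (T \ K).card ≤ 1 := by
    have := card_sdiff_add_card_inter T K
    rw [inter_comm] at this
    omega
  have key : ∀ v ∈ T, v ∈ K → ∃ w ∈ T, G.Adj v w ∧ w ∉ K := by
    intro v hv hvK
    obtain ⟨a, ha, b, hb, hab, hnab, hw⟩ := h.2 v hv
    have h1 := (hw a ha).2 (Or.inl rfl)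
    have h2 := (hw b hb).2 (Or.inr rfl)
    by_contra! hcon
    exact hnab (hK a (hcon a ha h1) v hvK b (hcon b hb h2) h1.symm h2 hab)
  obtain ⟨v, hv⟩ := h.1
  obtain ⟨w, hw, hwK⟩ : ∃ w ∈ T, w ∉ K := by
    by_cases hvK : v ∈ K
    · obtain ⟨w, hw, -, hwK⟩ := key v hv hvK
      exact ⟨w, hw, hwK⟩
    · exact ⟨v, hv, hvK⟩
  have huniq : ∀ x ∈ T, x ∉ K → x = w := fun x hx hxK =>
    card_le_one.1 hd x (mem_sdiff.2 ⟨hx, hxK⟩) w (mem_sdiff.2 ⟨hw, hwK⟩)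
  obtain ⟨a, ha, b, hb, hab, hnab, hadj⟩ := h.2 w hw
  obtain ⟨x, hx, hxn⟩ : ∃ x ∈ T, x ∉ ({w, a, b} : Finset V) := by
    by_contra! hcon
    have := card_le_card (show T ⊆ {w, a, b} from hcon)
    have := card_le_three (a := w) (b := a) (c := b)
    omega
  simp only [mem_insert, mem_singleton, not_or] at hxn
  have hxK : x ∈ K := by
    by_contra hxK
    exact hxn.1 (huniq x hx hxK)
  obtain ⟨y, hy, hxy, hyK⟩ := key x hx hxK
  have hyw := huniq y hy hyK
  subst hyw
  rcases (hadj x hx).1 hxy.symm with h | h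
  exacts [hxn.2.1 h, hxn.2.2 h]

/-- The total is `2|T| - 4`. A cluster subgraph through `v₀` meets `T` in a clique and has weight at
most `2 + (|T| - 4)`; one avoiding `v₀` misses at least two vertices of `T`. Both give half of the
total. -/
theorem IsHole.isGoodIn {S T : Finset V} {v₀ : V} (h : IsHole G T) (hv₀ : v₀ ∈ S) (hTS : T ⊆ S)
    (hadj : ∀ v ∈ T, G.Adj v₀ v) {d : V → ℤ} (hd1 : ∀ v ∈ T, d v = 1)
    (hd0 : d v₀ = T.card - 4) (hd : ∀ v ∈ S, v ∉ T → v ≠ v₀ → d v = 0) :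
    IsGoodIn 2 G S S fun v => (d v : ℚ) := by
  have h4 := h.four_le_card
  have hv₀T : v₀ ∉ T := fun hv => (hadj _ hv).ne rfl
  have hsum : ∀ K ⊆ S, ∑ v ∈ K, d v =
      ((K ∩ T).card : ℤ) + if v₀ ∈ K then (T.card : ℤ) - 4 else 0 := by
    intro K hK
    rw [← sum_filter_add_sum_filter_not K (· ∈ T), Finset.filter_mem_eq_inter,
      sum_congr rfl fun v hv => hd1 v (mem_inter.1 hv).2]
    congr 1
    · simp
    · split_ifs with hv
      · rw [sum_eq_single v₀, hd0]
        · intro v hv hne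
          rw [mem_filter] at hv
          exact hd v (hK hv.1) hv.2 hne
        · simp [hv, hv₀T]
      · refine sum_eq_zero fun v hv' => ?_
        rw [mem_filter] at hv'
        exact hd v (hK hv'.1) hv'.2 fun e => hv (e ▸ hv'.1)
  refine isGoodIn_of_strong (fun v hv => ?_) ?_ fun K hK hcl => ?_
  · by_cases hvT : v ∈ T
    · rw [hd1 v hvT]; norm_num
    by_cases hv0 : v = v₀
    · rw [hv0, hd0]; omega
    · rw [hd v hv hvT hv0]
  · obtain ⟨v, hv⟩ := h.1
    exact ⟨v, hTS hv, by rw [hd1 v hv]; norm_num⟩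
  rw [hsum K hK, hsum S Subset.rfl, if_pos hv₀, inter_eq_right.2 hTS]
  split_ifs with hv
  · have := h.card_inter_le_of_clique (K := K) fun u hu w hw huw => by
      rw [mem_inter] at hu hw
      exact hcl u hu.1 v₀ hv w hw.1 (hadj u hu.2).symm (hadj w hw.2) huw
    omega
  · have := h.card_inter_add_two_le hcl
    omega

end GoodWeights

/-! ### Weights on twin classes, built up vertex by vertex. -/

section TwinClasses

variable {V : Type*} [DecidableEq V] {G : SimpleGraph V}

/-- `B` is a set of vertices, partitioned into classes of true twins of `G[B]` with representatives
`cls v`, and `d` is a cost function on the representatives for which no cluster subgraph has more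
than half of the total cost, up to `1 / 2`. Classes with several members lie in the closed
neighbourhood of `v₀`. -/
structure TwinWeights (G : SimpleGraph V) (v₀ : V) (B : Finset V) (cls : V → V) (d : V → ℤ) :
    Prop where
  center_mem : v₀ ∈ B
  cls_center : cls v₀ = v₀
  cls_mem : ∀ v ∈ B, cls v ∈ B
  cls_cls : ∀ v ∈ B, cls (cls v) = cls v
  adj_iff : ∀ u ∈ B, ∀ v ∈ B, cls u ≠ cls v → (G.Adj u v ↔ G.Adj (cls u) (cls v))
  adj_of_eq : ∀ u ∈ B, ∀ v ∈ B, cls u = cls v → u ≠ v → G.Adj u v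
  bound : ∀ K ⊆ B, (∀ v ∈ K, cls v = v) → ClusterOn G K →
    2 * ∑ v ∈ K, d v ≤ ∑ v ∈ B.filter (fun v => cls v = v), d v + 1
  nonneg : ∀ v ∈ B, 0 ≤ d v
  one_le : ∀ v ∈ B, v = v₀ ∨ G.Adj v₀ v → 1 ≤ d (cls v)
  nbhd : ∀ u ∈ B, ∀ v ∈ B, cls u = cls v → u ≠ v → u = v₀ ∨ G.Adj v₀ u
  -- Weights of vertices that are not representatives do not enter `bound`. They are kept at `1` in
  -- store for the moment when a split turns the vertex into a representative.
  one : ∀ v ∈ B, G.Adj v₀ v → cls v ≠ v → d v = 1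

namespace TwinWeights

variable {v₀ z : V} {B : Finset V} {cls cls' : V → V} {d d' : V → ℤ}

theorem center (v₀ : V) : TwinWeights G v₀ {v₀} id fun _ => 1 where
  center_mem := mem_singleton_self _
  cls_center := rfl
  cls_mem := fun _ h => h
  cls_cls := fun _ _ => rfl
  adj_iff := fun _ _ _ _ _ => Iff.rfl
  adj_of_eq := fun _ _ _ _ h h' => absurd h h'
  bound := fun K hK _ _ => by
    have := card_le_card hK
    simp only [card_singleton] at this
    simp
    omega
  nonneg := fun _ _ => zero_le_one
  one_le := fun _ _ _ => le_rfl
  nbhd := fun _ _ _ _ h h' => absurd h h'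
  one := fun _ _ _ _ => rfl

/-- A vertex that does not belong to a single class of twins is separated from its twin. -/
theorem cls_eq_self {S : Finset V} (h : TwinWeights G v₀ S cls d)
    (htw : ∀ u u', ¬ AreTrueTwins G S u u') {v : V} (hv : v ∈ S) : cls v = v := by
  by_contra hne
  refine htw v (cls v) ⟨hv, h.cls_mem v hv,
    h.adj_of_eq v hv _ (h.cls_mem v hv) (h.cls_cls v hv).symm (Ne.symm hne), fun t ht h1 h2 => ?_⟩
  by_cases hc : cls t = cls v
  · exact iff_of_true (h.adj_of_eq v hv t ht hc.symm h1.symm)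
      (h.adj_of_eq _ (h.cls_mem v hv) t ht ((h.cls_cls v hv).trans hc.symm) h2.symm)
  · rw [h.adj_iff v hv t ht (Ne.symm hc), h.adj_iff _ (h.cls_mem v hv) t ht
      (by rw [h.cls_cls v hv]; exact Ne.symm hc), h.cls_cls v hv]

/-- Without twins in `S` every vertex is its own representative, so `bound` and `one_le` become the
hypotheses of `isGoodIn_of_central`. -/
theorem isGoodIn {S : Finset V} (h : TwinWeights G v₀ S cls d)
    (htw : ∀ u u', ¬ AreTrueTwins G S u u') : IsGoodIn 2 G S S fun v => (d v : ℚ) := by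
  refine isGoodIn_of_central h.center_mem h.nonneg (fun v hv hn => ?_) fun K hK hcl => ?_
  · have := h.one_le v hv hn
    rwa [h.cls_eq_self htw hv] at this
  · have := h.bound K hK (fun v hv => h.cls_eq_self htw (hK hv)) hcl
    rwa [Finset.filter_true_of_mem fun v hv => h.cls_eq_self htw hv] at this

/-- The representatives of the vertices of a cluster subgraph form a cluster subgraph. -/
theorem clusterOn_image (h : TwinWeights G v₀ B cls d) {K : Finset V} (hK : K ⊆ B)
    (hcl : ClusterOn G K) : ClusterOn G (K.image cls) := by
  intro a ha b hb c hc hab hbc hac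
  obtain ⟨u, hu, rfl⟩ := mem_image.1 ha
  obtain ⟨v, hv, rfl⟩ := mem_image.1 hb
  obtain ⟨w, hw, rfl⟩ := mem_image.1 hc
  have h1 := (h.adj_iff u (hK hu) v (hK hv) hab.ne).2 hab
  have h2 := (h.adj_iff v (hK hv) w (hK hw) hbc.ne).2 hbc
  exact (h.adj_iff u (hK hu) w (hK hw) hac).1
    (hcl u hu v hv w hw h1 h2 fun e => hac (congrArg cls e))

/-- Add a vertex that splits some of the classes, with the number of these as its cost. -/
theorem split (h : TwinWeights G v₀ B cls d) (hzB : z ∉ B) (N : Finset V)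
    (hN : ∀ v, v ∈ N ↔ v ∈ B ∧ ¬ (G.Adj z v ↔ G.Adj z (cls v)) ∧ cls' v = v)
    (hz : cls' z = z)
    (hgood : ∀ v ∈ B, (G.Adj z v ↔ G.Adj z (cls v)) → cls' v = cls v)
    (hbad : ∀ v ∈ B, ¬ (G.Adj z v ↔ G.Adj z (cls v)) →
      cls' v ∈ B ∧ cls (cls' v) = cls v ∧ (G.Adj z (cls' v) ↔ G.Adj z v))
    (heq : ∀ u ∈ B, ∀ v ∈ B, ¬ (G.Adj z u ↔ G.Adj z (cls u)) → ¬ (G.Adj z v ↔ G.Adj z (cls v)) →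
      cls u = cls v → cls' u = cls' v)
    (hdz : d' z = N.card) (hd : ∀ v ∈ B, d' v = d v) (hk : G.Adj v₀ z → 1 ≤ d' z) :
    TwinWeights G v₀ (insert z B) cls' d' := by
  have hne : ∀ {v}, v ∈ B → v ≠ z := fun hv e => hzB (e ▸ hv)
  have hmem : ∀ v ∈ B, cls' v ∈ B := fun v hv => by
    by_cases hb : G.Adj z v ↔ G.Adj z (cls v)
    · rw [hgood v hv hb]; exact h.cls_mem v hv
    · exact (hbad v hv hb).1
  have hcc : ∀ v ∈ B, cls (cls' v) = cls v := fun v hv => by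
    by_cases hb : G.Adj z v ↔ G.Adj z (cls v)
    · rw [hgood v hv hb]; exact h.cls_cls v hv
    · exact (hbad v hv hb).2.1
  have hzz : ∀ v ∈ B, (G.Adj z (cls' v) ↔ G.Adj z v) := fun v hv => by
    by_cases hb : G.Adj z v ↔ G.Adj z (cls v)
    · rw [hgood v hv hb]; exact hb.symm
    · exact (hbad v hv hb).2.2
  have hbad' : ∀ v ∈ B, ¬ (G.Adj z v ↔ G.Adj z (cls v)) →
      ¬ (G.Adj z (cls' v) ↔ G.Adj z (cls (cls' v))) := fun v hv hb => by
    rwa [hzz v hv, hcc v hv]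
  have hcls : ∀ v ∈ B, cls v = v → cls' v = v := fun v hv hv' => by
    rw [hgood v hv (by rw [hv']), hv']
  have hc'c' : ∀ v ∈ B, cls' (cls' v) = cls' v := fun v hv => by
    by_cases hb : G.Adj z v ↔ G.Adj z (cls v)
    · rw [hgood v hv hb]
      exact hcls _ (h.cls_mem v hv) (h.cls_cls v hv)
    · exact heq _ (hmem v hv) v hv (hbad' v hv hb) hb (hcc v hv)
  have hNB : ∀ {v}, v ∈ N → v ∈ B := fun hv => ((hN _).1 hv).1
  have hNne : ∀ v ∈ N, cls v ≠ v := fun v hv e => ((hN v).1 hv).2.1 (by rw [e])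
  -- Classes with several members lie in the closed neighbourhood of `v₀`, and `v₀` represents its
  -- own class. So a vertex that is no representative is a neighbour of `v₀` and has weight `1`.
  have hNd : ∀ v ∈ B, cls v ≠ v → d v = 1 := by
    intro v hv hvc
    have hv0 := h.nbhd v hv (cls v) (h.cls_mem v hv) (h.cls_cls v hv).symm (Ne.symm hvc)
    have : v ≠ v₀ := by rintro rfl; exact hvc h.cls_center
    exact h.one v hv (hv0.resolve_left this) hvc
  have hNinj : Set.InjOn cls (N : Set V) := fun u hu v hv huv => by
    have hu' := (hN u).1 hu
    have hv' := (hN v).1 hv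
    rw [← hu'.2.2, ← hv'.2.2]
    exact heq u hu'.1 v hv'.1 hu'.2.1 hv'.2.1 huv
  have hcls1 : ∀ v ∈ N, 1 ≤ d (cls v) := fun v hv => by
    have := h.nbhd v (hNB hv) (cls v) (h.cls_mem v (hNB hv)) (h.cls_cls v (hNB hv)).symm
      (Ne.symm (hNne v hv))
    exact h.one_le v (hNB hv) this
  refine ⟨mem_insert_of_mem h.center_mem, hcls _ h.center_mem h.cls_center, ?_, ?_, ?_, ?_, ?_, ?_,
    ?_, ?_, ?_⟩
  · intro v hv
    rcases mem_insert.1 hv with rfl | hv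
    · rw [hz]; exact mem_insert_self _ _
    · exact mem_insert_of_mem (hmem v hv)
  · intro v hv
    rcases mem_insert.1 hv with rfl | hv
    · rw [hz, hz]
    · exact hc'c' v hv
  · intro u hu v hv huv
    rw [mem_insert] at hu hv
    rcases hu with rfl | hu <;> rcases hv with rfl | hv
    · exact absurd rfl huv
    · rw [hz]; exact (hzz v hv).symm
    · rw [hz, G.adj_comm u, G.adj_comm (cls' u)]; exact (hzz u hu).symm
    · by_cases hc : cls u = cls v
      · exact iff_of_true (h.adj_of_eq u hu v hv hc fun e => huv (congrArg _ e))
          (h.adj_of_eq _ (hmem u hu) _ (hmem v hv) (by rw [hcc u hu, hcc v hv, hc]) huv)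
      · rw [h.adj_iff u hu v hv hc, h.adj_iff _ (hmem u hu) _ (hmem v hv)
          (by rwa [hcc u hu, hcc v hv]), hcc u hu, hcc v hv]
  · intro u hu v hv huv hne'
    rw [mem_insert] at hu hv
    rcases hu with rfl | hu <;> rcases hv with rfl | hv
    · exact absurd rfl hne'
    · exact absurd (hz ▸ huv ▸ hmem v hv) hzB
    · exact absurd (hz ▸ huv ▸ hmem u hu) hzB
    · exact h.adj_of_eq u hu v hv (by rw [← hcc u hu, huv, hcc v hv]) hne'
  · intro K hK hKc hcl
    set R := B.filter (fun v => cls v = v) with hR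
    have hR' : (insert z B).filter (fun v => cls' v = v) = insert z (R ∪ N) := by
      ext v
      simp only [mem_filter, mem_insert, mem_union, hR, hN]
      constructor
      · rintro ⟨rfl | hv, hv'⟩
        · exact Or.inl rfl
        · refine Or.inr ?_
          by_cases hb : G.Adj z v ↔ G.Adj z (cls v)
          · exact Or.inl ⟨hv, by rw [← hgood v hv hb, hv']⟩
          · exact Or.inr ⟨hv, hb, hv'⟩
      · rintro (rfl | ⟨hv, hv'⟩ | ⟨hv, -, hv'⟩)
        · exact ⟨Or.inl rfl, hz⟩
        · exact ⟨Or.inr hv, hcls v hv hv'⟩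
        · exact ⟨Or.inr hv, hv'⟩
    have hRN : Disjoint R N := disjoint_left.2 fun v hv hvN => hNne v hvN (mem_filter.1 hv).2
    have hRB : R ⊆ B := filter_subset _ _
    have hNsub : N ⊆ B := fun v hv => hNB hv
    have hsumN : ∀ M ⊆ N, ∑ v ∈ M, d v = M.card := fun M hM => by
      rw [sum_congr rfl fun v hv => hNd v (hNB (hM hv)) (hNne v (hM hv))]
      simp
    have hzRN : z ∉ R ∪ N := fun hz => hzB (union_subset hRB hNsub hz)
    -- The new representatives contribute `|N|` and `z` contributes `|N|` again, so a cluster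
    -- subgraph may gain up to `|N|`.
    have htot : ∑ v ∈ insert z (R ∪ N), d' v = ∑ v ∈ R, d v + 2 * N.card := by
      rw [sum_insert hzRN, hdz, sum_congr rfl fun v hv => hd v (union_subset hRB hNsub hv),
        sum_union hRN, hsumN N Subset.rfl]
      ring
    rw [hR', htot]
    set K1 := K.erase z with hK1
    have hK1B : K1 ⊆ B := fun v hv =>
      (mem_insert.1 (hK (mem_of_mem_erase hv))).resolve_left (ne_of_mem_erase hv)
    have hK1cl := hcl.mono (erase_subset z K)
    -- The old bound is applied to the old representatives of the members of `K`.
    set K0 := K1.image cls with hK0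
    have hK0bd := h.bound K0 (fun v hv => by
        obtain ⟨u, hu, rfl⟩ := mem_image.1 hv
        exact h.cls_mem u (hK1B hu))
      (fun v hv => by
        obtain ⟨u, hu, rfl⟩ := mem_image.1 hv
        exact h.cls_cls u (hK1B hu)) (h.clusterOn_image hK1B hK1cl)
    have hK0B : ∀ v ∈ K0, v ∈ B := fun v hv => by
      obtain ⟨u, hu, rfl⟩ := mem_image.1 hv
      exact h.cls_mem u (hK1B hu)
    have hsplit : ∑ v ∈ K1, d' v = ∑ v ∈ K1 ∩ R, d v + (K1 ∩ N).card := by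
      rw [sum_congr rfl fun v hv => hd v (hK1B hv), ← hsumN (K1 ∩ N) inter_subset_right,
        ← sum_union (hRN.mono inter_subset_right inter_subset_right)]
      congr 1
      rw [← inter_union_distrib_left]
      refine (inter_eq_left.2 fun v hv => ?_).symm
      have : v ∈ insert z (R ∪ N) := hR' ▸ mem_filter.2
        ⟨hK (mem_of_mem_erase hv), hKc v (mem_of_mem_erase hv)⟩
      exact (mem_insert.1 this).resolve_left (ne_of_mem_erase hv)
    have hsub1 : K1 ∩ R ⊆ K0 := fun v hv => by
      rw [mem_inter] at hv
      exact mem_image.2 ⟨v, hv.1, (mem_filter.1 hv.2).2⟩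
    by_cases hzK : z ∈ K
    · have hsub2 : (K1 ∩ N).image cls ⊆ K0 := image_subset_image inter_subset_left
      -- With `z` in `K`, a split class contributes at most one of its old and its new
      -- representative: they are adjacent and `z` sees exactly one of them, which would give an
      -- induced path. So the members other than `z` cost no more than `K0`.
      have hdisj : Disjoint (K1 ∩ R) ((K1 ∩ N).image cls) := by
        refine disjoint_left.2 fun r hr hr' => ?_
        obtain ⟨v, hv, rfl⟩ := mem_image.1 hr'
        rw [mem_inter] at hr hv
        have hvB := hK1B hv.1
        have hadj : G.Adj v (cls v) := h.adj_of_eq v hvB _ (h.cls_mem v hvB)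
          (h.cls_cls v hvB).symm (Ne.symm (hNne v hv.2))
        have hvK := mem_of_mem_erase hv.1
        have hcK := mem_of_mem_erase hr.1
        refine ((hN v).1 hv.2).2.1 ⟨fun hzv => ?_, fun hzc => ?_⟩
        · exact hcl z hzK v hvK _ hcK hzv hadj (hne (hK1B hr.1)).symm
        · exact hcl z hzK _ hcK v hvK hzc hadj.symm (hne hvB).symm
      have h1 := sum_le_sum_of_subset_of_nonneg (f := d) (union_subset hsub1 hsub2)
        fun v hv _ => h.nonneg v (hK0B v hv)
      rw [sum_union hdisj, sum_image (hNinj.mono (by simp))] at h1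
      have h2 : ((K1 ∩ N).card : ℤ) ≤ ∑ v ∈ K1 ∩ N, d (cls v) := by
        have := Finset.card_nsmul_le_sum (K1 ∩ N) (fun v => d (cls v)) 1
          fun v hv => hcls1 v (mem_inter.1 hv).2
        simpa using this
      rw [← Finset.add_sum_erase K d' hzK, ← hK1, hsplit, hdz]
      linarith
    -- Without `z`, the only gain over `K0` comes from new representatives, and these weigh at most
    -- `|N|` in total.
    · have h1 := sum_le_sum_of_subset_of_nonneg (f := d) hsub1
        fun v hv _ => h.nonneg v (hK0B v hv)
      have h2 : (((K1 ∩ N).card : ℕ) : ℤ) ≤ N.card := by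
        exact_mod_cast card_le_card inter_subset_right
      rw [← erase_eq_of_notMem hzK, ← hK1, hsplit]
      linarith
  · intro v hv
    rcases mem_insert.1 hv with rfl | hv
    · rw [hdz]; positivity
    · rw [hd v hv]; exact h.nonneg v hv
  · intro v hv hn
    rcases mem_insert.1 hv with rfl | hv
    · rw [hz]
      rcases hn with rfl | hn
      · exact absurd h.center_mem hzB
      · exact hk hn
    · rw [hd _ (hmem v hv)]
      by_cases hb : G.Adj z v ↔ G.Adj z (cls v)
      · rw [hgood v hv hb]; exact h.one_le v hv hn
      · rw [hNd _ (hmem v hv)]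
        rw [hcc v hv]
        intro e
        exact hbad' v hv hb (by rw [hcc v hv, e])
  · intro u hu v hv huv hne'
    rw [mem_insert] at hu hv
    rcases hu with rfl | hu <;> rcases hv with rfl | hv
    · exact absurd rfl hne'
    · exact absurd (hz ▸ huv ▸ hmem v hv) hzB
    · exact absurd (hz ▸ huv ▸ hmem u hu) hzB
    · exact h.nbhd u hu v hv (by rw [← hcc u hu, huv, hcc v hv]) hne'
  · intro v hv hadj hne'
    rcases mem_insert.1 hv with rfl | hv
    · exact absurd hz hne'
    · rw [hd v hv]
      exact hNd v hv fun e => hne' (hcls v hv e)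

/-- Add a twin of a vertex. -/
theorem addTwin (h : TwinWeights G v₀ B cls d) (hzB : z ∉ B) (hv₀z : G.Adj v₀ z) {m : V}
    (hm : m ∈ B) (hm' : m = v₀ ∨ G.Adj v₀ m) (hzm : G.Adj z m)
    (htw : ∀ t ∈ B, t ≠ m → (G.Adj z t ↔ G.Adj m t))
    (hz : cls' z = cls m) (hcls : ∀ v ∈ B, cls' v = cls v) (hdz : d' z = 1)
    (hd : ∀ v ∈ B, d' v = d v) : TwinWeights G v₀ (insert z B) cls' d' := by
  have hne : ∀ {v}, v ∈ B → v ≠ z := fun hv e => hzB (e ▸ hv)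
  have hcm := h.cls_mem m hm
  have hadj : ∀ v ∈ B, cls m ≠ cls v → (G.Adj z v ↔ G.Adj (cls m) (cls v)) := fun v hv hmv => by
    rw [htw v hv (fun e => hmv (by rw [e])), h.adj_iff m hm v hv hmv]
  have hadj' : ∀ v ∈ B, cls m = cls v → G.Adj z v := fun v hv hmv => by
    by_cases hvm : v = m
    · rwa [hvm]
    · rw [htw v hv hvm]
      exact h.adj_of_eq m hm v hv hmv (Ne.symm hvm)
  refine ⟨mem_insert_of_mem h.center_mem, by rw [hcls _ h.center_mem, h.cls_center], ?_, ?_, ?_,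
    ?_, ?_, ?_, ?_, ?_, ?_⟩
  · intro v hv
    rcases mem_insert.1 hv with rfl | hv
    · rw [hz]; exact mem_insert_of_mem hcm
    · rw [hcls v hv]; exact mem_insert_of_mem (h.cls_mem v hv)
  · intro v hv
    rcases mem_insert.1 hv with rfl | hv
    · rw [hz, hcls _ hcm, h.cls_cls m hm]
    · rw [hcls v hv, hcls _ (h.cls_mem v hv), h.cls_cls v hv]
  · intro u hu v hv huv
    rw [mem_insert] at hu hv
    rcases hu with rfl | hu <;> rcases hv with rfl | hv
    · exact absurd rfl huv
    · rw [hz, hcls v hv] at huv ⊢; exact hadj v hv huv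
    · rw [hz, hcls u hu] at huv ⊢
      rw [G.adj_comm u, G.adj_comm (cls u)]; exact hadj u hu huv.symm
    · rw [hcls u hu, hcls v hv] at huv ⊢; exact h.adj_iff u hu v hv huv
  · intro u hu v hv huv hne'
    rw [mem_insert] at hu hv
    rcases hu with rfl | hu <;> rcases hv with rfl | hv
    · exact absurd rfl hne'
    · rw [hz, hcls v hv] at huv; exact hadj' v hv huv
    · rw [hz, hcls u hu] at huv; exact (hadj' u hu huv.symm).symm
    · rw [hcls u hu, hcls v hv] at huv; exact h.adj_of_eq u hu v hv huv hne'
  · intro K hK hKc hcl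
    -- The vertex `z` joins an existing class and is no representative, so neither the total nor the
    -- admissible sets `K` change.
    have hzc : cls' z ≠ z := by rw [hz]; exact hne hcm
    have hKB : K ⊆ B := fun v hv =>
      (mem_insert.1 (hK hv)).resolve_left fun e => hzc (e ▸ hKc v hv)
    have hR' : (insert z B).filter (fun v => cls' v = v) = B.filter (fun v => cls v = v) := by
      rw [filter_insert, if_neg hzc]
      exact filter_congr fun v hv => by rw [hcls v hv]
    rw [hR', sum_congr rfl fun v hv => hd v (hKB hv),
      sum_congr rfl fun v hv => hd v (mem_filter.1 hv).1]
    exact h.bound K hKB (fun v hv => by rw [← hcls v (hKB hv), hKc v hv]) hcl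
  · intro v hv
    rcases mem_insert.1 hv with rfl | hv
    · rw [hdz]; norm_num
    · rw [hd v hv]; exact h.nonneg v hv
  · intro v hv hn
    rcases mem_insert.1 hv with rfl | hv
    · rw [hz, hd _ hcm]; exact h.one_le m hm hm'
    · rw [hcls v hv, hd _ (h.cls_mem v hv)]; exact h.one_le v hv hn
  · intro u hu v hv huv hne'
    rw [mem_insert] at hu hv
    rcases hu with rfl | hu
    · exact Or.inr hv₀z
    rcases hv with rfl | hv
    · rw [hz, hcls u hu] at huv
      by_cases hum : u = m
      · rwa [hum]
      · exact h.nbhd u hu m hm huv hum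
    · rw [hcls u hu, hcls v hv] at huv; exact h.nbhd u hu v hv huv hne'
  · intro v hv hadj hne₁
    rcases mem_insert.1 hv with rfl | hv
    · exact hdz
    · rw [hcls v hv] at hne₁
      rw [hd v hv]; exact h.one v hv hadj hne₁

/-- Add a neighbour of `v₀` whose neighbours in `B` form a clique that is not maximal, and raise
the cost of `v₀`. -/
theorem addFree (h : TwinWeights G v₀ B cls d) (hzB : z ∉ B) (hv₀z : G.Adj v₀ z)
    (hB : ∀ v ∈ B, v = v₀ ∨ G.Adj v₀ v)
    (hhom : ∀ v ∈ B, (G.Adj z v ↔ G.Adj z (cls v)))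
    (hclq : ∀ u ∈ B, ∀ v ∈ B, G.Adj z u → G.Adj z v → u ≠ v → G.Adj u v)
    {t : V} (ht : t ∈ B) (hzt : ¬ G.Adj z t) (htl : ∀ l ∈ B, G.Adj z l → G.Adj l t)
    (hz : cls' z = z) (hcls : ∀ v ∈ B, cls' v = cls v) (hdz : d' z = 1) (hd0 : d' v₀ = d v₀ + 1)
    (hd : ∀ v ∈ B, v ≠ v₀ → d' v = d v) : TwinWeights G v₀ (insert z B) cls' d' := by
  have hne : ∀ {v}, v ∈ B → v ≠ z := fun hv e => hzB (e ▸ hv)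
  have hle : ∀ v ∈ B, d v ≤ d' v := fun v hv => by
    by_cases hv0 : v = v₀
    · rw [hv0, hd0]; omega
    · rw [hd v hv hv0]
  refine ⟨mem_insert_of_mem h.center_mem, by rw [hcls _ h.center_mem, h.cls_center], ?_, ?_, ?_,
    ?_, ?_, ?_, ?_, ?_, ?_⟩
  · intro v hv
    rcases mem_insert.1 hv with rfl | hv
    · rw [hz]; exact mem_insert_self _ _
    · rw [hcls v hv]; exact mem_insert_of_mem (h.cls_mem v hv)
  · intro v hv
    rcases mem_insert.1 hv with rfl | hv
    · rw [hz, hz]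
    · rw [hcls v hv, hcls _ (h.cls_mem v hv), h.cls_cls v hv]
  · intro u hu v hv huv
    rw [mem_insert] at hu hv
    rcases hu with rfl | hu <;> rcases hv with rfl | hv
    · exact absurd rfl huv
    · rw [hz, hcls v hv]; exact hhom v hv
    · rw [hz, hcls u hu, G.adj_comm u, G.adj_comm (cls u)]; exact hhom u hu
    · rw [hcls u hu, hcls v hv] at huv ⊢; exact h.adj_iff u hu v hv huv
  · intro u hu v hv huv hne'
    rw [mem_insert] at hu hv
    rcases hu with rfl | hu <;> rcases hv with rfl | hv
    · exact absurd rfl hne'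
    · rw [hz, hcls v hv] at huv; exact absurd (huv ▸ h.cls_mem v hv) hzB
    · rw [hz, hcls u hu] at huv; exact absurd (huv ▸ h.cls_mem u hu) hzB
    · rw [hcls u hu, hcls v hv] at huv; exact h.adj_of_eq u hu v hv huv hne'
  · intro K hK hKc hcl
    set R := B.filter (fun v => cls v = v) with hR
    have hR' : (insert z B).filter (fun v => cls' v = v) = insert z R := by
      rw [filter_insert, if_pos hz]
      congr 1
      exact filter_congr fun v hv => by rw [hcls v hv]
    have hv₀R : v₀ ∈ R := mem_filter.2 ⟨h.center_mem, h.cls_center⟩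
    have hzR : z ∉ R := fun hz => hzB (mem_filter.1 hz).1
    have hsum : ∀ M ⊆ B, ∑ v ∈ M, d' v = ∑ v ∈ M, d v + if v₀ ∈ M then 1 else 0 := by
      intro M hM
      have : ∀ v ∈ M, d' v = d v + if v = v₀ then 1 else 0 := fun v hv => by
        split_ifs with hv0
        · rw [hv0, hd0]
        · rw [hd v (hM hv) hv0, add_zero]
      rw [sum_congr rfl this, sum_add_distrib, sum_ite_eq']
    -- The total grows by `2`, so a cluster subgraph may gain `1`. Only one that contains both `z`
    -- and `v₀` gains `2`.
    rw [hR', sum_insert hzR, hdz, hsum R (filter_subset _ _), if_pos hv₀R]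
    set K1 := K.erase z with hK1
    have hK1B : K1 ⊆ B := fun v hv =>
      (mem_insert.1 (hK (mem_of_mem_erase hv))).resolve_left (ne_of_mem_erase hv)
    have hK1c : ∀ v ∈ K1, cls v = v := fun v hv => by
      rw [← hcls v (hK1B hv), hKc v (mem_of_mem_erase hv)]
    have hbd := h.bound K1 hK1B hK1c (hcl.mono (erase_subset z K))
    by_cases hzK : z ∈ K
    · rw [← Finset.add_sum_erase K d' hzK, ← hK1, hdz, hsum K1 hK1B]
      split_ifs with hv0
      -- As all of `B` lies in the closed neighbourhood of `v₀`, a cluster subgraph containing the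
      -- edge `v₀ z` is a clique. Its part in `B` extends by the representative of `t`, whose weight
      -- of at least `1` in the old bound compensates for the excess.
      · have hzadj : ∀ v ∈ K1, G.Adj z v := fun v hv => by
          rcases hB v (hK1B hv) with rfl | hv'
          · exact hv₀z.symm
          · exact hcl z hzK v₀ (mem_of_mem_erase hv0) v (mem_of_mem_erase hv) hv₀z.symm hv'
              (hne (hK1B hv)).symm
        have hctB := h.cls_mem t ht
        have hzc : ¬ G.Adj z (cls t) := fun hc => hzt ((hhom t ht).2 hc)
        have hcK : cls t ∉ K1 := fun hc => hzc (hzadj _ hc)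
        have hcadj : ∀ v ∈ K1, G.Adj v (cls t) := fun v hv => by
          have h1 := htl v (hK1B hv) (hzadj v hv)
          rw [h.adj_iff v (hK1B hv) t ht] at h1
          · rwa [hK1c v hv] at h1
          · rw [hK1c v hv]
            rintro rfl
            exact hcK hv
        have hclq' : ∀ u ∈ insert (cls t) K1, ∀ v ∈ insert (cls t) K1, u ≠ v → G.Adj u v := by
          intro u hu v hv huv
          rw [mem_insert] at hu hv
          rcases hu with rfl | hu <;> rcases hv with rfl | hv
          · exact absurd rfl huv
          · exact (hcadj v hv).symm
          · exact hcadj u hu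
          · exact hclq u (hK1B hu) v (hK1B hv) (hzadj u hu) (hzadj v hv) huv
        have := h.bound (insert (cls t) K1) (insert_subset hctB hK1B) (fun v hv => by
            rcases mem_insert.1 hv with rfl | hv
            exacts [h.cls_cls t ht, hK1c v hv])
          fun u hu v _ w hw _ _ huw => hclq' u hu w hw huw
        rw [sum_insert hcK] at this
        linarith [h.one_le t ht (hB t ht)]
      · linarith
    · rw [← erase_eq_of_notMem hzK, ← hK1, hsum K1 hK1B]
      split_ifs <;> linarith
  · intro v hv
    rcases mem_insert.1 hv with rfl | hv
    · rw [hdz]; norm_num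
    · exact (h.nonneg v hv).trans (hle v hv)
  · intro v hv hn
    rcases mem_insert.1 hv with rfl | hv
    · rw [hz, hdz]
    · rw [hcls v hv]
      exact (h.one_le v hv hn).trans (hle _ (h.cls_mem v hv))
  · intro u hu v hv huv hne'
    rcases mem_insert.1 hu with rfl | hu
    · exact Or.inr hv₀z
    · exact hB u hu
  · intro v hv hadj hne'
    rcases mem_insert.1 hv with rfl | hv
    · exact hdz
    · rw [hcls v hv] at hne'
      rw [hd v hv hadj.ne']; exact h.one v hv hadj hne'

end TwinWeights

end TwinClasses

/-! ## Maximum cardinality search -/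

section MaximumCardinalitySearch

variable {V : Type*} {G : SimpleGraph V}

open Classical in
/-- The number of neighbours of `w` among the vertices of `P` with time stamp greater than `t`. -/
noncomputable def nbrCount (G : SimpleGraph V) (P : Finset V) (τ : V → ℤ) (t : ℤ) (w : V) : ℕ :=
  (P.filter fun u => t < τ u ∧ G.Adj w u).card

/-- The vertices of `P` have been visited in the order of decreasing time stamps, always taking a
vertex of `A` with as many visited neighbours as possible. -/
structure IsMCS (G : SimpleGraph V) (A P : Finset V) (τ : V → ℤ) : Prop where
  subset : P ⊆ A
  injOn : Set.InjOn τ P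
  count_le : ∀ z ∈ P, ∀ w ∈ A, (w ∉ P ∨ τ w ≤ τ z) →
    nbrCount G P τ (τ z) w ≤ nbrCount G P τ (τ z) z

theorem IsMCS.empty (G : SimpleGraph V) (A : Finset V) (τ : V → ℤ) : IsMCS G A ∅ τ :=
  ⟨empty_subset _, by simp, by simp⟩

theorem nbrCount_congr {P P' : Finset V} {τ τ' : V → ℤ} {t t' : ℤ} {w : V}
    (h : ∀ u, (u ∈ P ∧ t < τ u) ↔ (u ∈ P' ∧ t' < τ' u)) :
    nbrCount G P τ t w = nbrCount G P' τ' t' w := by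
  unfold nbrCount
  congr 1
  ext u
  have := h u
  simp only [mem_filter]
  tauto

/-- The earlier neighbours of every vertex form a clique. -/
def IsPerfectOrder (G : SimpleGraph V) (A : Finset V) (τ : V → ℤ) : Prop :=
  ∀ z ∈ A, ∀ a ∈ A, ∀ b ∈ A, τ z < τ a → τ z < τ b → G.Adj z a → G.Adj z b → a ≠ b → G.Adj a b

/-- The last visited vertex of a hole has both of its neighbours before it, and they are not
adjacent. -/
theorem IsPerfectOrder.not_isHole {A T : Finset V} {τ : V → ℤ} (h : IsPerfectOrder G A τ)
    (hτ : Set.InjOn τ A) (hT : T ⊆ A) : ¬ IsHole G T := by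
  rintro ⟨hne, hdeg⟩
  obtain ⟨v, hv, hmin⟩ := exists_min_image T τ hne
  obtain ⟨a, ha, b, hb, hab, hnab, hadj⟩ := hdeg v hv
  have h1 := (hadj a ha).2 (Or.inl rfl)
  have h2 := (hadj b hb).2 (Or.inr rfl)
  have hlt : ∀ x ∈ T, G.Adj v x → τ v < τ x := fun x hx hvx =>
    (hmin x hx).lt_of_ne fun e => hvx.ne (hτ (hT hv) (hT hx) e)
  exact hnab (h v (hT hv) a (hT ha) b (hT hb) (hlt a ha h1) (hlt b hb h2) h1 h2 hab)

/-- `p 0, …, p k` is an induced path in `A`. -/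
structure IsInducedPath (G : SimpleGraph V) (A : Finset V) (p : ℕ → V) (k : ℕ) : Prop where
  mem : ∀ i ≤ k, p i ∈ A
  inj : ∀ i ≤ k, ∀ j ≤ k, p i = p j → i = j
  adj : ∀ i ≤ k, ∀ j ≤ k, G.Adj (p i) (p j) ↔ i + 1 = j ∨ j + 1 = i

theorem IsInducedPath.reverse {A : Finset V} {p : ℕ → V} {k : ℕ} (h : IsInducedPath G A p k) :
    IsInducedPath G A (fun i => p (k - i)) k where
  mem i _ := h.mem _ (by omega)
  inj i hi j hj hij := by have := h.inj _ (by omega) _ (by omega) hij; omega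
  adj i hi j hj := by
    rw [h.adj _ (by omega) _ (by omega)]
    omega

theorem IsInducedPath.mono {A : Finset V} {p : ℕ → V} {k i : ℕ} (h : IsInducedPath G A p k)
    (hi : i ≤ k) : IsInducedPath G A p i where
  mem j hj := h.mem j (by omega)
  inj a ha b hb := h.inj a (by omega) b (by omega)
  adj a ha b hb := h.adj a (by omega) b (by omega)

theorem IsInducedPath.snoc {A : Finset V} {p : ℕ → V} {k : ℕ} (h : IsInducedPath G A p k) {c : V}
    (hc : c ∈ A) (hne : ∀ i ≤ k, p i ≠ c) (hadj : ∀ i ≤ k, G.Adj (p i) c ↔ i = k) :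
    IsInducedPath G A (fun i => if i ≤ k then p i else c) (k + 1) where
  mem i hi := by
    split_ifs with h1
    exacts [h.mem i h1, hc]
  inj i hi j hj hij := by
    split_ifs at hij with h1 h2 h2
    · exact h.inj i h1 j h2 hij
    · exact absurd hij (hne i h1)
    · exact absurd hij.symm (hne j h2)
    · omega
  adj i hi j hj := by
    split_ifs with h1 h2 h2
    · exact h.adj i h1 j h2
    · rw [hadj i h1]; omega
    · rw [G.adj_comm, hadj j h2]; omega
    · have : i = j := by omega
      simp [this]

variable [DecidableEq V]

/-- The new stamp is below all others, so the counts at the earlier vertices are unaffected. -/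
theorem IsMCS.insert {A P : Finset V} {τ τ' : V → ℤ} (h : IsMCS G A P τ) {z : V} (hz : z ∈ A)
    (hzP : z ∉ P) (hτ : ∀ u ∈ P, τ' u = τ u) (hτz : ∀ u ∈ P, τ' z < τ u)
    (hmax : ∀ w ∈ A, w ∉ P → nbrCount G P τ (τ' z) w ≤ nbrCount G P τ (τ' z) z) :
    IsMCS G A (insert z P) τ' := by
  have hzu : ∀ u ∈ P, u ≠ z := fun u hu e => hzP (e ▸ hu)
  have hcz : ∀ w, nbrCount G (Insert.insert z P) τ' (τ' z) w = nbrCount G P τ (τ' z) w := fun w =>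
    nbrCount_congr fun u => by
      rw [mem_insert]
      constructor
      · rintro ⟨rfl | hu, hlt⟩
        · exact absurd hlt (lt_irrefl _)
        · exact ⟨hu, hτ u hu ▸ hlt⟩
      · rintro ⟨hu, hlt⟩
        exact ⟨Or.inr hu, (hτ u hu).symm ▸ hlt⟩
  have hcp : ∀ x ∈ P, ∀ w, nbrCount G (Insert.insert z P) τ' (τ' x) w = nbrCount G P τ (τ x) w :=
    fun x hx w => nbrCount_congr fun u => by
      rw [mem_insert, hτ x hx]
      constructor
      · rintro ⟨rfl | hu, hlt⟩
        · exact absurd hlt (hτz x hx).le.not_gt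
        · exact ⟨hu, hτ u hu ▸ hlt⟩
      · rintro ⟨hu, hlt⟩
        exact ⟨Or.inr hu, (hτ u hu).symm ▸ hlt⟩
  refine ⟨insert_subset hz h.subset, ?_, ?_⟩
  · intro u hu v hv huv
    rw [mem_coe, mem_insert] at hu hv
    rcases hu with rfl | hu <;> rcases hv with rfl | hv
    · rfl
    · exact absurd (huv.trans (hτ v hv)) (hτz v hv).ne
    · exact absurd (huv.symm.trans (hτ u hu)) (hτz u hu).ne
    · exact h.injOn hu hv (by rw [← hτ u hu, huv, hτ v hv])
  · intro x hx w hw hwx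
    rw [mem_insert] at hx
    rcases hx with rfl | hx
    · rw [hcz, hcz]
      by_cases hwP : w ∈ P
      · rcases hwx with hwx | hwx
        · exact absurd (mem_insert_of_mem hwP) hwx
        · rw [hτ w hwP] at hwx
          exact absurd hwx (hτz w hwP).not_ge
      · exact hmax w hw hwP
    · rw [hcp x hx, hcp x hx]
      refine h.count_le x hx w hw ?_
      by_cases hwP : w ∈ P
      · rcases hwx with hwx | hwx
        · exact absurd (mem_insert_of_mem hwP) hwx
        · exact Or.inr (by rwa [hτ w hwP, hτ x hx] at hwx)
      · exact Or.inl hwP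

theorem exists_isMCS (G : SimpleGraph V) (A : Finset V) : ∃ τ, IsMCS G A A τ := by
  have key : ∀ k ≤ A.card, ∃ P τ, IsMCS G A P τ ∧ P.card = k ∧ ∀ u ∈ P, -(k : ℤ) ≤ τ u := by
    intro k
    induction k with
    | zero => exact fun _ => ⟨∅, 0, .empty G A 0, rfl, by simp⟩
    | succ k ih =>
      intro hk
      obtain ⟨P, τ, h, hc, hτ⟩ := ih (by omega)
      have hne : (A \ P).Nonempty := by
        rw [← card_pos]
        have := le_card_sdiff P A
        omega
      -- The stamps used are `-1, -2, …`, so `-(k + 1)` lies below the stamps of all visited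
      -- vertices and the count ranges over all of `P`.
      obtain ⟨z, hz, hmax⟩ := exists_max_image (A \ P) (nbrCount G P τ (-((k : ℤ) + 1))) hne
      rw [mem_sdiff] at hz
      refine ⟨insert z P, Function.update τ z (-((k : ℤ) + 1)), h.insert hz.1 hz.2 (fun u hu =>
        Function.update_of_ne (ne_of_mem_of_not_mem hu hz.2) _ _) (fun u hu => ?_)
        (fun w hw hwP => ?_), by rw [card_insert_of_notMem hz.2, hc], fun u hu => ?_⟩
      · rw [Function.update_self]
        have := hτ u hu
        omega
      · rw [Function.update_self]
        exact hmax w (mem_sdiff.2 ⟨hw, hwP⟩)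
      · rcases mem_insert.1 hu with rfl | hu
        · rw [Function.update_self]; push_cast; omega
        · rw [Function.update_of_ne (ne_of_mem_of_not_mem hu hz.2)]
          have := hτ u hu
          push_cast
          omega
  obtain ⟨P, τ, h, hc, -⟩ := key A.card le_rfl
  rw [eq_of_subset_of_card_le h.subset hc.ge] at h
  exact ⟨τ, h⟩

/-- In a perfect maximum cardinality search, a vertex `z` whose earlier neighbours form a maximal
clique is a twin of the vertex visited just before. -/
theorem IsMCS.twin_of_maximal {A : Finset V} {τ : V → ℤ} (h : IsMCS G A A τ)
    (hp : IsPerfectOrder G A τ) {z : V} (hz : z ∈ A)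
    (hmax : ∀ t ∈ A, τ z < τ t → ¬ G.Adj z t → ∃ l ∈ A, τ z < τ l ∧ G.Adj z l ∧ ¬ G.Adj l t)
    {m : V} (hm : m ∈ A) (hzm : τ z < τ m) (hlast : ∀ u ∈ A, τ z < τ u → τ m ≤ τ u) :
    G.Adj z m ∧ ∀ t ∈ A, τ z < τ t → t ≠ m → (G.Adj z t ↔ G.Adj m t) := by
  classical
  set E : ℤ → V → Finset V := fun t w => A.filter fun u => t < τ u ∧ G.Adj w u with hE
  have hmemE : ∀ t w u, u ∈ E t w ↔ u ∈ A ∧ t < τ u ∧ G.Adj w u := fun t w u => by simp [hE]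
  have hcount : ∀ x ∈ A, ∀ w ∈ A, τ w ≤ τ x → (E (τ x) w).card ≤ (E (τ x) x).card :=
    fun x hx w hw hwx => by
      have := h.count_le x hx w hw (Or.inr hwx)
      unfold nbrCount at this
      convert this
  set L := E (τ z) z with hL
  have hLne : L.Nonempty := by
    by_cases hzm' : G.Adj z m
    · exact ⟨m, (hmemE _ _ _).2 ⟨hm, hzm, hzm'⟩⟩
    · obtain ⟨l, hl, h1, h2, -⟩ := hmax m hm hzm hzm'
      exact ⟨l, (hmemE _ _ _).2 ⟨hl, h1, h2⟩⟩
  -- the last vertex of the clique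
  obtain ⟨q, hq, hqmin⟩ := exists_min_image L τ hLne
  obtain ⟨hqA, hzq, hzqadj⟩ := (hmemE _ _ _).1 hq
  have hLclq : ∀ a ∈ L, ∀ b ∈ L, a ≠ b → G.Adj a b := fun a ha b hb hab => by
    obtain ⟨ha1, ha2, ha3⟩ := (hmemE _ _ _).1 ha
    obtain ⟨hb1, hb2, hb3⟩ := (hmemE _ _ _).1 hb
    exact hp z hz a ha1 b hb1 ha2 hb2 ha3 hb3 hab
  have hLq : ∀ a ∈ L, a ≠ q → τ q < τ a := fun a ha haq =>
    (hqmin a ha).lt_of_ne fun e => haq (h.injOn ((hmemE _ _ _).1 ha).1 hqA e.symm)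
  -- An earlier neighbour of `q` outside `L` would, by perfectness at `q`, be adjacent to all of
  -- `L`, against the maximality of the clique.
  have hEq : E (τ q) q = L.erase q := by
    refine Subset.antisymm (fun t ht => ?_) fun t ht => ?_
    · obtain ⟨ht1, ht2, ht3⟩ := (hmemE _ _ _).1 ht
      refine mem_erase.2 ⟨ht3.ne', ?_⟩
      by_contra htL
      have hzt : ¬ G.Adj z t := fun hc => htL ((hmemE _ _ _).2 ⟨ht1, hzq.trans ht2, hc⟩)
      obtain ⟨l, hl1, hl2, hl3, hl4⟩ := hmax t ht1 (hzq.trans ht2) hzt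
      have hlL : l ∈ L := (hmemE _ _ _).2 ⟨hl1, hl2, hl3⟩
      by_cases hlq : l = q
      · exact hl4 (hlq ▸ ht3)
      · refine hl4 (hp q hqA l hl1 t ht1 (hLq l hlL hlq) ht2 (hLclq q hq l hlL (Ne.symm hlq)) ht3 ?_)
        rintro rfl
        exact htL hlL
    · obtain ⟨ht1, ht2⟩ := mem_erase.1 ht
      exact (hmemE _ _ _).2 ⟨((hmemE _ _ _).1 ht2).1, hLq t ht2 ht1,
        hLclq q hq t ht2 (Ne.symm ht1)⟩
  have hEqc : (E (τ q) q).card + 1 = L.card := by rw [hEq, card_erase_add_one hq]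
  -- It remains to see that `q` is visited immediately before `z`. Otherwise let `w` be the vertex
  -- visited right after `q`. When `w` is chosen, `z` already sees all of `L`, so `w` sees at least
  -- `|L|` visited vertices.
  have hqlast : ∀ u ∈ A, τ z < τ u → τ q ≤ τ u := by
    by_contra! hcon
    obtain ⟨u, hu, hzu, huq⟩ := hcon
    obtain ⟨w, hw, hwmax⟩ := exists_max_image (A.filter fun u => τ z < τ u ∧ τ u < τ q) τ
      ⟨u, mem_filter.2 ⟨hu, hzu, huq⟩⟩
    obtain ⟨hwA, hzw, hwq⟩ := mem_filter.1 hw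
    have hwL : w ∉ L := fun hc => (hqmin w hc).not_gt hwq
    have hLw : L ⊆ E (τ w) z := fun t ht => by
      obtain ⟨h1, h2, h3⟩ := (hmemE _ _ _).1 ht
      exact (hmemE _ _ _).2 ⟨h1, hwq.trans_le (hqmin t ht), h3⟩
    have hc1 : L.card ≤ (E (τ w) w).card := (card_le_card hLw).trans (hcount w hwA z hz hzw.le)
    have hafter : ∀ t ∈ E (τ w) w, t = q ∨ τ q < τ t := fun t ht => by
      obtain ⟨h1, h2, h3⟩ := (hmemE _ _ _).1 ht
      by_contra! hc
      have hlt : τ t < τ q := hc.2.lt_of_ne fun e => hc.1 (h.injOn h1 hqA e)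
      exact (hwmax t (mem_filter.2 ⟨h1, hzw.trans h2, hlt⟩)).not_gt h2
    -- If `w` is adjacent to `q`, perfectness at `w` places its earlier neighbours in `L`, hence
    -- they are all of `L`, and `w` contradicts maximality. If not, `w` already saw `|L|` visited
    -- vertices when `q`, with only `|L| - 1`, was chosen.
    by_cases hqw : q ∈ E (τ w) w
    · have hsub : E (τ w) w ⊆ L := fun t ht => by
        by_cases htq : t = q
        · rwa [htq]
        · obtain ⟨h1, h2, h3⟩ := (hmemE _ _ _).1 ht
          obtain ⟨h4, h5, h6⟩ := (hmemE _ _ _).1 hqw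
          have : t ∈ E (τ q) q := (hmemE _ _ _).2 ⟨h1, (hafter t ht).resolve_left htq,
            hp w hwA q hqA t h1 hwq h2 h6 h3 (Ne.symm htq)⟩
          rw [hEq] at this
          exact mem_of_mem_erase this
      have hEL := eq_of_subset_of_card_le hsub hc1
      have hzw' : ¬ G.Adj z w := fun hc => hwL ((hmemE _ _ _).2 ⟨hwA, hzw, hc⟩)
      obtain ⟨l, hl1, hl2, hl3, hl4⟩ := hmax w hwA hzw hzw'
      have : l ∈ E (τ w) w := hEL ▸ (hmemE _ _ _).2 ⟨hl1, hl2, hl3⟩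
      exact hl4 ((hmemE _ _ _).1 this).2.2.symm
    · have hsub : E (τ w) w ⊆ E (τ q) w := fun t ht => by
        obtain ⟨h1, h2, h3⟩ := (hmemE _ _ _).1 ht
        refine (hmemE _ _ _).2 ⟨h1, (hafter t ht).resolve_left ?_, h3⟩
        rintro rfl
        exact hqw ht
      have := (card_le_card hsub).trans (hcount q hqA w hwA hwq.le)
      omega
  have hmq : m = q := h.injOn hm hqA (le_antisymm (hlast q hqA hzq) (hqlast m hm hzm))
  subst hmq
  refine ⟨hzqadj, fun t ht hzt htm => ?_⟩
  have hmt : τ m < τ t := (hlast t ht hzt).lt_of_ne fun e => htm (h.injOn ht hm e.symm)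
  have h1 : t ∈ L ↔ G.Adj z t := by rw [hmemE]; tauto
  have h2 : t ∈ E (τ m) m ↔ G.Adj m t := by rw [hmemE]; tauto
  rw [← h1, ← h2, hEq, mem_erase]
  tauto

/-- The vertex `c`, adjacent exactly to the two ends, closes the path to an induced cycle of length
`k + 2 ≥ 4`. -/
theorem IsInducedPath.isHole {A : Finset V} {p : ℕ → V} {k : ℕ} (h : IsInducedPath G A p k)
    (hk : 2 ≤ k) {c : V} (hne : ∀ i ≤ k, p i ≠ c)
    (hadj : ∀ i ≤ k, G.Adj (p i) c ↔ i = 0 ∨ i = k) :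
    IsHole G (insert c ((range (k + 1)).image p)) := by
  refine ⟨insert_nonempty _ _, fun v hv => ?_⟩
  have hmem : ∀ i ≤ k, p i ∈ insert c ((range (k + 1)).image p) := fun i hi =>
    mem_insert_of_mem (mem_image.2 ⟨i, by simpa using Nat.lt_succ_of_le hi, rfl⟩)
  have hall : ∀ (Q : V → Prop), (∀ i ≤ k, Q (p i)) → Q c →
      ∀ w ∈ insert c ((range (k + 1)).image p), Q w := by
    intro Q h1 h2 w hw
    rcases mem_insert.1 hw with rfl | hw
    · exact h2
    · obtain ⟨i, hi, rfl⟩ := mem_image.1 hw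
      exact h1 i (by simpa [Nat.lt_succ_iff] using hi)
  have hpp : ∀ i ≤ k, ∀ j ≤ k, p i = p j ↔ i = j := fun i hi j hj =>
    ⟨h.inj i hi j hj, fun e => by rw [e]⟩
  have hpc : ∀ i ≤ k, (p i = c) = False := fun i hi => eq_false (hne i hi)
  have hcp : ∀ i ≤ k, (c = p i) = False := fun i hi => eq_false (hne i hi).symm
  rcases mem_insert.1 hv with rfl | hv
  · refine ⟨p 0, hmem 0 (by omega), p k, hmem k le_rfl, ?_, ?_, hall _ (fun i hi => ?_) ?_⟩
    · rw [Ne, hpp 0 (by omega) k le_rfl]; omega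
    · rw [h.adj 0 (by omega) k le_rfl]; omega
    · rw [G.adj_comm, hadj i hi, hpp i hi 0 (by omega), hpp i hi k le_rfl]
    · simp [hcp 0 (by omega), hcp k le_rfl]
  obtain ⟨i, hi, rfl⟩ := mem_image.1 hv
  have hi : i ≤ k := by simpa [Nat.lt_succ_iff] using hi
  rcases Nat.eq_zero_or_pos i with rfl | h0
  · refine ⟨p 1, hmem 1 (by omega), c, mem_insert_self _ _, hne 1 (by omega), ?_,
      hall _ (fun j hj => ?_) ?_⟩
    · rw [hadj 1 (by omega)]; omega
    · rw [h.adj 0 (by omega) j hj, hpp j hj 1 (by omega), hpc j hj, or_false]; omega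
    · rw [hadj 0 hi]; simp
  rcases hi.eq_or_lt with rfl | hlt
  · refine ⟨p (i - 1), hmem _ (by omega), c, mem_insert_self _ _, hne _ (by omega), ?_,
      hall _ (fun j hj => ?_) ?_⟩
    · rw [hadj _ (by omega)]; omega
    · rw [h.adj i hi j hj, hpp j hj _ (by omega), hpc j hj, or_false]; omega
    · rw [hadj i hi]; simp
  · refine ⟨p (i - 1), hmem _ (by omega), p (i + 1), hmem _ (by omega), ?_, ?_,
      hall _ (fun j hj => ?_) ?_⟩
    · rw [Ne, hpp _ (by omega) _ (by omega)]; omega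
    · rw [h.adj _ (by omega) _ (by omega)]; omega
    · rw [h.adj i hi j hj, hpp j hj _ (by omega), hpp j hj _ (by omega)]; omega
    · rw [hadj i hi, hcp _ (by omega), hcp _ (by omega), or_false, iff_false]; omega

/-- A maximum cardinality search with an induced path whose inner vertices come after its ends
finds a hole. -/
theorem IsMCS.exists_isHole_of_path {A : Finset V} {τ : V → ℤ} (h : IsMCS G A A τ) (N : ℕ) :
    ∀ (p : ℕ → V) (k : ℕ), IsInducedPath G A p k → 2 ≤ k → τ (p k) < τ (p 0) →
      (∀ i, 0 < i → i < k → τ (p i) < τ (p k)) → (A.filter fun u => τ (p k) < τ u).card = N →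
      ∃ T ⊆ A, IsHole G T := by
  classical
  induction N using Nat.strong_induction_on with
  | _ N ih =>
    intro p k hp hk hends hint hN
    -- When `p k` was preferred to `p 1`, the latter already saw `p 0`, which `p k` does not see. So
    -- `p k` must see some visited vertex that `p 1` does not.
    obtain ⟨c, hcA, hτc, hkc, h1c⟩ : ∃ c ∈ A, τ (p k) < τ c ∧ G.Adj (p k) c ∧ ¬ G.Adj (p 1) c := by
      by_contra! hcon
      have hcount := h.count_le (p k) (hp.mem k le_rfl) (p 1) (hp.mem 1 (by omega))
        (Or.inr (hint 1 one_pos (by omega)).le)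
      refine hcount.not_gt (card_lt_card ?_)
      refine ⟨fun u hu => ?_, fun hsub => ?_⟩
      · rw [mem_filter] at hu ⊢
        exact ⟨hu.1, hu.2.1, hcon u hu.1 hu.2.1 hu.2.2⟩
      · have h0 : p 0 ∈ A.filter fun u => τ (p k) < τ u ∧ G.Adj (p 1) u :=
          mem_filter.2 ⟨hp.mem 0 (by omega), hends, (hp.adj 1 (by omega) 0 (by omega)).2 (by omega)⟩
        have := (mem_filter.1 (hsub h0)).2.2
        rw [hp.adj k le_rfl 0 (by omega)] at this
        omega
    have hne : ∀ i ≤ k, p i ≠ c := by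
      rintro i hi rfl
      rcases Nat.eq_zero_or_pos i with rfl | h0
      · rw [hp.adj k le_rfl 0 hi] at hkc; omega
      · rcases hi.eq_or_lt with rfl | hlt
        · exact lt_irrefl _ hτc
        · exact (hint i h0 hlt).not_gt hτc
    -- The first inner or final vertex adjacent to `c` cuts off a shorter induced path from `p 0`.
    -- Its index is at least `2` by the choice of `c`.
    have hex : ∃ i, 1 ≤ i ∧ G.Adj (p i) c := ⟨k, by omega, hkc⟩
    set i := Nat.find hex with hi
    obtain ⟨hi1, hic⟩ := Nat.find_spec hex
    rw [← hi] at hi1 hic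
    have hmin : ∀ j, 1 ≤ j → j < i → ¬ G.Adj (p j) c := fun j hj hji hc =>
      Nat.find_min hex hji ⟨hj, hc⟩
    have hik : i ≤ k := Nat.find_min' hex ⟨by omega, hkc⟩
    have hi2 : 2 ≤ i := by
      by_contra! hlt
      have : i = 1 := by omega
      rw [this] at hic
      exact h1c hic
    have hpi := hp.mono hik
    have hτi : ∀ j, 1 ≤ j → j ≤ i → τ (p j) ≤ τ (p k) := fun j hj hji => by
      rcases (hji.trans hik).eq_or_lt with rfl | hlt
      · exact le_rfl
      · exact (hint j hj hlt).le
    by_cases h0c : G.Adj (p 0) c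
    · refine ⟨_, ?_, hpi.isHole hi2 (fun j hj => hne j (hj.trans hik)) fun j hj => ?_⟩
      · refine insert_subset hcA fun v hv => ?_
        obtain ⟨j, hj, rfl⟩ := mem_image.1 hv
        exact hpi.mem j (by simpa [Nat.lt_succ_iff] using hj)
      · constructor
        · intro hjc
          by_contra! hcon
          exact hmin j (by omega) (by omega) hjc
        · rintro (rfl | rfl)
          exacts [h0c, hic]
    have hsn := hpi.snoc hcA (fun j hj => hne j (hj.trans hik)) fun j hj => by
      constructor
      · intro hjc
        by_contra! hcon
        rcases Nat.eq_zero_or_pos j with rfl | h0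
        · exact h0c hjc
        · exact hmin j h0 (by omega) hjc
      · rintro rfl
        exact hic
    have hlt : ∀ x ∈ A, τ (p k) < τ x →
        (A.filter fun u => τ x < τ u).card < N := fun x hx hkx => by
      rw [← hN]
      refine card_lt_card ⟨fun u hu => ?_, fun hsub => ?_⟩
      · rw [mem_filter] at hu ⊢
        exact ⟨hu.1, hkx.trans hu.2⟩
      · exact lt_irrefl _ (mem_filter.1 (hsub (mem_filter.2 ⟨hx, hkx⟩))).2
    have hτ0c : τ (p 0) ≠ τ c := fun e =>
      hne 0 (by omega) (h.injOn (hp.mem 0 (by omega)) hcA e)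
    -- The path from `p 0` through `p i` to `c` satisfies the hypotheses again, reversed if `p 0` is
    -- visited after `c`. Both of its ends precede `p k` in the search, so fewer vertices precede
    -- its later end.
    rcases lt_or_gt_of_ne hτ0c with hlt0 | hlt0
    · refine ih _ (hlt _ (hp.mem 0 (by omega)) hends) _ _ hsn.reverse (by omega) ?_ ?_ (by simp)
      · simpa using hlt0
      · intro j hj1 hj2
        simp only [Nat.sub_self, Nat.zero_le, if_true]
        rw [if_pos (by omega)]
        exact (hτi _ (by omega) (by omega)).trans_lt hends
    · refine ih _ (hlt _ hcA hτc) _ _ hsn (by omega) ?_ ?_ (by simp)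
      · simpa using hlt0
      · intro j hj1 hj2
        simp only [if_pos (show j ≤ i by omega)]
        rw [if_neg (by omega)]
        exact (hτi _ (by omega) (by omega)).trans_lt hτc

/-- A violation of perfectness is an induced path with the last visited vertex in the middle, the
starting point for `IsMCS.exists_isHole_of_path`. -/
theorem IsMCS.exists_isHole {A : Finset V} {τ : V → ℤ} (h : IsMCS G A A τ)
    (hp : ¬ IsPerfectOrder G A τ) : ∃ T ⊆ A, IsHole G T := by
  unfold IsPerfectOrder at hp
  push Not at hp
  obtain ⟨z, hz, a, ha, b, hb, hza, hzb, hzadj, hzbdj, hab, hnab⟩ := hp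
  wlog hlt : τ b < τ a generalizing a b
  · exact this b hb a ha hzb hza hzbdj hzadj hab.symm (fun h => hnab h.symm)
      ((not_lt.1 hlt).lt_of_ne fun e => hab (h.injOn ha hb e))
  refine h.exists_isHole_of_path _ (fun i => if i = 0 then a else if i = 1 then z else b) 2
    ⟨?_, ?_, ?_⟩ le_rfl (by simpa using hlt) ?_ rfl
  · intro i hi
    split_ifs <;> assumption
  · have h1 := hzadj.ne
    have h2 := hzbdj.ne
    intro i hi j hj
    interval_cases i <;> interval_cases j <;> simp [hab, hab.symm, h1, h1.symm, h2, h2.symm]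
  · intro i hi j hj
    have hnba : ¬ G.Adj b a := fun h => hnab h.symm
    interval_cases i <;> interval_cases j <;>
      simp [hzadj, hzadj.symm, hzbdj, hzbdj.symm, hnab, hnba]
  · intro i h1 h2
    interval_cases i
    simpa using hzb

end MaximumCardinalitySearch

/-! ### Splitting classes, and existence of good cost functions. -/

section Split

variable {V : Type*} {G : SimpleGraph V}

/-- `cls'` arises from the classes `cls` of `B` by splitting them according to adjacency with `z`,
where `N` consists of the new representatives. -/
structure IsSplit (G : SimpleGraph V) (B : Finset V) (cls : V → V) (z : V) (cls' : V → V)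
    (N : Finset V) : Prop where
  mem_iff : ∀ v, v ∈ N ↔ v ∈ B ∧ ¬ (G.Adj z v ↔ G.Adj z (cls v)) ∧ cls' v = v
  good : ∀ v ∈ B, (G.Adj z v ↔ G.Adj z (cls v)) → cls' v = cls v
  bad : ∀ v ∈ B, ¬ (G.Adj z v ↔ G.Adj z (cls v)) →
    cls' v ∈ B ∧ cls (cls' v) = cls v ∧ (G.Adj z (cls' v) ↔ G.Adj z v)
  eq : ∀ u ∈ B, ∀ v ∈ B, ¬ (G.Adj z u ↔ G.Adj z (cls u)) → ¬ (G.Adj z v ↔ G.Adj z (cls v)) →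
    cls u = cls v → cls' u = cls' v

theorem IsSplit.congr {B N : Finset V} {cls cls' cls'' : V → V} {z : V}
    (h : IsSplit G B cls z cls' N) (he : ∀ v ∈ B, cls'' v = cls' v) :
    IsSplit G B cls z cls'' N where
  mem_iff v := by
    rw [h.mem_iff]
    constructor
    · rintro ⟨h1, h2, h3⟩
      exact ⟨h1, h2, (he v h1).trans h3⟩
    · rintro ⟨h1, h2, h3⟩
      exact ⟨h1, h2, (he v h1).symm.trans h3⟩
  good v hv hg := (he v hv).trans (h.good v hv hg)
  bad v hv hb := by rw [he v hv]; exact h.bad v hv hb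
  eq u hu v hv h1 h2 h3 := by rw [he u hu, he v hv]; exact h.eq u hu v hv h1 h2 h3

end Split

section ExistsGood

variable {V : Type*} [DecidableEq V] {G : SimpleGraph V}

/-- The new representative is chosen by a predicate that depends on `v` only through its class, so
that members of the same part receive the same one. -/
theorem exists_isSplit (G : SimpleGraph V) (B : Finset V) (cls : V → V) (z : V) :
    ∃ cls' N, IsSplit G B cls z cls' N := by
  classical
  set Q : V → V → Prop := fun v u => u ∈ B ∧ cls u = cls v ∧ ¬ (G.Adj z u ↔ G.Adj z (cls u))
    with hQ
  have : Nonempty V := ⟨z⟩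
  have hQv : ∀ v ∈ B, ¬ (G.Adj z v ↔ G.Adj z (cls v)) → Q v (Classical.epsilon (Q v)) :=
    fun v hv hb => Classical.epsilon_spec (p := Q v) ⟨v, hv, rfl, hb⟩
  set cls' : V → V := fun v =>
    if G.Adj z v ↔ G.Adj z (cls v) then cls v else Classical.epsilon (Q v) with hcls'
  have hbad : ∀ v, ¬ (G.Adj z v ↔ G.Adj z (cls v)) → cls' v = Classical.epsilon (Q v) :=
    fun v hb => if_neg hb
  refine ⟨cls', B.filter fun v => ¬ (G.Adj z v ↔ G.Adj z (cls v)) ∧ cls' v = v,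
    fun v => mem_filter, fun v _ hg => if_pos hg, fun v hv hb => ?_, fun u _ v _ hu hv huv => ?_⟩
  · obtain ⟨h1, h2, h3⟩ := hQv v hv hb
    rw [hbad v hb]
    refine ⟨h1, h2, ?_⟩
    rw [h2] at h3
    tauto
  · rw [hbad u hu, hbad v hv]
    simp only [hQ, huv]

namespace TwinWeights

/-- Handle the next vertex of a perfect maximum cardinality search of the neighbourhood. -/
theorem mcsStep {v₀ z m : V} {A B N : Finset V} {τ : V → ℤ} {cls cls' : V → V} {d d' : V → ℤ}
    (h : TwinWeights G v₀ B cls d) (hA : ∀ a ∈ A, G.Adj v₀ a) (hmcs : IsMCS G A A τ)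
    (hp : IsPerfectOrder G A τ) (hz : z ∈ A) (hB : ∀ u, u ∈ B ↔ u = v₀ ∨ u ∈ A ∧ τ z < τ u)
    (hm : (m = v₀ ∧ ∀ u ∈ A, ¬ τ z < τ u) ∨
      (m ∈ A ∧ τ z < τ m ∧ ∀ u ∈ A, τ z < τ u → τ m ≤ τ u))
    (hs : IsSplit G B cls z cls' N)
    (hcase :
      (1 ≤ N.card ∧ cls' z = z ∧ d' z = N.card ∧ ∀ v ∈ B, d' v = d v) ∨
      (N.card = 0 ∧ (G.Adj z m ∧ ∀ t ∈ B, t ≠ m → (G.Adj z t ↔ G.Adj m t)) ∧ cls' z = cls m ∧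
        d' z = 1 ∧ ∀ v ∈ B, d' v = d v) ∨
      (N.card = 0 ∧ ¬ (G.Adj z m ∧ ∀ t ∈ B, t ≠ m → (G.Adj z t ↔ G.Adj m t)) ∧ cls' z = z ∧
        d' z = 1 ∧ d' v₀ = d v₀ + 1 ∧ ∀ v ∈ B, v ≠ v₀ → d' v = d v)) :
    TwinWeights G v₀ (insert z B) cls' d' := by
  have hv₀A : v₀ ∉ A := fun hc => (hA v₀ hc).ne rfl
  have hzB : z ∉ B := by
    rw [hB]
    rintro (rfl | hc)
    exacts [hv₀A hz, lt_irrefl _ hc.2]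
  -- If some class were split, the chosen representative of the part split off would be an element
  -- of `N`.
  have hhom : N.card = 0 → ∀ v ∈ B, (G.Adj z v ↔ G.Adj z (cls v)) := by
    intro hN v hv
    by_contra hb
    obtain ⟨h1, h2, h3⟩ := hs.bad v hv hb
    have hb' : ¬ (G.Adj z (cls' v) ↔ G.Adj z (cls (cls' v))) := by rwa [h2, h3]
    have := (hs.mem_iff (cls' v)).2 ⟨h1, hb', hs.eq _ h1 v hv hb' hb h2⟩
    rw [card_eq_zero.1 hN] at this
    simp at this
  rcases hcase with ⟨hN, hcz, hdz, hd⟩ | ⟨hN, ⟨hzm, htw⟩, hcz, hdz, hd⟩ |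
    ⟨hN, htw, hcz, hdz, hd0, hd⟩
  · exact h.split hzB N hs.mem_iff hcz hs.good hs.bad hs.eq hdz hd fun _ => by
      rw [hdz]; exact_mod_cast hN
  · have hmB : m ∈ B := by
      rw [hB]
      rcases hm with hm | hm
      exacts [Or.inl hm.1, Or.inr ⟨hm.1, hm.2.1⟩]
    refine h.addTwin hzB (hA z hz) hmB ?_ hzm htw hcz
      (fun v hv => hs.good v hv (hhom hN v hv)) hdz hd
    rcases hm with hm | hm
    exacts [Or.inl hm.1, Or.inr (hA m hm.1)]
  -- If no such `t` existed, the earlier neighbours of `z` would form a maximal clique, and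
  -- `IsMCS.twin_of_maximal` would make `z` a twin of `m`. For the first vertex of the search, `m =
  -- v₀` is a twin anyway.
  · obtain ⟨t, ht, hzt, htl⟩ : ∃ t ∈ A, τ z < τ t ∧ ¬ G.Adj z t ∧
        ∀ l ∈ A, τ z < τ l → G.Adj z l → G.Adj l t := by
      by_contra! hcon
      refine htw ?_
      rcases hm with ⟨rfl, hm⟩ | ⟨hm, hzm, hlast⟩
      · refine ⟨(hA z hz).symm, fun t ht htm => ?_⟩
        rcases (hB t).1 ht with rfl | ⟨ht, hzt⟩
        exacts [absurd rfl htm, absurd hzt (hm t ht)]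
      · obtain ⟨h1, h2⟩ := hmcs.twin_of_maximal hp hz hcon hm hzm hlast
        refine ⟨h1, fun t ht htm => ?_⟩
        rcases (hB t).1 ht with rfl | ⟨ht, hzt⟩
        · exact iff_of_true (hA z hz).symm (hA m hm).symm
        · exact h2 t ht hzt htm
    refine h.addFree hzB (hA z hz) ?_ (hhom hN) ?_ ((hB t).2 (Or.inr ⟨ht, hzt⟩)) htl.1 ?_ hcz
      (fun v hv => hs.good v hv (hhom hN v hv)) hdz hd0 hd
    · intro v hv
      rcases (hB v).1 hv with hv | hv
      exacts [Or.inl hv, Or.inr (hA v hv.1)]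
    · intro u hu v hv hzu hzv huv
      rcases (hB u).1 hu with rfl | hu
      · rcases (hB v).1 hv with rfl | hv
        exacts [absurd rfl huv, hA v hv.1]
      · rcases (hB v).1 hv with rfl | hv
        · exact (hA u hu.1).symm
        · exact hp z hz u hu.1 v hv.1 hu.2 hv.2 hzu hzv huv
    · intro l hl hzl
      rcases (hB l).1 hl with rfl | hl
      exacts [hA t ht, htl.2 l hl.1 hl.2 hzl]

/-- Handle a vertex outside of the closed neighbourhood. -/
theorem outerStep {v₀ z : V} {B N : Finset V} {cls cls' : V → V} {d d' : V → ℤ}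
    (h : TwinWeights G v₀ B cls d) (hzB : z ∉ B) (hz : ¬ G.Adj v₀ z)
    (hs : IsSplit G B cls z cls' N) (hcz : cls' z = z) (hdz : d' z = N.card)
    (hd : ∀ v ∈ B, d' v = d v) : TwinWeights G v₀ (insert z B) cls' d' :=
  h.split hzB N hs.mem_iff hcz hs.good hs.bad hs.eq hdz hd fun hc => absurd hc hz

end TwinWeights

/-- A graph without true twins that is not a cluster graph has a `2`-good cost function. -/
theorem exists_isGoodIn {S : Finset V} (hS : ¬ ClusterOn G S)
    (htw : ∀ u u', ¬ AreTrueTwins G S u u') : ∃ T d, IsGoodIn 2 G S T d := by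
  classical
  obtain ⟨v₀, hv₀⟩ : S.Nonempty := by
    by_contra hne
    rw [not_nonempty_iff_eq_empty] at hne
    subst hne
    exact hS fun u hu => by simp at hu
  set A := S.filter fun v => G.Adj v₀ v with hAdef
  have hA : ∀ a ∈ A, G.Adj v₀ a := fun a ha => (mem_filter.1 ha).2
  have hAS : A ⊆ S := filter_subset _ _
  have hv₀A : v₀ ∉ A := fun hc => (hA v₀ hc).ne rfl
  obtain ⟨τ, hmcs⟩ := exists_isMCS G A
  by_cases hp : IsPerfectOrder G A τ
  -- The sets `P` are the initial segments of the search order; the vertex of least stamp is the one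
  -- inserted last.
  · have phase1 : ∀ k, ∀ P ⊆ A, P.card = k → (∀ u ∈ P, ∀ w ∈ A, τ u < τ w → w ∈ P) →
        ∃ cls d, TwinWeights G v₀ (insert v₀ P) cls d := by
      intro k
      induction k with
      | zero =>
        intro P _ hc _
        rw [card_eq_zero.1 hc]
        exact ⟨id, fun _ => 1, TwinWeights.center v₀⟩
      | succ k ih =>
        intro P hPA hc hup
        obtain ⟨z, hz, hmin⟩ := exists_min_image P τ (card_pos.1 (by omega))
        have hlt : ∀ u ∈ P, u ≠ z → τ z < τ u := fun u hu hne =>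
          (hmin u hu).lt_of_ne fun e => hne (hmcs.injOn (hPA hu) (hPA hz) e.symm)
        obtain ⟨cls, d, h⟩ := ih (P.erase z) ((erase_subset _ _).trans hPA)
          (by rw [card_erase_of_mem hz, hc]; rfl) fun u hu w hw huw => by
            have hu' := mem_of_mem_erase hu
            refine mem_erase.2 ⟨?_, hup u hu' w hw huw⟩
            rintro rfl
            exact (hmin u hu').not_gt huw
        have hB : ∀ u, u ∈ insert v₀ (P.erase z) ↔ u = v₀ ∨ u ∈ A ∧ τ z < τ u := by
          intro u
          rw [mem_insert, mem_erase]
          refine or_congr_right ⟨fun hu => ⟨hPA hu.2, hlt u hu.2 hu.1⟩, fun hu => ⟨?_, ?_⟩⟩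
          · rintro rfl
            exact lt_irrefl _ hu.2
          · exact hup z hz u hu.1 hu.2
        have hzB : z ∉ insert v₀ (P.erase z) := by
          rw [hB]
          rintro (rfl | hc)
          exacts [hv₀A (hPA hz), lt_irrefl _ hc.2]
        obtain ⟨m, hm⟩ : ∃ m, (m = v₀ ∧ ∀ u ∈ A, ¬ τ z < τ u) ∨
            (m ∈ A ∧ τ z < τ m ∧ ∀ u ∈ A, τ z < τ u → τ m ≤ τ u) := by
          by_cases hne : (A.filter fun u => τ z < τ u).Nonempty
          · obtain ⟨m, hm, hmin⟩ := exists_min_image _ τ hne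
            rw [mem_filter] at hm
            exact ⟨m, Or.inr ⟨hm.1, hm.2, fun u hu hzu => hmin u (mem_filter.2 ⟨hu, hzu⟩)⟩⟩
          · refine ⟨v₀, Or.inl ⟨rfl, fun u hu hzu => hne ⟨u, mem_filter.2 ⟨hu, hzu⟩⟩⟩⟩
        obtain ⟨cls', N, hs⟩ := exists_isSplit G (insert v₀ (P.erase z)) cls z
        have hins : insert v₀ P = insert z (insert v₀ (P.erase z)) := by
          rw [insert_comm, insert_erase hz]
        have hoffV : ∀ (f : V → V) (x : V), ∀ v ∈ insert v₀ (P.erase z),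
            Function.update f z x v = f v := fun f x v hv =>
          Function.update_of_ne (ne_of_mem_of_not_mem hv hzB) _ _
        have hoff : ∀ (f : V → ℤ) (x : ℤ), ∀ v ∈ insert v₀ (P.erase z),
            Function.update f z x v = f v := fun f x v hv =>
          Function.update_of_ne (ne_of_mem_of_not_mem hv hzB) _ _
        have key := fun (x : V) (d' : V → ℤ) =>
          h.mcsStep (d' := d') hA hmcs hp (hPA hz) hB hm (hs.congr (hoffV cls' x))
        rw [hins]
        by_cases hN : 1 ≤ N.card
        · exact ⟨_, _, key z (Function.update d z N.card)
            (Or.inl ⟨hN, by simp, by simp, hoff _ _⟩)⟩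
        have hN0 : N.card = 0 := by omega
        by_cases ht : G.Adj z m ∧ ∀ t ∈ insert v₀ (P.erase z), t ≠ m → (G.Adj z t ↔ G.Adj m t)
        · exact ⟨_, _, key (cls m) (Function.update d z 1)
            (Or.inr (Or.inl ⟨hN0, ht, by simp, by simp, hoff _ _⟩))⟩
        · have hne : z ≠ v₀ := fun e => hv₀A (e ▸ hPA hz)
          refine ⟨_, _, key z (Function.update (Function.update d v₀ (d v₀ + 1)) z 1)
            (Or.inr (Or.inr ⟨hN0, ht, by simp, by simp, ?_, fun v hv hv0 => ?_⟩))⟩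
          · rw [Function.update_of_ne hne.symm, Function.update_self]
          · rw [hoff _ _ v hv, Function.update_of_ne hv0]
    obtain ⟨cls, d, h⟩ := phase1 _ A Subset.rfl rfl fun _ _ w hw _ => hw
    -- Vertices outside the closed neighbourhood may be inserted in any order: they need no positive
    -- weight, so splitting no class does no harm.
    have phase2 : ∀ Q : Finset V, Q ⊆ S \ insert v₀ A →
        ∃ cls d, TwinWeights G v₀ (Q ∪ insert v₀ A) cls d := by
      intro Q
      induction Q using Finset.induction_on with
      | empty => exact fun _ => ⟨cls, d, by rwa [empty_union]⟩
      | insert z Q hz ih =>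
        intro hQ
        obtain ⟨cls, d, h⟩ := ih ((subset_insert _ _).trans hQ)
        have hzS := mem_sdiff.1 (hQ (mem_insert_self z Q))
        have hzB : z ∉ Q ∪ insert v₀ A := by
          rw [mem_union]
          rintro (hc | hc)
          exacts [hz hc, hzS.2 hc]
        have hzv : ¬ G.Adj v₀ z := fun hc =>
          hzS.2 (mem_insert_of_mem (mem_filter.2 ⟨hzS.1, hc⟩))
        obtain ⟨cls', N, hs⟩ := exists_isSplit G (Q ∪ insert v₀ A) cls z
        refine ⟨Function.update cls' z z, Function.update d z N.card, ?_⟩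
        rw [insert_union]
        exact h.outerStep hzB hzv (hs.congr fun v hv =>
          Function.update_of_ne (ne_of_mem_of_not_mem hv hzB) _ _) (by simp) (by simp)
          fun v hv => Function.update_of_ne (ne_of_mem_of_not_mem hv hzB) _ _
    obtain ⟨cls, d, h⟩ := phase2 _ Subset.rfl
    rw [sdiff_union_of_subset (insert_subset hv₀ hAS)] at h
    exact ⟨_, _, h.isGoodIn htw⟩
  · obtain ⟨T, hT, hhole⟩ := hmcs.exists_isHole hp
    have hv₀T : v₀ ∉ T := fun hc => hv₀A (hT hc)
    refine ⟨S, _, hhole.isGoodIn (d := fun v => if v ∈ T then 1 else if v = v₀ then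
      (T.card : ℤ) - 4 else 0) hv₀ (hT.trans hAS) (fun v hv => hA v (hT hv)) ?_ ?_ ?_⟩
    · intro v hv; simp [hv]
    · simp [hv₀T]
    · intro v _ h1 h2; simp [h1, h2]

end ExistsGood

/-- The local-ratio algorithm always has a run, and all its runs are correct. -/
theorem localRatio_exists_and_correct (V : Type*) [Fintype V] [DecidableEq V]
    (G : SimpleGraph V) (c : V → ℚ) (hc : ∀ v, 0 ≤ c v) :
    (∃ X : Finset V, LocalRatio G Finset.univ c X) ∧
      ∀ X : Finset V, LocalRatio G Finset.univ c X →
        IsMinimalHittingSet G Finset.univ X ∧ cost c X ≤ 2 * OPT G Finset.univ c :=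
  ⟨exists_localRatio (fun _ h1 h2 => exists_isGoodIn h1 h2) _ c fun v _ => hc v,
    fun _ hX => hX.correct fun v _ => hc v⟩

/-! ## Reasoning about programs -/

theorem iterDown_induction {α : Type*} {f : ℕ → α → α} (I : ℕ → α → Prop) (n : ℕ) {s : α}
    (hs : I n s) (hstep : ∀ m < n, ∀ s, I (m + 1) s → I m (f m s)) : I 0 (iterDown f n s) := by
  induction n generalizing s with
  | zero => exact hs
  | succ n ih => exact ih (hstep n (by omega) s hs) fun m hm => hstep m (by omega)

/-- The variables that a statement may change. -/
def HStmt.regs : HStmt → List ℕ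
  | .assign v _ => [v]
  | .seq p q => p.regs ++ q.regs
  | .ite _ p q => p.regs ++ q.regs
  | .iter i p => i :: p.regs
  | _ => []

/-- The arrays that a statement may change. -/
def HStmt.arrs : HStmt → List ℕ
  | .store k _ _ => [k]
  | .map k _ _ => [k]
  | .seq p q => p.arrs ++ q.arrs
  | .ite _ p q => p.arrs ++ q.arrs
  | .iter _ p => p.arrs
  | _ => []

/-- A frame rule: the lists of written variables and arrays are computable, so its side condition
can be decided for concrete programs. -/
theorem HStmt.run_reg_of_notMem {n v : ℕ} (p : HStmt) (hv : v ∉ p.regs) (σ : RAMState) :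
    (p.run n σ).reg v = σ.reg v := by
  induction p generalizing σ with
  | skip | store | map => rfl
  | assign w e =>
    rw [HStmt.regs, List.mem_singleton] at hv
    simp [HStmt.run, RAMState.setReg, Function.update_of_ne hv]
  | seq p q hp hq =>
    simp only [HStmt.regs, List.mem_append, not_or] at hv
    rw [HStmt.run, hq hv.2, hp hv.1]
  | ite c p q hp hq =>
    simp only [HStmt.regs, List.mem_append, not_or] at hv
    rw [HStmt.run]
    split
    exacts [hp hv.1 σ, hq hv.2 σ]
  | iter i p hp =>
    simp only [HStmt.regs, List.mem_cons, not_or] at hv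
    refine iterDown_induction (fun _ (s : RAMState) => s.reg v = σ.reg v) n rfl fun m _ s hs => ?_
    rw [hp hv.2, ← hs]
    simp [RAMState.setReg, Function.update_of_ne hv.1]

theorem HStmt.run_arr_of_notMem {n k : ℕ} (p : HStmt) (hk : k ∉ p.arrs) (σ : RAMState) :
    (p.run n σ).arr k = σ.arr k := by
  induction p generalizing σ with
  | skip | assign => rfl
  | store w a e | map w a e =>
    rw [HStmt.arrs, List.mem_singleton] at hk
    simp [HStmt.run, RAMState.setArr, Function.update_of_ne hk]
  | seq p q hp hq =>
    simp only [HStmt.arrs, List.mem_append, not_or] at hk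
    rw [HStmt.run, hq hk.2, hp hk.1]
  | ite c p q hp hq =>
    simp only [HStmt.arrs, List.mem_append, not_or] at hk
    rw [HStmt.run]
    split
    exacts [hp hk.1 σ, hq hk.2 σ]
  | iter i p hp =>
    refine iterDown_induction (fun _ (s : RAMState) => s.arr k = σ.arr k) n rfl fun m _ s hs => ?_
    rw [hp hk, ← hs]
    rfl

/-- The rule for loops, with an invariant indexed by the number of remaining iterations. -/
theorem HStmt.iter_induction {n i : ℕ} {p : HStmt} (I : ℕ → RAMState → Prop) {σ : RAMState}
    (h : I n σ) (hstep : ∀ m < n, ∀ s, I (m + 1) s → I m (p.run n (s.setReg i m))) :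
    I 0 ((HStmt.iter i p).run n σ) :=
  iterDown_induction I n h hstep

/-! ### Derived expressions; positive values stand for truth. -/

/-- Negation. -/
def HExpr.not (e : HExpr) : HExpr := .cond e (.const 0) (.const 1)

/-- Conjunction. -/
def HExpr.and (a b : HExpr) : HExpr := .cond a b (.const 0)

/-- Disjunction. -/
def HExpr.or (a b : HExpr) : HExpr := .cond a (.const 1) b

/-- Strict inequality. -/
def HExpr.lt (a b : HExpr) : HExpr := .sub b a

/-- Equality. -/
def HExpr.eq (a b : HExpr) : HExpr := .not (.or (.lt a b) (.lt b a))

/-- Equivalence. -/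
def HExpr.iff (a b : HExpr) : HExpr := .cond a b (.not b)

/-- Existential quantification. -/
def HExpr.any (l : ℕ) (e : HExpr) : HExpr := .sum l (.cond e (.const 1) (.const 0))

/-- Universal quantification. -/
def HExpr.all (l : ℕ) (e : HExpr) : HExpr := .not (.any l (.not e))

/-- The largest `i < n` that satisfies a condition, or `-1`. -/
def HExpr.find (l : ℕ) (e : HExpr) : HExpr :=
  .sub (.sup l (.cond e (.add (.bvar l) (.const 1)) (.const 0))) (.const 1)

/-- The product with a number between `0` and `n`. -/
def HExpr.times (l : ℕ) (e d : HExpr) : HExpr := .sum l (.cond (.lt (.bvar l) d) e (.const 0))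

/-- The entry of the adjacency matrix, when array `4` holds the starting points of the rows. -/
def HExpr.adj (u v : HExpr) : HExpr := .load 0 (.add (.load 4 u) v)

section Eval

variable {n : ℕ} {σ : RAMState} {ρ : ℕ → ℤ} {l k v : ℕ} {z : ℤ} {a b c e : HExpr}

@[simp] theorem HExpr.eval_size : HExpr.size.eval n σ ρ = n := rfl
@[simp] theorem HExpr.eval_var : (HExpr.var v).eval n σ ρ = σ.reg v := rfl
@[simp] theorem HExpr.eval_bvar : (HExpr.bvar l).eval n σ ρ = ρ l := rfl
@[simp] theorem HExpr.eval_const : (HExpr.const z).eval n σ ρ = z := rfl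
@[simp] theorem HExpr.eval_add :
    (HExpr.add a b).eval n σ ρ = a.eval n σ ρ + b.eval n σ ρ := rfl
@[simp] theorem HExpr.eval_sub :
    (HExpr.sub a b).eval n σ ρ = a.eval n σ ρ - b.eval n σ ρ := rfl
@[simp] theorem HExpr.eval_load :
    (HExpr.load k e).eval n σ ρ = σ.arr k (e.eval n σ ρ) := rfl
@[simp] theorem HExpr.eval_cond : (HExpr.cond c a b).eval n σ ρ =
    if 0 < c.eval n σ ρ then a.eval n σ ρ else b.eval n σ ρ := rfl
@[simp] theorem HExpr.eval_sum : (HExpr.sum l e).eval n σ ρ =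
    ∑ i : Fin n, e.eval n σ (Function.update ρ l ((i : ℕ) : ℤ)) := rfl

@[simp] theorem HExpr.eval_scale :
    (HExpr.scale e a).eval n σ ρ = e.eval n σ ρ * σ.arr 2 (a.eval n σ ρ) := rfl

theorem HExpr.eval_not : e.not.eval n σ ρ = if 0 < e.eval n σ ρ then 0 else 1 := rfl

@[simp] theorem HExpr.eval_not_pos : 0 < e.not.eval n σ ρ ↔ ¬ 0 < e.eval n σ ρ := by
  rw [HExpr.eval_not]; split <;> simp_all

@[simp] theorem HExpr.eval_and_pos :
    0 < (a.and b).eval n σ ρ ↔ 0 < a.eval n σ ρ ∧ 0 < b.eval n σ ρ := by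
  rw [HExpr.and, HExpr.eval_cond]; split <;> simp_all

@[simp] theorem HExpr.eval_or_pos :
    0 < (a.or b).eval n σ ρ ↔ 0 < a.eval n σ ρ ∨ 0 < b.eval n σ ρ := by
  rw [HExpr.or, HExpr.eval_cond]; split <;> simp_all

@[simp] theorem HExpr.eval_lt_pos :
    0 < (a.lt b).eval n σ ρ ↔ a.eval n σ ρ < b.eval n σ ρ := sub_pos

@[simp] theorem HExpr.eval_eq_pos :
    0 < (a.eq b).eval n σ ρ ↔ a.eval n σ ρ = b.eval n σ ρ := by
  rw [HExpr.eq, HExpr.eval_not_pos, HExpr.eval_or_pos, HExpr.eval_lt_pos, HExpr.eval_lt_pos]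
  omega

@[simp] theorem HExpr.eval_iff_pos :
    0 < (a.iff b).eval n σ ρ ↔ (0 < a.eval n σ ρ ↔ 0 < b.eval n σ ρ) := by
  rw [HExpr.iff, HExpr.eval_cond]
  split
  · simp [*]
  · rw [HExpr.eval_not_pos]; simp [*]

@[simp] theorem HExpr.eval_any_pos : 0 < (HExpr.any l e).eval n σ ρ ↔
    ∃ i : Fin n, 0 < e.eval n σ (Function.update ρ l ((i : ℕ) : ℤ)) := by
  rw [HExpr.any, HExpr.eval_sum]
  simp only [HExpr.eval_cond, HExpr.eval_const]
  rw [Finset.sum_boole, Nat.cast_pos, card_pos, filter_nonempty_iff]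
  simp

@[simp] theorem HExpr.eval_all_pos : 0 < (HExpr.all l e).eval n σ ρ ↔
    ∀ i : Fin n, 0 < e.eval n σ (Function.update ρ l ((i : ℕ) : ℤ)) := by
  rw [HExpr.all, HExpr.eval_not_pos, HExpr.eval_any_pos]
  simp only [HExpr.eval_not_pos, not_exists, not_not]

theorem HExpr.eval_sup_eq : (HExpr.sup l e).eval n σ ρ =
    ((Finset.univ.sup fun i : Fin n =>
      (e.eval n σ (Function.update ρ l ((i : ℕ) : ℤ))).toNat : ℕ) : ℤ) := rfl

theorem HExpr.le_eval_sup (i : Fin n) :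
    e.eval n σ (Function.update ρ l ((i : ℕ) : ℤ)) ≤ (HExpr.sup l e).eval n σ ρ := by
  rw [HExpr.eval_sup_eq]
  refine (Int.self_le_toNat _).trans (Int.ofNat_le.2 ?_)
  exact Finset.le_sup (f := fun i : Fin n =>
    (e.eval n σ (Function.update ρ l ((i : ℕ) : ℤ))).toNat) (mem_univ i)

theorem HExpr.eval_sup_nonneg : 0 ≤ (HExpr.sup l e).eval n σ ρ := by
  rw [HExpr.eval_sup_eq]; positivity

theorem HExpr.exists_eval_sup (h : 0 < (HExpr.sup l e).eval n σ ρ) : ∃ i : Fin n,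
    (HExpr.sup l e).eval n σ ρ = e.eval n σ (Function.update ρ l ((i : ℕ) : ℤ)) := by
  have hne : (univ : Finset (Fin n)).Nonempty := by
    rw [univ_nonempty_iff]
    by_contra hcon
    rw [not_nonempty_iff] at hcon
    simp [HExpr.eval_sup_eq] at h
  obtain ⟨i, -, hi⟩ := Finset.exists_mem_eq_sup univ hne fun i : Fin n =>
    (e.eval n σ (Function.update ρ l ((i : ℕ) : ℤ))).toNat
  refine ⟨i, ?_⟩
  rw [HExpr.eval_sup_eq, hi] at h ⊢
  exact Int.toNat_of_nonneg (by omega)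

theorem HExpr.eval_find_cases (n : ℕ) (σ : RAMState) (ρ : ℕ → ℤ) (l : ℕ) (e : HExpr) :
    (∃ i : Fin n, (HExpr.find l e).eval n σ ρ = ((i : ℕ) : ℤ) ∧
      0 < e.eval n σ (Function.update ρ l ((i : ℕ) : ℤ))) ∨
    ((HExpr.find l e).eval n σ ρ = -1 ∧
      ∀ i : Fin n, ¬ 0 < e.eval n σ (Function.update ρ l ((i : ℕ) : ℤ))) := by
  set e' : HExpr := .cond e (.add (.bvar l) (.const 1)) (.const 0) with he'
  have hval : ∀ i : Fin n, e'.eval n σ (Function.update ρ l ((i : ℕ) : ℤ)) =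
      if 0 < e.eval n σ (Function.update ρ l ((i : ℕ) : ℤ)) then ((i : ℕ) : ℤ) + 1 else 0 :=
    fun i => by simp [he']
  rcases (HExpr.eval_sup_nonneg (n := n) (σ := σ) (ρ := ρ) (l := l) (e := e')).eq_or_lt with h | h
  · refine Or.inr ⟨?_, fun i hi => ?_⟩
    · rw [HExpr.find, HExpr.eval_sub, ← he', ← h]; rfl
    · have := HExpr.le_eval_sup (n := n) (σ := σ) (ρ := ρ) (l := l) (e := e') i
      rw [hval, if_pos hi] at this
      omega
  · obtain ⟨i, hi⟩ := HExpr.exists_eval_sup h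
    have hpos : 0 < e.eval n σ (Function.update ρ l ((i : ℕ) : ℤ)) := by
      by_contra hcon
      rw [hi, hval, if_neg hcon] at h
      exact h.false
    refine Or.inl ⟨i, ?_, hpos⟩
    rw [HExpr.find, HExpr.eval_sub, ← he', hi, hval, if_pos hpos]
    simp

theorem HExpr.eval_find (h : ∃ i : Fin n, 0 < e.eval n σ (Function.update ρ l ((i : ℕ) : ℤ))) :
    ∃ i : Fin n, (HExpr.find l e).eval n σ ρ = ((i : ℕ) : ℤ) ∧
      0 < e.eval n σ (Function.update ρ l ((i : ℕ) : ℤ)) := by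
  rcases HExpr.eval_find_cases n σ ρ l e with h' | h'
  · exact h'
  · obtain ⟨i, hi⟩ := h
    exact absurd hi (h'.2 i)

/-- A `y`-fold sum replaces the product, because a general multiplication could double bit lengths.
The summation range has length `n`, hence the bound on `y`. -/
theorem HExpr.eval_times {x y : ℤ}
    (he : ∀ i : Fin n, e.eval n σ (Function.update ρ l ((i : ℕ) : ℤ)) = x)
    (ha : ∀ i : Fin n, a.eval n σ (Function.update ρ l ((i : ℕ) : ℤ)) = y)
    (h0 : 0 ≤ y) (hn : y ≤ n) : (HExpr.times l e a).eval n σ ρ = x * y := by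
  rw [HExpr.times, HExpr.eval_sum]
  simp only [HExpr.eval_cond, HExpr.eval_lt_pos, HExpr.eval_bvar, Function.update_self, he, ha,
    HExpr.eval_const]
  obtain ⟨m, rfl⟩ := Int.eq_ofNat_of_zero_le h0
  rw [← Finset.sum_filter, Finset.sum_const, nsmul_eq_mul, mul_comm]
  congr 2
  have hm : m ≤ n := by exact_mod_cast hn
  have : (univ.filter fun i : Fin n => ((i : ℕ) : ℤ) < (m : ℤ)).card = m := by
    simp only [Nat.cast_lt]
    rw [Fin.card_filter_val_lt]
    omega
  exact this

end Eval

section Run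

variable {n : ℕ} {σ : RAMState} {l k v : ℕ} {z : ℤ} {a c e : HExpr} {p q : HStmt}

@[simp] theorem HStmt.run_skip : HStmt.skip.run n σ = σ := rfl
@[simp] theorem HStmt.run_seq : (HStmt.seq p q).run n σ = q.run n (p.run n σ) := rfl
@[simp] theorem HStmt.run_assign :
    (HStmt.assign v e).run n σ = σ.setReg v (e.eval n σ 0) := rfl
@[simp] theorem HStmt.run_store :
    (HStmt.store k a e).run n σ = σ.setArr k (a.eval n σ 0) (e.eval n σ 0) := rfl

theorem HStmt.run_ite_pos (h : 0 < c.eval n σ 0) : (HStmt.ite c p q).run n σ = p.run n σ :=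
  if_pos h

theorem HStmt.run_ite_neg (h : ¬ 0 < c.eval n σ 0) : (HStmt.ite c p q).run n σ = q.run n σ :=
  if_neg h

@[simp] theorem HStmt.run_map_reg : ((HStmt.map k l e).run n σ).reg = σ.reg := rfl

@[simp] theorem HStmt.run_map_arr_self (i : Fin n) :
    ((HStmt.map k l e).run n σ).arr k ((i : ℕ) : ℤ) =
      e.eval n σ (Function.update 0 l ((i : ℕ) : ℤ)) := by
  simp [HStmt.run]

theorem HStmt.run_map_arr_of_ne {k' : ℕ} (h : k' ≠ k) :
    ((HStmt.map k l e).run n σ).arr k' = σ.arr k' := by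
  simp [HStmt.run, h]

end Run

/-! ### Vertex sets and graphs in machine states. -/

/-- The vertex set whose characteristic vector is array `k`. -/
def bset (n : ℕ) (σ : RAMState) (k : ℕ) : Finset (Fin n) :=
  univ.filter fun i => 0 < σ.arr k ((i : ℕ) : ℤ)

@[simp] theorem mem_bset {n k : ℕ} {σ : RAMState} {i : Fin n} :
    i ∈ bset n σ k ↔ 0 < σ.arr k ((i : ℕ) : ℤ) := by simp [bset]

theorem bset_congr {n k : ℕ} {σ σ' : RAMState} (h : σ'.arr k = σ.arr k) :
    bset n σ' k = bset n σ k := by simp [bset, h]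

/-- Arrays `0` and `4` give access to the adjacency matrix. -/
def ReadsGraph {n : ℕ} (G : SimpleGraph (Fin n)) (σ : RAMState) : Prop :=
  ∀ u v : Fin n, 0 < σ.arr 0 (σ.arr 4 ((u : ℕ) : ℤ) + ((v : ℕ) : ℤ)) ↔ G.Adj u v

theorem ReadsGraph.congr {n : ℕ} {G : SimpleGraph (Fin n)} {σ σ' : RAMState}
    (h : ReadsGraph G σ) (h0 : σ'.arr 0 = σ.arr 0) (h4 : σ'.arr 4 = σ.arr 4) :
    ReadsGraph G σ' := by
  unfold ReadsGraph at *
  rwa [h0, h4]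

theorem ReadsGraph.run {n : ℕ} {G : SimpleGraph (Fin n)} {σ : RAMState} (h : ReadsGraph G σ)
    (p : HStmt) (h0 : 0 ∉ p.arrs) (h4 : 4 ∉ p.arrs) : ReadsGraph G (p.run n σ) :=
  h.congr (p.run_arr_of_notMem h0 σ) (p.run_arr_of_notMem h4 σ)

theorem ReadsGraph.eval_adj {n : ℕ} {G : SimpleGraph (Fin n)} {σ : RAMState} {ρ : ℕ → ℤ}
    (h : ReadsGraph G σ) {a b : HExpr} {u v : Fin n} (ha : a.eval n σ ρ = ((u : ℕ) : ℤ))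
    (hb : b.eval n σ ρ = ((v : ℕ) : ℤ)) : 0 < (HExpr.adj a b).eval n σ ρ ↔ G.Adj u v := by
  rw [HExpr.adj, HExpr.eval_load, HExpr.eval_add, HExpr.eval_load, ha, hb]
  exact h u v

/-! ## Maximum cardinality search on the machine -/

open HExpr HStmt in
/-- Visit a vertex of array `11` that has no stamp in array `12` and maximum label in array `13`,
and give it the stamp `var 2`. -/
def mcsVisit : HStmt :=
  seq (assign 4 (sup 0 (cond (and (load 11 (bvar 0)) (lt (load 12 (bvar 0)) (const 0)))
    (add (load 13 (bvar 0)) (const 1)) (const 0))))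
  (seq (assign 3 (find 0 (and (and (load 11 (bvar 0)) (lt (load 12 (bvar 0)) (const 0)))
    (eq (add (load 13 (bvar 0)) (const 1)) (var 4)))))
  (ite (lt (const (-1)) (var 3))
    (seq (store 12 (var 3) (var 2))
      (map 13 0 (add (load 13 (bvar 0)) (cond (adj (var 3) (bvar 0)) (const 1) (const 0)))))
    skip))

open HExpr HStmt in
/-- Maximum cardinality search on the vertex set in array `11`, with stamps in array `12`. -/
def mcsOrder : HStmt :=
  seq (map 12 0 (const (-1))) (seq (map 13 0 (const 0)) (HStmt.iter 2 mcsVisit))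

/-- The values of array `k` at the vertices. -/
def vals (n : ℕ) (σ : RAMState) (k : ℕ) : Fin n → ℤ := fun i => σ.arr k ((i : ℕ) : ℤ)

section

variable {n : ℕ} {G : SimpleGraph (Fin n)}

/-- The loop invariant of maximum cardinality search. -/
structure McsInv (G : SimpleGraph (Fin n)) (A P : Finset (Fin n)) (m : ℕ) (σ : RAMState) :
    Prop where
  reads : ReadsGraph G σ
  mask : bset n σ 11 = A
  mem : ∀ i, i ∈ P ↔ 0 ≤ vals n σ 12 i
  mcs : IsMCS G A P (vals n σ 12)
  le : ∀ u ∈ P, (m : ℤ) ≤ vals n σ 12 u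
  lt : ∀ u ∈ P, vals n σ 12 u < n
  lab : ∀ w, vals n σ 13 w = nbrCount G P (vals n σ 12) (-1) w
  -- Either every iteration so far has visited a vertex, or nothing is left to visit. Both give `P =
  -- A` at `m = 0`.
  card : n ≤ m + P.card ∨ P = A

-- Here `mx` is one more than the largest label of an unvisited vertex, and `0` if there is none.
-- Shifting the labels by one distinguishes label `0` from the absence of candidates.
open Classical in
theorem McsInv.visit {A P : Finset (Fin n)} {m : ℕ} {σ : RAMState} (hm : m < n)
    (h : McsInv G A P (m + 1) σ) : ∃ P', McsInv G A P' m (mcsVisit.run n (σ.setReg 2 m)) := by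
  set σ1 := σ.setReg 2 m with hσ1
  have ha1 : σ1.arr = σ.arr := rfl
  set mx := (HExpr.sup 0 (.cond (.and (.load 11 (.bvar 0)) (.lt (.load 12 (.bvar 0)) (.const 0)))
    (.add (.load 13 (.bvar 0)) (.const 1)) (.const 0))).eval n σ1 0 with hmx
  set σ2 := σ1.setReg 4 mx with hσ2
  have hcand : ∀ i : Fin n, (0 < σ.arr 11 ((i : ℕ) : ℤ) ∧ σ.arr 12 ((i : ℕ) : ℤ) < 0) ↔
      i ∈ A ∧ i ∉ P := fun i => by
    rw [← h.mask, mem_bset, h.mem, not_le, vals]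
  have hle : ∀ i ∈ A, i ∉ P → σ.arr 13 ((i : ℕ) : ℤ) + 1 ≤ mx := fun i hi hiP => by
    have := HExpr.le_eval_sup (n := n) (σ := σ1) (ρ := 0) (l := 0)
      (e := .cond (.and (.load 11 (.bvar 0)) (.lt (.load 12 (.bvar 0)) (.const 0)))
        (.add (.load 13 (.bvar 0)) (.const 1)) (.const 0)) i
    rw [← hmx, HExpr.eval_cond, if_pos] at this
    · simpa [ha1] using this
    · simpa [ha1] using (hcand i).2 ⟨hi, hiP⟩
  set z := (HExpr.find 0 (.and (.and (.load 11 (.bvar 0)) (.lt (.load 12 (.bvar 0)) (.const 0)))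
    (.eq (.add (.load 13 (.bvar 0)) (.const 1)) (.var 4)))).eval n σ2 0 with hz
  set σ3 := σ2.setReg 3 z with hσ3
  have hrun : mcsVisit.run n σ1 = (HStmt.ite (.lt (.const (-1)) (.var 3))
      (.seq (.store 12 (.var 3) (.var 2))
      (.map 13 0 (.add (.load 13 (.bvar 0)) (.cond (.adj (.var 3) (.bvar 0)) (.const 1) (.const 0)))))
      .skip).run n σ3 := rfl
  rw [hrun]
  have hc := HExpr.eval_find_cases n σ2 0 0 (.and (.and (.load 11 (.bvar 0))
    (.lt (.load 12 (.bvar 0)) (.const 0))) (.eq (.add (.load 13 (.bvar 0)) (.const 1)) (.var 4)))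
  rw [← hz] at hc
  have ha2 : σ2.arr = σ.arr := rfl
  have h4 : σ2.reg 4 = mx := by simp [hσ2, RAMState.setReg]
  simp only [HExpr.eval_and_pos, HExpr.eval_lt_pos, HExpr.eval_eq_pos, HExpr.eval_load,
    HExpr.eval_bvar, HExpr.eval_const, HExpr.eval_add, HExpr.eval_var, Function.update_self, ha2,
    hcand, h4] at hc
  rcases hc with ⟨i, hzi, ⟨hi, hiP⟩, hlab⟩ | ⟨hz1, hnone⟩
  · rw [HStmt.run_ite_pos (by simp [hσ3, RAMState.setReg, hzi]; omega)]
    have h3 : σ3.reg 3 = ((i : ℕ) : ℤ) := by simp [hσ3, RAMState.setReg, hzi]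
    have h2 : σ3.reg 2 = m := by simp [hσ3, hσ2, hσ1, RAMState.setReg]
    set σ4 := (HStmt.store 12 (.var 3) (.var 2)).run n σ3 with hσ4
    have hR4 : ReadsGraph G σ4 := ReadsGraph.run (σ := σ3) h.reads _ (by decide) (by decide)
    have h43 : σ4.reg 3 = ((i : ℕ) : ℤ) := h3
    have h412 : σ4.arr 12 = Function.update (σ.arr 12) ((i : ℕ) : ℤ) m := by
      simp only [hσ4, HStmt.run_store, HExpr.eval_var, h3, h2]
      simp [RAMState.setArr]
      rfl
    have h413 : σ4.arr 13 = σ.arr 13 := HStmt.run_arr_of_notMem _ (by decide) σ3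
    have h411 : σ4.arr 11 = σ.arr 11 := HStmt.run_arr_of_notMem _ (by decide) σ3
    rw [HStmt.run_seq, ← hσ4]
    set q : HStmt := .map 13 0 (.add (.load 13 (.bvar 0))
      (.cond (.adj (.var 3) (.bvar 0)) (.const 1) (.const 0))) with hq
    set σ5 := q.run n σ4 with hσ5
    have h512 : vals n σ5 12 = Function.update (vals n σ 12) i m := by
      funext j
      have : σ5.arr 12 = σ4.arr 12 := HStmt.run_arr_of_notMem _ (by decide) σ4
      simp [vals, this, h412, Function.update_apply, Fin.val_inj]
    have hst : ∀ u ∈ P, vals n σ5 12 u = vals n σ 12 u := fun u hu => by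
      rw [h512, Function.update_of_ne (ne_of_mem_of_not_mem hu hiP)]
    have hsti : vals n σ5 12 i = m := by rw [h512, Function.update_self]
    -- All stamps in `P` exceed `m` and none is negative, so the thresholds `m` and `-1` count the
    -- same vertices; the labels use the latter.
    have hcnt : ∀ w, nbrCount G P (vals n σ 12) m w = nbrCount G P (vals n σ 12) (-1) w :=
      fun w => nbrCount_congr fun u => by
        refine and_congr_right fun hu => ?_
        have := h.le u hu
        push_cast at this
        constructor <;> intro <;> omega
    refine ⟨insert i P, hR4.run _ (by decide) (by decide), ?_, ?_, ?_, ?_, ?_, ?_, ?_⟩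
    · rw [← h.mask]
      exact bset_congr ((HStmt.run_arr_of_notMem _ (by decide) σ4).trans h411)
    · intro j
      rw [mem_insert, h512, Function.update_apply]
      split
      · simp [*]
      · rw [h.mem]; simp [*]
    · refine h.mcs.insert hi hiP hst (fun u hu => ?_) fun w hw hwP => ?_
      · have := h.le u hu
        push_cast at this
        rw [hsti]
        omega
      · rw [hsti, hcnt, hcnt]
        have h1 := hle w hw hwP
        rw [← hlab] at h1
        have h2 : σ.arr 13 ((w : ℕ) : ℤ) = nbrCount G P (vals n σ 12) (-1) w := h.lab w
        have h3 : σ.arr 13 ((i : ℕ) : ℤ) = nbrCount G P (vals n σ 12) (-1) i := h.lab i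
        omega
    · intro u hu
      rcases mem_insert.1 hu with rfl | hu
      · rw [hsti]
      · rw [hst u hu]
        have := h.le u hu
        push_cast at this
        omega
    · intro u hu
      rcases mem_insert.1 hu with rfl | hu
      · rw [hsti]; exact_mod_cast hm
      · rw [hst u hu]; exact h.lt u hu
    · intro w
      have hadj : 0 < (HExpr.adj (.var 3) (.bvar 0)).eval n σ4 (Function.update 0 0 ((w : ℕ) : ℤ)) ↔
          G.Adj i w := hR4.eval_adj h43 rfl
      have h1 : σ.arr 13 ((w : ℕ) : ℤ) = nbrCount G P (vals n σ 12) (-1) w := h.lab w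
      have hv : vals n σ5 13 w = nbrCount G P (vals n σ 12) (-1) w + if G.Adj i w then 1 else 0 := by
        rw [vals, hσ5, hq, HStmt.run_map_arr_self, HExpr.eval_add, HExpr.eval_cond,
          HExpr.eval_load, HExpr.eval_bvar, Function.update_self, h413, h1]
        exact congrArg₂ _ rfl (if_congr hadj rfl rfl)
      rw [hv]
      unfold nbrCount
      have hPi : ∀ u ∈ P, (-1 : ℤ) < vals n σ 12 u := fun u hu => by
        have := h.le u hu
        push_cast at this
        omega
      have hPi' : ∀ u ∈ insert i P, (-1 : ℤ) < vals n σ5 12 u := fun u hu => by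
        rcases mem_insert.1 hu with rfl | hu
        · rw [hsti]; omega
        · rw [hst u hu]; exact hPi u hu
      rw [filter_congr fun u hu => and_iff_right (hPi u hu),
        filter_congr fun u hu => and_iff_right (hPi' u hu), filter_insert]
      split_ifs with ha hb hb
      · rw [card_insert_of_notMem (by simp [hiP])]; simp
      · exact absurd ha.symm hb
      · exact absurd hb.symm ha
      · simp
    · left
      rcases h.card with hcard | hcard
      · rw [card_insert_of_notMem hiP]; omega
      · exact absurd hi (hcard ▸ hiP)
  · rw [HStmt.run_ite_neg (by simp [hσ3, RAMState.setReg, hz1])]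
    have hPA : P = A := by
      refine h.mcs.subset.antisymm fun i hi => ?_
      by_contra hiP
      have hpos : 0 < mx := by
        have := hle i hi hiP
        have h2 : σ.arr 13 ((i : ℕ) : ℤ) = nbrCount G P (vals n σ 12) (-1) i := h.lab i
        omega
      obtain ⟨j, hj⟩ := HExpr.exists_eval_sup hpos
      rw [← hmx, HExpr.eval_cond] at hj
      simp only [HExpr.eval_and_pos, HExpr.eval_lt_pos, HExpr.eval_load,
        HExpr.eval_bvar, HExpr.eval_const, HExpr.eval_add, Function.update_self, ha1, hcand] at hj
      split at hj
      · exact hnone j ⟨‹_›, hj.symm⟩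
      · omega
    exact ⟨P, h.reads, h.mask, h.mem, h.mcs, fun u hu => by
      have := h.le u hu
      push_cast at this
      show (m : ℤ) ≤ vals n σ 12 u
      omega, h.lt, h.lab, Or.inr hPA⟩

theorem mcsOrder_spec {σ : RAMState} (h : ReadsGraph G σ) {A : Finset (Fin n)}
    (hA : bset n σ 11 = A) : ReadsGraph G (mcsOrder.run n σ) ∧ bset n (mcsOrder.run n σ) 11 = A ∧
      IsMCS G A A (vals n (mcsOrder.run n σ) 12) ∧
      (∀ u, u ∈ A ↔ 0 ≤ vals n (mcsOrder.run n σ) 12 u) ∧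
      ∀ u ∈ A, vals n (mcsOrder.run n σ) 12 u < n := by
  set σ1 := (HStmt.map 12 0 (.const (-1))).run n σ with hσ1
  set σ2 := (HStmt.map 13 0 (.const 0)).run n σ1 with hσ2
  have hrun : mcsOrder.run n σ = (HStmt.iter 2 mcsVisit).run n σ2 := rfl
  have hst : vals n σ2 12 = fun _ => -1 := by
    funext i
    rw [vals, hσ2, HStmt.run_map_arr_of_ne (by decide), hσ1, HStmt.run_map_arr_self]
    rfl
  have h0 : McsInv G A ∅ n σ2 := by
    refine ⟨(h.run _ (by decide) (by decide)).run _ (by decide) (by decide), ?_, ?_,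
      .empty _ _ _, by simp, by simp, ?_, by simp⟩
    · rw [← hA]
      exact bset_congr rfl
    · intro i
      rw [hst]
      simp
    · intro w
      rw [vals, hσ2, HStmt.run_map_arr_self]
      simp [nbrCount]
  have hend := HStmt.iter_induction (n := n) (i := 2) (p := mcsVisit)
    (fun m σ => ∃ P, McsInv G A P m σ) ⟨∅, h0⟩ fun m hm s ⟨P, hs⟩ => hs.visit hm
  rw [← hrun] at hend
  obtain ⟨P, hP⟩ := hend
  have hPA : P = A := by
    rcases hP.card with hc | hc
    · have : P = univ := by
        rw [← card_eq_iff_eq_univ, Fintype.card_fin]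
        have := card_le_univ P
        rw [Fintype.card_fin] at this
        omega
      have h2 := hP.mcs.subset
      rw [this] at h2 ⊢
      exact h2.antisymm (subset_univ _)
    · exact hc
  subst hPA
  exact ⟨hP.reads, hP.mask, hP.mcs, hP.mem, hP.lt⟩

/-- An order is perfect if the earlier neighbours of each vertex are adjacent to the last of
them. -/
theorem isPerfectOrder_of_last {V : Type*} {G : SimpleGraph V} {A : Finset V} {τ : V → ℤ}
    (hτ : Set.InjOn τ A)
    (h : ∀ z ∈ A, (∃ u ∈ A, τ z < τ u ∧ G.Adj z u) → ∃ p ∈ A, τ z < τ p ∧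
      ∀ u ∈ A, τ z < τ u → G.Adj z u → τ p ≤ τ u ∧ (u ≠ p → G.Adj u p)) :
    IsPerfectOrder G A τ := by
  have key : ∀ k : ℕ, ∀ z ∈ A, (A.filter fun w => τ z < τ w).card = k →
      ∀ a ∈ A, ∀ b ∈ A, τ z < τ a → τ z < τ b → G.Adj z a → G.Adj z b → a ≠ b → G.Adj a b := by
    intro k
    induction k using Nat.strong_induction_on with
    | _ k ih =>
      intro z hz hk a ha b hb hza hzb hna hnb hab
      obtain ⟨p, hp, hzp, hu⟩ := h z hz ⟨a, ha, hza, hna⟩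
      obtain ⟨h1, h2⟩ := hu a ha hza hna
      obtain ⟨h3, h4⟩ := hu b hb hzb hnb
      by_cases hap : a = p
      · subst hap
        exact (h4 hab.symm).symm
      by_cases hbp : b = p
      · subst hbp
        exact h2 hap
      have hlt : (A.filter fun w => τ p < τ w).card < k := by
        rw [← hk]
        refine card_lt_card ⟨fun w hw => ?_, fun hsub => ?_⟩
        · rw [mem_filter] at hw ⊢
          exact ⟨hw.1, hzp.trans hw.2⟩
        · exact lt_irrefl _ (mem_filter.1 (hsub (mem_filter.2 ⟨hp, hzp⟩))).2
      -- Both vertices are adjacent to the last earlier neighbour `p` and precede it, so the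
      -- question moves from `z` to `p`, which has fewer predecessors.
      exact ih _ hlt p hp rfl a ha b hb (h1.lt_of_ne fun e => hap (hτ ha hp e.symm))
        (h3.lt_of_ne fun e => hbp (hτ hb hp e.symm)) (h2 hap).symm (h4 hbp).symm hab
  exact fun z hz => key _ z hz rfl

open HExpr HStmt in
/-- Compute in array `18` the last earlier neighbour of each vertex, and set `var 5` to a positive
value if the order of array `12` is not perfect. -/
def mcsCheck : HStmt :=
  seq (map 17 0 (sup 1 (cond (and (and (load 11 (bvar 1)) (adj (bvar 0) (bvar 1)))
    (lt (load 12 (bvar 0)) (load 12 (bvar 1)))) (sub size (load 12 (bvar 1))) (const 0))))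
  (seq (map 18 0 (find 1 (and (and (load 11 (bvar 1)) (adj (bvar 0) (bvar 1)))
    (and (lt (load 12 (bvar 0)) (load 12 (bvar 1)))
      (eq (load 17 (bvar 0)) (sub size (load 12 (bvar 1))))))))
  (assign 5 (any 0 (any 1 (and (and (and (load 11 (bvar 0)) (load 11 (bvar 1)))
    (and (adj (bvar 0) (bvar 1)) (lt (load 12 (bvar 0)) (load 12 (bvar 1)))))
    (and (not (eq (bvar 1) (load 18 (bvar 0)))) (not (adj (bvar 1) (load 18 (bvar 0))))))))))

/-- The last earlier neighbour has the least stamp, hence maximises `n - τ`, which is positive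
because stamps stay below `n`; so the default value `0` of the maximum means that there is no
earlier neighbour. -/
theorem mcsCheck_spec {σ : RAMState} (h : ReadsGraph G σ) {A : Finset (Fin n)}
    (hA : bset n σ 11 = A) (hτ : Set.InjOn (vals n σ 12) A) (hn : ∀ u ∈ A, vals n σ 12 u < n) :
    0 < (mcsCheck.run n σ).reg 5 ↔ ¬ IsPerfectOrder G A (vals n σ 12) := by
  classical
  set e1 : HExpr := .cond (.and (.and (.load 11 (.bvar 1)) (.adj (.bvar 0) (.bvar 1)))
    (.lt (.load 12 (.bvar 0)) (.load 12 (.bvar 1)))) (.sub .size (.load 12 (.bvar 1))) (.const 0)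
    with he1
  set σ1 := (HStmt.map 17 0 (.sup 1 e1)).run n σ with hσ1
  set e2 : HExpr := .and (.and (.load 11 (.bvar 1)) (.adj (.bvar 0) (.bvar 1)))
    (.and (.lt (.load 12 (.bvar 0)) (.load 12 (.bvar 1)))
      (.eq (.load 17 (.bvar 0)) (.sub .size (.load 12 (.bvar 1))))) with he2
  set σ2 := (HStmt.map 18 0 (.find 1 e2)).run n σ1 with hσ2
  set e3 : HExpr := .and (.and (.and (.load 11 (.bvar 0)) (.load 11 (.bvar 1)))
    (.and (.adj (.bvar 0) (.bvar 1)) (.lt (.load 12 (.bvar 0)) (.load 12 (.bvar 1)))))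
    (.and (.not (.eq (.bvar 1) (.load 18 (.bvar 0)))) (.not (.adj (.bvar 1) (.load 18 (.bvar 0)))))
    with he3
  have hmem : ∀ i : Fin n, 0 < σ.arr 11 ((i : ℕ) : ℤ) ↔ i ∈ A := fun i => by rw [← hA, mem_bset]
  have hrun : (mcsCheck.run n σ).reg 5 = (HExpr.any 0 (.any 1 e3)).eval n σ2 0 := by
    have : mcsCheck.run n σ = σ2.setReg 5 ((HExpr.any 0 (.any 1 e3)).eval n σ2 0) := rfl
    rw [this]
    simp [RAMState.setReg]
  have hR1 : ReadsGraph G σ1 := h.run _ (by decide) (by decide)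
  have hR2 : ReadsGraph G σ2 := hR1.run _ (by decide) (by decide)
  have h111 : σ1.arr 11 = σ.arr 11 := rfl
  have h112 : σ1.arr 12 = σ.arr 12 := rfl
  have h211 : σ2.arr 11 = σ.arr 11 := rfl
  have h212 : σ2.arr 12 = σ.arr 12 := rfl
  have hv1 : ∀ z u : Fin n, e1.eval n σ
      (Function.update (Function.update 0 0 ((z : ℕ) : ℤ)) 1 ((u : ℕ) : ℤ)) = _root_.ite
      ((u ∈ A ∧ G.Adj z u) ∧ vals n σ 12 z < vals n σ 12 u) (n - vals n σ 12 u) 0 := fun z u => by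
    have hadj : 0 < (HExpr.adj (.bvar 0) (.bvar 1)).eval n σ
      (Function.update (Function.update 0 0 ((z : ℕ) : ℤ)) 1 ((u : ℕ) : ℤ)) ↔ G.Adj z u :=
      h.eval_adj rfl rfl
    rw [he1, HExpr.eval_cond]
    refine if_congr ?_ ?_ rfl
    · simp [hadj, hmem, vals]
    · simp [vals]
  have hv2 : ∀ z u : Fin n, 0 < e2.eval n σ1
      (Function.update (Function.update 0 0 ((z : ℕ) : ℤ)) 1 ((u : ℕ) : ℤ)) ↔
      (u ∈ A ∧ G.Adj z u) ∧ vals n σ 12 z < vals n σ 12 u ∧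
        vals n σ1 17 z = n - vals n σ 12 u := fun z u => by
    have hadj : 0 < (HExpr.adj (.bvar 0) (.bvar 1)).eval n σ1
      (Function.update (Function.update 0 0 ((z : ℕ) : ℤ)) 1 ((u : ℕ) : ℤ)) ↔ G.Adj z u :=
      hR1.eval_adj rfl rfl
    simp [he2, hadj, hmem, vals, h111, h112]
  have hlast : ∀ z, (∃ u ∈ A, vals n σ 12 z < vals n σ 12 u ∧ G.Adj z u) →
      ∃ p ∈ A, vals n σ2 18 z = ((p : ℕ) : ℤ) ∧ vals n σ 12 z < vals n σ 12 p ∧ G.Adj z p ∧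
        ∀ u ∈ A, vals n σ 12 z < vals n σ 12 u → G.Adj z u → vals n σ 12 p ≤ vals n σ 12 u := by
    rintro z ⟨u, hu, hzu, hau⟩
    have h17 : vals n σ1 17 z = (HExpr.sup 1 e1).eval n σ (Function.update 0 0 ((z : ℕ) : ℤ)) := by
      rw [vals, hσ1, HStmt.run_map_arr_self]
    have hge : ∀ u ∈ A, vals n σ 12 z < vals n σ 12 u → G.Adj z u →
        n - vals n σ 12 u ≤ vals n σ1 17 z := fun u hu hzu hau => by
      have := HExpr.le_eval_sup (n := n) (σ := σ) (ρ := Function.update 0 0 ((z : ℕ) : ℤ)) (l := 1)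
        (e := e1) u
      rw [hv1, if_pos ⟨⟨hu, hau⟩, hzu⟩] at this
      rwa [h17]
    have hpos : 0 < vals n σ1 17 z := by
      have := hge u hu hzu hau
      have := hn u hu
      omega
    obtain ⟨w, hw⟩ := HExpr.exists_eval_sup (h17 ▸ hpos)
    rw [← h17, hv1] at hw
    split at hw
    · rename_i hwc
      obtain ⟨p, hp, hpc⟩ := HExpr.eval_find (n := n) (σ := σ1)
        (ρ := Function.update 0 0 ((z : ℕ) : ℤ)) (l := 1) (e := e2)
        ⟨w, (hv2 z w).2 ⟨hwc.1, hwc.2, hw⟩⟩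
      obtain ⟨⟨hpA, hzp⟩, hlt, heq⟩ := (hv2 z p).1 hpc
      refine ⟨p, hpA, ?_, hlt, hzp, fun u hu hzu hau => ?_⟩
      · rw [vals, hσ2, HStmt.run_map_arr_self, hp]
      · have := hge u hu hzu hau
        omega
    · omega
  have hv3 : ∀ z u p : Fin n, vals n σ2 18 z = ((p : ℕ) : ℤ) → (0 < e3.eval n σ2
      (Function.update (Function.update 0 0 ((z : ℕ) : ℤ)) 1 ((u : ℕ) : ℤ)) ↔
      ((z ∈ A ∧ u ∈ A) ∧ G.Adj z u ∧ vals n σ 12 z < vals n σ 12 u) ∧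
        u ≠ p ∧ ¬ G.Adj u p) := fun z u p hp => by
    set ρ := Function.update (Function.update (0 : ℕ → ℤ) 0 ((z : ℕ) : ℤ)) 1 ((u : ℕ) : ℤ) with hρ
    have h0 : ρ 0 = ((z : ℕ) : ℤ) := rfl
    have h1 : ρ 1 = ((u : ℕ) : ℤ) := rfl
    unfold vals at hp
    have hadj : 0 < (HExpr.adj (.bvar 0) (.bvar 1)).eval n σ2 ρ ↔ G.Adj z u := hR2.eval_adj h0 h1
    have hadj' : 0 < (HExpr.adj (.bvar 1) (.load 18 (.bvar 0))).eval n σ2 ρ ↔ G.Adj u p :=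
      hR2.eval_adj h1 (by rw [HExpr.eval_load, HExpr.eval_bvar, h0, hp])
    simp only [he3, HExpr.eval_and_pos, HExpr.eval_load, HExpr.eval_bvar, h0, h1, h211, h212, hmem,
      hadj, hadj', HExpr.eval_not_pos, HExpr.eval_eq_pos, HExpr.eval_lt_pos, hp, vals,
      Nat.cast_inj, Fin.val_inj, ne_eq]
  have hv3' : ∀ z u : Fin n, 0 < e3.eval n σ2
      (Function.update (Function.update 0 0 ((z : ℕ) : ℤ)) 1 ((u : ℕ) : ℤ)) →
      (z ∈ A ∧ u ∈ A) ∧ G.Adj z u ∧ vals n σ 12 z < vals n σ 12 u := fun z u hpos => by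
    set ρ := Function.update (Function.update (0 : ℕ → ℤ) 0 ((z : ℕ) : ℤ)) 1 ((u : ℕ) : ℤ) with hρ
    have h0 : ρ 0 = ((z : ℕ) : ℤ) := rfl
    have h1 : ρ 1 = ((u : ℕ) : ℤ) := rfl
    have hadj : 0 < (HExpr.adj (.bvar 0) (.bvar 1)).eval n σ2 ρ ↔ G.Adj z u := hR2.eval_adj h0 h1
    rw [he3, HExpr.eval_and_pos] at hpos
    simpa only [HExpr.eval_and_pos, HExpr.eval_load, HExpr.eval_bvar, h0, h1, h211, h212, hmem,
      hadj, HExpr.eval_lt_pos, vals] using hpos.1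
  rw [hrun]
  simp only [HExpr.eval_any_pos]
  constructor
  · rintro ⟨z, u, hzu⟩ hperf
    obtain ⟨⟨hz, hu⟩, hadj, hlt⟩ := hv3' z u hzu
    obtain ⟨p, hp, hpv, hzp, hap, -⟩ := hlast z ⟨u, hu, hlt, hadj⟩
    obtain ⟨-, hne, hnadj⟩ := (hv3 z u p hpv).1 hzu
    exact hnadj (hperf z hz u hu p hp hlt hzp hadj hap hne)
  · intro hnp
    by_contra hcon
    push Not at hcon
    refine hnp (isPerfectOrder_of_last hτ fun z hz hex => ?_)
    obtain ⟨p, hp, hpv, hzp, hap, hmin⟩ := hlast z hex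
    refine ⟨p, hp, hzp, fun u hu hlt hadj => ⟨hmin u hu hlt hadj, fun hne => ?_⟩⟩
    by_contra hnadj
    exact (hcon z u).not_gt ((hv3 z u p hpv).2 ⟨⟨⟨hz, hu⟩, hadj, hlt⟩, hne, hnadj⟩)

/-- Maximum cardinality search on the vertex set in array `11`; `var 5` becomes positive if the
order is not perfect. -/
def mcs : HStmt := .seq mcsOrder mcsCheck

/-- Perfect orders exclude holes and other search orders produce one, so the flag tests for a hole,
whichever order was found. -/
theorem mcs_spec {σ : RAMState} (h : ReadsGraph G σ) {A : Finset (Fin n)}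
    (hA : bset n σ 11 = A) :
      IsMCS G A A (vals n (mcs.run n σ) 12) ∧
      (∀ u, u ∈ A ↔ 0 ≤ vals n (mcs.run n σ) 12 u) ∧
      (∀ u ∈ A, vals n (mcs.run n σ) 12 u < n) ∧
      (¬ 0 < (mcs.run n σ).reg 5 → IsPerfectOrder G A (vals n (mcs.run n σ) 12)) ∧
      (0 < (mcs.run n σ).reg 5 ↔ ∃ T ⊆ A, IsHole G T) := by
  obtain ⟨h1, h2, h3, h4, h5⟩ := mcsOrder_spec h hA
  have h12 : vals n (mcs.run n σ) 12 = vals n (mcsOrder.run n σ) 12 := by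
    have : (mcs.run n σ).arr 12 = (mcsOrder.run n σ).arr 12 :=
      HStmt.run_arr_of_notMem mcsCheck (by decide) (mcsOrder.run n σ)
    unfold vals
    rw [this]
  have hc : 0 < (mcs.run n σ).reg 5 ↔ ¬ IsPerfectOrder G A (vals n (mcsOrder.run n σ) 12) :=
    mcsCheck_spec h1 h2 h3.injOn h5
  rw [h12]
  refine ⟨h3, h4, h5, fun hn => by simpa using hc.not.1 hn, hc.trans ⟨fun hn => h3.exists_isHole hn,
    fun ⟨T, hT, hh⟩ hp => hp.not_isHole h3.injOn hT hh⟩⟩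

end

/-! ## Good cost functions on the machine -/

theorem RAMState.arr_setArr (s : RAMState) (k q : ℕ) (a z x : ℤ) :
    (s.setArr k a z).arr q x = if q = k ∧ x = a then z else s.arr q x := by
  by_cases hq : q = k
  · subst hq
    simp [RAMState.setArr, Function.update_apply]
  · simp [RAMState.setArr, hq]

open HExpr HStmt in
/-- Remove vertices from array `11` as long as the remaining set contains a hole. -/
def findHole : HStmt :=
  HStmt.iter 6 (ite (load 11 (var 6)) (seq (store 11 (var 6) (const 0))
    (seq mcs (ite (var 5) skip (store 11 (var 6) (const 1))))) skip)

open HExpr HStmt in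
/-- The vertex `e` is adjacent to `var 3` exactly if the representative of its class is not. -/
def splits (e : HExpr) : HExpr := not (iff (adj (var 3) e) (adj (var 3) (load 14 e)))

open HExpr HStmt in
/-- Handle the vertex `var 3`: array `10` holds the processed vertices, array `14` the
representatives of their classes, array `15` their weights. -/
def addVertex : HStmt :=
  seq (map 16 0 (cond (and (load 10 (bvar 0)) (splits (bvar 0)))
    (find 1 (and (load 10 (bvar 1)) (and (eq (load 14 (bvar 1)) (load 14 (bvar 0)))
      (splits (bvar 1))))) (load 14 (bvar 0))))
  (seq (assign 9 (sum 0 (cond (and (and (load 10 (bvar 0)) (splits (bvar 0)))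
    (eq (load 16 (bvar 0)) (bvar 0))) (const 1) (const 0))))
  (seq (assign 10 (and (adj (var 3) (var 8)) (all 0 (or (not (load 10 (bvar 0)))
    (or (eq (bvar 0) (var 8)) (iff (adj (var 3) (bvar 0)) (adj (var 8) (bvar 0))))))))
  (seq (assign 11 (load 14 (var 8)))
  (seq (map 14 0 (load 16 (bvar 0)))
  (seq (ite (and (load 11 (var 3)) (eq (var 9) (const 0)))
    (ite (var 10) (seq (store 14 (var 3) (var 11)) (store 15 (var 3) (const 1)))
      (seq (store 15 (var 1) (add (load 15 (var 1)) (const 1)))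
        (seq (store 14 (var 3) (var 3)) (store 15 (var 3) (const 1)))))
    (seq (store 14 (var 3) (var 3)) (store 15 (var 3) (var 9))))
  (seq (store 10 (var 3) (const 1)) (assign 8 (var 3))))))))

open HExpr HStmt in
/-- Handle all vertices: first the neighbours of `var 1`, in the order of the stamps in array
`12`, then the others. -/
def twinWeights : HStmt :=
  seq (map 10 0 (eq (bvar 0) (var 1)))
  (seq (map 14 0 (bvar 0))
  (seq (map 15 0 (const 1))
  (seq (assign 8 (var 1))
  (seq (HStmt.iter 7 (seq (assign 3 (find 0 (and (load 11 (bvar 0)) (eq (load 12 (bvar 0)) (var 7)))))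
    (ite (lt (const (-1)) (var 3)) addVertex skip)))
  (HStmt.iter 7 (ite (and (load 6 (var 7)) (not (load 10 (var 7))))
    (seq (assign 3 (var 7)) addVertex) skip))))))

open HExpr HStmt in
/-- Compute in array `15` a good cost function on the vertices in array `6`. -/
def goodWeights : HStmt :=
  seq (assign 1 (find 0 (load 6 (bvar 0))))
  (seq (map 11 0 (and (load 6 (bvar 0)) (adj (var 1) (bvar 0))))
  (seq mcs
  (ite (var 5)
    (seq findHole (map 15 0 (cond (load 11 (bvar 0)) (const 1) (cond (eq (bvar 0) (var 1))
      (sub (sum 1 (cond (load 11 (bvar 1)) (const 1) (const 0))) (const 4)) (const 0)))))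
    twinWeights)))

section

variable {n : ℕ} {G : SimpleGraph (Fin n)}

/-- A vertex kept after its test lies in every hole of the remaining set, and this persists when the
set shrinks. In the end all vertices are indispensable, so a hole contained in the remaining set
equals it. -/
theorem findHole_spec {σ : RAMState} (h : ReadsGraph G σ) {A : Finset (Fin n)}
    (hA : bset n σ 11 = A) (hole : ∃ T ⊆ A, IsHole G T) :
    bset n (findHole.run n σ) 11 ⊆ A ∧ IsHole G (bset n (findHole.run n σ) 11) := by
  have hend := HStmt.iter_induction (n := n) (i := 6) (p := .ite (.load 11 (.var 6))
      (.seq (.store 11 (.var 6) (.const 0))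
      (.seq mcs (.ite (.var 5) .skip (.store 11 (.var 6) (.const 1))))) .skip)
    (fun m s => ReadsGraph G s ∧ bset n s 11 ⊆ A ∧ (∃ T ⊆ bset n s 11, IsHole G T) ∧
      ∀ v ∈ bset n s 11, m ≤ (v : ℕ) → ∀ T ⊆ (bset n s 11).erase v, ¬ IsHole G T)
    (σ := σ) ⟨h, hA.le, hA.symm ▸ hole, fun v _ hv => absurd v.2 (by omega)⟩ ?_
  · obtain ⟨-, h1, ⟨T, hT, hh⟩, h2⟩ := hend
    refine ⟨h1, ?_⟩
    convert hh using 1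
    refine (hT.antisymm fun v hv => ?_).symm
    by_contra hvT
    exact h2 v hv (Nat.zero_le _) T (subset_erase.2 ⟨hT, hvT⟩) hh
  · intro m hm s ⟨hR, hsub, hex, hmin⟩
    obtain ⟨v, hv⟩ : ∃ v : Fin n, (v : ℕ) = m := ⟨⟨m, hm⟩, rfl⟩
    set s1 := s.setReg 6 m with hs1
    have h6 : s1.reg 6 = ((v : ℕ) : ℤ) := by simp [hs1, RAMState.setReg_reg, hv]
    have hb1 : bset n s1 11 = bset n s 11 := rfl
    by_cases hvA : v ∈ bset n s 11
    · rw [HStmt.run_ite_pos (by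
        rw [HExpr.eval_load, HExpr.eval_var, h6]; exact mem_bset.1 hvA), HStmt.run_seq,
        HStmt.run_seq]
      set s2 := (HStmt.store 11 (.var 6) (.const 0)).run n s1 with hs2
      have h2v : ∀ x, s2.arr 11 x = if x = ((v : ℕ) : ℤ) then 0 else s.arr 11 x := fun x => by
        rw [hs2, HStmt.run_store, RAMState.arr_setArr, HExpr.eval_var, h6]
        simp [hs1]
      have hb2 : bset n s2 11 = (bset n s 11).erase v := by
        ext i
        rw [mem_erase, mem_bset, mem_bset, h2v]
        simp only [Nat.cast_inj, Fin.val_inj]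
        split <;> simp [*]
      have hR2 : ReadsGraph G s2 := ReadsGraph.run (σ := s1) hR _ (by decide) (by decide)
      have hR3 : ReadsGraph G (mcs.run n s2) := hR2.run _ (by decide) (by decide)
      have hspec := (mcs_spec hR2 hb2).2.2.2.2
      have h311 : (mcs.run n s2).arr 11 = s2.arr 11 := mcs.run_arr_of_notMem (by decide) s2
      have h36 : (mcs.run n s2).reg 6 = ((v : ℕ) : ℤ) :=
        (mcs.run_reg_of_notMem (by decide) s2).trans h6
      have hb3 : bset n (mcs.run n s2) 11 = (bset n s 11).erase v := (bset_congr h311).trans hb2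
      by_cases hf : 0 < (mcs.run n s2).reg 5
      · rw [HStmt.run_ite_pos (c := .var 5) hf, HStmt.run_skip, hb3]
        refine ⟨hR3, (erase_subset _ _).trans hsub, hspec.1 hf, fun u hu hmu T hT => ?_⟩
        rw [mem_erase] at hu
        have hne : (u : ℕ) ≠ m := fun e => hu.1 (Fin.ext (e.trans hv.symm))
        exact hmin u hu.2 (by omega) T (hT.trans (erase_subset_erase _ (erase_subset _ _)))
      · rw [HStmt.run_ite_neg (c := .var 5) hf]
        set s4 := (HStmt.store 11 (.var 6) (.const 1)).run n (mcs.run n s2) with hs4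
        have hb4 : bset n s4 11 = bset n s 11 := by
          ext i
          rw [mem_bset, hs4, HStmt.run_store, RAMState.arr_setArr, HExpr.eval_var, h36, h311, h2v]
          simp only [Nat.cast_inj, Fin.val_inj, HExpr.eval_const, true_and]
          by_cases hi : i = v
          · subst hi
            simpa using hvA
          · simp [hi]
        rw [hb4]
        refine ⟨hR3.run _ (by decide) (by decide), hsub, hex, fun u hu hmu T hT => ?_⟩
        by_cases huv : u = v
        · subst huv
          exact fun hh => hf (hspec.2 ⟨T, hT, hh⟩)
        · have hne : (u : ℕ) ≠ m := fun e => huv (Fin.ext (e.trans hv.symm))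
          exact hmin u hu (by omega) T hT
    · rw [HStmt.run_ite_neg (by
        rw [HExpr.eval_load, HExpr.eval_var, h6]; exact fun h => hvA (mem_bset.2 h)),
        HStmt.run_skip, hb1]
      refine ⟨hR, hsub, hex, fun u hu hmu T hT => ?_⟩
      have hne : (u : ℕ) ≠ m := fun e => hvA ((Fin.ext (e.trans hv.symm) : u = v) ▸ hu)
      exact hmin u hu (by omega) T hT

end

/-! ### Inserting one vertex into the twin classes on the machine. -/

section

variable {n : ℕ} {G : SimpleGraph (Fin n)}

/-- Shows that members of the same part of a split class obtain the same new representative. -/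
theorem HExpr.eval_find_congr {σ : RAMState} {ρ ρ' : ℕ → ℤ} {l : ℕ} {e : HExpr}
    (h : ∀ i : Fin n, 0 < e.eval n σ (Function.update ρ l ((i : ℕ) : ℤ)) ↔
      0 < e.eval n σ (Function.update ρ' l ((i : ℕ) : ℤ))) :
    (HExpr.find l e).eval n σ ρ = (HExpr.find l e).eval n σ ρ' := by
  have : (fun i : Fin n => (HExpr.cond e (.add (.bvar l) (.const 1)) (.const 0)).eval n σ
      (Function.update ρ l ((i : ℕ) : ℤ))) = fun i : Fin n =>
      (HExpr.cond e (.add (.bvar l) (.const 1)) (.const 0)).eval n σ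
      (Function.update ρ' l ((i : ℕ) : ℤ)) := by
    funext i
    rw [HExpr.eval_cond, HExpr.eval_cond]
    exact if_congr (h i) (by simp) rfl
  simp only [HExpr.find, HExpr.eval_sub, HExpr.eval_sup_eq, HExpr.eval_const, congr_fun this _]

theorem eval_splits {σ : RAMState} {ρ : ℕ → ℤ} {e : HExpr} {z x : Fin n} {cls : Fin n → Fin n}
    (hR : ReadsGraph G σ) (hz : σ.reg 3 = ((z : ℕ) : ℤ))
    (hcls : ∀ i : Fin n, σ.arr 14 ((i : ℕ) : ℤ) = ((cls i : ℕ) : ℤ))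
    (he : e.eval n σ ρ = ((x : ℕ) : ℤ)) :
    0 < (splits e).eval n σ ρ ↔ ¬ (G.Adj z x ↔ G.Adj z (cls x)) := by
  rw [splits, HExpr.eval_not_pos, HExpr.eval_iff_pos, hR.eval_adj (a := .var 3) hz he,
    hR.eval_adj (a := .var 3) hz (by rw [HExpr.eval_load, he, hcls])]

/-- What array `14`, array `15` and the other data look like after processing the vertex `z`. -/
theorem addVertex_spec {σ : RAMState} {z m v₀ : Fin n} {A B : Finset (Fin n)}
    {cls : Fin n → Fin n} (hR : ReadsGraph G σ) (hz : σ.reg 3 = ((z : ℕ) : ℤ))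
    (hm : σ.reg 8 = ((m : ℕ) : ℤ)) (hv₀ : σ.reg 1 = ((v₀ : ℕ) : ℤ)) (hA : bset n σ 11 = A)
    (hB : bset n σ 10 = B) (hcls : ∀ i : Fin n, σ.arr 14 ((i : ℕ) : ℤ) = ((cls i : ℕ) : ℤ))
    (hzB : z ∉ B) (hv₀B : v₀ ∈ B) : ∃ cls' N, IsSplit G B cls z cls' N ∧
      (∀ i : Fin n, (addVertex.run n σ).arr 14 ((i : ℕ) : ℤ) = ((cls' i : ℕ) : ℤ)) ∧
      bset n (addVertex.run n σ) 10 = insert z B ∧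
      (addVertex.run n σ).reg 8 = ((z : ℕ) : ℤ) ∧
      ((¬ (z ∈ A ∧ N.card = 0) ∧ cls' z = z ∧ vals n (addVertex.run n σ) 15 z = N.card ∧
          ∀ v ∈ B, vals n (addVertex.run n σ) 15 v = vals n σ 15 v) ∨
        (z ∈ A ∧ N.card = 0 ∧ (G.Adj z m ∧ ∀ t ∈ B, t ≠ m → (G.Adj z t ↔ G.Adj m t)) ∧
          cls' z = cls m ∧ vals n (addVertex.run n σ) 15 z = 1 ∧
          ∀ v ∈ B, vals n (addVertex.run n σ) 15 v = vals n σ 15 v) ∨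
        (z ∈ A ∧ N.card = 0 ∧ ¬ (G.Adj z m ∧ ∀ t ∈ B, t ≠ m → (G.Adj z t ↔ G.Adj m t)) ∧
          cls' z = z ∧ vals n (addVertex.run n σ) 15 z = 1 ∧
          vals n (addVertex.run n σ) 15 v₀ = vals n σ 15 v₀ + 1 ∧
          ∀ v ∈ B, v ≠ v₀ → vals n (addVertex.run n σ) 15 v = vals n σ 15 v)) := by
  classical
  have hBm : ∀ i : Fin n, 0 < σ.arr 10 ((i : ℕ) : ℤ) ↔ i ∈ B := fun i => by rw [← hB, mem_bset]
  have hzv : z ≠ v₀ := fun e => hzB (e ▸ hv₀B)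
  set bad : Fin n → Prop := fun x => ¬ (G.Adj z x ↔ G.Adj z (cls x)) with hbad
  set E : HExpr := .and (.load 10 (.bvar 1)) (.and (.eq (.load 14 (.bvar 1)) (.load 14 (.bvar 0)))
    (splits (.bvar 1))) with hE
  have hEv : ∀ i u : Fin n, 0 < E.eval n σ
      (Function.update (Function.update 0 0 ((i : ℕ) : ℤ)) 1 ((u : ℕ) : ℤ)) ↔
      u ∈ B ∧ cls u = cls i ∧ bad u := fun i u => by
    set ρ := Function.update (Function.update (0 : ℕ → ℤ) 0 ((i : ℕ) : ℤ)) 1 ((u : ℕ) : ℤ) with hρ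
    have h0 : ρ 0 = ((i : ℕ) : ℤ) := rfl
    have h1 : ρ 1 = ((u : ℕ) : ℤ) := rfl
    have hs : 0 < (splits (.bvar 1)).eval n σ ρ ↔ bad u := eval_splits hR hz hcls h1
    simp only [hE, HExpr.eval_and_pos, HExpr.eval_load, HExpr.eval_bvar, h0, h1, hBm,
      HExpr.eval_eq_pos, hcls, hs, Nat.cast_inj, Fin.val_inj]
  set p1 : HStmt := .map 16 0 (.cond (.and (.load 10 (.bvar 0)) (splits (.bvar 0)))
    (.find 1 E) (.load 14 (.bvar 0))) with hp1
  set σ1 := p1.run n σ with hσ1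
  have h16 : ∀ i : Fin n, σ1.arr 16 ((i : ℕ) : ℤ) = if i ∈ B ∧ bad i then
      (HExpr.find 1 E).eval n σ (Function.update 0 0 ((i : ℕ) : ℤ)) else ((cls i : ℕ) : ℤ) :=
    fun i => by
      rw [hσ1, hp1, HStmt.run_map_arr_self, HExpr.eval_cond, HExpr.eval_load, HExpr.eval_bvar,
        Function.update_self, hcls]
      refine if_congr ?_ rfl rfl
      rw [HExpr.eval_and_pos, HExpr.eval_load, HExpr.eval_bvar, Function.update_self, hBm]
      exact and_congr_right fun _ => eval_splits hR hz hcls rfl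
  have hex : ∀ i : Fin n, ∃ u : Fin n, σ1.arr 16 ((i : ℕ) : ℤ) = ((u : ℕ) : ℤ) ∧
      (i ∈ B → bad i → u ∈ B ∧ cls u = cls i ∧ bad u) ∧ (¬ bad i → u = cls i) := fun i => by
    rw [h16]
    split
    · rename_i hi
      -- The search succeeds since `i` itself qualifies.
      obtain ⟨u, hu, hpos⟩ := HExpr.eval_find (n := n) (σ := σ)
        (ρ := Function.update 0 0 ((i : ℕ) : ℤ)) (l := 1) (e := E) ⟨i, (hEv i i).2 ⟨hi.1, rfl, hi.2⟩⟩
      exact ⟨u, hu, fun _ _ => (hEv i u).1 hpos, fun h => absurd hi.2 h⟩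
    · rename_i hi
      exact ⟨cls i, rfl, fun h1 h2 => absurd ⟨h1, h2⟩ hi, fun _ => rfl⟩
  choose new hnew hnew1 hnew2 using hex
  set N := B.filter fun i => bad i ∧ new i = i with hN
  have hsplit : IsSplit G B cls z new N := by
    refine ⟨fun v => mem_filter, fun v _ hv => hnew2 v (not_not.2 hv), fun v hv hb => ?_,
      fun u hu v hv hbu hbv huv => ?_⟩
    · obtain ⟨h1, h2, h3⟩ := hnew1 v hv hb
      refine ⟨h1, h2, ?_⟩
      simp only [hbad, h2] at h3
      tauto
    · have : ((new u : ℕ) : ℤ) = ((new v : ℕ) : ℤ) := by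
        rw [← hnew, ← hnew, h16, h16, if_pos ⟨hu, hbu⟩, if_pos ⟨hv, hbv⟩]
        exact HExpr.eval_find_congr fun i => by rw [hEv, hEv, huv]
      exact Fin.val_injective (by exact_mod_cast this)
  have hR1 : ReadsGraph G σ1 := hR.run _ (by decide) (by decide)
  have h1A : ∀ k, k ≠ 16 → σ1.arr k = σ.arr k := fun k hk => HStmt.run_map_arr_of_ne hk
  have h1r : σ1.reg = σ.reg := rfl
  have hcls1 : ∀ i : Fin n, σ1.arr 14 ((i : ℕ) : ℤ) = ((cls i : ℕ) : ℤ) := hcls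
  set e9 : HExpr := .sum 0 (.cond (.and (.and (.load 10 (.bvar 0)) (splits (.bvar 0)))
    (.eq (.load 16 (.bvar 0)) (.bvar 0))) (.const 1) (.const 0)) with he9
  have hk : e9.eval n σ1 0 = N.card := by
    rw [he9, HExpr.eval_sum]
    have : ∀ i : Fin n, (HExpr.cond (.and (.and (.load 10 (.bvar 0)) (splits (.bvar 0)))
      (.eq (.load 16 (.bvar 0)) (.bvar 0))) (.const 1) (.const 0)).eval n σ1
      (Function.update 0 0 ((i : ℕ) : ℤ)) = if i ∈ N then 1 else 0 := fun i => by
      have hs : 0 < (splits (.bvar 0)).eval n σ1 (Function.update 0 0 ((i : ℕ) : ℤ)) ↔ bad i :=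
        eval_splits hR1 hz hcls1 rfl
      rw [HExpr.eval_cond]
      refine if_congr ?_ rfl rfl
      rw [hN, mem_filter]
      simp only [HExpr.eval_and_pos, HExpr.eval_load, HExpr.eval_bvar, Function.update_self,
        h1A 10 (by decide), hBm, hs, HExpr.eval_eq_pos, hnew, Nat.cast_inj, Fin.val_inj, and_assoc]
    rw [sum_congr rfl fun i _ => this i]
    simp
  set σ2 := σ1.setReg 9 N.card with hσ2
  set e10 : HExpr := .and (.adj (.var 3) (.var 8)) (.all 0 (.or (.not (.load 10 (.bvar 0)))
    (.or (.eq (.bvar 0) (.var 8)) (.iff (.adj (.var 3) (.bvar 0)) (.adj (.var 8) (.bvar 0))))))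
    with he10
  have hR2 : ReadsGraph G σ2 := hR1
  have h2z : σ2.reg 3 = ((z : ℕ) : ℤ) := hz
  have h2m : σ2.reg 8 = ((m : ℕ) : ℤ) := hm
  have htw : 0 < e10.eval n σ2 0 ↔ G.Adj z m ∧ ∀ t ∈ B, t ≠ m → (G.Adj z t ↔ G.Adj m t) := by
    rw [he10, HExpr.eval_and_pos, hR2.eval_adj (a := .var 3) (b := .var 8) h2z h2m, HExpr.eval_all_pos]
    refine and_congr_right fun _ => forall_congr' fun t => ?_
    have h1 : 0 < (HExpr.adj (.var 3) (.bvar 0)).eval n σ2 (Function.update 0 0 ((t : ℕ) : ℤ)) ↔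
      G.Adj z t := hR2.eval_adj h2z rfl
    have h2 : 0 < (HExpr.adj (.var 8) (.bvar 0)).eval n σ2 (Function.update 0 0 ((t : ℕ) : ℤ)) ↔
      G.Adj m t := hR2.eval_adj h2m rfl
    have h3 : σ2.arr 10 = σ.arr 10 := rfl
    simp only [HExpr.eval_or_pos, HExpr.eval_not_pos, HExpr.eval_load, HExpr.eval_bvar,
      Function.update_self, h3, hBm, HExpr.eval_eq_pos, HExpr.eval_var, h2m, Nat.cast_inj,
      Fin.val_inj, HExpr.eval_iff_pos, h1, h2]
    tauto
  set σ3 := (σ2.setReg 10 (e10.eval n σ2 0)).setReg 11 ((cls m : ℕ) : ℤ) with hσ3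
  set σ4 := (HStmt.map 14 0 (.load 16 (.bvar 0))).run n σ3 with hσ4
  have h4cls : ∀ i : Fin n, σ4.arr 14 ((i : ℕ) : ℤ) = ((new i : ℕ) : ℤ) := fun i => by
    rw [hσ4, HStmt.run_map_arr_self]
    exact hnew i
  have h4A : ∀ k, k ≠ 14 → k ≠ 16 → σ4.arr k = σ.arr k := fun k h14 h16 => by
    rw [hσ4, HStmt.run_map_arr_of_ne h14]
    exact h1A k h16
  have h4r : ∀ q, q ≠ 9 → q ≠ 10 → q ≠ 11 → σ4.reg q = σ.reg q := fun q h1 h2 h3 => by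
    simp [hσ4, hσ3, hσ2, RAMState.setReg_reg, h1, h2, h3, h1r]
  have h49 : σ4.reg 9 = N.card := by simp [hσ4, hσ3, hσ2, RAMState.setReg_reg]
  have h410 : σ4.reg 10 = e10.eval n σ2 0 := by simp [hσ4, hσ3, RAMState.setReg_reg]
  have h411 : σ4.reg 11 = ((cls m : ℕ) : ℤ) := by simp [hσ4, hσ3, RAMState.setReg_reg]
  have h43 : σ4.reg 3 = ((z : ℕ) : ℤ) := (h4r 3 (by decide) (by decide) (by decide)).trans hz
  have h41 : σ4.reg 1 = ((v₀ : ℕ) : ℤ) := (h4r 1 (by decide) (by decide) (by decide)).trans hv₀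
  set p5 : HStmt := .ite (.and (.load 11 (.var 3)) (.eq (.var 9) (.const 0)))
    (.ite (.var 10) (.seq (.store 14 (.var 3) (.var 11)) (.store 15 (.var 3) (.const 1)))
      (.seq (.store 15 (.var 1) (.add (.load 15 (.var 1)) (.const 1)))
        (.seq (.store 14 (.var 3) (.var 3)) (.store 15 (.var 3) (.const 1)))))
    (.seq (.store 14 (.var 3) (.var 3)) (.store 15 (.var 3) (.var 9))) with hp5
  set σ5 := p5.run n σ4 with hσ5
  have h5r : σ5.reg = σ4.reg := by
    funext q
    exact p5.run_reg_of_notMem (by simp [hp5, HStmt.regs]) σ4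
  have h510 : σ5.arr 10 = σ.arr 10 :=
    (p5.run_arr_of_notMem (by decide) σ4).trans (h4A 10 (by decide) (by decide))
  have hrun : addVertex.run n σ =
      (σ5.setArr 10 (σ5.reg 3) 1).setReg 8 (σ5.reg 3) := by
    rw [hσ5, hσ4, hσ3, hσ2, ← hk]
    have h8 : ((cls m : ℕ) : ℤ) = (HExpr.load 14 (.var 8)).eval n
        ((σ1.setReg 9 (e9.eval n σ1 0)).setReg 10
          (e10.eval n (σ1.setReg 9 (e9.eval n σ1 0)) 0)) 0 := by
      rw [HExpr.eval_load, ← hcls, ← hm]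
      rfl
    rw [h8]
    rfl
  have h53 : σ5.reg 3 = ((z : ℕ) : ℤ) := by rw [h5r, h43]
  rw [hrun, h53]
  set σ6 := (σ5.setArr 10 ((z : ℕ) : ℤ) 1).setReg 8 ((z : ℕ) : ℤ) with hσ6
  have h614 : σ6.arr 14 = σ5.arr 14 := by simp [hσ6, RAMState.setArr]
  have h615 : vals n σ6 15 = vals n σ5 15 := by
    funext i
    simp [vals, hσ6, RAMState.setArr]
  have h610 : bset n σ6 10 = insert z B := by
    ext i
    rw [mem_bset, hσ6, RAMState.setReg_arr, RAMState.arr_setArr, h510, mem_insert, ← hBm]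
    simp only [Nat.cast_inj, Fin.val_inj, true_and]
    split <;> simp [*]
  have h68 : σ6.reg 8 = ((z : ℕ) : ℤ) := by simp [hσ6, RAMState.setReg_reg]
  rw [h614, h615, h610, h68]
  have hAz : 0 < σ4.arr 11 ((z : ℕ) : ℤ) ↔ z ∈ A := by
    rw [h4A 11 (by decide) (by decide), ← hA, mem_bset]
  have hcond : 0 < (HExpr.and (.load 11 (.var 3)) (.eq (.var 9) (.const 0))).eval n σ4 0 ↔
      z ∈ A ∧ N.card = 0 := by
    rw [HExpr.eval_and_pos, HExpr.eval_load, HExpr.eval_var, h43, hAz, HExpr.eval_eq_pos,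
      HExpr.eval_var, h49, HExpr.eval_const, Nat.cast_eq_zero]
  -- The class of `z` can be set afterwards: `z` is not in `B`, so this does not disturb the split.
  have hoff : ∀ x : Fin n, ∀ v ∈ B, Function.update new z x v = new v := fun x v hv =>
    Function.update_of_ne (ne_of_mem_of_not_mem hv hzB) _ _
  have h4d : ∀ i : Fin n, σ4.arr 15 ((i : ℕ) : ℤ) = vals n σ 15 i := fun i => by
    rw [h4A 15 (by decide) (by decide)]; rfl
  have hvz : ∀ v ∈ B, (v : ℕ) ≠ (z : ℕ) := fun v hv e => hzB (Fin.ext e ▸ hv)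
  by_cases hc : z ∈ A ∧ N.card = 0
  · by_cases ht : G.Adj z m ∧ ∀ t ∈ B, t ≠ m → (G.Adj z t ↔ G.Adj m t)
    · have h5 : σ5 = (σ4.setArr 14 ((z : ℕ) : ℤ) ((cls m : ℕ) : ℤ)).setArr 15 ((z : ℕ) : ℤ) 1 := by
        rw [hσ5, hp5, HStmt.run_ite_pos (hcond.2 hc),
          HStmt.run_ite_pos (c := .var 10) (by rw [HExpr.eval_var, h410]; exact htw.2 ht)]
        simp only [HStmt.run_seq, HStmt.run_store, HExpr.eval_var, HExpr.eval_const, h43, h411,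
          RAMState.setArr_reg]
      refine ⟨Function.update new z (cls m), N, hsplit.congr (hoff _), fun i => ?_, rfl, rfl,
        Or.inr (Or.inl ⟨hc.1, hc.2, ht, by simp, ?_, fun v hv => ?_⟩)⟩
      · rw [h5, RAMState.arr_setArr, if_neg (by simp), RAMState.arr_setArr, Function.update_apply]
        simp only [Nat.cast_inj, Fin.val_inj, true_and, h4cls]
        split <;> rfl
      · rw [h5, vals, RAMState.arr_setArr, if_pos ⟨rfl, rfl⟩]
      · rw [h5, vals, RAMState.arr_setArr, if_neg (by simp [hvz v hv]), RAMState.arr_setArr,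
          if_neg (by simp), h4d]
    · have h5 : σ5 = ((σ4.setArr 15 ((v₀ : ℕ) : ℤ) (vals n σ 15 v₀ + 1)).setArr 14
          ((z : ℕ) : ℤ) ((z : ℕ) : ℤ)).setArr 15 ((z : ℕ) : ℤ) 1 := by
        rw [hσ5, hp5, HStmt.run_ite_pos (hcond.2 hc),
          HStmt.run_ite_neg (c := .var 10) (by rw [HExpr.eval_var, h410]; exact htw.not.2 ht)]
        simp only [HStmt.run_seq, HStmt.run_store, HExpr.eval_var, HExpr.eval_const, h43,
          RAMState.setArr_reg, HExpr.eval_add, HExpr.eval_load, h41, h4d]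
      refine ⟨Function.update new z z, N, hsplit.congr (hoff _), fun i => ?_, rfl, rfl,
        Or.inr (Or.inr ⟨hc.1, hc.2, ht, by simp, ?_, ?_, fun v hv hne => ?_⟩)⟩
      · rw [h5, RAMState.arr_setArr, if_neg (by simp), RAMState.arr_setArr, RAMState.arr_setArr,
          if_neg (c := _ ∧ ((i : ℕ) : ℤ) = ((v₀ : ℕ) : ℤ)) (by simp), Function.update_apply]
        simp only [Nat.cast_inj, Fin.val_inj, true_and, h4cls]
        split <;> rfl
      · rw [h5, vals, RAMState.arr_setArr, if_pos ⟨rfl, rfl⟩]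
      · rw [h5, vals, RAMState.arr_setArr, if_neg (by simp [hvz v₀ hv₀B]), RAMState.arr_setArr,
          if_neg (by simp), RAMState.arr_setArr, if_pos ⟨rfl, rfl⟩]
      · rw [h5, vals, RAMState.arr_setArr, if_neg (by simp [hvz v hv]), RAMState.arr_setArr,
          if_neg (by simp), RAMState.arr_setArr, if_neg (by simp [Fin.val_inj, hne]), h4d]
  · have h5 : σ5 = (σ4.setArr 14 ((z : ℕ) : ℤ) ((z : ℕ) : ℤ)).setArr 15 ((z : ℕ) : ℤ) N.card := by
      rw [hσ5, hp5, HStmt.run_ite_neg (hcond.not.2 hc)]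
      simp only [HStmt.run_seq, HStmt.run_store, HExpr.eval_var, h43, h49, RAMState.setArr_reg]
    refine ⟨Function.update new z z, N, hsplit.congr (hoff _), fun i => ?_, rfl, rfl,
      Or.inl ⟨hc, by simp, ?_, fun v hv => ?_⟩⟩
    · rw [h5, RAMState.arr_setArr, if_neg (by simp), RAMState.arr_setArr, Function.update_apply]
      simp only [Nat.cast_inj, Fin.val_inj, true_and, h4cls]
      split <;> rfl
    · rw [h5, vals, RAMState.arr_setArr, if_pos ⟨rfl, rfl⟩]
    · rw [h5, vals, RAMState.arr_setArr, if_neg (by simp [hvz v hv]), RAMState.arr_setArr,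
        if_neg (by simp), h4d]

end

/-! ### The loops that compute the weights. -/

section

variable {n : ℕ} {G : SimpleGraph (Fin n)}

/-- The invariant of the computation of weights, when the vertices of `B` have been processed,
`last` being the last one. -/
structure WeightInv (G : SimpleGraph (Fin n)) (v₀ : Fin n) (A S : Finset (Fin n)) (τ : Fin n → ℤ)
    (B : Finset (Fin n)) (last : Fin n) (cls : Fin n → Fin n) (σ : RAMState) : Prop where
  reads : ReadsGraph G σ
  center : σ.reg 1 = ((v₀ : ℕ) : ℤ)
  mask : bset n σ 11 = A
  alive : bset n σ 6 = S
  stamps : vals n σ 12 = τ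
  processed : bset n σ 10 = B
  last : σ.reg 8 = ((last : ℕ) : ℤ)
  classes : ∀ i : Fin n, σ.arr 14 ((i : ℕ) : ℤ) = ((cls i : ℕ) : ℤ)
  weights : TwinWeights G v₀ B cls (vals n σ 15)
  le : ∀ v ∈ B, vals n σ 15 v ≤ B.card

theorem WeightInv.setReg {v₀ last : Fin n} {A S B : Finset (Fin n)} {τ : Fin n → ℤ}
    {cls : Fin n → Fin n} {σ : RAMState} (h : WeightInv G v₀ A S τ B last cls σ) {r : ℕ} (z : ℤ)
    (h1 : r ≠ 1) (h8 : r ≠ 8) : WeightInv G v₀ A S τ B last cls (σ.setReg r z) where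
  reads := h.reads
  center := by rw [RAMState.setReg_reg, if_neg h1.symm, h.center]
  mask := h.mask
  alive := h.alive
  stamps := h.stamps
  processed := h.processed
  last := by rw [RAMState.setReg_reg, if_neg h8.symm, h.last]
  classes := h.classes
  weights := h.weights
  le := h.le

/-- `m` is the vertex with the least stamp above `t` in `A`, or `v₀` if there is none. -/
def IsLast (v₀ : Fin n) (A : Finset (Fin n)) (τ : Fin n → ℤ) (t : ℤ) (m : Fin n) : Prop :=
  (m = v₀ ∧ ∀ u ∈ A, ¬ t < τ u) ∨ (m ∈ A ∧ t < τ m ∧ ∀ u ∈ A, t < τ u → τ m ≤ τ u)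

/-- The branches of the program are the cases of `TwinWeights.mcsStep` and `TwinWeights.outerStep`.
Weights stay at most `|B|`: an old weight rises by at most `1`, and the new one is `1` or the number
of new representatives. This later makes multiplication by repeated addition possible. -/
theorem WeightInv.addVertex {v₀ m z : Fin n} {A S B : Finset (Fin n)} {τ : Fin n → ℤ}
    {cls : Fin n → Fin n} {σ : RAMState} (h : WeightInv G v₀ A S τ B m cls σ)
    (hA : ∀ a ∈ A, G.Adj v₀ a) (hmcs : IsMCS G A A τ) (hp : IsPerfectOrder G A τ)
    (hz : σ.reg 3 = ((z : ℕ) : ℤ)) (hzB : z ∉ B)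
    (hzA : (z ∈ A ∧ (∀ u, u ∈ B ↔ u = v₀ ∨ u ∈ A ∧ τ z < τ u) ∧ IsLast v₀ A τ (τ z) m) ∨
      (z ∉ A ∧ ¬ G.Adj v₀ z)) :
    ∃ cls', WeightInv G v₀ A S τ (insert z B) z cls' (addVertex.run n σ) := by
  obtain ⟨cls', N, hs, h14, h10, h8, hcase⟩ := addVertex_spec h.reads hz h.last h.center h.mask
    h.processed h.classes hzB h.weights.center_mem
  have harr : ∀ k, k ∉ _root_.addVertex.arrs → (_root_.addVertex.run n σ).arr k = σ.arr k :=
    fun k hk => HStmt.run_arr_of_notMem _ hk σ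
  have hNB : N ⊆ B := fun v hv => ((hs.mem_iff v).1 hv).1
  have hcard : (insert z B).card = B.card + 1 := card_insert_of_notMem hzB
  refine ⟨cls', h.reads.run _ (by decide) (by decide),
    (HStmt.run_reg_of_notMem _ (by decide) σ).trans h.center,
    (bset_congr (harr 11 (by decide))).trans h.mask, (bset_congr (harr 6 (by decide))).trans h.alive,
    ?_, h10, h8, h14, ?_, ?_⟩
  · rw [← h.stamps]
    unfold vals
    rw [harr 12 (by decide)]
  · rcases hzA with ⟨hzA, hB, hm⟩ | ⟨hzA, hnadj⟩
    · refine h.weights.mcsStep hA hmcs hp hzA hB hm hs ?_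
      rcases hcase with ⟨h1, h2⟩ | h1 | h1
      · refine Or.inl ⟨?_, h2⟩
        by_contra h0
        exact h1 ⟨hzA, by omega⟩
      · exact Or.inr (Or.inl h1.2)
      · exact Or.inr (Or.inr h1.2)
    · rcases hcase with ⟨-, h2, h3, h4⟩ | h1 | h1
      · exact h.weights.outerStep hzB hnadj hs h2 h3 h4
      exacts [absurd h1.1 hzA, absurd h1.1 hzA]
  · intro v hv
    have hle : ∀ v ∈ B, vals n σ 15 v ≤ B.card := h.le
    have hNc : N.card ≤ B.card := card_le_card hNB
    rw [hcard]
    push_cast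
    rw [mem_insert] at hv
    rcases hcase with ⟨-, -, h3, h4⟩ | ⟨-, -, -, -, h3, h4⟩ | ⟨-, -, -, -, h3, h4, h5⟩
    · rcases hv with rfl | hv
      · rw [h3]; omega
      · rw [h4 v hv]; have := hle v hv; omega
    · rcases hv with rfl | hv
      · rw [h3]; omega
      · rw [h4 v hv]; have := hle v hv; omega
    · rcases hv with rfl | hv
      · rw [h3]; omega
      · by_cases hv0 : v = v₀
        · rw [hv0, h4]; have := hle v₀ h.weights.center_mem; omega
        · rw [h5 v hv hv0]; have := hle v hv; omega


theorem twinWeights_spec {v₀ : Fin n} {A S : Finset (Fin n)} {σ : RAMState} (hR : ReadsGraph G σ)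
    (h1 : σ.reg 1 = ((v₀ : ℕ) : ℤ)) (hA : bset n σ 11 = A) (hS : bset n σ 6 = S) (hv₀ : v₀ ∈ S)
    (hAS : ∀ a, a ∈ A ↔ a ∈ S ∧ G.Adj v₀ a) (hmcs : IsMCS G A A (vals n σ 12))
    (hp : IsPerfectOrder G A (vals n σ 12)) (h0 : ∀ u ∈ A, 0 ≤ vals n σ 12 u)
    (hn : ∀ u ∈ A, vals n σ 12 u < n) :
    ∃ cls, TwinWeights G v₀ S cls (vals n (twinWeights.run n σ) 15) ∧
      ∀ v ∈ S, vals n (twinWeights.run n σ) 15 v ≤ n := by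
  set τ := vals n σ 12 with hτ
  have hA' : ∀ a ∈ A, G.Adj v₀ a := fun a ha => ((hAS a).1 ha).2
  set σ1 := (HStmt.map 10 0 (.eq (.bvar 0) (.var 1))).run n σ with hσ1
  set σ2 := (HStmt.map 14 0 (.bvar 0)).run n σ1 with hσ2
  set σ3 := (HStmt.map 15 0 (.const 1)).run n σ2 with hσ3
  set σ4 := σ3.setReg 8 ((v₀ : ℕ) : ℤ) with hσ4
  set p5 : HStmt := .seq (.assign 3 (.find 0 (.and (.load 11 (.bvar 0))
    (.eq (.load 12 (.bvar 0)) (.var 7))))) (.ite (.lt (.const (-1)) (.var 3)) addVertex .skip)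
    with hp5
  set p6 : HStmt := .ite (.and (.load 6 (.var 7)) (.not (.load 10 (.var 7))))
    (.seq (.assign 3 (.var 7)) addVertex) .skip with hp6
  set σ5 := (HStmt.iter 7 p5).run n σ4 with hσ5
  have hrun : twinWeights.run n σ = (HStmt.iter 7 p6).run n σ5 := by
    rw [hσ5, hσ4, ← h1]
    rfl
  have hstart : WeightInv G v₀ A S τ {v₀} v₀ id σ4 := by
    have hd : vals n σ4 15 = fun _ => 1 := by
      funext i
      exact HStmt.run_map_arr_self (σ := σ2) (k := 15) (l := 0) (e := .const 1) i
    refine ⟨((hR.run (.map 10 0 (.eq (.bvar 0) (.var 1))) (by decide) (by decide)).run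
      (.map 14 0 (.bvar 0)) (by decide) (by decide)).run (.map 15 0 (.const 1)) (by decide)
      (by decide), h1, hA, hS, rfl, ?_, ?_, fun i => ?_, ?_, ?_⟩
    · ext i
      have : σ4.arr 10 ((i : ℕ) : ℤ) = (HExpr.eq (.bvar 0) (.var 1)).eval n σ
          (Function.update 0 0 ((i : ℕ) : ℤ)) :=
        HStmt.run_map_arr_self (σ := σ) (k := 10) (l := 0) (e := .eq (.bvar 0) (.var 1)) i
      rw [mem_bset, this, HExpr.eval_eq_pos, HExpr.eval_bvar, HExpr.eval_var, h1,
        Function.update_self, mem_singleton, Nat.cast_inj, Fin.val_inj]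
    · simp [hσ4, RAMState.setReg_reg]
    · exact HStmt.run_map_arr_self (σ := σ1) (k := 14) (l := 0) (e := .bvar 0) i
    · rw [hd]
      exact TwinWeights.center v₀
    · rw [hd]
      simp
  -- The loop runs through the stamps rather than the vertices, downwards, which is the order of the
  -- search. A stamp that is not in use leaves everything unchanged.
  have hphase1 := HStmt.iter_induction (n := n) (i := 7) (p := p5) (σ := σ4)
    (fun m s => ∃ last cls, WeightInv G v₀ A S τ (insert v₀ (A.filter fun u => (m : ℤ) ≤ τ u))
      last cls s ∧ IsLast v₀ A τ ((m : ℤ) - 1) last) ?_ ?_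
  · rw [← hσ5] at hphase1
    obtain ⟨last, cls, hinv, -⟩ := hphase1
    have hBA : insert v₀ (A.filter fun u => ((0 : ℕ) : ℤ) ≤ τ u) = insert v₀ A := by
      rw [filter_true_of_mem]
      exact_mod_cast h0
    rw [hBA] at hinv
    -- The second loop runs through all vertex numbers and skips those that are not in `S` or
    -- already processed.
    have hphase2 := HStmt.iter_induction (n := n) (i := 7) (p := p6) (σ := σ5)
      (fun m s => ∃ B last cls, WeightInv G v₀ A S τ B last cls s ∧ insert v₀ A ⊆ B ∧ B ⊆ S ∧
        ∀ v ∈ S, m ≤ (v : ℕ) → v ∈ B)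
      ⟨_, last, cls, hinv, Subset.rfl, insert_subset hv₀ fun a ha => ((hAS a).1 ha).1,
        fun v _ hv => absurd v.2 (by omega)⟩ ?_
    · rw [← hrun] at hphase2
      obtain ⟨B, last, cls, hinv, -, hBS, hall⟩ := hphase2
      obtain rfl : B = S := hBS.antisymm fun v hv => hall v hv (Nat.zero_le _)
      refine ⟨cls, hinv.weights, fun v hv => (hinv.le v hv).trans ?_⟩
      have := card_le_univ B
      rw [Fintype.card_fin] at this
      exact_mod_cast this
    · intro m hm s ⟨B, last, cls, hs, hAB, hBS, hall⟩
      obtain ⟨v, hv⟩ : ∃ v : Fin n, (v : ℕ) = m := ⟨⟨m, hm⟩, rfl⟩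
      have hs1 := hs.setReg (r := 7) (m : ℤ) (by decide) (by decide)
      set s1 := s.setReg 7 (m : ℤ) with hs1def
      have h7 : s1.reg 7 = ((v : ℕ) : ℤ) := by rw [hs1def, RAMState.setReg_reg, if_pos rfl, hv]
      have hcond : 0 < (HExpr.and (.load 6 (.var 7)) (.not (.load 10 (.var 7)))).eval n s1 0 ↔
          v ∈ S ∧ v ∉ B := by
        rw [HExpr.eval_and_pos, HExpr.eval_not_pos, HExpr.eval_load, HExpr.eval_load,
          HExpr.eval_var, h7, ← mem_bset, ← mem_bset, hs1.alive, hs1.processed]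
      have hlt : ∀ u ∈ S, m ≤ (u : ℕ) → u ≠ v → u ∈ B := fun u hu hmu hne => by
        have : (u : ℕ) ≠ v := fun e => hne (Fin.ext e)
        exact hall u hu (by omega)
      by_cases hc : v ∈ S ∧ v ∉ B
      · rw [hp6, HStmt.run_ite_pos (hcond.2 hc), HStmt.run_seq]
        have hs2 := hs1.setReg (r := 3) ((v : ℕ) : ℤ) (by decide) (by decide)
        obtain ⟨cls', h'⟩ := hs2.addVertex hA' hmcs hp (z := v) (by simp [RAMState.setReg_reg])
          hc.2 (Or.inr ⟨fun hvA => hc.2 (hAB (mem_insert_of_mem hvA)), fun hadj => hc.2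
            (hAB (mem_insert_of_mem ((hAS v).2 ⟨hc.1, hadj⟩)))⟩)
        rw [HStmt.run_assign, HExpr.eval_var, h7]
        refine ⟨_, v, cls', h', hAB.trans (subset_insert _ _), insert_subset hc.1 hBS,
          fun u hu hmu => ?_⟩
        by_cases huv : u = v
        · rw [huv]; exact mem_insert_self _ _
        · exact mem_insert_of_mem (hlt u hu hmu huv)
      · rw [hp6, HStmt.run_ite_neg (hcond.not.2 hc), HStmt.run_skip]
        refine ⟨B, last, cls, hs1, hAB, hBS, fun u hu hmu => ?_⟩
        by_cases huv : u = v
        · subst huv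
          by_contra hnot
          exact hc ⟨hu, hnot⟩
        · exact hlt u hu hmu huv
  · have : A.filter (fun u => (n : ℤ) ≤ τ u) = ∅ :=
      filter_false_of_mem fun u hu => not_le.2 (hn u hu)
    rw [this]
    exact ⟨v₀, id, hstart, Or.inl ⟨rfl, fun u hu h => by have := hn u hu; omega⟩⟩
  · intro m hm s ⟨last, cls, hs, hlast⟩
    have hs1 := hs.setReg (r := 7) (m : ℤ) (by decide) (by decide)
    set s1 := s.setReg 7 (m : ℤ) with hs1def
    have h7 : s1.reg 7 = m := by rw [hs1def, RAMState.setReg_reg, if_pos rfl]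
    set e3 : HExpr := .and (.load 11 (.bvar 0)) (.eq (.load 12 (.bvar 0)) (.var 7)) with he3
    have hv3 : ∀ i : Fin n, 0 < e3.eval n s1 (Function.update 0 0 ((i : ℕ) : ℤ)) ↔
        i ∈ A ∧ τ i = m := fun i => by
      rw [he3, HExpr.eval_and_pos, HExpr.eval_eq_pos, HExpr.eval_load, HExpr.eval_load,
        HExpr.eval_bvar, Function.update_self, HExpr.eval_var, h7, ← mem_bset, hs1.mask,
        ← hs1.stamps]
      rfl
    rw [hp5, HStmt.run_seq, HStmt.run_assign]
    have hcast : (((m + 1 : ℕ) : ℤ)) - 1 = m := by push_cast; ring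
    rw [hcast] at hlast
    rcases HExpr.eval_find_cases n s1 0 0 e3 with ⟨z, hz, hpos⟩ | ⟨hneg, hnone⟩
    · obtain ⟨hzA, hzm⟩ := (hv3 z).1 hpos
      rw [hz]
      have hs2 := hs1.setReg (r := 3) ((z : ℕ) : ℤ) (by decide) (by decide)
      set s2 := s1.setReg 3 ((z : ℕ) : ℤ) with hs2def
      have h3 : s2.reg 3 = ((z : ℕ) : ℤ) := by rw [hs2def, RAMState.setReg_reg, if_pos rfl]
      rw [HStmt.run_ite_pos (by rw [HExpr.eval_lt_pos, HExpr.eval_var, h3, HExpr.eval_const]; omega)]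
      have hzv : z ≠ v₀ := fun e => (hA' z hzA).ne e.symm
      obtain ⟨cls', h'⟩ := hs2.addVertex hA' hmcs hp h3 (by
          rw [mem_insert, mem_filter, hzm]
          rintro (h | h)
          exacts [hzv h, by have := h.2; push_cast at this; omega])
        (Or.inl ⟨hzA, fun u => by
          rw [mem_insert, mem_filter, hzm]
          push_cast
          rw [Int.add_one_le_iff], hzm.symm ▸ hlast⟩)
      refine ⟨z, cls', ?_, Or.inr ⟨hzA, by omega, fun u _ hu => by omega⟩⟩
      convert h' using 1
      ext u
      simp only [mem_insert, mem_filter]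
      by_cases huz : u = z
      · subst huz; simp [hzA, hzm]
      · have : u ∈ A → τ u ≠ m := fun huA e => huz (hmcs.injOn huA hzA (e.trans hzm.symm))
        simp only [huz, false_or]
        refine or_congr_right (and_congr_right fun huA => ?_)
        have := this huA
        push_cast
        omega
    · have hs2 := hs1.setReg (r := 3) (-1) (by decide) (by decide)
      rw [hneg, HStmt.run_ite_neg (by
        rw [HExpr.eval_lt_pos, HExpr.eval_var, RAMState.setReg_reg, if_pos rfl]; simp),
        HStmt.run_skip]
      have hne : ∀ u ∈ A, τ u ≠ m := fun u hu e => hnone u ((hv3 u).2 ⟨hu, e⟩)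
      have heq : ∀ u ∈ A, ((m : ℤ) - 1 < τ u ↔ (m : ℤ) < τ u) := fun u hu => by
        have := hne u hu
        omega
      refine ⟨last, cls, ?_, ?_⟩
      · convert hs2 using 2
        refine filter_congr fun u hu => ?_
        have := hne u hu
        push_cast
        omega
      · rcases hlast with ⟨h1, h2⟩ | ⟨h1, h2, h3⟩
        · exact Or.inl ⟨h1, fun u hu h => h2 u hu ((heq u hu).1 h)⟩
        · exact Or.inr ⟨h1, (heq _ h1).2 h2, fun u hu h => h3 u hu ((heq u hu).1 h)⟩

/-- The flag of the search in the neighbourhood of `v₀` decides between the weights of a hole with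
its centre and the weights on twin classes. Both are at most `n`. -/
theorem goodWeights_spec {S : Finset (Fin n)} {σ : RAMState} (hR : ReadsGraph G σ)
    (hS : bset n σ 6 = S) (hcl : ¬ ClusterOn G S) (htw : ∀ u u', ¬ AreTrueTwins G S u u') :
    IsGoodIn 2 G S S (fun v => (vals n (goodWeights.run n σ) 15 v : ℚ)) ∧
      ∀ v ∈ S, 0 ≤ vals n (goodWeights.run n σ) 15 v ∧ vals n (goodWeights.run n σ) 15 v ≤ n := by
  have hmemS : ∀ i : Fin n, 0 < σ.arr 6 ((i : ℕ) : ℤ) ↔ i ∈ S := fun i => by rw [← hS, mem_bset]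
  obtain ⟨v₀, hv, hv₀⟩ : ∃ v₀ : Fin n, (HExpr.find 0 (.load 6 (.bvar 0))).eval n σ 0 =
      ((v₀ : ℕ) : ℤ) ∧ v₀ ∈ S := by
    obtain ⟨w, hw⟩ : S.Nonempty := by
      by_contra hne
      rw [not_nonempty_iff_eq_empty] at hne
      subst hne
      exact hcl fun u hu => by simp at hu
    obtain ⟨i, hi, hpos⟩ := HExpr.eval_find (n := n) (σ := σ) (ρ := 0) (l := 0)
      (e := .load 6 (.bvar 0)) ⟨w, (hmemS w).2 hw⟩
    exact ⟨i, hi, (hmemS i).1 hpos⟩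
  set σ1 := σ.setReg 1 ((v₀ : ℕ) : ℤ) with hσ1
  have h11 : σ1.reg 1 = ((v₀ : ℕ) : ℤ) := by rw [hσ1, RAMState.setReg_reg, if_pos rfl]
  have hR1 : ReadsGraph G σ1 := hR
  set p2 : HStmt := .map 11 0 (.and (.load 6 (.bvar 0)) (.adj (.var 1) (.bvar 0))) with hp2
  set σ2 := p2.run n σ1 with hσ2
  have hR2 : ReadsGraph G σ2 := hR1.run _ (by decide) (by decide)
  have hA : ∀ a, a ∈ bset n σ2 11 ↔ a ∈ S ∧ G.Adj v₀ a := fun a => by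
    rw [mem_bset, hσ2, hp2, HStmt.run_map_arr_self, HExpr.eval_and_pos,
      hR1.eval_adj (a := .var 1) (b := .bvar 0) h11 rfl, HExpr.eval_load, HExpr.eval_bvar,
      Function.update_self]
    exact and_congr_left fun _ => hmemS a
  set A := bset n σ2 11 with hAdef
  set σ3 := mcs.run n σ2 with hσ3
  have hR3 : ReadsGraph G σ3 := hR2.run _ (by decide) (by decide)
  have hA3 : bset n σ3 11 = A := bset_congr (mcs.run_arr_of_notMem (by decide) σ2)
  have hS3 : bset n σ3 6 = S := (bset_congr (mcs.run_arr_of_notMem (by decide) σ2)).trans hS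
  have h31 : σ3.reg 1 = ((v₀ : ℕ) : ℤ) := (mcs.run_reg_of_notMem (by decide) σ2).trans h11
  obtain ⟨hm1, hm2, hm3, hm4, hm5⟩ := mcs_spec hR2 hAdef.symm
  rw [← hσ3] at hm1 hm2 hm3 hm4 hm5
  set p4 : HStmt := .map 15 0 (.cond (.load 11 (.bvar 0)) (.const 1) (.cond (.eq (.bvar 0) (.var 1))
      (.sub (.sum 1 (.cond (.load 11 (.bvar 1)) (.const 1) (.const 0))) (.const 4)) (.const 0)))
    with hp4
  have hrun : goodWeights.run n σ =
      (HStmt.ite (.var 5) (.seq findHole p4) twinWeights).run n σ3 := by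
    rw [hσ3, hσ2, hσ1, ← hv]
    rfl
  rw [hrun]
  by_cases hf : 0 < σ3.reg 5
  · rw [HStmt.run_ite_pos (c := .var 5) hf, HStmt.run_seq]
    obtain ⟨hsub, hhole⟩ := findHole_spec hR3 hA3 (hm5.1 hf)
    set σ4 := findHole.run n σ3 with hσ4
    set T := bset n σ4 11 with hT
    have h41 : σ4.reg 1 = ((v₀ : ℕ) : ℤ) := (findHole.run_reg_of_notMem (by decide) σ3).trans h31
    have hval : ∀ i, vals n (p4.run n σ4) 15 i = if i ∈ T then 1 else if i = v₀ then
        (T.card : ℤ) - 4 else 0 := fun i => by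
      rw [vals, hp4, HStmt.run_map_arr_self, HExpr.eval_cond, HExpr.eval_cond]
      refine if_congr ?_ rfl (if_congr ?_ ?_ rfl)
      · rw [hT, mem_bset]; rfl
      · rw [HExpr.eval_eq_pos, HExpr.eval_bvar, HExpr.eval_var, h41, Function.update_self,
          Nat.cast_inj, Fin.val_inj]
      · rw [HExpr.eval_sub, HExpr.eval_sum, HExpr.eval_const]
        congr 1
        rw [hT, bset, card_filter]
        push_cast
        rfl
    have hTS : ∀ v ∈ T, v ∈ S ∧ G.Adj v₀ v := fun v hv => (hA v).1 (hsub hv)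
    have hv₀T : v₀ ∉ T := fun hc => (hTS _ hc).2.ne rfl
    have h4 := hhole.four_le_card
    have hTn : T.card ≤ n := by simpa using card_le_univ T
    refine ⟨hhole.isGoodIn hv₀ (fun v hv => (hTS v hv).1) (fun v hv => (hTS v hv).2)
      (fun v hv => by rw [hval, if_pos hv]) (by rw [hval, if_neg hv₀T, if_pos rfl])
      (fun v _ h1 h2 => by rw [hval, if_neg h1, if_neg h2]), fun v _ => ?_⟩
    rw [hval]
    split_ifs <;> omega
  · rw [HStmt.run_ite_neg (c := .var 5) hf]
    obtain ⟨cls, hw, hle⟩ := twinWeights_spec hR3 h31 hA3 hS3 hv₀ hA hm1 (hm4 hf)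
      (fun u hu => (hm2 u).1 hu) hm3
    exact ⟨hw.isGoodIn htw, fun v hv => ⟨hw.nonneg v hv, hle v hv⟩⟩

end

/-! ## The local-ratio algorithm on the machine -/

section LocalRatio

variable {V : Type*} [DecidableEq V] {G : SimpleGraph V}

/-- The possible results depend only on the costs of the vertices, up to a common factor. -/
theorem LocalRatio.scale {S X : Finset V} {c : V → ℚ} (h : LocalRatio G S c X) :
    ∀ {c' : V → ℚ} {K : ℚ}, 0 < K → (∀ v ∈ S, c' v = K * c v) → LocalRatio G S c' X := by
  induction h with
  | cluster S c hcl => exact fun _ _ => .cluster S _ hcl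
  | zero_keep S c X u hcl hu hcu _ hX ih =>
    intro c' K hK hc
    exact .zero_keep S c' X u hcl hu (by rw [hc u hu, hcu, mul_zero])
      (ih hK fun v hv => hc v (mem_of_mem_erase hv)) hX
  | zero_add S c X u hcl hu hcu _ hX ih =>
    intro c' K hK hc
    exact .zero_add S c' X u hcl hu (by rw [hc u hu, hcu, mul_zero])
      (ih hK fun v hv => hc v (mem_of_mem_erase hv)) hX
  | twins_keep S c X u u' hcl hz htw _ hX ih =>
    intro c' K hK hc
    refine .twins_keep S c' X u u' hcl (fun v hv => ?_) htw (ih hK fun v hv => ?_) hX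
    · rw [hc v hv]; exact mul_ne_zero hK.ne' (hz v hv)
    · rw [Function.update_apply, Function.update_apply, hc u htw.1, hc u' htw.2.1,
        hc v (mem_of_mem_erase hv)]
      split_ifs <;> ring
  | twins_add S c X u u' hcl hz htw _ hX ih =>
    intro c' K hK hc
    refine .twins_add S c' X u u' hcl (fun v hv => ?_) htw (ih hK fun v hv => ?_) hX
    · rw [hc v hv]; exact mul_ne_zero hK.ne' (hz v hv)
    · rw [Function.update_apply, Function.update_apply, hc u htw.1, hc u' htw.2.1,
        hc v (mem_of_mem_erase hv)]
      split_ifs <;> ring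
  | subtract S c X T d lam hcl hz htw hgood hlam _ ih =>
    intro c' K hK hc
    have hval : ∀ v ∈ T, ∀ μ, c' v - K * μ * d v = K * (c v - μ * d v) := fun v hv μ => by
      rw [hc v (hgood.1 hv)]; ring
    refine .subtract S c' X T d (K * lam) hcl (fun v hv => ?_) htw hgood ⟨fun v hv => ?_,
      fun μ hμ => ?_⟩ (ih hK fun v hv => ?_)
    · rw [hc v hv]; exact mul_ne_zero hK.ne' (hz v hv)
    · rw [hval v hv]; exact mul_nonneg hK.le (hlam.1 v hv)
    · have h1 : μ / K ∈ {μ : ℚ | ∀ v ∈ T, 0 ≤ c v - μ * d v} := fun v hv => by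
        have := hμ v hv
        rw [← mul_div_cancel₀ μ hK.ne', hval v hv] at this
        exact (mul_nonneg_iff_of_pos_left hK).1 this
      have := hlam.2 h1
      rwa [div_le_iff₀' hK] at this
    · dsimp only
      split_ifs with hvT
      · exact hval v hvT lam
      · exact hc v hv

theorem LocalRatio.subset {S X : Finset V} {c : V → ℚ} (h : LocalRatio G S c X) : X ⊆ S := by
  induction h with
  | cluster => exact empty_subset _
  | zero_keep S c X u _ _ _ _ _ ih => exact ih.trans (erase_subset _ _)
  | zero_add S c X u _ hu _ _ _ ih => exact insert_subset hu (ih.trans (erase_subset _ _))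
  | twins_keep S c X u u' _ _ _ _ _ ih => exact ih.trans (erase_subset _ _)
  | twins_add S c X u u' _ _ htw _ _ ih =>
    exact insert_subset htw.2.1 (ih.trans (erase_subset _ _))
  | subtract _ _ _ _ _ _ _ _ _ _ _ _ ih => exact ih

/-- Subtract the largest possible multiple of a good integral cost function, scaling the costs so
that they remain integral. -/
theorem LocalRatio.of_subtract {S X : Finset V} {C C' d : V → ℤ} {x : V}
    (hcl : ¬ ClusterOn G S) (hC : ∀ v ∈ S, 0 < C v) (htw : ∀ u u', ¬ AreTrueTwins G S u u')
    (hgood : IsGoodIn 2 G S S fun v => (d v : ℚ)) (hx : x ∈ S) (hdx : 0 < d x)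
    (hmin : ∀ w ∈ S, 0 < d w → C x * d w ≤ C w * d x)
    (hC' : ∀ v ∈ S, C' v = C v * d x - C x * d v) (h : LocalRatio G S (fun v => (C' v : ℚ)) X) :
    LocalRatio G S (fun v => (C v : ℚ)) X := by
  have hdx' : (0 : ℚ) < d x := by exact_mod_cast hdx
  refine .subtract S _ X S (fun v => (d v : ℚ)) _
    ((isClusterGraph_induce_iff _ _).not.2 hcl)
    (fun v hv => by have := hC v hv; exact_mod_cast this.ne') htw hgood
    (isGreatest_ratio (v := x) hgood.2.1 (fun v hv => by have := hC v hv; exact_mod_cast this.le)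
      hx hdx' fun w hw hdw => ?_) (h.scale (inv_pos.2 hdx') fun v hv => ?_)
  · have := hmin w hw (by exact_mod_cast hdw)
    exact_mod_cast this
  · rw [if_pos hv, hC' v hv]
    push_cast
    field_simp

end LocalRatio

/-! ### The program text of the local-ratio algorithm. -/

open HExpr HStmt in
/-- Subtract from the costs in array `5` a multiple of the weights in array `15`. -/
def subtractWeights : HStmt :=
  seq (assign 12 (find 0 (and (and (load 6 (bvar 0)) (load 15 (bvar 0)))
    (all 1 (or (not (and (load 6 (bvar 1)) (load 15 (bvar 1))))
      (not (lt (times 2 (load 5 (bvar 1)) (load 15 (bvar 0)))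
        (times 2 (load 5 (bvar 0)) (load 15 (bvar 1))))))))))
  (seq (assign 18 (load 5 (var 12)))
  (seq (assign 19 (load 15 (var 12)))
  (map 5 0 (sub (times 1 (load 5 (bvar 0)) (var 19)) (times 1 (var 18) (load 15 (bvar 0)))))))

open HExpr in
/-- The set of vertices that satisfies `mem` is not a cluster graph. -/
def hasPath (mem : HExpr → HExpr) : HExpr :=
  any 0 (any 1 (any 2 (and (and (mem (bvar 0)) (and (mem (bvar 1)) (mem (bvar 2))))
    (and (and (adj (bvar 0) (bvar 1)) (adj (bvar 1) (bvar 2)))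
      (and (not (eq (bvar 0) (bvar 2))) (not (adj (bvar 0) (bvar 2))))))))

open HExpr in
/-- `a` and `b` are true twins among the vertices of array `6`. -/
def areTwins (a b : HExpr) : HExpr :=
  and (and (load 6 a) (load 6 b)) (and (adj a b) (all 2 (or (not (load 6 (bvar 2)))
    (or (eq (bvar 2) a) (or (eq (bvar 2) b) (iff (adj a (bvar 2)) (adj b (bvar 2))))))))

open HExpr in
/-- `a` is a vertex of array `6` of cost `0`. -/
def isZero (a : HExpr) : HExpr := and (load 6 a) (eq (load 5 a) (const 0))

open HExpr HStmt in
/-- Delete the vertex `v` and record how to undo this in position `var 0` of arrays `7`, `8`,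
`9`. -/
def deleteVertex (k : ℤ) (v u : HExpr) : HStmt :=
  seq (store 7 (var 0) (const k)) (seq (store 8 (var 0) v) (seq (store 9 (var 0) u)
    (store 6 v (const 0))))

open HExpr HStmt in
/-- One step of the recursion: after a subtraction, if necessary, delete a vertex of cost `0` or
one of two twins. -/
def reduceStep : HStmt :=
  ite (hasPath (load 6))
    (seq (ite (or (any 0 (isZero (bvar 0))) (any 0 (any 1 (areTwins (bvar 0) (bvar 1))))) skip
      (seq goodWeights subtractWeights))
    (seq (assign 13 (find 0 (isZero (bvar 0))))
    (ite (lt (const (-1)) (var 13)) (deleteVertex 1 (var 13) (var 13))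
      (seq (assign 13 (find 0 (any 1 (areTwins (bvar 0) (bvar 1)))))
      (seq (assign 14 (find 0 (areTwins (var 13) (bvar 0))))
      (seq (store 5 (var 13) (add (load 5 (var 13)) (load 5 (var 14))))
      (deleteVertex 2 (var 14) (var 13))))))))
    (store 7 (var 0) (const 0))

open HExpr HStmt in
/-- Undo one deletion, extending the solution in array `3`. -/
def undoStep : HStmt :=
  seq (assign 17 (sub (sub size (const 1)) (var 16)))
  (ite (eq (load 7 (var 17)) (const 1))
    (seq (store 6 (load 8 (var 17)) (const 1))
      (ite (hasPath fun e => and (load 6 e) (not (load 3 e))) (store 3 (load 8 (var 17)) (const 1))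
        skip))
    (ite (eq (load 7 (var 17)) (const 2))
      (seq (store 6 (load 8 (var 17)) (const 1))
        (ite (load 3 (load 9 (var 17))) (store 3 (load 8 (var 17)) (const 1)) skip))
      skip))

open HExpr HStmt in
/-- Set up the adjacency matrix, integral costs and the vertex set. -/
def setUp : HStmt :=
  seq (map 4 0 (sum 1 (bvar 0)))
  (seq (map 5 0 (load 1 (bvar 0)))
  (seq (HStmt.iter 16 (map 5 0 (cond (eq (bvar 0) (var 16)) (load 5 (bvar 0))
    (scale (load 5 (bvar 0)) (var 16)))))
  (map 6 0 (const 1))))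

/-- The local-ratio algorithm. -/
def localRatioProg : HStmt :=
  .seq setUp (.seq (.iter 0 reduceStep) (.iter 16 undoStep))

theorem localRatioProg_keepsTwo : localRatioProg.keepsTwo = true := by decide

theorem localRatioProg_depth : localRatioProg.depth = 4 := by decide

section

variable {n : ℕ} {G : SimpleGraph (Fin n)}

/-- Ratios are compared after cross-multiplication, and the costs are scaled by the weight of the
minimising vertex, so no division occurs. All factors are weights between `0` and `n`, as
`HExpr.eval_times` requires. -/
theorem subtractWeights_spec {S : Finset (Fin n)} {σ : RAMState} (hS : bset n σ 6 = S)
    (hd : ∀ v ∈ S, 0 ≤ vals n σ 15 v ∧ vals n σ 15 v ≤ n)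
    (hne : ∃ v ∈ S, vals n σ 15 v ≠ 0) :
    ∃ x ∈ S, 0 < vals n σ 15 x ∧
      (∀ w ∈ S, 0 < vals n σ 15 w →
        vals n σ 5 x * vals n σ 15 w ≤ vals n σ 5 w * vals n σ 15 x) ∧
      ∀ v ∈ S, vals n (subtractWeights.run n σ) 5 v =
        vals n σ 5 v * vals n σ 15 x - vals n σ 5 x * vals n σ 15 v := by
  have hmemS : ∀ i : Fin n, 0 < σ.arr 6 ((i : ℕ) : ℤ) ↔ i ∈ S := fun i => by rw [← hS, mem_bset]
  set e : HExpr := .and (.and (.load 6 (.bvar 0)) (.load 15 (.bvar 0)))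
    (.all 1 (.or (.not (.and (.load 6 (.bvar 1)) (.load 15 (.bvar 1))))
      (.not (.lt (.times 2 (.load 5 (.bvar 1)) (.load 15 (.bvar 0)))
        (.times 2 (.load 5 (.bvar 0)) (.load 15 (.bvar 1))))))) with he
  have hev : ∀ x : Fin n, 0 < e.eval n σ (Function.update 0 0 ((x : ℕ) : ℤ)) ↔
      (x ∈ S ∧ 0 < vals n σ 15 x) ∧ ∀ w ∈ S, 0 < vals n σ 15 w →
        vals n σ 5 x * vals n σ 15 w ≤ vals n σ 5 w * vals n σ 15 x := fun x => by
    rw [he, HExpr.eval_and_pos, HExpr.eval_and_pos, HExpr.eval_all_pos]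
    simp only [HExpr.eval_load, HExpr.eval_bvar, Function.update_self, hmemS]
    refine and_congr_right fun hx => forall_congr' fun w => ?_
    have h1 : (Function.update (Function.update (0 : ℕ → ℤ) 0 ((x : ℕ) : ℤ)) 1 ((w : ℕ) : ℤ)) 1 =
      ((w : ℕ) : ℤ) := rfl
    rw [HExpr.eval_or_pos, HExpr.eval_not_pos, HExpr.eval_and_pos, HExpr.eval_not_pos,
      HExpr.eval_lt_pos, HExpr.eval_load, HExpr.eval_load, HExpr.eval_bvar, h1, hmemS]
    have hxd := hd x hx.1
    by_cases hw : w ∈ S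
    · have hwd := hd w hw
      rw [HExpr.eval_times (x := vals n σ 5 w) (y := vals n σ 15 x) (fun _ => rfl) (fun _ => rfl)
          hxd.1 hxd.2, HExpr.eval_times (x := vals n σ 5 x) (y := vals n σ 15 w) (fun _ => rfl)
          (fun _ => rfl) hwd.1 hwd.2]
      rw [not_lt, imp_iff_not_or, imp_iff_not_or]
      change ¬ (_ ∧ 0 < vals n σ 15 w) ∨ _ ↔ _
      tauto
    · simp [hw]
  obtain ⟨y, hy, hdy, hymin⟩ := exists_min_ratio (T := S) (c := fun v => (vals n σ 5 v : ℚ))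
    (d := fun v => (vals n σ 15 v : ℚ)) (fun v hv => by exact_mod_cast (hd v hv).1) (by
      obtain ⟨v, hv, h0⟩ := hne
      exact ⟨v, hv, by exact_mod_cast h0⟩)
  obtain ⟨x, hx, hpos⟩ := HExpr.eval_find (n := n) (σ := σ) (ρ := 0) (l := 0) (e := e)
    ⟨y, (hev y).2 ⟨⟨hy, by exact_mod_cast hdy⟩, fun w hw h0 => by
      have := hymin w hw (by exact_mod_cast h0)
      exact_mod_cast this⟩⟩
  obtain ⟨⟨hxS, hdx⟩, hmin⟩ := (hev x).1 hpos
  refine ⟨x, hxS, hdx, hmin, fun v hv => ?_⟩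
  set σ1 := ((σ.setReg 12 ((x : ℕ) : ℤ)).setReg 18 (vals n σ 5 x)).setReg 19 (vals n σ 15 x)
    with hσ1
  have hrun : subtractWeights.run n σ = (HStmt.map 5 0 (.sub
      (.times 1 (.load 5 (.bvar 0)) (.var 19)) (.times 1 (.var 18) (.load 15 (.bvar 0))))).run n
      σ1 := by
    have h1 : vals n σ 5 x = (HExpr.load 5 (.var 12)).eval n (σ.setReg 12 ((x : ℕ) : ℤ)) 0 := by
      simp [vals, RAMState.setReg_reg]
    have h2 : vals n σ 15 x = (HExpr.load 15 (.var 12)).eval n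
        ((σ.setReg 12 ((x : ℕ) : ℤ)).setReg 18 (vals n σ 5 x)) 0 := by
      simp [vals, RAMState.setReg_reg]
    rw [hσ1, h2, h1, ← hx]
    rfl
  rw [hrun, vals, HStmt.run_map_arr_self, HExpr.eval_sub,
    HExpr.eval_times (x := vals n σ 5 v) (y := vals n σ 15 x) (fun _ => rfl)
      (fun _ => by simp [hσ1, RAMState.setReg_reg]) (hd x hxS).1 (hd x hxS).2,
    HExpr.eval_times (x := vals n σ 5 x) (y := vals n σ 15 v)
      (fun _ => by simp [hσ1, RAMState.setReg_reg]) (fun _ => rfl) (hd v hv).1 (hd v hv).2]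

theorem hasPath_pos {σ : RAMState} (hR : ReadsGraph G σ) {ρ : ℕ → ℤ} {mem : HExpr → HExpr}
    {S : Finset (Fin n)} (hmem : ∀ (l : ℕ) (ρ : ℕ → ℤ) (i : Fin n), ρ l = ((i : ℕ) : ℤ) →
      (0 < (mem (.bvar l)).eval n σ ρ ↔ i ∈ S)) :
    0 < (hasPath mem).eval n σ ρ ↔ ¬ ClusterOn G S := by
  unfold ClusterOn
  push Not
  simp only [hasPath, HExpr.eval_any_pos]
  refine exists_congr fun u => ?_
  rw [← exists_and_left]
  refine exists_congr fun v => ?_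
  rw [← exists_and_left, ← exists_and_left]
  refine exists_congr fun w => ?_
  set ρ' := Function.update (Function.update (Function.update ρ 0 ((u : ℕ) : ℤ)) 1 ((v : ℕ) : ℤ))
    2 ((w : ℕ) : ℤ) with hρ
  have h0 : ρ' 0 = ((u : ℕ) : ℤ) := by simp [hρ]
  have h1 : ρ' 1 = ((v : ℕ) : ℤ) := by simp [hρ]
  have h2 : ρ' 2 = ((w : ℕ) : ℤ) := by simp [hρ]
  simp only [HExpr.eval_and_pos, HExpr.eval_not_pos, HExpr.eval_eq_pos, hmem 0 _ u h0,
    hmem 1 _ v h1, hmem 2 _ w h2, hR.eval_adj (ρ := ρ') (a := .bvar 0) (b := .bvar 1) h0 h1,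
    hR.eval_adj (ρ := ρ') (a := .bvar 1) (b := .bvar 2) h1 h2, HExpr.eval_bvar, h0, h2, Nat.cast_inj,
    Fin.val_inj, hR.eval_adj (ρ := ρ') (a := .bvar 0) (b := .bvar 2) h0 h2]
  tauto

theorem areTwins_pos {σ : RAMState} (hR : ReadsGraph G σ) {ρ : ℕ → ℤ} {a b : HExpr}
    {u u' : Fin n} (ha : ∀ z, a.eval n σ (Function.update ρ 2 z) = ((u : ℕ) : ℤ))
    (hb : ∀ z, b.eval n σ (Function.update ρ 2 z) = ((u' : ℕ) : ℤ)) :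
    0 < (areTwins a b).eval n σ ρ ↔ AreTrueTwins G (bset n σ 6) u u' := by
  have ha' := ha (ρ 2)
  have hb' := hb (ρ 2)
  rw [Function.update_eq_self] at ha' hb'
  unfold areTwins AreTrueTwins
  simp only [HExpr.eval_and_pos, HExpr.eval_load, ha', hb', hR.eval_adj ha' hb', mem_bset,
    HExpr.eval_all_pos, HExpr.eval_or_pos, HExpr.eval_not_pos, HExpr.eval_eq_pos, HExpr.eval_bvar,
    Function.update_self, ha, hb, HExpr.eval_iff_pos, Nat.cast_inj, Fin.val_inj, and_assoc]
  refine and_congr_right fun _ => and_congr_right fun _ => and_congr_right fun _ =>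
    forall_congr' fun v => ?_
  rw [hR.eval_adj (ha _) (b := .bvar 2) (v := v) (by simp),
    hR.eval_adj (hb _) (b := .bvar 2) (v := v) (by simp)]
  tauto

theorem isZero_pos {σ : RAMState} {ρ : ℕ → ℤ} {a : HExpr} {u : Fin n}
    (ha : a.eval n σ ρ = ((u : ℕ) : ℤ)) :
    0 < (isZero a).eval n σ ρ ↔ u ∈ bset n σ 6 ∧ vals n σ 5 u = 0 := by
  rw [isZero, HExpr.eval_and_pos, HExpr.eval_eq_pos, HExpr.eval_load, HExpr.eval_load, ha,
    mem_bset]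
  rfl

end

/-! ### One step of the recursion. -/

section

variable {n : ℕ} {G : SimpleGraph (Fin n)}

open Classical in
/-- `(S, C)` arises from `(S', C')` by undoing the deletion of `v`, where `k = 1` if `v` had cost
`0` and `k = 2` if `v` was a twin of `u`; solutions are extended accordingly. -/
def IsUndo (G : SimpleGraph (Fin n)) (k v u : ℤ) (S S' : Finset (Fin n)) (C C' : Fin n → ℤ) :
    Prop :=
  (k = 0 ∧ S' = S ∧ C' = C) ∨
  (k = 1 ∧ ∃ x : Fin n, v = ((x : ℕ) : ℤ) ∧ x ∈ S ∧ S' = S.erase x ∧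
    ∀ X, LocalRatio G S' (fun w => (C' w : ℚ)) X →
      LocalRatio G S (fun w => (C w : ℚ)) (if IsHittingSet G S X then X else insert x X)) ∨
  (k = 2 ∧ ∃ x y : Fin n, v = ((x : ℕ) : ℤ) ∧ u = ((y : ℕ) : ℤ) ∧ x ∈ S ∧ S' = S.erase x ∧
    ∀ X, LocalRatio G S' (fun w => (C' w : ℚ)) X →
      LocalRatio G S (fun w => (C w : ℚ)) (if y ∈ X then insert x X else X))

/-- Afterwards there is a zero-cost vertex or a pair of twins, so the same pass can delete a vertex,
and `n` passes are enough. -/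
theorem reducePrepare_spec {S : Finset (Fin n)} {σ : RAMState} (hR : ReadsGraph G σ)
    (hS : bset n σ 6 = S) (hC : ∀ v ∈ S, 0 ≤ vals n σ 5 v) (hcl : ¬ ClusterOn G S) :
    ∃ σ' : RAMState, (HStmt.ite (.or (.any 0 (isZero (.bvar 0)))
        (.any 0 (.any 1 (areTwins (.bvar 0) (.bvar 1))))) .skip
        (.seq goodWeights subtractWeights)).run n σ = σ' ∧
      ReadsGraph G σ' ∧ bset n σ' 6 = S ∧ (∀ v ∈ S, 0 ≤ vals n σ' 5 v) ∧ σ'.reg 0 = σ.reg 0 ∧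
      σ'.arr 7 = σ.arr 7 ∧ σ'.arr 8 = σ.arr 8 ∧ σ'.arr 9 = σ.arr 9 ∧
      (∀ X, LocalRatio G S (fun w => (vals n σ' 5 w : ℚ)) X →
        LocalRatio G S (fun w => (vals n σ 5 w : ℚ)) X) ∧
      ((∃ u ∈ S, vals n σ' 5 u = 0) ∨ ∃ u u', AreTrueTwins G S u u') := by
  have hcond : 0 < (HExpr.or (.any 0 (isZero (.bvar 0)))
      (.any 0 (.any 1 (areTwins (.bvar 0) (.bvar 1))))).eval n σ 0 ↔
      (∃ u ∈ S, vals n σ 5 u = 0) ∨ ∃ u u', AreTrueTwins G S u u' := by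
    rw [HExpr.eval_or_pos, HExpr.eval_any_pos, HExpr.eval_any_pos]
    refine or_congr (exists_congr fun u => ?_) (exists_congr fun u => ?_)
    · rw [isZero_pos (u := u) (by simp), hS]
    · rw [HExpr.eval_any_pos]
      refine exists_congr fun u' => ?_
      rw [areTwins_pos hR (u := u) (u' := u') (fun z => by simp) (fun z => by simp), hS]
  by_cases hc : (∃ u ∈ S, vals n σ 5 u = 0) ∨ ∃ u u', AreTrueTwins G S u u'
  · exact ⟨σ, by rw [HStmt.run_ite_pos (hcond.2 hc), HStmt.run_skip], hR, hS, hC, rfl, rfl, rfl,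
      rfl, fun _ h => h, hc⟩
  · rw [HStmt.run_ite_neg (hcond.not.2 hc)]
    have hCpos : ∀ v ∈ S, 0 < vals n σ 5 v := fun v hv =>
      (hC v hv).lt_of_ne fun e => hc (Or.inl ⟨v, hv, e.symm⟩)
    have htw : ∀ u u', ¬ AreTrueTwins G S u u' := fun u u' h => hc (Or.inr ⟨u, u', h⟩)
    obtain ⟨hgood, hd⟩ := goodWeights_spec hR hS hcl htw
    set σ1 := goodWeights.run n σ with hσ1
    have h15 : vals n σ1 5 = vals n σ 5 := by
      unfold vals; rw [hσ1, goodWeights.run_arr_of_notMem (by decide) σ]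
    have h16 : bset n σ1 6 = S := (bset_congr (goodWeights.run_arr_of_notMem (by decide) σ)).trans hS
    obtain ⟨x, hx, hdx, hmin, hval⟩ := subtractWeights_spec h16 hd (by
      obtain ⟨v, hv, h0⟩ := hgood.2.2.1
      exact ⟨v, hv, fun e => h0 (by simp [e])⟩)
    rw [h15] at hmin hval
    have harr : ∀ k, k ∉ (HStmt.seq goodWeights subtractWeights).arrs →
        ((HStmt.seq goodWeights subtractWeights).run n σ).arr k = σ.arr k :=
      fun k hk => HStmt.run_arr_of_notMem _ hk σ
    refine ⟨_, rfl, hR.run _ (by decide) (by decide), (bset_congr (harr 6 (by decide))).trans hS,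
      fun v hv => ?_, HStmt.run_reg_of_notMem _ (by decide) σ, harr 7 (by decide),
      harr 8 (by decide), harr 9 (by decide), fun X hX =>
        LocalRatio.of_subtract hcl hCpos htw hgood hx hdx hmin hval hX, Or.inl ⟨x, hx, ?_⟩⟩
    · rw [HStmt.run_seq, ← hσ1, hval v hv]
      rcases (hd v hv).1.eq_or_lt with h0 | h0
      · rw [← h0, mul_zero, sub_zero]
        exact mul_nonneg (hCpos v hv).le hdx.le
      · exact sub_nonneg.2 (hmin v hv h0)
    · rw [HStmt.run_seq, ← hσ1, hval x hx, sub_self]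

theorem deleteVertex_spec {σ : RAMState} {k : ℤ} {v u : HExpr} {x y : Fin n}
    (hv : ∀ τ : RAMState, τ.reg = σ.reg → v.eval n τ 0 = ((x : ℕ) : ℤ))
    (hu : ∀ τ : RAMState, τ.reg = σ.reg → u.eval n τ 0 = ((y : ℕ) : ℤ)) :
    (deleteVertex k v u).run n σ = (((σ.setArr 7 (σ.reg 0) k).setArr 8 (σ.reg 0)
      ((x : ℕ) : ℤ)).setArr 9 (σ.reg 0) ((y : ℕ) : ℤ)).setArr 6 ((x : ℕ) : ℤ) 0 := by
  simp only [deleteVertex, HStmt.run_seq, HStmt.run_store, HExpr.eval_var, HExpr.eval_const,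
    RAMState.setArr_reg]
  rw [hv (σ.setArr 7 (σ.reg 0) k) rfl, hu ((σ.setArr 7 (σ.reg 0) k).setArr 8 _ _) rfl,
    hv (((σ.setArr 7 (σ.reg 0) k).setArr 8 _ _).setArr 9 _ _) rfl]

theorem reduceStep_spec {S : Finset (Fin n)} {σ : RAMState} {m : ℕ} (hR : ReadsGraph G σ)
    (hS : bset n σ 6 = S) (hC : ∀ v ∈ S, 0 ≤ vals n σ 5 v) (h0 : σ.reg 0 = m) :
    ∃ (σ' : RAMState) (S' : Finset (Fin n)), reduceStep.run n σ = σ' ∧ ReadsGraph G σ' ∧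
      bset n σ' 6 = S' ∧ (∀ v ∈ S', 0 ≤ vals n σ' 5 v) ∧
      IsUndo G (σ'.arr 7 m) (σ'.arr 8 m) (σ'.arr 9 m) S S' (vals n σ 5) (vals n σ' 5) ∧
      (∀ z : ℤ, z ≠ m → σ'.arr 7 z = σ.arr 7 z ∧ σ'.arr 8 z = σ.arr 8 z ∧
        σ'.arr 9 z = σ.arr 9 z) ∧
      (S'.card < S.card ∨ ClusterOn G S') := by
  classical
  have hcond : 0 < (hasPath (.load 6)).eval n σ 0 ↔ ¬ ClusterOn G S :=
    hasPath_pos hR fun l ρ i hi => by rw [HExpr.eval_load, HExpr.eval_bvar, hi, ← mem_bset, hS]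
  by_cases hcl : ClusterOn G S
  · refine ⟨σ.setArr 7 m 0, S, ?_, hR, hS, hC, Or.inl ⟨?_, rfl, rfl⟩, fun z hz => ?_, Or.inr hcl⟩
    · rw [reduceStep, HStmt.run_ite_neg (hcond.not.2 (not_not.2 hcl)), HStmt.run_store,
        HExpr.eval_var, h0, HExpr.eval_const]
    · rw [RAMState.arr_setArr, if_pos ⟨rfl, rfl⟩]
    · simp [RAMState.arr_setArr, hz]
  rw [reduceStep, HStmt.run_ite_pos (hcond.2 hcl), HStmt.run_seq]
  obtain ⟨σ1, h1, hR1, hS1, hC1, h10, h17, h18, h19, hrec, hex⟩ :=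
    reducePrepare_spec hR hS hC hcl
  rw [h1, HStmt.run_seq, HStmt.run_assign]
  have hncl := (isClusterGraph_induce_iff G S).not.2 hcl
  have hz : ∀ u : Fin n, 0 < (isZero (.bvar 0)).eval n σ1 (Function.update 0 0 ((u : ℕ) : ℤ)) ↔
      u ∈ S ∧ vals n σ1 5 u = 0 := fun u => by rw [isZero_pos (u := u) (by simp), hS1]
  rcases HExpr.eval_find_cases n σ1 0 0 (isZero (.bvar 0)) with ⟨x, hx, hpos⟩ | ⟨hneg, hnone⟩
  · obtain ⟨hxS, hx0⟩ := (hz x).1 hpos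
    rw [hx]
    set σ2 := σ1.setReg 13 ((x : ℕ) : ℤ) with hσ2
    have h213 : σ2.reg 13 = ((x : ℕ) : ℤ) := by rw [hσ2, RAMState.setReg_reg, if_pos rfl]
    have h20 : σ2.reg 0 = m := by rw [hσ2, RAMState.setReg_reg, if_neg (by decide), h10, h0]
    rw [HStmt.run_ite_pos (by
      rw [HExpr.eval_lt_pos, HExpr.eval_var, h213, HExpr.eval_const]; omega),
      deleteVertex_spec (x := x) (y := x) (fun τ h => by rw [HExpr.eval_var, h, h213])
        (fun τ h => by rw [HExpr.eval_var, h, h213]), h20]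
    refine ⟨_, S.erase x, rfl, hR1.congr (by simp [RAMState.setArr, hσ2])
      (by simp [RAMState.setArr, hσ2]), ?_, ?_, ?_, ?_, Or.inl (card_erase_lt_of_mem hxS)⟩
    · ext i
      rw [mem_bset, mem_erase, ← hS1, mem_bset]
      simp only [RAMState.arr_setArr, Nat.cast_inj, Fin.val_inj, hσ2, RAMState.setReg_arr]
      by_cases hi : i = x <;> simp [hi]
    · intro v hv
      simpa [vals, RAMState.arr_setArr, hσ2] using hC1 v (mem_of_mem_erase hv)
    · refine Or.inr (Or.inl ⟨by simp [RAMState.arr_setArr], x, by simp [RAMState.arr_setArr], hxS,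
        rfl, fun X hX => hrec _ ?_⟩)
      -- Scaling by `1` transfers the run to a cost function that agrees on the remaining vertices.
      have hX' : LocalRatio G (S.erase x) (fun w => (vals n σ1 5 w : ℚ)) X :=
        hX.scale one_pos fun v _ => by simp [vals, RAMState.arr_setArr, hσ2]
      have hx0' : (vals n σ1 5 x : ℚ) = 0 := by exact_mod_cast hx0
      split
      · exact .zero_keep S _ X x hncl hxS hx0' hX' ‹_›
      · exact .zero_add S _ X x hncl hxS hx0' hX' ‹_›
    · intro z hz
      simp [RAMState.arr_setArr, hz, hσ2, h17, h18, h19]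
  · rw [hneg, HStmt.run_ite_neg (by
      rw [HExpr.eval_lt_pos, HExpr.eval_var, RAMState.setReg_reg, if_pos rfl]; simp)]
    have hnz : ∀ u ∈ S, vals n σ1 5 u ≠ 0 := fun u hu h => hnone u ((hz u).2 ⟨hu, h⟩)
    obtain ⟨w, w', htw⟩ := hex.resolve_left fun ⟨u, hu, h⟩ => hnz u hu h
    set σ2 := σ1.setReg 13 (-1) with hσ2
    have hR2 : ReadsGraph G σ2 := hR1
    have hS2 : bset n σ2 6 = S := hS1
    have ht : ∀ u u' : Fin n, 0 < (areTwins (.bvar 0) (.bvar 1)).eval n σ2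
        (Function.update (Function.update 0 0 ((u : ℕ) : ℤ)) 1 ((u' : ℕ) : ℤ)) ↔
        AreTrueTwins G S u u' := fun u u' => by
      rw [areTwins_pos hR2 (u := u) (u' := u') (fun z => by simp) (fun z => by simp), hS2]
    obtain ⟨y, hy, hypos⟩ := HExpr.eval_find (n := n) (σ := σ2) (ρ := 0) (l := 0)
      (e := .any 1 (areTwins (.bvar 0) (.bvar 1)))
      ⟨w, HExpr.eval_any_pos.2 ⟨w', (ht w w').2 htw⟩⟩
    obtain ⟨y', hyt⟩ := HExpr.eval_any_pos.1 hypos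
    rw [ht] at hyt
    rw [HStmt.run_seq, HStmt.run_assign, hy]
    set σ3 := σ2.setReg 13 ((y : ℕ) : ℤ) with hσ3
    have h313 : σ3.reg 13 = ((y : ℕ) : ℤ) := by rw [hσ3, RAMState.setReg_reg, if_pos rfl]
    have hR3 : ReadsGraph G σ3 := hR1
    have hS3 : bset n σ3 6 = S := hS1
    have ht3 : ∀ u' : Fin n, 0 < (areTwins (.var 13) (.bvar 0)).eval n σ3
        (Function.update 0 0 ((u' : ℕ) : ℤ)) ↔ AreTrueTwins G S y u' := fun u' => by
      rw [areTwins_pos hR3 (u := y) (u' := u') (fun z => by simp [h313]) (fun z => by simp), hS3]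
    obtain ⟨x, hx, hxpos⟩ := HExpr.eval_find (n := n) (σ := σ3) (ρ := 0) (l := 0)
      (e := areTwins (.var 13) (.bvar 0)) ⟨y', (ht3 y').2 hyt⟩
    have htw := (ht3 x).1 hxpos
    rw [HStmt.run_seq, HStmt.run_assign, hx]
    set σ4 := σ3.setReg 14 ((x : ℕ) : ℤ) with hσ4
    have h414 : σ4.reg 14 = ((x : ℕ) : ℤ) := by rw [hσ4, RAMState.setReg_reg, if_pos rfl]
    have h413 : σ4.reg 13 = ((y : ℕ) : ℤ) := by
      rw [hσ4, RAMState.setReg_reg, if_neg (by decide), h313]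
    have h40 : σ4.reg 0 = m := by
      rw [hσ4, RAMState.setReg_reg, if_neg (by decide), hσ3, RAMState.setReg_reg,
        if_neg (by decide), hσ2, RAMState.setReg_reg, if_neg (by decide), h10, h0]
    have h4a : σ4.arr = σ1.arr := rfl
    rw [HStmt.run_seq, HStmt.run_store]
    simp only [HExpr.eval_add, HExpr.eval_load, HExpr.eval_var, h413, h414]
    rw [deleteVertex_spec (x := x) (y := y) (fun τ h => by rw [HExpr.eval_var, h]; exact h414)
        (fun τ h => by rw [HExpr.eval_var, h]; exact h413), RAMState.setArr_reg, h40]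
    have hxy : x ≠ y := htw.2.2.1.ne.symm
    refine ⟨_, S.erase x, rfl, hR1.congr (by simp [RAMState.setArr, h4a])
      (by simp [RAMState.setArr, h4a]), ?_, ?_, ?_, ?_, Or.inl (card_erase_lt_of_mem htw.2.1)⟩
    · ext i
      rw [mem_bset, mem_erase, ← hS1, mem_bset]
      simp only [RAMState.arr_setArr, Nat.cast_inj, Fin.val_inj, h4a]
      by_cases hi : i = x <;> simp [hi]
    · intro v hv
      have h1 := hC1 v (mem_of_mem_erase hv)
      have h2 := hC1 x htw.2.1
      have h3 := hC1 y htw.1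
      unfold vals at h1 h2 h3 ⊢
      simp only [RAMState.arr_setArr, h4a]
      norm_num
      split_ifs
      · omega
      · exact h1
    · refine Or.inr (Or.inr ⟨by simp [RAMState.arr_setArr], x, y, by simp [RAMState.arr_setArr],
        by simp [RAMState.arr_setArr], htw.2.1, rfl, fun X hX => hrec _ ?_⟩)
      have hX' : LocalRatio G (S.erase x) (Function.update (fun w => (vals n σ1 5 w : ℚ)) y
          ((vals n σ1 5 y : ℚ) + (vals n σ1 5 x : ℚ))) X :=
        hX.scale one_pos fun v _ => by
          by_cases hv : v = y
          · subst hv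
            simp [vals, RAMState.arr_setArr, h4a]
          · simp [vals, RAMState.arr_setArr, h4a, Fin.val_inj, hv]
      have hnz' : ∀ u ∈ S, (vals n σ1 5 u : ℚ) ≠ 0 := fun u hu => by exact_mod_cast hnz u hu
      split
      · exact .twins_add S _ X y x hncl hnz' htw hX' ‹_›
      · exact .twins_keep S _ X y x hncl hnz' htw hX' ‹_›
    · intro z hz
      simp [RAMState.arr_setArr, hz, h4a, h17, h18, h19]

end

/-! ### The reduction loop, the undo loop and the initialisation. -/

section

variable {n : ℕ} {G : SimpleGraph (Fin n)}

/-- The sets and costs `S i`, `C i` that remain when `i` steps are left form a possible history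
that is recorded in the arrays of `σ`. -/
structure History (G : SimpleGraph (Fin n)) (C₀ : Fin n → ℤ) (m : ℕ) (S : ℕ → Finset (Fin n))
    (C : ℕ → Fin n → ℤ) (σ : RAMState) : Prop where
  univ : S n = univ
  costs : C n = C₀
  undo : ∀ i, m ≤ i → i < n → IsUndo G (σ.arr 7 i) (σ.arr 8 i) (σ.arr 9 i) (S (i + 1)) (S i)
    (C (i + 1)) (C i)
  card : (S m).card ≤ m ∨ ClusterOn G (S m)

theorem reduceLoop_spec {C₀ : Fin n → ℤ} {σ : RAMState} (hR : ReadsGraph G σ)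
    (hS : bset n σ 6 = univ) (hC₀ : vals n σ 5 = C₀) (hC : ∀ v, 0 ≤ C₀ v) :
    ∃ S C, History G C₀ 0 S C ((HStmt.iter 0 reduceStep).run n σ) ∧
      ReadsGraph G ((HStmt.iter 0 reduceStep).run n σ) ∧
      bset n ((HStmt.iter 0 reduceStep).run n σ) 6 = S 0 := by
  have h := HStmt.iter_induction (n := n) (i := 0) (p := reduceStep) (σ := σ)
    (fun m s => ∃ S C, History G C₀ m S C s ∧ ReadsGraph G s ∧ bset n s 6 = S m ∧
      vals n s 5 = C m ∧ ∀ v ∈ S m, 0 ≤ C m v)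
    -- Only the entries at `n` matter at the start; the entry at `m` is overwritten in the
    -- corresponding pass.
    ⟨fun _ => univ, fun _ => C₀, ⟨rfl, rfl, fun i h1 h2 => by omega, Or.inl (by simp)⟩, hR, hS,
      hC₀, fun v _ => hC v⟩ ?_
  · obtain ⟨S, C, h1, h2, h3, -⟩ := h
    exact ⟨S, C, h1, h2, h3⟩
  · intro m hm s ⟨S, C, hist, hR, hS, hCm, hC⟩
    obtain ⟨s', S', h1, h2, h3, h4, h5, h6, h7⟩ := reduceStep_spec (σ := s.setReg 0 m) (m := m)
      (S := S (m + 1)) hR hS (fun v hv => by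
        have := hC v hv
        rw [← hCm] at this
        exact this) (by rw [RAMState.setReg_reg, if_pos rfl])
    rw [h1]
    have hne : ∀ i, m + 1 ≤ i → i ≠ m := fun i hi => by omega
    refine ⟨Function.update S m S', Function.update C m (vals n s' 5), ⟨?_, ?_, ?_, ?_⟩, h2, ?_, ?_,
      ?_⟩
    · rw [Function.update_of_ne hm.ne', hist.univ]
    · rw [Function.update_of_ne hm.ne', hist.costs]
    · intro i hmi hin
      rw [Function.update_of_ne (hne (i + 1) (by omega)),
        Function.update_of_ne (hne (i + 1) (by omega))]
      rcases hmi.eq_or_lt with rfl | hlt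
      · rw [Function.update_self, Function.update_self, ← hCm]
        exact h5
      · rw [Function.update_of_ne hlt.ne', Function.update_of_ne hlt.ne']
        obtain ⟨e1, e2, e3⟩ := h6 i (by exact_mod_cast hlt.ne')
        rw [e1, e2, e3]
        exact hist.undo i hlt hin
    · rw [Function.update_self]
      rcases h7 with h7 | h7
      · rcases hist.card with hc | hc
        · exact Or.inl (by omega)
        · have hsub : S' ⊆ S (m + 1) := by
            rcases h5 with ⟨-, h, -⟩ | ⟨-, x, -, -, h, -⟩ | ⟨-, x, y, -, -, -, h, -⟩
            · exact h.le
            · rw [h]; exact erase_subset _ _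
            · rw [h]; exact erase_subset _ _
          exact Or.inr (hc.mono hsub)
      · exact Or.inr h7
    · rw [Function.update_self, h3]
    · rw [Function.update_self]
    · rw [Function.update_self, Function.update_self]
      exact h4

/-- Array `3` holds the characteristic vector of `X`. -/
def HoldsSet (n : ℕ) (σ : RAMState) (X : Finset (Fin n)) : Prop :=
  ∀ i : Fin n, σ.arr 3 ((i : ℕ) : ℤ) = if i ∈ X then 1 else 0

theorem HoldsSet.insert {σ : RAMState} {X : Finset (Fin n)} (h : HoldsSet n σ X) (x : Fin n) :
    HoldsSet n (σ.setArr 3 ((x : ℕ) : ℤ) 1) (insert x X) := fun i => by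
  rw [RAMState.arr_setArr, h i]
  simp only [Nat.cast_inj, Fin.val_inj, true_and, mem_insert]
  by_cases hi : i = x <;> simp [hi]

theorem undoStep_spec {σ : RAMState} {m : ℕ} {S S' X : Finset (Fin n)} {C C' : Fin n → ℤ}
    (hR : ReadsGraph G σ) (hS : bset n σ 6 = S') (hX : HoldsSet n σ X)
    (hm : (n : ℤ) - 1 - σ.reg 16 = m)
    (hundo : IsUndo G (σ.arr 7 m) (σ.arr 8 m) (σ.arr 9 m) S S' C C')
    (hrec : LocalRatio G S' (fun w => (C' w : ℚ)) X) :
    ∃ X', ReadsGraph G (undoStep.run n σ) ∧ bset n (undoStep.run n σ) 6 = S ∧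
      HoldsSet n (undoStep.run n σ) X' ∧ LocalRatio G S (fun w => (C w : ℚ)) X' := by
  classical
  have hR' : ReadsGraph G (undoStep.run n σ) := hR.run _ (by decide) (by decide)
  set σ1 := σ.setReg 17 m with hσ1
  have h17 : σ1.reg 17 = m := by rw [hσ1, RAMState.setReg_reg, if_pos rfl]
  have h1a : σ1.arr = σ.arr := rfl
  set p : HStmt := .ite (.eq (.load 7 (.var 17)) (.const 1))
    (.seq (.store 6 (.load 8 (.var 17)) (.const 1))
      (.ite (hasPath fun e => .and (.load 6 e) (.not (.load 3 e)))
        (.store 3 (.load 8 (.var 17)) (.const 1)) .skip))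
    (.ite (.eq (.load 7 (.var 17)) (.const 2))
      (.seq (.store 6 (.load 8 (.var 17)) (.const 1))
        (.ite (.load 3 (.load 9 (.var 17))) (.store 3 (.load 8 (.var 17)) (.const 1)) .skip))
      .skip) with hp
  have hrun : undoStep.run n σ = p.run n σ1 := by
    rw [hσ1, ← hm]
    rfl
  rw [hrun] at hR' ⊢
  have h7 : ∀ k : ℤ, 0 < (HExpr.eq (.load 7 (.var 17)) (.const k)).eval n σ1 0 ↔
      σ.arr 7 m = k := fun k => by
    rw [HExpr.eval_eq_pos, HExpr.eval_load, HExpr.eval_var, h17, HExpr.eval_const, h1a]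
  have hins : ∀ x ∈ S, S' = S.erase x → bset n (σ1.setArr 6 ((x : ℕ) : ℤ) 1) 6 = S :=
    fun x hx hSx => by
      ext i
      rw [mem_bset, RAMState.arr_setArr, h1a]
      by_cases hi : i = x
      · simp [hi, hx]
      · have : i ∈ S' ↔ i ∈ S := by rw [hSx, mem_erase]; simp [hi]
        simp [hi, Fin.val_inj, ← this, ← hS]
  rcases hundo with ⟨hk, rfl, rfl⟩ | ⟨hk, x, hx, hxS, hS', hX'⟩ | ⟨hk, x, y, hx, hy, hxS, hS', hX'⟩
  · refine ⟨X, hR', ?_⟩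
    rw [hp, HStmt.run_ite_neg (by rw [h7, hk]; norm_num),
      HStmt.run_ite_neg (by rw [h7, hk]; norm_num), HStmt.run_skip]
    exact ⟨hS, hX, hrec⟩
  · have hXS : X ⊆ S := hrec.subset.trans (hS' ▸ erase_subset _ _)
    rw [hp, HStmt.run_ite_pos (by rw [h7, hk]), HStmt.run_seq, HStmt.run_store, HExpr.eval_load,
      HExpr.eval_var, h17, h1a, hx, HExpr.eval_const] at hR' ⊢
    set σ2 := σ1.setArr 6 ((x : ℕ) : ℤ) 1 with hσ2
    have hR2 : ReadsGraph G σ2 := hR.congr (by simp [hσ2, RAMState.setArr, h1a])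
      (by simp [hσ2, RAMState.setArr, h1a])
    have h23 : ∀ z, σ2.arr 3 z = σ.arr 3 z := fun z => by
      rw [hσ2, RAMState.arr_setArr, if_neg (by simp), h1a]
    have hX2 : HoldsSet n σ2 X := fun i => by rw [h23, hX]
    have h28 : (HExpr.load 8 (.var 17)).eval n σ2 0 = ((x : ℕ) : ℤ) := by
      rw [HExpr.eval_load, HExpr.eval_var, hσ2, RAMState.setArr_reg, h17, RAMState.arr_setArr,
        if_neg (by simp), h1a, hx]
    have hcond : 0 < (hasPath fun e => .and (.load 6 e) (.not (.load 3 e))).eval n σ2 0 ↔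
        ¬ IsHittingSet G S X := by
      rw [isHittingSet_iff, and_iff_right hXS]
      refine hasPath_pos hR2 fun l ρ i hi => ?_
      rw [HExpr.eval_and_pos, HExpr.eval_not_pos, HExpr.eval_load, HExpr.eval_load,
        HExpr.eval_bvar, hi, ← mem_bset, hins x hxS hS', mem_sdiff, hX2]
      split <;> simp [*]
    by_cases hh : IsHittingSet G S X
    · rw [HStmt.run_ite_neg (hcond.not.2 (not_not.2 hh)), HStmt.run_skip] at hR' ⊢
      have := hX' X hrec
      rw [if_pos hh] at this
      exact ⟨X, hR', hins x hxS hS', hX2, this⟩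
    · rw [HStmt.run_ite_pos (hcond.2 hh), HStmt.run_store, h28, HExpr.eval_const] at hR' ⊢
      have := hX' X hrec
      rw [if_neg hh] at this
      refine ⟨_, hR', ?_, hX2.insert x, this⟩
      rw [← hins x hxS hS']
      exact bset_congr (by simp [RAMState.setArr, hσ2])
  · rw [hp, HStmt.run_ite_neg (by rw [h7, hk]; norm_num), HStmt.run_ite_pos (by rw [h7, hk]),
      HStmt.run_seq, HStmt.run_store, HExpr.eval_load,
      HExpr.eval_var, h17, h1a, hx, HExpr.eval_const] at hR' ⊢
    set σ2 := σ1.setArr 6 ((x : ℕ) : ℤ) 1 with hσ2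
    have h23 : ∀ z, σ2.arr 3 z = σ.arr 3 z := fun z => by
      rw [hσ2, RAMState.arr_setArr, if_neg (by simp), h1a]
    have hX2 : HoldsSet n σ2 X := fun i => by rw [h23, hX]
    have h28 : (HExpr.load 8 (.var 17)).eval n σ2 0 = ((x : ℕ) : ℤ) := by
      rw [HExpr.eval_load, HExpr.eval_var, hσ2, RAMState.setArr_reg, h17, RAMState.arr_setArr,
        if_neg (by simp), h1a, hx]
    have h29 : (HExpr.load 9 (.var 17)).eval n σ2 0 = ((y : ℕ) : ℤ) := by
      rw [HExpr.eval_load, HExpr.eval_var, hσ2, RAMState.setArr_reg, h17, RAMState.arr_setArr,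
        if_neg (by simp), h1a, hy]
    have hcond : 0 < (HExpr.load 3 (.load 9 (.var 17))).eval n σ2 0 ↔ y ∈ X := by
      rw [HExpr.eval_load, h29, hX2]
      split <;> simp [*]
    have := hX' X hrec
    by_cases hh : y ∈ X
    · rw [HStmt.run_ite_pos (hcond.2 hh), HStmt.run_store, h28, HExpr.eval_const] at hR' ⊢
      rw [if_pos hh] at this
      refine ⟨_, hR', ?_, hX2.insert x, this⟩
      rw [← hins x hxS hS']
      exact bset_congr (by simp [RAMState.setArr, hσ2])
    · rw [HStmt.run_ite_neg (hcond.not.2 hh), HStmt.run_skip] at hR' ⊢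
      rw [if_neg hh] at this
      exact ⟨X, hR', hins x hxS hS', hX2, this⟩

theorem undoLoop_spec {C₀ : Fin n → ℤ} {S : ℕ → Finset (Fin n)} {C : ℕ → Fin n → ℤ}
    {σ : RAMState} (hist : History G C₀ 0 S C σ) (hR : ReadsGraph G σ) (hS : bset n σ 6 = S 0)
    (hX : HoldsSet n σ ∅) : ∃ X, HoldsSet n ((HStmt.iter 16 undoStep).run n σ) X ∧
      LocalRatio G univ (fun w => (C₀ w : ℚ)) X := by
  have hcl : ClusterOn G (S 0) := by
    rcases hist.card with h | h
    · rw [card_eq_zero.1 (Nat.le_zero.1 h)]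
      intro u hu
      simp at hu
    · exact h
  -- Deletions were recorded at positions `n - 1, …, 0`. Undoing runs through positions `0, …, n -
  -- 1`, so with `w` passes left the current vertex set is `S (n - w)`.
  have h := HStmt.iter_induction (n := n) (i := 16) (p := undoStep) (σ := σ)
    (fun w s => ∃ X, w ≤ n ∧ ReadsGraph G s ∧ bset n s 6 = S (n - w) ∧ HoldsSet n s X ∧
      LocalRatio G (S (n - w)) (fun v => (C (n - w) v : ℚ)) X ∧ s.arr 7 = σ.arr 7 ∧
      s.arr 8 = σ.arr 8 ∧ s.arr 9 = σ.arr 9)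
    ⟨∅, le_rfl, hR, by rwa [Nat.sub_self], hX, by
      rw [Nat.sub_self]
      exact .cluster _ _ ((isClusterGraph_induce_iff _ _).2 hcl), rfl, rfl, rfl⟩ ?_
  · obtain ⟨X, -, -, -, h1, h2, -⟩ := h
    rw [Nat.sub_zero, hist.univ, hist.costs] at h2
    exact ⟨X, h1, h2⟩
  · intro w hw s ⟨X, hwn, hR, hS, hX, hrec, h7, h8, h9⟩
    have hundo := hist.undo (n - (w + 1)) (Nat.zero_le _) (by omega)
    rw [show n - (w + 1) + 1 = n - w by omega, ← h7, ← h8, ← h9] at hundo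
    obtain ⟨X', h1, h2, h3, h4⟩ := undoStep_spec (σ := s.setReg 16 w) (m := n - (w + 1)) hR hS hX
      (by rw [RAMState.setReg_reg, if_pos rfl]; omega) hundo hrec
    have harr : ∀ k, k ∉ undoStep.arrs → (undoStep.run n (s.setReg 16 w)).arr k = s.arr k :=
      fun k hk => undoStep.run_arr_of_notMem hk _
    exact ⟨X', hw.le, h1, h2, h3, h4, (harr 7 (by decide)).trans h7,
      (harr 8 (by decide)).trans h8, (harr 9 (by decide)).trans h9⟩

/-- The machine state, seen by high-level programs, that holds the input. -/
noncomputable def inputState (G : SimpleGraph (Fin n)) (c : Fin n → ℚ) : RAMState where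
  reg := fun _ => 0
  arr := fun k => (ramInput G c).arr (arrIdx k)

/-- Quotient and remainder modulo `n` recover the row and the column from the position. -/
theorem ramInput_arr_zero (G : SimpleGraph (Fin n)) [DecidableRel G.Adj] (c : Fin n → ℚ)
    (u v : Fin n) :
    (ramInput G c).arr 0 ((n : ℤ) * (u : ℕ) + (v : ℕ)) = if G.Adj u v then 1 else 0 := by
  have hiff : (∃ i j : Fin n, (n : ℤ) * (u : ℕ) + (v : ℕ) = (n : ℤ) * (i : ℕ) + (j : ℕ) ∧
      G.Adj i j) ↔ G.Adj u v := by
    refine ⟨?_, fun h => ⟨u, v, rfl, h⟩⟩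
    rintro ⟨i, j, hij, hadj⟩
    have hij' : n * (u : ℕ) + v = n * (i : ℕ) + j := by exact_mod_cast hij
    have hn : 0 < n := u.pos
    have h1 := congrArg (· / n) hij'
    have h2 := congrArg (· % n) hij'
    simp only [Nat.mul_add_div hn, Nat.div_eq_of_lt v.2, Nat.div_eq_of_lt j.2, add_zero] at h1
    simp only [Nat.mul_add_mod, Nat.mod_eq_of_lt v.2, Nat.mod_eq_of_lt j.2] at h2
    rwa [Fin.ext h1, Fin.ext h2]
  by_cases h : G.Adj u v
  · rw [if_pos h]
    exact if_pos (hiff.2 h)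
  · rw [if_neg h]
    exact if_neg (hiff.not.2 h)

theorem ramInput_arr_one (G : SimpleGraph (Fin n)) (c : Fin n → ℚ) (i : Fin n) :
    (ramInput G c).arr 1 ((i : ℕ) : ℤ) = (c i).num := by
  simp [ramInput]

theorem ramInput_arr_two (G : SimpleGraph (Fin n)) (c : Fin n → ℚ) (i : Fin n) :
    (ramInput G c).arr 2 ((i : ℕ) : ℤ) = (c i).den := by
  simp [ramInput]

theorem setUp_spec (G : SimpleGraph (Fin n)) (c : Fin n → ℚ) :
    ReadsGraph G (setUp.run n (inputState G c)) ∧ bset n (setUp.run n (inputState G c)) 6 = univ ∧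
      HoldsSet n (setUp.run n (inputState G c)) ∅ ∧
      ∀ v, (vals n (setUp.run n (inputState G c)) 5 v : ℚ) = (∏ u, ((c u).den : ℚ)) * c v := by
  set σ := inputState G c with hσ
  set σ1 := (HStmt.map 4 0 (.sum 1 (.bvar 0))).run n σ with hσ1
  set σ2 := (HStmt.map 5 0 (.load 1 (.bvar 0))).run n σ1 with hσ2
  set p3 : HStmt := .map 5 0 (.cond (.eq (.bvar 0) (.var 16)) (.load 5 (.bvar 0))
    (.scale (.load 5 (.bvar 0)) (.var 16))) with hp3
  set σ3 := (HStmt.iter 16 p3).run n σ2 with hσ3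
  set σ4 := (HStmt.map 6 0 (.const 1)).run n σ3 with hσ4
  have hrun : setUp.run n σ = σ4 := rfl
  have harr : ∀ k, k ∉ setUp.arrs → σ4.arr k = σ.arr k := fun k hk =>
    setUp.run_arr_of_notMem hk σ
  have h44 : ∀ i : Fin n, σ4.arr 4 ((i : ℕ) : ℤ) = (n : ℤ) * (i : ℕ) := fun i => by
    rw [hσ4, HStmt.run_arr_of_notMem _ (by decide), hσ3, HStmt.run_arr_of_notMem _ (by decide),
      hσ2, HStmt.run_arr_of_notMem _ (by decide), hσ1, HStmt.run_map_arr_self]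
    simp
  have hnum : ∀ i : Fin n, σ.arr 1 ((i : ℕ) : ℤ) = (c i).num :=
    ramInput_arr_one G c
  have hden : ∀ i : Fin n, σ.arr 2 ((i : ℕ) : ℤ) = (c i).den :=
    ramInput_arr_two G c
  rw [hrun]
  refine ⟨fun u v => ?_, ?_, fun i => ?_, fun v => ?_⟩
  · rw [harr 0 (by decide), h44]
    classical
    rw [show σ.arr 0 = (ramInput G c).arr 0 from rfl, ramInput_arr_zero]
    split_ifs with h <;> simp [h]
  · ext i
    rw [mem_bset, hσ4, HStmt.run_map_arr_self]
    simp
  · rw [harr 3 (by decide)]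
    simp [hσ, inputState, arrIdx, ramInput]
  -- Each numerator is multiplied by the denominators of all other vertices. This is the cost times
  -- the product of all denominators, obtained without division.
  · have hloop := HStmt.iter_induction (n := n) (i := 16) (p := p3) (σ := σ2)
      (fun m s => s.arr 2 = σ.arr 2 ∧ ∀ v : Fin n, s.arr 5 ((v : ℕ) : ℤ) =
        (c v).num * ∏ u ∈ univ.filter (fun u : Fin n => m ≤ (u : ℕ) ∧ u ≠ v), ((c u).den : ℤ))
      ⟨rfl, fun v => ?_⟩ ?_
    · have h5 : vals n σ4 5 v = σ3.arr 5 ((v : ℕ) : ℤ) := by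
        rw [vals, hσ4, HStmt.run_map_arr_of_ne (by decide)]
      have hfil : univ.filter (fun u : Fin n => 0 ≤ (u : ℕ) ∧ u ≠ v) = univ.erase v := by
        ext u; simp
      rw [h5, hloop.2 v, hfil]
      push_cast
      rw [← mul_prod_erase univ (fun u => ((c u).den : ℚ)) (mem_univ v)]
      have := Rat.den_mul_eq_num (c v)
      linear_combination -(∏ u ∈ univ.erase v, ((c u).den : ℚ)) * this
    · rw [hσ2, HStmt.run_map_arr_self, filter_false_of_mem fun u _ h => by have := u.2; omega,
        prod_empty, mul_one, HExpr.eval_load, HExpr.eval_bvar, Function.update_self, ← hnum]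
      rfl
    · intro m hm s ⟨h2, h5⟩
      refine ⟨(HStmt.run_arr_of_notMem p3 (by decide) _).trans h2, fun v => ?_⟩
      obtain ⟨w, hw⟩ : ∃ w : Fin n, (w : ℕ) = m := ⟨⟨m, hm⟩, rfl⟩
      have h16 : (s.setReg 16 m).reg 16 = ((w : ℕ) : ℤ) := by
        rw [RAMState.setReg_reg, if_pos rfl, hw]
      rw [hp3, HStmt.run_map_arr_self]
      simp only [HExpr.eval_cond, HExpr.eval_eq_pos, HExpr.eval_scale, HExpr.eval_load,
        HExpr.eval_bvar, HExpr.eval_var, Function.update_self, h16, RAMState.setReg_arr, h5, h2,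
        hden, Nat.cast_inj, Fin.val_inj]
      split_ifs with hvw
      · subst hvw
        congr 2
        refine filter_congr fun u _ => and_congr_left fun hu => ?_
        have : (u : ℕ) ≠ v := fun e => hu (Fin.ext e)
        omega
      · have : univ.filter (fun u : Fin n => m ≤ (u : ℕ) ∧ u ≠ v) =
            insert w (univ.filter fun u : Fin n => m + 1 ≤ (u : ℕ) ∧ u ≠ v) := by
          ext u
          simp only [mem_filter, mem_univ, true_and, mem_insert]
          by_cases huw : u = w
          · subst huw
            simp [hw.ge, Ne.symm hvw]
          · have : (u : ℕ) ≠ w := fun e => huw (Fin.ext e)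
            simp only [huw, false_or]
            refine and_congr_left fun _ => ?_
            omega
        rw [this, prod_insert (by simp [hw])]
        ring

theorem localRatioProg_spec (G : SimpleGraph (Fin n)) (c : Fin n → ℚ) (hc : ∀ v, 0 ≤ c v) :
    ∃ X, HoldsSet n (localRatioProg.run n (inputState G c)) X ∧ LocalRatio G univ c X := by
  obtain ⟨h1, h2, h3, h4⟩ := setUp_spec G c
  set σ1 := setUp.run n (inputState G c) with hσ1
  set σ2 := (HStmt.iter 0 reduceStep).run n σ1 with hσ2
  have hK : (0 : ℚ) < ∏ u, ((c u).den : ℚ) := prod_pos fun u _ => by exact_mod_cast (c u).den_pos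
  obtain ⟨S, C, hist, hR, hS⟩ := reduceLoop_spec h1 h2 rfl fun v => by
    have : (0 : ℚ) ≤ vals n σ1 5 v := by rw [h4]; exact mul_nonneg hK.le (hc v)
    exact_mod_cast this
  obtain ⟨X, hX, hrec⟩ := undoLoop_spec hist hR hS fun i => by
    rw [← hσ2, hσ2, HStmt.run_arr_of_notMem _ (by decide)]
    exact h3 i
  -- The common factor introduced to clear denominators is removed again.
  exact ⟨X, hX, hrec.scale (inv_pos.2 hK) fun v _ => by rw [h4, inv_mul_cancel_left₀ hK.ne']⟩

end

/-! ### Resource bounds for the compiled program. -/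

section

variable {n : ℕ}

theorem le_inputSize (c : Fin n → ℚ) : n ≤ inputSize c :=
  (Nat.le_self_pow two_ne_zero n).trans (Nat.le_add_right _ _)

theorem boundedState_ramInput (G : SimpleGraph (Fin n)) (c : Fin n → ℚ) :
    BoundedState (inputSize c) (ramInput G c) := by
  have h1 : (1 : ℕ) ≤ 2 ^ inputSize c := Nat.one_le_two_pow
  have hb : ∀ (i : Fin n) {z : ℤ}, bitLen z ≤ bitLen (c i).num + bitLen ((c i).den : ℤ) →
      z.natAbs ≤ 2 ^ inputSize c := fun i z hz => by
    refine (natAbs_le_two_pow_bitLen z).trans (Nat.pow_le_pow_right two_pos (hz.trans ?_))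
    exact (single_le_sum (f := fun i => bitLen (c i).num + bitLen ((c i).den : ℤ))
      (fun _ _ => Nat.zero_le _) (mem_univ i)).trans (Nat.le_add_left _ _)
  refine ⟨fun r => ?_, fun k z => ?_⟩
  · simp only [ramInput]
    split_ifs
    · exact (Int.natAbs_natCast n).le.trans ((le_inputSize c).trans Nat.lt_two_pow_self.le)
    · simp
  · simp only [ramInput]
    split_ifs
    · exact h1
    · simp
    · exact hb _ (Nat.le_add_right _ _)
    · exact hb _ (Nat.le_add_left _ _)
    · simp
    · simp

theorem represents_inputState (G : SimpleGraph (Fin n)) (c : Fin n → ℚ) :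
    Represents n (inputState G c) (ramInput G c) :=
  ⟨rfl, fun _ => rfl, fun _ => rfl⟩

/-- The local-ratio algorithm is implemented by a program that takes `O(n ^ 4)` steps and has
polynomial bit cost. -/
theorem exists_localRatio_program : ∃ (P : RAMProg) (C : ℕ) (p : Polynomial ℕ),
    ∀ (n : ℕ) (G : SimpleGraph (Fin n)) (c : Fin n → ℚ), (∀ v, 0 ≤ c v) →
      ∃ (X : Finset (Fin n)) (s : RAMState) (t b : ℕ),
        RAMExec P (ramInput G c) s t b ∧ t ≤ C * (n ^ 4 + 1) ∧ b ≤ p.eval (inputSize c) ∧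
        RAMOutputs s X ∧ LocalRatio G Finset.univ c X := by
  obtain ⟨C, q, h⟩ := localRatioProg.exists_exec localRatioProg_keepsTwo
  refine ⟨localRatioProg.compile 1, C, q, fun n G c hc => ?_⟩
  obtain ⟨s, t, b, hex, ht, hb, hr, -⟩ := h n (inputSize c) (inputState G c) (ramInput G c)
    (le_inputSize c) (represents_inputState G c) rfl (boundedState_ramInput G c)
  obtain ⟨X, hX, hrec⟩ := localRatioProg_spec G c hc
  rw [localRatioProg_depth] at ht
  refine ⟨X, s, t, b, hex, ht, hb, fun i => ?_, hrec⟩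
  have := hr.2.2 3
  rw [show arrIdx 3 = 3 from rfl] at this
  rw [this]
  exact hX i

end

/-! ## Vertex cover and cluster vertex deletion -/

section Pendant

variable {n : ℕ}

/-- The graph that arises from `G` by attaching a pendant vertex `n + i` to each vertex `i`. -/
def addPendants (G : SimpleGraph (Fin n)) : SimpleGraph (Fin (n + n)) where
  Adj u v := (∃ i j, G.Adj i j ∧ u = Fin.castAdd n i ∧ v = Fin.castAdd n j) ∨
    ∃ i : Fin n, (u = Fin.castAdd n i ∧ v = Fin.natAdd n i) ∨
      (u = Fin.natAdd n i ∧ v = Fin.castAdd n i)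
  symm := ⟨by
    rintro u v (⟨i, j, h, rfl, rfl⟩ | ⟨i, h | h⟩)
    exacts [Or.inl ⟨j, i, h.symm, rfl, rfl⟩, Or.inr ⟨i, Or.inr h.symm⟩, Or.inr ⟨i, Or.inl h.symm⟩]⟩
  loopless := ⟨by
    rintro u (⟨i, j, h, rfl, hij⟩ | ⟨i, ⟨rfl, h⟩ | ⟨rfl, h⟩⟩)
    · exact h.ne (Fin.castAdd_injective n n hij)
    · have := congrArg Fin.val h
      simp at this
      have := i.2
      omega
    · have := congrArg Fin.val h
      simp at this
      have := i.2
      omega⟩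

theorem castAdd_ne_natAdd (i j : Fin n) : Fin.castAdd n i ≠ Fin.natAdd n j := fun h => by
  have := congrArg Fin.val h
  simp at this
  omega

variable {G : SimpleGraph (Fin n)}

theorem addPendants_adj_castAdd {i j : Fin n} :
    (addPendants G).Adj (Fin.castAdd n i) (Fin.castAdd n j) ↔ G.Adj i j := by
  constructor
  · rintro (⟨i', j', h, hi, hj⟩ | ⟨k, ⟨-, h⟩ | ⟨h, -⟩⟩)
    · rwa [Fin.castAdd_injective n n hi, Fin.castAdd_injective n n hj]
    · exact absurd h (castAdd_ne_natAdd _ _)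
    · exact absurd h (castAdd_ne_natAdd _ _)
  · exact fun h => Or.inl ⟨i, j, h, rfl, rfl⟩

theorem addPendants_adj_natAdd {i : Fin n} {v : Fin (n + n)} :
    (addPendants G).Adj (Fin.natAdd n i) v ↔ v = Fin.castAdd n i := by
  constructor
  · rintro (⟨i', j', -, h, -⟩ | ⟨k, ⟨h, -⟩ | ⟨h, rfl⟩⟩)
    · exact absurd h.symm (castAdd_ne_natAdd _ _)
    · exact absurd h.symm (castAdd_ne_natAdd _ _)
    · rw [Fin.natAdd_injective n n h]
  · exact fun h => Or.inr ⟨i, Or.inr ⟨rfl, h⟩⟩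

theorem cost_append (c : Fin n → ℚ) (X : Finset (Fin (n + n))) :
    cost (Fin.append c c) X = ∑ i, ((if Fin.castAdd n i ∈ X then c i else 0) +
      if Fin.natAdd n i ∈ X then c i else 0) := by
  rw [cost, ← univ_inter X, ← sum_ite_mem, Fin.sum_univ_add, ← sum_add_distrib]
  simp only [Fin.append_left, Fin.append_right, univ_inter]

/-- A hitting set of the graph with pendant vertices yields a vertex cover. -/
theorem isVertexCover_of_isHittingSet {X : Finset (Fin (n + n))}
    (hX : IsHittingSet (addPendants G) univ X) : G.IsVertexCover
      (↑(univ.filter fun i : Fin n => Fin.castAdd n i ∈ X ∨ Fin.natAdd n i ∈ X) : Set (Fin n)) := by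
  intro i j hij
  rw [isHittingSet_iff] at hX
  by_contra hcon
  simp only [coe_filter, mem_univ, true_and, Set.mem_ofPred_eq, not_or] at hcon
  have h := hX.2 (Fin.natAdd n i) (by simpa using hcon.1.2) (Fin.castAdd n i)
    (by simpa using hcon.1.1) (Fin.castAdd n j) (by simpa using hcon.2.1)
    (addPendants_adj_natAdd.2 rfl) (addPendants_adj_castAdd.2 hij) (castAdd_ne_natAdd _ _).symm
  exact hij.ne (Fin.castAdd_injective n n (addPendants_adj_natAdd.1 h)).symm

/-- A vertex and its pendant vertex have the same cost, so replacing either or both by the vertex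
itself is never more expensive. -/
theorem cost_filter_le (c : Fin n → ℚ) (hc : ∀ i, 0 ≤ c i) (X : Finset (Fin (n + n))) :
    cost c (univ.filter fun i : Fin n => Fin.castAdd n i ∈ X ∨ Fin.natAdd n i ∈ X) ≤
      cost (Fin.append c c) X := by
  rw [cost_append, cost, sum_filter]
  refine sum_le_sum fun i _ => ?_
  have := hc i
  by_cases h1 : Fin.castAdd n i ∈ X <;> by_cases h2 : Fin.natAdd n i ∈ X <;>
    simp only [h1, h2, if_true, if_false, or_true, or_self, or_false] <;>
    linarith

/-- A vertex cover is a hitting set of the graph with pendant vertices. -/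
theorem SimpleGraph.IsVertexCover.isHittingSet {Y : Finset (Fin n)}
    (hY : G.IsVertexCover (↑Y : Set (Fin n))) :
    IsHittingSet (addPendants G) univ (Y.map (Fin.castAddEmb n)) := by
  rw [isHittingSet_iff]
  refine ⟨subset_univ _, fun u hu v hv w hw huv hvw huw => ?_⟩
  have hmem : ∀ i, Fin.castAdd n i ∈ univ \ Y.map (Fin.castAddEmb n) → i ∉ Y := fun i hi hiY =>
    (mem_sdiff.1 hi).2 (mem_map.2 ⟨i, hiY, rfl⟩)
  have hnadj : ∀ i j, i ∉ Y → j ∉ Y → ¬ G.Adj i j := fun i j hi hj h => by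
    rcases hY h with h | h
    exacts [hi h, hj h]
  induction v using Fin.addCases with
  | right j =>
    rw [(addPendants_adj_natAdd.1 huv.symm), addPendants_adj_natAdd.1 hvw] at huw
    exact absurd rfl huw
  | left j =>
    -- Once the cover is deleted, the only possible neighbour of an original vertex is its own
    -- pendant vertex, so it cannot be the middle of an induced path.
    have key : ∀ x ∈ univ \ Y.map (Fin.castAddEmb n), (addPendants G).Adj x (Fin.castAdd n j) →
        x = Fin.natAdd n j := fun x hx hadj => by
      induction x using Fin.addCases with
      | left i => exact absurd (addPendants_adj_castAdd.1 hadj) (hnadj i j (hmem i hx) (hmem j hv))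
      | right i => rw [Fin.castAdd_injective n n (addPendants_adj_natAdd.1 hadj)]
    exact absurd ((key u hu huv).trans (key w hw hvw.symm).symm) huw

theorem cost_map_castAdd (c : Fin n → ℚ) (Y : Finset (Fin n)) :
    cost (Fin.append c c) (Y.map (Fin.castAddEmb n)) = cost c Y := by
  simp [cost, sum_map]

theorem inputSize_append (c : Fin n → ℚ) :
    inputSize (Fin.append c c) ≤ 4 * inputSize c := by
  unfold inputSize
  rw [Fin.sum_univ_add]
  simp only [Fin.append_left, Fin.append_right]
  nlinarith [Nat.zero_le (∑ i : Fin n, (bitLen (c i).num + bitLen ((c i).den : ℤ)))]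

end Pendant

/-! ## Running a program inside another one -/

/-- Rename registers and arrays. -/
def RAMInstr.rename (f g : ℕ → ℕ) : RAMInstr → RAMInstr
  | .const r z => .const (f r) z
  | .add r a b => .add (f r) (f a) (f b)
  | .sub r a b => .sub (f r) (f a) (f b)
  | .mul r a b => .mul (f r) (f a) (f b)
  | .load r k a => .load (f r) (g k) (f a)
  | .store k a b => .store (g k) (f a) (f b)

/-- Rename registers and arrays. -/
def RAMProg.rename (f g : ℕ → ℕ) : RAMProg → RAMProg
  | .instr i => .instr (i.rename f g)
  | .seq p q => .seq (p.rename f g) (q.rename f g)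
  | .ite a p q => .ite (f a) (p.rename f g) (q.rename f g)
  | .loop a p => .loop (f a) (p.rename f g)

/-- The state `t` contains the state `s` in the registers `f r` and the arrays `g k`, and agrees
with `t₀` elsewhere. -/
structure Embeds (f g : ℕ → ℕ) (t₀ s t : RAMState) : Prop where
  reg : ∀ r, t.reg (f r) = s.reg r
  arr : ∀ k, t.arr (g k) = s.arr k
  reg_eq : ∀ q, q ∉ Set.range f → t.reg q = t₀.reg q
  arr_eq : ∀ q, q ∉ Set.range g → t.arr q = t₀.arr q

namespace Embeds

variable {f g : ℕ → ℕ} {t₀ s t : RAMState}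

theorem setReg (h : Embeds f g t₀ s t) (hf : f.Injective) (r : ℕ) (z : ℤ) :
    Embeds f g t₀ (s.setReg r z) (t.setReg (f r) z) where
  reg q := by rw [RAMState.setReg_reg, RAMState.setReg_reg, h.reg]; simp [hf.eq_iff]
  arr := h.arr
  reg_eq q hq := by
    rw [RAMState.setReg_reg, if_neg fun e => hq ⟨r, e.symm⟩, h.reg_eq q hq]
  arr_eq := h.arr_eq

theorem setArr (h : Embeds f g t₀ s t) (hg : g.Injective) (k : ℕ) (a z : ℤ) :
    Embeds f g t₀ (s.setArr k a z) (t.setArr (g k) a z) where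
  reg := h.reg
  arr q := by rw [RAMState.setArr_arr, RAMState.setArr_arr, h.arr, h.arr]; simp [hg.eq_iff]
  reg_eq := h.reg_eq
  arr_eq q hq := by
    rw [RAMState.setArr_arr, if_neg fun e => hq ⟨k, e.symm⟩, h.arr_eq q hq]

theorem instr_run (h : Embeds f g t₀ s t) (hf : f.Injective) (hg : g.Injective) (i : RAMInstr) :
    Embeds f g t₀ (i.run s) ((i.rename f g).run t) := by
  cases i with
  | const r z => exact h.setReg hf r z
  | add r a b | sub r a b | mul r a b =>
    simp only [RAMInstr.rename, RAMInstr.run, h.reg]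
    exact h.setReg hf r _
  | load r k a =>
    simp only [RAMInstr.rename, RAMInstr.run, h.reg, h.arr]
    exact h.setReg hf r _
  | store k a b =>
    simp only [RAMInstr.rename, RAMInstr.run, h.reg]
    exact h.setArr hg k _ _

theorem bitCost (h : Embeds f g t₀ s t) (i : RAMInstr) :
    (i.rename f g).bitCost t = i.bitCost s := by
  cases i <;> simp [RAMInstr.rename, RAMInstr.bitCost, h.reg, h.arr]

end Embeds

/-- The given algorithm is arbitrary and may use any registers and arrays. Renaming confines it to a
reserved part of memory at the same cost. -/
theorem RAMExec.rename {f g : ℕ → ℕ} (hf : f.Injective) (hg : g.Injective) {P : RAMProg}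
    {s s' : RAMState} {T b : ℕ} (h : RAMExec P s s' T b) {t₀ : RAMState} :
    ∀ {t : RAMState}, Embeds f g t₀ s t →
      ∃ t', RAMExec (P.rename f g) t t' T b ∧ Embeds f g t₀ s' t' := by
  induction h with
  | instr i s =>
    intro t ht
    refine ⟨_, ?_, ht.instr_run hf hg i⟩
    rw [← ht.bitCost i]
    exact .instr _ _
  | seq p q s s' s'' T T' b b' _ _ ihp ihq =>
    intro t ht
    obtain ⟨t', h1, ht'⟩ := ihp ht
    obtain ⟨t'', h2, ht''⟩ := ihq ht'
    exact ⟨t'', .seq _ _ _ _ _ _ _ _ _ h1 h2, ht''⟩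
  | ite_pos a p q s s' T b ha _ ih =>
    intro t ht
    obtain ⟨t', h1, ht'⟩ := ih ht
    rw [← ht.reg] at ha ⊢
    exact ⟨t', .ite_pos _ _ _ _ _ _ _ ha h1, ht'⟩
  | ite_neg a p q s s' T b ha _ ih =>
    intro t ht
    obtain ⟨t', h1, ht'⟩ := ih ht
    rw [← ht.reg] at ha ⊢
    exact ⟨t', .ite_neg _ _ _ _ _ _ _ ha h1, ht'⟩
  | loop_pos a p s s' s'' T T' b b' ha _ _ ihp ihq =>
    intro t ht
    obtain ⟨t', h1, ht'⟩ := ihp ht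
    obtain ⟨t'', h2, ht''⟩ := ihq ht'
    rw [← ht.reg] at ha ⊢
    exact ⟨t'', .loop_pos _ _ _ _ _ _ _ _ _ ha h1 h2, ht''⟩
  | loop_neg a p s ha =>
    intro t ht
    rw [← ht.reg] at ha ⊢
    exact ⟨t, .loop_neg _ _ _ ha, ht⟩

/-! ## The input with pendant vertices -/

/-- Every entry of the arrays from `4` on of `s'` agrees with `s`, or has its target value. -/
def Fills (T : ℕ → ℤ → ℤ) (s s' : RAMState) : Prop :=
  ∀ k z, s'.arr (k + 4) z = s.arr (k + 4) z ∨ s'.arr (k + 4) z = T k z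

namespace Fills

variable {T : ℕ → ℤ → ℤ} {s s' s'' : RAMState}

theorem of_arr_eq (h : s'.arr = s.arr) : Fills T s s' := fun k z => Or.inl (by rw [h])

theorem trans (h : Fills T s s') (h' : Fills T s' s'') : Fills T s s'' := fun k z => by
  rcases h' k z with e | e
  · rw [e]; exact h k z
  · exact Or.inr e

theorem done (h : Fills T s s') {k : ℕ} {z : ℤ} (hs : s.arr (k + 4) z = T k z) :
    s'.arr (k + 4) z = T k z := (h k z).elim (fun e => e.trans hs) id

theorem store {n k : ℕ} {a e : HExpr} {z : ℤ} (ha : a.eval n s 0 = z) (he : e.eval n s 0 = T k z) :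
    Fills T s ((HStmt.store (k + 4) a e).run n s) ∧
      ((HStmt.store (k + 4) a e).run n s).arr (k + 4) z = T k z := by
  rw [HStmt.run_store, ha, he]
  refine ⟨fun k' z' => ?_, by rw [RAMState.arr_setArr, if_pos ⟨rfl, rfl⟩]⟩
  rw [RAMState.arr_setArr]
  split_ifs with h
  · obtain ⟨h1, rfl⟩ := h
    obtain rfl : k' = k := by omega
    exact Or.inr rfl
  · exact Or.inl rfl

end Fills

section PendantInput

variable {n : ℕ}

/-- The arrays that describe the graph with pendant vertices. -/
noncomputable def pendantArr (G : SimpleGraph (Fin n)) (c : Fin n → ℚ) : ℕ → ℤ → ℤ :=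
  (ramInput (addPendants G) (Fin.append c c)).arr

/-- The position of `u v` in the adjacency matrix of the graph with pendant vertices. -/
def pendantPos (u v : Fin (n + n)) : ℤ := ((n + n : ℕ) : ℤ) * (u : ℕ) + (v : ℕ)

theorem pendantArr_zero (G : SimpleGraph (Fin n)) (c : Fin n → ℚ)
    [DecidableRel (addPendants G).Adj] (u v : Fin (n + n)) :
    pendantArr G c 0 (pendantPos u v) = if (addPendants G).Adj u v then 1 else 0 :=
  ramInput_arr_zero _ _ u v

/-- Write the entries that belong to vertex `i`, the value of variable `1`, and to the pendant
vertex attached to it. -/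
def pendantRow : HStmt :=
  .seq (.assign 3 (.sum 0 (.var 1)))
  (.seq (.iter 2 (.store 4 (.add (.add (.var 3) (.var 3)) (.var 2))
    (.load 0 (.add (.var 3) (.var 2)))))
  (.seq (.store 4 (.add (.add (.add (.var 3) (.var 3)) .size) (.var 1)) (.const 1))
  (.seq (.store 4 (.add (.sum 0 (.add .size .size)) (.add (.add (.var 3) (.var 3)) (.var 1)))
    (.const 1))
  (.seq (.store 5 (.var 1) (.load 1 (.var 1)))
  (.seq (.store 5 (.add .size (.var 1)) (.load 1 (.var 1)))
  (.seq (.store 6 (.var 1) (.load 2 (.var 1)))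
    (.store 6 (.add .size (.var 1)) (.load 2 (.var 1)))))))))

/-- Write the input with pendant vertices, shifted by `4` variables and arrays. -/
def pendantInput : HStmt := .seq (.assign 4 (.add .size .size)) (.iter 1 pendantRow)

/-- The entries that belong to vertex `i` and its pendant vertex have been written. -/
structure RowDone (G : SimpleGraph (Fin n)) (c : Fin n → ℚ) (i : Fin n) (s : RAMState) : Prop where
  adj : ∀ j : Fin n, s.arr 4 (pendantPos (Fin.castAdd n i) (Fin.castAdd n j)) =
    pendantArr G c 0 (pendantPos (Fin.castAdd n i) (Fin.castAdd n j))
  out : s.arr 4 (pendantPos (Fin.castAdd n i) (Fin.natAdd n i)) =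
    pendantArr G c 0 (pendantPos (Fin.castAdd n i) (Fin.natAdd n i))
  back : s.arr 4 (pendantPos (Fin.natAdd n i) (Fin.castAdd n i)) =
    pendantArr G c 0 (pendantPos (Fin.natAdd n i) (Fin.castAdd n i))
  num : s.arr 5 ((Fin.castAdd n i : ℕ) : ℤ) = pendantArr G c 1 ((Fin.castAdd n i : ℕ) : ℤ)
  num' : s.arr 5 ((Fin.natAdd n i : ℕ) : ℤ) = pendantArr G c 1 ((Fin.natAdd n i : ℕ) : ℤ)
  den : s.arr 6 ((Fin.castAdd n i : ℕ) : ℤ) = pendantArr G c 2 ((Fin.castAdd n i : ℕ) : ℤ)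
  den' : s.arr 6 ((Fin.natAdd n i : ℕ) : ℤ) = pendantArr G c 2 ((Fin.natAdd n i : ℕ) : ℤ)

/-- Later writes only store target values, so completed entries stay correct; no bookkeeping of
disjoint addresses is needed. -/
theorem RowDone.fills {G : SimpleGraph (Fin n)} {c : Fin n → ℚ} {i : Fin n} {s s' : RAMState}
    (h : RowDone G c i s) (hs : Fills (pendantArr G c) s s') : RowDone G c i s' :=
  ⟨fun j => hs.done (k := 0) (h.adj j), hs.done (k := 0) h.out, hs.done (k := 0) h.back,
    hs.done (k := 1) h.num, hs.done (k := 1) h.num', hs.done (k := 2) h.den,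
    hs.done (k := 2) h.den'⟩

theorem pendantRow_spec (G : SimpleGraph (Fin n)) (c : Fin n → ℚ) {σ : RAMState} {i : Fin n}
    (hi : σ.reg 1 = ((i : ℕ) : ℤ)) (h0 : σ.arr 0 = (ramInput G c).arr 0)
    (h1 : σ.arr 1 = (ramInput G c).arr 1) (h2 : σ.arr 2 = (ramInput G c).arr 2) :
    Fills (pendantArr G c) σ (pendantRow.run n σ) ∧ RowDone G c i (pendantRow.run n σ) := by
  classical
  set T := pendantArr G c with hT
  set σ1 := (HStmt.assign 3 (.sum 0 (.var 1))).run n σ with hσ1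
  set body : HStmt := .store 4 (.add (.add (.var 3) (.var 3)) (.var 2))
    (.load 0 (.add (.var 3) (.var 2))) with hbody
  set σ2 := (HStmt.iter 2 body).run n σ1 with hσ2
  set σ3 := (HStmt.store 4 (.add (.add (.add (.var 3) (.var 3)) .size) (.var 1)) (.const 1)).run n
    σ2 with hσ3
  set σ4 := (HStmt.store 4 (.add (.sum 0 (.add .size .size))
    (.add (.add (.var 3) (.var 3)) (.var 1))) (.const 1)).run n σ3 with hσ4
  set σ5 := (HStmt.store 5 (.var 1) (.load 1 (.var 1))).run n σ4 with hσ5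
  set σ6 := (HStmt.store 5 (.add .size (.var 1)) (.load 1 (.var 1))).run n σ5 with hσ6
  set σ7 := (HStmt.store 6 (.var 1) (.load 2 (.var 1))).run n σ6 with hσ7
  set σ8 := (HStmt.store 6 (.add .size (.var 1)) (.load 2 (.var 1))).run n σ7 with hσ8
  have hrun : pendantRow.run n σ = σ8 := rfl
  have hr13 : σ1.reg 3 = (n : ℤ) * (i : ℕ) := by
    rw [hσ1, HStmt.run_assign, RAMState.setReg_reg, if_pos rfl]
    simp [hi]
  have hr11 : σ1.reg 1 = ((i : ℕ) : ℤ) := hi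
  have hr23 : σ2.reg 3 = (n : ℤ) * (i : ℕ) :=
    (HStmt.run_reg_of_notMem _ (by decide) _).trans hr13
  have hr21 : σ2.reg 1 = ((i : ℕ) : ℤ) := (HStmt.run_reg_of_notMem _ (by decide) _).trans hr11
  have ha20 : σ2.arr 0 = σ.arr 0 := HStmt.run_arr_of_notMem _ (by decide) _
  have ha21 : σ2.arr 1 = σ.arr 1 := HStmt.run_arr_of_notMem _ (by decide) _
  have ha22 : σ2.arr 2 = σ.arr 2 := HStmt.run_arr_of_notMem _ (by decide) _
  have hnum : ∀ s : RAMState, s.arr 1 = σ.arr 1 →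
      s.arr 1 ((i : ℕ) : ℤ) = T 1 ((Fin.castAdd n i : ℕ) : ℤ) ∧
      s.arr 1 ((i : ℕ) : ℤ) = T 1 ((Fin.natAdd n i : ℕ) : ℤ) := fun s hs => by
    rw [hs, h1, hT, pendantArr, ramInput_arr_one, ramInput_arr_one, ramInput_arr_one,
      Fin.append_left, Fin.append_right]
    exact ⟨rfl, rfl⟩
  have hden : ∀ s : RAMState, s.arr 2 = σ.arr 2 →
      s.arr 2 ((i : ℕ) : ℤ) = T 2 ((Fin.castAdd n i : ℕ) : ℤ) ∧
      s.arr 2 ((i : ℕ) : ℤ) = T 2 ((Fin.natAdd n i : ℕ) : ℤ) := fun s hs => by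
    rw [hs, h2, hT, pendantArr, ramInput_arr_two, ramInput_arr_two, ramInput_arr_two,
      Fin.append_left, Fin.append_right]
    exact ⟨rfl, rfl⟩
  have f1 : Fills T σ σ1 := .of_arr_eq rfl
  obtain ⟨f2, -, hadj⟩ := HStmt.iter_induction (n := n) (i := 2) (p := body) (σ := σ1)
    (fun m s => Fills T σ1 s ∧ (s.arr 0 = σ.arr 0 ∧ s.reg 3 = (n : ℤ) * (i : ℕ)) ∧
      ∀ j : Fin n, m ≤ (j : ℕ) → s.arr 4 (pendantPos (Fin.castAdd n i) (Fin.castAdd n j)) =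
        T 0 (pendantPos (Fin.castAdd n i) (Fin.castAdd n j)))
    ⟨.of_arr_eq rfl, ⟨rfl, hr13⟩, fun j hj => absurd j.2 (by omega)⟩ (by
      intro m hm s ⟨hf, ⟨hs0, hs3⟩, hs⟩
      obtain ⟨v, hv⟩ : ∃ v : Fin n, (v : ℕ) = m := ⟨⟨m, hm⟩, rfl⟩
      have hst := Fills.store (T := T) (s := s.setReg 2 m) (n := n) (k := 0)
        (a := .add (.add (.var 3) (.var 3)) (.var 2)) (e := .load 0 (.add (.var 3) (.var 2)))
        (z := pendantPos (Fin.castAdd n i) (Fin.castAdd n v))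
        (by
          have e3 : (s.setReg 2 m).reg 3 = (n : ℤ) * (i : ℕ) := hs3
          have e2 : (s.setReg 2 m).reg 2 = (v : ℕ) := by rw [RAMState.setReg_reg, if_pos rfl, hv]
          simp only [HExpr.eval_add, HExpr.eval_var, e3, e2, pendantPos, Fin.val_castAdd]
          push_cast
          ring)
        (by
          have e3 : (s.setReg 2 m).reg 3 = (n : ℤ) * (i : ℕ) := hs3
          have e2 : (s.setReg 2 m).reg 2 = (v : ℕ) := by rw [RAMState.setReg_reg, if_pos rfl, hv]
          have e0 : (s.setReg 2 m).arr 0 = (ramInput G c).arr 0 := hs0.trans h0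
          rw [HExpr.eval_load, HExpr.eval_add, HExpr.eval_var, HExpr.eval_var, e3, e2, e0, hT,
            pendantArr_zero, ramInput_arr_zero]
          exact if_congr addPendants_adj_castAdd.symm rfl rfl)
      have hf1 : Fills T s (s.setReg 2 m) := .of_arr_eq rfl
      refine ⟨(hf.trans hf1).trans hst.1, ⟨?_, ?_⟩, fun j hj => ?_⟩
      · exact (HStmt.run_arr_of_notMem body (by decide) _).trans hs0
      · exact (HStmt.run_reg_of_notMem body (by decide) _).trans hs3
      · rcases hj.eq_or_lt with e | hlt
        · obtain rfl : v = j := Fin.ext (hv.trans e)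
          exact hst.2
        · exact (hf1.trans hst.1).done (k := 0) (hs j hlt))
  obtain ⟨f3, g3⟩ := Fills.store (T := T) (s := σ2) (n := n) (k := 0)
    (a := .add (.add (.add (.var 3) (.var 3)) .size) (.var 1)) (e := .const 1)
    (z := pendantPos (Fin.castAdd n i) (Fin.natAdd n i))
    (by
      simp only [HExpr.eval_add, HExpr.eval_var, HExpr.eval_size, hr23, hr21, pendantPos,
        Fin.val_castAdd, Fin.val_natAdd]
      push_cast
      ring)
    (by rw [hT, pendantArr_zero, if_pos (addPendants_adj_natAdd.2 rfl).symm, HExpr.eval_const])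
  obtain ⟨f4, g4⟩ := Fills.store (T := T) (s := σ3) (n := n) (k := 0)
    (a := .add (.sum 0 (.add .size .size)) (.add (.add (.var 3) (.var 3)) (.var 1)))
    (e := .const 1) (z := pendantPos (Fin.natAdd n i) (Fin.castAdd n i))
    (by
      have e3 : σ3.reg 3 = (n : ℤ) * (i : ℕ) := hr23
      have e1 : σ3.reg 1 = (i : ℕ) := hr21
      simp only [HExpr.eval_add, HExpr.eval_var, HExpr.eval_size, HExpr.eval_sum, e3, e1,
        pendantPos, Fin.val_castAdd, Fin.val_natAdd, sum_const, card_univ, Fintype.card_fin,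
        nsmul_eq_mul]
      push_cast
      ring)
    (by rw [hT, pendantArr_zero, if_pos (addPendants_adj_natAdd.2 rfl), HExpr.eval_const])
  have e1 : ∀ s : RAMState, s.reg 1 = σ2.reg 1 → (HExpr.var 1).eval n s 0 = ((i : ℕ) : ℤ) :=
    fun s hs => hs.trans hr21
  have e1' : ∀ s : RAMState, s.reg 1 = σ2.reg 1 →
      (HExpr.add .size (.var 1)).eval n s 0 = ((Fin.natAdd n i : ℕ) : ℤ) := fun s hs => by
    rw [HExpr.eval_add, e1 s hs, HExpr.eval_size, Fin.val_natAdd, Nat.cast_add]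
  have el : ∀ (s : RAMState) (k : ℕ), s.reg 1 = σ2.reg 1 →
      (HExpr.load k (.var 1)).eval n s 0 = s.arr k ((i : ℕ) : ℤ) := fun s k hs => by
    rw [HExpr.eval_load, e1 s hs]
  obtain ⟨f5, g5⟩ := Fills.store (T := T) (s := σ4) (n := n) (k := 1) (a := .var 1)
    (e := .load 1 (.var 1)) (e1 σ4 rfl) ((el σ4 1 rfl).trans (hnum σ4 ha21).1)
  obtain ⟨f6, g6⟩ := Fills.store (T := T) (s := σ5) (n := n) (k := 1) (a := .add .size (.var 1))
    (e := .load 1 (.var 1)) (e1' σ5 rfl) ((el σ5 1 rfl).trans (hnum σ5 ha21).2)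
  obtain ⟨f7, g7⟩ := Fills.store (T := T) (s := σ6) (n := n) (k := 2) (a := .var 1)
    (e := .load 2 (.var 1)) (e1 σ6 rfl) ((el σ6 2 rfl).trans (hden σ6 ha22).1)
  obtain ⟨f8, g8⟩ := Fills.store (T := T) (s := σ7) (n := n) (k := 2) (a := .add .size (.var 1))
    (e := .load 2 (.var 1)) (e1' σ7 rfl) ((el σ7 2 rfl).trans (hden σ7 ha22).2)
  have f78 := f7.trans f8
  have f68 := f6.trans f78
  have f58 := f5.trans f68
  have f48 := f4.trans f58
  have f38 := f3.trans f48
  exact ⟨(f1.trans f2).trans f38, fun j => f38.done (k := 0) (hadj j (Nat.zero_le _)),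
    f48.done g3, f58.done g4, f68.done g5, f78.done g6, f8.done g7, g8⟩

theorem pendantInput_spec (G : SimpleGraph (Fin n)) (c : Fin n → ℚ) :
    (∀ r, (pendantInput.run n (inputState G c)).reg (r + 4) =
      (ramInput (addPendants G) (Fin.append c c)).reg r) ∧
    ∀ k, (pendantInput.run n (inputState G c)).arr (k + 4) =
      (ramInput (addPendants G) (Fin.append c c)).arr k := by
  classical
  set σ := inputState G c with hσ
  set σ1 := (HStmt.assign 4 (.add .size .size)).run n σ with hσ1
  obtain ⟨hf, -, hrow⟩ := HStmt.iter_induction (n := n) (i := 1) (p := pendantRow) (σ := σ1)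
    (fun m s => Fills (pendantArr G c) σ s ∧
      (s.arr 0 = (ramInput G c).arr 0 ∧ s.arr 1 = (ramInput G c).arr 1 ∧
        s.arr 2 = (ramInput G c).arr 2) ∧
      ∀ i : Fin n, m ≤ (i : ℕ) → RowDone G c i s)
    ⟨.of_arr_eq rfl, ⟨rfl, rfl, rfl⟩, fun i hi => absurd i.2 (by omega)⟩ (by
      intro m hm s ⟨hf, ⟨hs0, hs1, hs2⟩, hs⟩
      obtain ⟨v, hv⟩ : ∃ v : Fin n, (v : ℕ) = m := ⟨⟨m, hm⟩, rfl⟩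
      obtain ⟨h1, h2⟩ := pendantRow_spec G c (σ := s.setReg 1 m) (i := v)
        (by rw [RAMState.setReg_reg, if_pos rfl, hv]) hs0 hs1 hs2
      have hf1 : Fills (pendantArr G c) s (s.setReg 1 m) := .of_arr_eq rfl
      refine ⟨(hf.trans hf1).trans h1, ⟨?_, ?_, ?_⟩, fun j hj => ?_⟩
      · exact (HStmt.run_arr_of_notMem pendantRow (by decide) _).trans hs0
      · exact (HStmt.run_arr_of_notMem pendantRow (by decide) _).trans hs1
      · exact (HStmt.run_arr_of_notMem pendantRow (by decide) _).trans hs2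
      · rcases hj.eq_or_lt with e | hlt
        · obtain rfl : v = j := Fin.ext (hv.trans e)
          exact h2
        · exact (hs j hlt).fills (hf1.trans h1))
  refine ⟨fun r => ?_, fun k => funext fun z => ?_⟩
  · have hmem : r + 4 ∉ (HStmt.iter 1 pendantRow).regs := by
      simp [HStmt.regs, pendantRow]
    refine (HStmt.run_reg_of_notMem _ hmem σ1).trans ?_
    rw [hσ1, HStmt.run_assign, RAMState.setReg_reg]
    simp only [ramInput, HExpr.eval_add, HExpr.eval_size, hσ, inputState]
    push_cast
    exact if_congr (by omega) rfl rfl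
  · rcases hf k z with e | e
    swap
    · exact e
    change (((HStmt.iter 1 pendantRow).run n σ1).arr (k + 4) z) = pendantArr G c k z
    -- These arrays start out as `0`, so an entry can be wrong only if its target is nonzero. Such a
    -- target belongs to an edge or to a vertex, and `RowDone` shows that it has been written.
    have hz : σ.arr (k + 4) z = 0 := by
      have : arrIdx (k + 4) = k + 5 := by simp [arrIdx]
      simp [hσ, inputState, this, ramInput]
    by_contra hne
    have hne0 : pendantArr G c k z ≠ 0 := fun h => hne (by rw [e, hz, h])
    have hdone : ∀ i : Fin n, RowDone G c i ((HStmt.iter 1 pendantRow).run n σ1) :=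
      fun i => hrow i (Nat.zero_le _)
    match k with
    | 0 =>
      have hex : ∃ i j : Fin (n + n), z = pendantPos i j ∧ (addPendants G).Adj i j := by
        by_contra hcon
        exact hne0 (if_neg hcon)
      obtain ⟨u, v, rfl, h⟩ := hex
      induction u using Fin.addCases with
      | left i =>
        induction v using Fin.addCases with
        | left j => exact hne ((hdone i).adj j)
        | right j =>
          obtain rfl := Fin.castAdd_injective n n (addPendants_adj_natAdd.1 h.symm)
          exact hne (hdone i).out
      | right i =>
        obtain rfl := addPendants_adj_natAdd.1 h
        exact hne (hdone i).back
    | 1 =>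
      have hex : 0 ≤ z ∧ z.toNat < n + n := by
        by_contra hcon
        exact hne0 (by simp [pendantArr, ramInput, hcon])
      obtain ⟨u, rfl⟩ : ∃ u : Fin (n + n), z = ((u : ℕ) : ℤ) :=
        ⟨⟨z.toNat, hex.2⟩, (Int.toNat_of_nonneg hex.1).symm⟩
      induction u using Fin.addCases with
      | left i => exact hne (hdone i).num
      | right i => exact hne (hdone i).num'
    | 2 =>
      have hex : 0 ≤ z ∧ z.toNat < n + n := by
        by_contra hcon
        exact hne0 (by simp [pendantArr, ramInput, hcon])
      obtain ⟨u, rfl⟩ : ∃ u : Fin (n + n), z = ((u : ℕ) : ℤ) :=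
        ⟨⟨z.toNat, hex.2⟩, (Int.toNat_of_nonneg hex.1).symm⟩
      induction u using Fin.addCases with
      | left i => exact hne (hdone i).den
      | right i => exact hne (hdone i).den'
    | k + 3 => exact hne0 (by simp [pendantArr, ramInput])

/-- Collect the vertices that the computed hitting set contains, or whose pendant vertex it
contains. -/
def collectCover : HStmt :=
  .map 3 0 (.cond (.or (.load 7 (.bvar 0)) (.load 7 (.add .size (.bvar 0)))) (.const 1) (.const 0))

end PendantInput

/-- An approximation algorithm for cluster vertex deletion yields one for vertex cover. -/
theorem hasPolyTimeApprox_isVertexCover {ρ : ℝ}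
    (h : HasPolyTimeApprox (fun _ G X => IsHittingSet G univ X) ρ) :
    HasPolyTimeApprox (fun _ G X => G.IsVertexCover (↑X : Set (Fin _))) ρ := by
  obtain ⟨P, p, hP⟩ := h
  obtain ⟨_, q₁, hpre⟩ := pendantInput.exists_exec (by decide)
  obtain ⟨_, q₂, hpost⟩ := collectCover.exists_exec (by decide)
  -- The embedded algorithm occupies the variables and arrays from `4` on. These avoid register `0`,
  -- the temporaries and the scratch array, so the code that follows still finds `n` in place.
  set f : ℕ → ℕ := fun r => varReg (r + 4) with hfdef
  set g : ℕ → ℕ := fun k => arrIdx (k + 4) with hgdef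
  have hf : f.Injective := fun a b hab => by
    simp only [hfdef, varReg] at hab
    omega
  have hg : g.Injective := fun a b hab => by
    simp only [hgdef, arrIdx] at hab
    split_ifs at hab <;> omega
  set p' := p.comp (4 * Polynomial.X) with hp'
  refine ⟨.seq (pendantInput.compile 1) (.seq (P.rename f g) (collectCover.compile 1)),
    -- The middle run has an input at most four times as large. The last run starts from a state
    -- whose entries are bounded in terms of the bit cost of the first two.
    q₁ + (p' + q₂.comp (Polynomial.X + q₁ + p')), fun n G c hc => ?_⟩
  obtain ⟨s₁, t₁, b₁, hex₁, -, hb₁, hr₁, h0₁⟩ := hpre n (inputSize c) (inputState G c)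
    (ramInput G c) (le_inputSize c) (represents_inputState G c) rfl (boundedState_ramInput G c)
  obtain ⟨hreg, harr⟩ := pendantInput_spec G c
  have hemb : Embeds f g s₁ (ramInput (addPendants G) (Fin.append c c)) s₁ :=
    ⟨fun r => (hr₁.2.1 (r + 4)).trans (hreg r), fun k => (hr₁.2.2 (k + 4)).trans (harr k),
      fun _ _ => rfl, fun _ _ => rfl⟩
  obtain ⟨X, s, t, b, hex, hb, hout, hX, hopt⟩ := hP (n + n) (addPendants G) (Fin.append c c)
    (fun v => by
      induction v using Fin.addCases with
      | left i => rw [Fin.append_left]; exact hc i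
      | right i => rw [Fin.append_right]; exact hc i)
  obtain ⟨s₂, hex₂, hemb₂⟩ := hex.rename hf hg hemb
  have hb₂ : b ≤ p'.eval (inputSize c) := by
    rw [hp', Polynomial.eval_comp]
    refine hb.trans (polynomial_eval_mono p ?_)
    simpa using inputSize_append c
  have h0 : s₂.reg 0 = n := by
    rw [hemb₂.reg_eq 0 (by rintro ⟨r, hr⟩; simp [hfdef, varReg] at hr)]
    exact hr₁.1
  have ht : s₂.reg (tmp 0) = 0 := by
    rw [hemb₂.reg_eq _ (by rintro ⟨r, hr⟩; simp only [hfdef, varReg, tmp] at hr; omega)]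
    exact h0₁
  set τ : RAMState := ⟨fun v => s₂.reg (varReg v), fun k => s₂.arr (arrIdx k)⟩ with hτ
  -- Nothing is known about the values that the given algorithm leaves behind, except that its bit
  -- cost bounds their length.
  have hbd := hex₂.boundedState (hex₁.boundedState (boundedState_ramInput G c))
  obtain ⟨s₃, t₃, b₃, hex₃, -, hb₃, hr₃, -⟩ := hpost n
    (inputSize c + b₁ + b) τ s₂ (by have := le_inputSize c; omega)
    ⟨h0, fun _ => rfl, fun _ => rfl⟩ ht hbd
  refine ⟨univ.filter fun i : Fin n => Fin.castAdd n i ∈ X ∨ Fin.natAdd n i ∈ X, s₃, _, _,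
    .seq _ _ _ _ _ _ _ _ _ hex₁ (.seq _ _ _ _ _ _ _ _ _ hex₂ hex₃), ?_, fun i => ?_,
    isVertexCover_of_isHittingSet hX, fun Y hY => ?_⟩
  · simp only [Polynomial.eval_add, Polynomial.eval_comp, Polynomial.eval_X]
    refine Nat.add_le_add hb₁ (Nat.add_le_add hb₂ (hb₃.trans (polynomial_eval_mono q₂ ?_)))
    omega
  · have h7 : ∀ j : Fin (n + n), τ.arr 7 ((j : ℕ) : ℤ) = if j ∈ X then 1 else 0 := fun j => by
      rw [← hout j, ← hemb₂.arr 3]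
    have h3 := hr₃.2.2 3
    rw [show arrIdx 3 = 3 from rfl] at h3
    rw [h3, collectCover, HStmt.run_map_arr_self, HExpr.eval_cond]
    refine if_congr ?_ rfl rfl
    have hl := h7 (Fin.castAdd n i)
    have hr := h7 (Fin.natAdd n i)
    rw [Fin.val_castAdd] at hl
    rw [Fin.val_natAdd, Nat.cast_add] at hr
    simp only [HExpr.eval_or_pos, HExpr.eval_load, HExpr.eval_bvar, HExpr.eval_add,
      HExpr.eval_size, Function.update_self, hl, hr, mem_filter, mem_univ, true_and]
    by_cases h1 : Fin.castAdd n i ∈ X <;> by_cases h2 : Fin.natAdd n i ∈ X <;>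
      simp only [h1, h2, if_true, if_false] <;> simp
  · have h1 := hopt _ (SimpleGraph.IsVertexCover.isHittingSet hY)
    rw [cost_map_castAdd] at h1
    refine le_trans ?_ h1
    exact_mod_cast cost_filter_le c hc X

theorem theorem1 :
    -- Every run of the local-ratio algorithm is correct, and the algorithm always has a run.
    (∀ (V : Type*) [Fintype V] [DecidableEq V] (G : SimpleGraph V) (c : V → ℚ),
      (∀ v, 0 ≤ c v) →
        (∃ X : Finset V, LocalRatio G Finset.univ c X) ∧
        ∀ X : Finset V, LocalRatio G Finset.univ c X →
          IsMinimalHittingSet G Finset.univ X ∧ cost c X ≤ 2 * OPT G Finset.univ c) ∧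
    -- It is implemented by a program that takes `O(n ^ 4)` steps and polynomial time.
    (∃ (P : RAMProg) (C : ℕ) (p : Polynomial ℕ),
      ∀ (n : ℕ) (G : SimpleGraph (Fin n)) (c : Fin n → ℚ), (∀ v, 0 ≤ c v) →
        ∃ (X : Finset (Fin n)) (s : RAMState) (t b : ℕ),
          RAMExec P (ramInput G c) s t b ∧
          t ≤ C * (n ^ 4 + 1) ∧
          b ≤ p.eval (inputSize c) ∧
          RAMOutputs s X ∧
          LocalRatio G Finset.univ c X ∧
          IsMinimalHittingSet G Finset.univ X ∧
          cost c X ≤ 2 * OPT G Finset.univ c) ∧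
    -- A better factor for cluster vertex deletion is a better factor for vertex cover.
    (∀ ρ : ℝ,
      HasPolyTimeApprox (fun _ G X => IsHittingSet G Finset.univ X) ρ →
        HasPolyTimeApprox (fun _ G X => G.IsVertexCover (↑X : Set (Fin _))) ρ) := by
  refine ⟨localRatio_exists_and_correct, ?_, fun _ => hasPolyTimeApprox_isVertexCover⟩
  obtain ⟨P, C, p, h⟩ := exists_localRatio_program
  refine ⟨P, C, p, fun n G c hc => ?_⟩
  obtain ⟨X, s, t, b, hex, ht, hb, hout, hX⟩ := h n G c hc
  exact ⟨X, s, t, b, hex, ht, hb, hout, hX, (localRatio_exists_and_correct _ G c hc).2 X hX⟩
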